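/- **Setting.** Fix $\eta\in\mathbb R\setminus\{0\}$. Consider $u_{xt}=F(u,u_x)$ with $(u,u_x)$ in an open set $U\subset\mathbb R^2$, together with one-forms $\omega^i=f_{i1}dx+f_{i2}dt$ ($i=1,2,3$) whose coefficients are functions of $(z_0,z_1)=(u,u_x)$, with $f_{21}=\eta$. The equation *describes $\eta$ pseudo-spherical surfaces* through these forms if $\omega^1\wedge\omega^2\not\equiv0$ and $d\omega^1=\omega^3\wedge\omega^2$, $d\omega^2=\omega^1\wedge\omega^3$, $d\omega^3=\omega^1\wedge\omega^2$ hold along a smooth function $u(x,t)$ if and only if $u$ is a solution. Where $\omega^1\wedge\omega^2\ne0$, a solution $u$ determines the metric $(\omega^1)^2+(\omega^2)^2$ of curvature $-1$. The *coefficients* $a,b,c$ of the second fundamental form of a local isometric immersion of it in $\mathbb R^3$ are given by $\omega^3_1=a\omega^1+b\omega^2$, $\omega^3_2=b\omega^1+c\omega^2$ (in the orthonormal frame dual to $\omega^1,\omega^2$). *Finite-jet coefficients* are smooth functions $a,b,c$ of $x,t,u,\partial_xu,\dots,\partial_x^\ell u,\partial_tu,\dots,\partial_t^\ell u$ for some $\ell\geq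 1$, on some nonempty connected open set $D$ of jets with $(u,u_x)\in U$, $\omega^1\wedge\omega^2\neq0$, such that for every solution $u$ with jets in $D$ their values along $u$ are the coefficients of the second fundamental form of local isometric immersions in $\mathbb R^3$ of the surface determined by $u$. They are *universal* if they are functions of $x,t$ only. The equations and forms are the following ones (Rabelo–Tenenblat); write $f=(f_{11},f_{12};f_{22};f_{31},f_{32})$. (I) $F=F(u)\not\equiv0$ smooth on $\mathbb R$, $F''+\alpha F=0$, $\alpha\ne0$, $U=\mathbb R^2$; for $A,B,Q\in\mathbb R$ with $\alpha(A^2-B^2)=1$ and $d:=Q^2\alpha+\eta^2\neq0$, $$f=\Big(-\alpha(Bz_1-AQ),\ \tfrac{A\alpha(QF'-\eta F)}{d};\ \tfrac{\eta F'+\alpha QF}{d};\ -\alpha(Az_1-BQ),\ \tfrac{B\alpha(QF'-\eta F)}{d}\Big).$$ (II) $F=\nu e^{\delta u}\sqrt{\beta+\gamma u_x^2}$ with $\nu,\delta,\gamma\neq0$, $\beta=0$ if $\gamma=1$, $U=\{\beta+\gamma z_1^2>0\}\ne\emptyset$; $s=\pm1$. If $\gamma\ne1$: $A^2-B^2=(\gamma-1)/\delta^2$,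 $\Delta=\beta+\gamma z_1^2$, $E=\nu e^{\delta z_0}$, $$f=\Big(\eta A\delta-\tfrac{(Bz_1-sA\sqrt\Delta)\delta^2}{\gamma-1},\ sA\delta E;\ sE;\ \eta B\delta-\tfrac{(Az_1-sB\sqrt\Delta)\delta^2}{\gamma-1},\ sB\delta E\Big).$$ If $\gamma=1$: $A\neq0$, $\sigma=\operatorname{sign}z_1$, $E=\nu e^{\delta z_0}$, $$f=\Big(\tfrac s2(\tfrac1A+\delta^2A)z_1+\eta\delta A,\ s\sigma A\delta E;\ s\sigma E;\ \tfrac12(-\tfrac1A+\delta^2A)z_1+s\eta\delta A,\ \sigma A\delta E\Big).$$ (III) $F=\lambda u+\xi u_x+\tau$. If $\lambda=\xi=\tau=0$: $U=\mathbb R^2$, $f=(z_1,0;e^{z_0};\eta,e^{z_0})$. If $\lambda\ne0$: $U=\mathbb R^2$, $T\neq0$, $s=\pm1$, $f=\big(s\eta Tz_1/\lambda,\ Tz_0+\tau T/\lambda;\ \lambda/\eta-s\xi;\ \eta Tz_1/\lambda,\ s(Tz_0+\tau T/\lambda)\big)$. If $\lambda=0$, $(\xi,\tau)\ne(0,0)$: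 $U=\{\xi z_1+\tau\neq0\}$, $f=(G,1/\eta;0;G,1/\eta)$ with $G=G(z_1)$, $G'=1/(\xi z_1+\tau)$. **Theorem.** In all these cases the equation describes $\eta$ pseudo-spherical surfaces through the given forms, and: 1. In case (I) with $\alpha>0$, finite-jet coefficients exist if and only if $B=0$, and then they exist near every jet of order one with $\omega^1\wedge\omega^2\neq0$. All finite-jet coefficients depend only on the jet of order zero, i.e. on $x,t,u$, and are not universal. 2. In case (III), finite-jet coefficients exist if and only if $\lambda,\xi,\tau$ do not vanish simultaneously, and then they exist near every jet of order one with $(u,u_x)\in U$ and $\omega^1\wedge\omega^2\neq0$. All finite-jet coefficients are universal. 3. In case (I) with $\alpha<0$, in case (II), and for $F=0$ (case (III) with $\lambda=\xi=\tau=0$), there are no finite-jet coefficients. -/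

import Mathlib

namespace PSS

noncomputable section

/-- Points `(x, t)` of the plane of independent variables. -/
abbrev Plane := ℝ × ℝ

/-- Euclidean three-space. -/
abbrev E3 := EuclideanSpace ℝ (Fin 3)

/-- Partial derivative with respect to `x`. -/
def dx {E : Type} [NormedAddCommGroup E] [NormedSpace ℝ E] (u : Plane → E) (p : Plane) : E :=
  fderiv ℝ u p (1, 0)

/-- Partial derivative with respect to `t`. -/
def dt {E : Type} [NormedAddCommGroup E] [NormedSpace ℝ E] (u : Plane → E) (p : Plane) : E :=
  fderiv ℝ u p (0, 1)

/-- `u` is a smooth solution on `V` of `u_{xt} = F(u, u_x)`, where `F` is considered on the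
domain `U` of the `(u, u_x)`-plane. -/
structure IsSolution (F : ℝ → ℝ → ℝ) (U : Set (ℝ × ℝ)) (V : Set Plane) (u : Plane → ℝ) :
    Prop where
  smooth : ContDiffOn ℝ (⊤ : ℕ∞) u V
  mem : ∀ p ∈ V, (u p, dx u p) ∈ U
  eqn : ∀ p ∈ V, dt (dx u) p = F (u p) (dx u p)

/-! ### One-forms whose coefficients are functions of `(u, u_x)` -/

/-- Coefficients of `ω^i = f_{i1} dx + f_{i2} dt`, `i = 1, 2, 3`, as functions of `(u, u_x)`. -/
structure Forms where
  f11 : ℝ → ℝ → ℝ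
  f12 : ℝ → ℝ → ℝ
  f21 : ℝ → ℝ → ℝ
  f22 : ℝ → ℝ → ℝ
  f31 : ℝ → ℝ → ℝ
  f32 : ℝ → ℝ → ℝ

/-- The value at `p` of a coefficient along a function `u(x, t)`. -/
def along (f : ℝ → ℝ → ℝ) (u : Plane → ℝ) (p : Plane) : ℝ := f (u p) (dx u p)

/-- The coefficient of `ω^1 ∧ ω^2`, as a function of `(u, u_x)`. -/
def Forms.area (ω : Forms) (z₀ z₁ : ℝ) : ℝ :=
  ω.f11 z₀ z₁ * ω.f22 z₀ z₁ - ω.f12 z₀ z₁ * ω.f21 z₀ z₁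

/-- The structure equations `dω^1 = ω^3 ∧ ω^2`, `dω^2 = ω^1 ∧ ω^3`, `dω^3 = ω^1 ∧ ω^2` at `p`,
for the forms evaluated along `u`. -/
def StructureEqs (ω : Forms) (u : Plane → ℝ) (p : Plane) : Prop :=
  dx (along ω.f12 u) p - dt (along ω.f11 u) p =
      along ω.f31 u p * along ω.f22 u p - along ω.f32 u p * along ω.f21 u p ∧
  dx (along ω.f22 u) p - dt (along ω.f21 u) p =
      along ω.f11 u p * along ω.f32 u p - along ω.f12 u p * along ω.f31 u p ∧
  dx (along ω.f32 u) p - dt (along ω.f31 u) p =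
      along ω.f11 u p * along ω.f22 u p - along ω.f12 u p * along ω.f21 u p

/-- The equation `u_{xt} = F(u, u_x)` on `U` describes `η` pseudo-spherical surfaces through the
one-forms `ω`: one has `f_{21} = η`, `ω^1 ∧ ω^2` does not vanish identically, and the structure
equations hold along a smooth function exactly when it is a solution. -/
structure Describes (η : ℝ) (F : ℝ → ℝ → ℝ) (U : Set (ℝ × ℝ)) (ω : Forms) : Prop where
  f21_eq : ∀ q ∈ U, ω.f21 q.1 q.2 = η
  nondegenerate : ∃ q ∈ U, ω.area q.1 q.2 ≠ 0
  iff_solution : ∀ (V : Set Plane) (u : Plane → ℝ), IsOpen V → ContDiffOn ℝ (⊤ : ℕ∞) u V →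
    (∀ p ∈ V, (u p, dx u p) ∈ U) →
    ((∀ p ∈ V, StructureEqs ω u p) ↔ IsSolution F U V u)

/-! ### Local isometric immersions and their second fundamental form -/

/-- On `W`, the map `X` is an isometric immersion into `ℝ³` of the metric
`(ω^1)² + (ω^2)²` determined by `u`, with adapted orthonormal frame `e 0, e 1, e 2` (the last one
normal, `dX = ω^1 e₀ + ω^2 e₁`), and its second fundamental form has the coefficients `a, b, c`
with respect to `ω^1, ω^2`:
`⟨de₀, e₂⟩ = a ω^1 + b ω^2`, `⟨de₁, e₂⟩ = b ω^1 + c ω^2`. -/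
structure IsImmersionOn (ω : Forms) (u : Plane → ℝ) (a b c : Plane → ℝ) (W : Set Plane)
    (X : Plane → E3) (e : Fin 3 → Plane → E3) : Prop where
  smooth : ContDiffOn ℝ (⊤ : ℕ∞) X W
  smooth_frame : ∀ i, ContDiffOn ℝ (⊤ : ℕ∞) (e i) W
  orthonormal : ∀ p ∈ W, Orthonormal ℝ (fun i => e i p)
  nondegenerate : ∀ p ∈ W, ω.area (u p) (dx u p) ≠ 0
  dx_eq : ∀ p ∈ W, dx X p = along ω.f11 u p • e 0 p + along ω.f21 u p • e 1 p
  dt_eq : ∀ p ∈ W, dt X p = along ω.f12 u p • e 0 p + along ω.f22 u p • e 1 p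
  second_dx_0 : ∀ p ∈ W, inner ℝ (dx (e 0) p) (e 2 p) =
    a p * along ω.f11 u p + b p * along ω.f21 u p
  second_dt_0 : ∀ p ∈ W, inner ℝ (dt (e 0) p) (e 2 p) =
    a p * along ω.f12 u p + b p * along ω.f22 u p
  second_dx_1 : ∀ p ∈ W, inner ℝ (dx (e 1) p) (e 2 p) =
    b p * along ω.f11 u p + c p * along ω.f21 u p
  second_dt_1 : ∀ p ∈ W, inner ℝ (dt (e 1) p) (e 2 p) =
    b p * along ω.f12 u p + c p * along ω.f22 u p

/-- On `V`, the functions `a, b, c` are the coefficients of the second fundamental form of local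
isometric immersions into `ℝ³` of the surface determined by `u`. -/
def IsSecondForm (ω : Forms) (u : Plane → ℝ) (V : Set Plane) (a b c : Plane → ℝ) : Prop :=
  ∀ p ∈ V, ∃ W : Set Plane, IsOpen W ∧ p ∈ W ∧ W ⊆ V ∧
    ∃ (X : Plane → E3) (e : Fin 3 → Plane → E3), IsImmersionOn ω u a b c W X e

/-! ### Dependence on finite jets -/

/-- Jets of order `l` of solutions of `u_{xt} = F(u, u_x)`: the coordinates are
`(x, t, u, (∂_x u, …, ∂_x^l u), (∂_t u, …, ∂_t^l u))`. All mixed derivatives are functions of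
these because of the equation. -/
abbrev Jet (l : ℕ) := ℝ × ℝ × ℝ × (Fin l → ℝ) × (Fin l → ℝ)

/-- The jet of order `l` of `u` at `p`. -/
def jet (l : ℕ) (u : Plane → ℝ) (p : Plane) : Jet l :=
  (p.1, p.2, u p, fun i => (dx^[i.val + 1] u) p, fun i => (dt^[i.val + 1] u) p)

/-- The jets (of order at least one) over `U` at which `ω^1 ∧ ω^2 ≠ 0`. -/
def regularJets (U : Set (ℝ × ℝ)) (ω : Forms) (n : ℕ) : Set (Jet (n + 1)) :=
  {j | (j.2.2.1, j.2.2.2.1 0) ∈ U ∧ ω.area j.2.2.1 (j.2.2.2.1 0) ≠ 0}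

/-- `a, b, c` are smooth functions on a connected open set `D` of regular jets of order `n + 1`
such that, for every solution `u` with jets in `D`, their values along `u` are the
coefficients of the second fundamental form of local isometric immersions into `ℝ³` of the
pseudo-spherical surface determined by `u`. -/
structure IsJetSecondForm (F : ℝ → ℝ → ℝ) (U : Set (ℝ × ℝ)) (ω : Forms) (n : ℕ)
    (D : Set (Jet (n + 1))) (a b c : Jet (n + 1) → ℝ) : Prop where
  isOpen : IsOpen D
  isConnected : IsConnected D
  regular : D ⊆ regularJets U ω n
  smooth_a : ContDiffOn ℝ (⊤ : ℕ∞) a D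
  smooth_b : ContDiffOn ℝ (⊤ : ℕ∞) b D
  smooth_c : ContDiffOn ℝ (⊤ : ℕ∞) c D
  secondForm : ∀ (V : Set Plane) (u : Plane → ℝ), IsOpen V → IsSolution F U V u →
    (∀ p ∈ V, jet (n + 1) u p ∈ D) →
    IsSecondForm ω u V (fun p => a (jet (n + 1) u p)) (fun p => b (jet (n + 1) u p))
      (fun p => c (jet (n + 1) u p))

/-- There are second fundamental form coefficients that depend on a jet of finite order. -/
def HasFiniteJetForm (F : ℝ → ℝ → ℝ) (U : Set (ℝ × ℝ)) (ω : Forms) : Prop :=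
  ∃ (n : ℕ) (D : Set (Jet (n + 1))) (a b c : Jet (n + 1) → ℝ), IsJetSecondForm F U ω n D a b c

/-- Such coefficients exist near every regular jet of order one. -/
def HasFiniteJetFormNearEveryJet (F : ℝ → ℝ → ℝ) (U : Set (ℝ × ℝ)) (ω : Forms) : Prop :=
  ∀ j ∈ regularJets U ω 0, ∃ (D : Set (Jet 1)) (a b c : Jet 1 → ℝ),
    j ∈ D ∧ IsJetSecondForm F U ω 0 D a b c

/-- `a, b, c` depend on the jet of order zero, i.e. on `x, t, u` only. -/
def DependOnZeroJet {l : ℕ} (D : Set (Jet l)) (a b c : Jet l → ℝ) : Prop :=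
  ∃ a₀ b₀ c₀ : ℝ → ℝ → ℝ → ℝ, ∀ j ∈ D, a j = a₀ j.1 j.2.1 j.2.2.1 ∧
    b j = b₀ j.1 j.2.1 j.2.2.1 ∧ c j = c₀ j.1 j.2.1 j.2.2.1

/-- `a, b, c` are universal: functions of `x, t` only, independent of `u`. -/
def AreUniversal {l : ℕ} (D : Set (Jet l)) (a b c : Jet l → ℝ) : Prop :=
  ∃ a₀ b₀ c₀ : ℝ → ℝ → ℝ, ∀ j ∈ D, a j = a₀ j.1 j.2.1 ∧ b j = b₀ j.1 j.2.1 ∧ c j = c₀ j.1 j.2.1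

/-! ### The one-forms of the classification -/

/-- The forms of `u_{xt} = F(u)`, `F'' + α F = 0`, with parameters `A, B, Q`. -/
def harmonicForms (F : ℝ → ℝ) (α η A B Q : ℝ) : Forms where
  f11 := fun _ z₁ => -α * (B * z₁ - A * Q)
  f12 := fun z₀ _ => A * α * (Q * deriv F z₀ - η * F z₀) / (Q ^ 2 * α + η ^ 2)
  f21 := fun _ _ => η
  f22 := fun z₀ _ => (η * deriv F z₀ + α * Q * F z₀) / (Q ^ 2 * α + η ^ 2)
  f31 := fun _ z₁ => -α * (A * z₁ - B * Q)
  f32 := fun z₀ _ => B * α * (Q * deriv F z₀ - η * F z₀) / (Q ^ 2 * α + η ^ 2)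

/-- `F : ℝ → ℝ` is a smooth solution, not identically zero, of `F'' + α F = 0`, and `ω` are
one-forms of the classification for `u_{xt} = F(u)`, with parameters `A, B, Q`. -/
structure IsHarmonic (η α : ℝ) (F : ℝ → ℝ) (A B Q : ℝ) (ω : Forms) : Prop where
  smooth : ContDiff ℝ (⊤ : ℕ∞) F
  ode : ∀ s, deriv (deriv F) s + α * F s = 0
  ne_zero : ∃ s, F s ≠ 0
  parameters : α * (A ^ 2 - B ^ 2) = 1
  denominator : Q ^ 2 * α + η ^ 2 ≠ 0
  forms : ω = harmonicForms F α η A B Q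

/-- The right-hand side `ν e^{δ u} √(β + γ u_x²)`. -/
def expRHS (ν δ β γ : ℝ) (z₀ z₁ : ℝ) : ℝ :=
  ν * Real.exp (δ * z₀) * Real.sqrt (β + γ * z₁ ^ 2)

/-- Its domain `β + γ u_x² > 0`. -/
def expDomain (β γ : ℝ) : Set (ℝ × ℝ) := {q | 0 < β + γ * q.2 ^ 2}

/-- The forms of `u_{xt} = ν e^{δ u} √(β + γ u_x²)`, `γ ≠ 1`; `s = ±1`. -/
def expForms (ν δ β γ η A B s : ℝ) : Forms where
  f11 := fun _ z₁ =>
    η * A * δ - (B * z₁ - s * A * Real.sqrt (β + γ * z₁ ^ 2)) * δ ^ 2 / (γ - 1)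
  f12 := fun z₀ _ => s * (A * δ * ν * Real.exp (δ * z₀))
  f21 := fun _ _ => η
  f22 := fun z₀ _ => s * (ν * Real.exp (δ * z₀))
  f31 := fun _ z₁ =>
    η * B * δ - (A * z₁ - s * B * Real.sqrt (β + γ * z₁ ^ 2)) * δ ^ 2 / (γ - 1)
  f32 := fun z₀ _ => s * (B * δ * ν * Real.exp (δ * z₀))

/-- The forms of `u_{xt} = ν e^{δ u} √(u_x²)` (the case `γ = 1`, `β = 0`); `s = ±1`. The factor
`sign u_x` (equal to `1` for `u_x > 0`) is what makes them right on both components of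
`u_x ≠ 0`. -/
def expOneForms (ν δ η A s : ℝ) : Forms where
  f11 := fun _ z₁ => s * ((1 / A + δ ^ 2 * A) / 2 * z₁) + η * δ * A
  f12 := fun z₀ z₁ => s * (Real.sign z₁ * (A * δ * ν * Real.exp (δ * z₀)))
  f21 := fun _ _ => η
  f22 := fun z₀ z₁ => s * (Real.sign z₁ * (ν * Real.exp (δ * z₀)))
  f31 := fun _ z₁ => (-(1 / A) + δ ^ 2 * A) / 2 * z₁ + s * (η * δ * A)
  f32 := fun z₀ z₁ => Real.sign z₁ * (A * δ * ν * Real.exp (δ * z₀))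

/-- One-forms of the classification for `u_{xt} = ν e^{δ u} √(β + γ u_x²)`. -/
inductive IsExp (η ν δ β γ : ℝ) : Forms → Prop
  | gamma_ne_one (A B s : ℝ) (hs : s = 1 ∨ s = -1) (hγ : γ ≠ 1)
      (hAB : A ^ 2 - B ^ 2 = (γ - 1) / δ ^ 2) : IsExp η ν δ β γ (expForms ν δ β γ η A B s)
  | gamma_eq_one (A s : ℝ) (hs : s = 1 ∨ s = -1) (hγ : γ = 1) (hβ : β = 0) (hA : A ≠ 0) :
      IsExp η ν δ β γ (expOneForms ν δ η A s)

/-- The right-hand side `lam u + ξ u_x + τ`. -/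
def linRHS (lam ξ τ : ℝ) (z₀ z₁ : ℝ) : ℝ := lam * z₀ + ξ * z₁ + τ

/-- The forms of `u_{xt} = 0`. -/
def zeroForms (η : ℝ) : Forms where
  f11 := fun _ z₁ => z₁
  f12 := fun _ _ => 0
  f21 := fun _ _ => η
  f22 := fun z₀ _ => Real.exp z₀
  f31 := fun _ _ => η
  f32 := fun z₀ _ => Real.exp z₀

/-- The forms of `u_{xt} = lam u + ξ u_x + τ`, `lam ≠ 0`; `s = ±1`. -/
def linForms (lam ξ τ η T s : ℝ) : Forms where
  f11 := fun _ z₁ => s * (η * T * z₁ / lam)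
  f12 := fun z₀ _ => T * z₀ + τ * T / lam
  f21 := fun _ _ => η
  f22 := fun _ _ => lam / η - s * ξ
  f31 := fun _ z₁ => η * T * z₁ / lam
  f32 := fun z₀ _ => s * (T * z₀ + τ * T / lam)

/-- The forms of `u_{xt} = ξ u_x + τ`, `(ξ, τ) ≠ 0`; `G` is an antiderivative of `1/(ξ z + τ)`. -/
def primitiveForms (η : ℝ) (G : ℝ → ℝ) : Forms where
  f11 := fun _ z₁ => G z₁
  f12 := fun _ _ => 1 / η
  f21 := fun _ _ => η
  f22 := fun _ _ => 0
  f31 := fun _ z₁ => G z₁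
  f32 := fun _ _ => 1 / η

/-- One-forms of the classification for `u_{xt} = lam u + ξ u_x + τ`, with their domain. -/
inductive IsLin (η lam ξ τ : ℝ) : Set (ℝ × ℝ) → Forms → Prop
  | all_zero (h : lam = 0 ∧ ξ = 0 ∧ τ = 0) : IsLin η lam ξ τ Set.univ (zeroForms η)
  | lam_ne_zero (T s : ℝ) (hs : s = 1 ∨ s = -1) (hlam : lam ≠ 0) (hT : T ≠ 0) :
      IsLin η lam ξ τ Set.univ (linForms lam ξ τ η T s)
  | lam_eq_zero (G : ℝ → ℝ) (hlam : lam = 0) (h : ¬ (ξ = 0 ∧ τ = 0))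
      (hG : ∀ z, ξ * z + τ ≠ 0 → HasDerivAt G (1 / (ξ * z + τ)) z) :
      IsLin η lam ξ τ {q | ξ * q.2 + τ ≠ 0} (primitiveForms η G)

end

end PSS

open PSS

/-! A triple `(a, b, c)` is a second fundamental form of the metric exactly when the Gauss and
Codazzi equations hold. Necessity comes from differentiating an adapted frame
(`IsImmersionOn.gaussCodazzi`), sufficiency from Bonnet's theorem (`FormCalculus.isSecondForm`).
Every jet over `U` is the jet of a local solution (`exists_solution_jet`, by the Goursat problem),
so finite-jet coefficients `y = (a, b, c)` satisfy Gauss and Codazzi as identities on an open set of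
jet space, where `u` and its pure derivatives are independent coordinates (`JetCodazzi`). All
families share the shape recorded in `FormCalculus`: locally `f11, f31` depend only on `u_x`, and
`f12, f22, f32` only on `u`.

Elimination. Regard `y` as a function of jets of one order more, so that it does not depend on the
top derivatives. The Codazzi equations are then affine in the derivative just above the highest one
on which `y` depends. The coefficient of that derivative says that the symmetric matrix formed by
the partial derivative of `y` annihilates `(f11, η)` for a `t`-derivative or for `u`, and `(f12,
f22)` for an `x`-derivative. Since `y` has constant determinant `-1`, a nonzero such partial
derivative makes the annihilated vector `(p, q)` isotropic for `y`, with `y (p, q) = μ (-q, p)` and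
`μ = ±1` (`isotropic_of_kernel`). Differentiating this relation and removing the derivatives of `y`
from the Codazzi equations leaves a relation affine in `y`. One more derivative in the same
direction leaves an identity between the forms alone, and this identity is contradictory. Thus all
`t`-derivatives drop out (`killed_eW`), and then all `x`-derivatives of order at least two
(`killed_eZ`). For `u_x` itself the argument needs extra information on the forms, the condition
`Obstruction` (`killed_eZ_zero`), which is checked in each family. So `y` depends on `x, t, u` only,
and only on `x, t` if `f11` really depends on `u_x` (`killed_eU`).

Conclusion. Three situations remain. If `y` is a function of `x, t`, the Codazzi equations may be
differentiated in `u` and in `u_x` with `y` and its derivatives fixed. When the mixed derivative is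
a nondegenerate linear system for `2b` and `a - c`, it gives `b = 0`, `a = c`, against `ac - b² =
-1` (`not_hasFiniteJetForm`). This covers (I) with `B ≠ 0`, all of (II), and `F = 0`. In the
remaining equations of (III), `(f31, f32) = ±(f11, f12)` and `f22` is constant. The Codazzi
equations become a system in `x, t` with explicit first integrals, so all coefficients are universal
(`areUniversal_of_proportional`), and explicit ones exist (`existence_of_proportional`). In (I) with
`B = 0`, `f11` is constant and `f32 = 0`. Here `y` must depend on `u`, so the constant vector `(f11,
η)` is isotropic. This determines `y` up to a global sign as a function of `u`
(`dependOnZeroJet_of_constant`), and that function is a solution (`existence_of_constant`). For `α <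
0` the relation `α (A² - B²) = 1` excludes `B = 0`. -/

namespace PSS

/-! ### Smoothness of superposition operators on spaces of continuous maps -/

section Nemytskii

open Filter Topology ContinuousMap

/-- Composition on the left with a continuous map, defined for all functions. -/
noncomputable def postcomp (K : Type) [TopologicalSpace K] {E G : Type} [TopologicalSpace E]
    [TopologicalSpace G] (f : E → G) (hf : Continuous f) (g : C(K, E)) : C(K, G) :=
  ContinuousMap.comp ⟨f, hf⟩ g

@[simp] theorem postcomp_apply {K : Type} [TopologicalSpace K] {E G : Type} [TopologicalSpace E]
    [TopologicalSpace G] (f : E → G) (hf : Continuous f) (g : C(K, E)) (k : K) :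
    postcomp K f hf g k = f (g k) := rfl

variable {K : Type} [TopologicalSpace K] [CompactSpace K]
  {E G : Type} [NormedAddCommGroup E] [NormedSpace ℝ E] [NormedAddCommGroup G] [NormedSpace ℝ G]

/-- Pointwise application of a continuous family of operators to a continuous map. -/
noncomputable def pointwiseApply (K E G : Type) [TopologicalSpace K] [CompactSpace K]
    [NormedAddCommGroup E] [NormedSpace ℝ E] [NormedAddCommGroup G] [NormedSpace ℝ G] :
    C(K, E →L[ℝ] G) →L[ℝ] C(K, E) →L[ℝ] C(K, G) :=
  LinearMap.mkContinuous₂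
    (LinearMap.mk₂ ℝ (fun (A : C(K, E →L[ℝ] G)) (h : C(K, E)) =>
      (⟨fun k => A k (h k), by fun_prop⟩ : C(K, G)))
      (fun A B h => by ext k; simp) (fun c A h => by ext k; simp)
      (fun A h g => by ext k; simp) (fun c A h => by ext k; simp)) 1
    (fun A h => by
      rw [one_mul, ContinuousMap.norm_le _ (by positivity)]
      intro k
      exact ((A k).le_opNorm (h k)).trans
        (by gcongr; exacts [A.norm_coe_le_norm k, h.norm_coe_le_norm k]))

@[simp] theorem pointwiseApply_apply (A : C(K, E →L[ℝ] G)) (h : C(K, E)) (k : K) :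
    pointwiseApply K E G A h k = A k (h k) := rfl

/-- Strict differentiability at `g k₀` bounds the remainder for all base points near `g k₀` at once.
Compactness of `K` makes the bound uniform in `k`, which is the estimate in the supremum norm. -/
theorem hasFDerivAt_postcomp {f : E → G} {f' : E → E →L[ℝ] G} (hf : Continuous f)
    (hf' : Continuous f') (h : ∀ x, HasFDerivAt f (f' x) x) (g : C(K, E)) :
    HasFDerivAt (postcomp K f hf) (pointwiseApply K E G (postcomp K f' hf' g)) g := by
  rw [hasFDerivAt_iff_isLittleO_nhds_zero, Asymptotics.isLittleO_iff]
  intro ε hε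
  have key : ∀ᶠ v in 𝓝 (0 : E), ∀ k ∈ (Set.univ : Set K),
      ‖f (g k + v) - f (g k) - f' (g k) v‖ ≤ ε * ‖v‖ := by
    refine isCompact_univ.eventually_forall_of_forall_eventually fun k₀ _ => ?_
    have hs : HasStrictFDerivAt f (f' (g k₀)) (g k₀) :=
      hasStrictFDerivAt_of_hasFDerivAt_of_continuousAt (Eventually.of_forall h) hf'.continuousAt
    have h1 := (Asymptotics.isLittleO_iff.1 hs.isLittleO) (half_pos hε)
    have hc : Tendsto (fun p : K × E => (g p.1 + p.2, g p.1)) (𝓝 (k₀, 0)) (𝓝 (g k₀, g k₀)) := by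
      have : Continuous fun p : K × E => (g p.1 + p.2, g p.1) := by fun_prop
      simpa using this.tendsto (k₀, 0)
    have h2 : ∀ᶠ p : K × E in 𝓝 (k₀, 0), ‖f' (g p.1) - f' (g k₀)‖ < ε / 2 := by
      have : Continuous fun p : K × E => ‖f' (g p.1) - f' (g k₀)‖ := by fun_prop
      exact this.tendsto (k₀, 0) |>.eventually (gt_mem_nhds (by simpa using half_pos hε))
    have h1' : ∀ᶠ p : K × E in 𝓝 (k₀, (0 : E)),
      ‖f (g p.1 + p.2) - f (g p.1) - f' (g k₀) (g p.1 + p.2 - g p.1)‖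
        ≤ ε / 2 * ‖g p.1 + p.2 - g p.1‖ := hc.eventually h1
    have h3 : ∀ᶠ p : E × K in 𝓝 ((0 : E), k₀), ‖f (g p.2 + p.1) - f (g p.2) - f' (g p.2) p.1‖ ≤
        ε * ‖p.1‖ := by
      have hsw : Tendsto (Prod.swap : E × K → K × E) (𝓝 (0, k₀)) (𝓝 (k₀, 0)) :=
        continuous_swap.tendsto (0, k₀)
      filter_upwards [hsw.eventually h1', hsw.eventually h2] with p hp1 hp2
      simp only [Prod.fst_swap, Prod.snd_swap, add_sub_cancel_left] at hp1 hp2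
      have : f (g p.2 + p.1) - f (g p.2) - f' (g p.2) p.1 =
        (f (g p.2 + p.1) - f (g p.2) - f' (g k₀) p.1) - (f' (g p.2) - f' (g k₀)) p.1 := by
        simp
      rw [this]
      refine (norm_sub_le _ _).trans ?_
      have := ((f' (g p.2) - f' (g k₀)).le_opNorm p.1).trans
        (mul_le_mul_of_nonneg_right hp2.le (norm_nonneg _))
      linarith
    exact h3
  obtain ⟨δ, hδ, H⟩ := Metric.eventually_nhds_iff.1 key
  filter_upwards [Metric.ball_mem_nhds (0 : C(K, E)) hδ] with v hv
  rw [ContinuousMap.norm_le _ (by positivity)]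
  intro k
  have hv' : ‖v‖ < δ := by simpa using hv
  have := H (y := v k) (by simpa using (v.norm_coe_le_norm k).trans_lt hv') k trivial
  exact this.trans (mul_le_mul_of_nonneg_left (v.norm_coe_le_norm k) hε.le)

/-- The derivative is the superposition operator of `f'` followed by the bounded linear map
`pointwiseApply`, so the order can be raised by induction. The target `G` varies in the induction
because `f'` is operator-valued. -/
theorem contDiff_postcomp_nat (n : ℕ) : ∀ {G : Type} [NormedAddCommGroup G] [NormedSpace ℝ G]
    {f : E → G} (hf : ContDiff ℝ n f), ContDiff ℝ n (postcomp K f hf.continuous) := by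
  induction n with
  | zero =>
    intro G _ _ f hf
    exact contDiff_zero.2 (ContinuousMap.continuous_postcomp _)
  | succ n ih =>
    intro G _ _ f hf
    obtain ⟨f', hf', h⟩ := contDiff_succ_iff_hasFDerivAt.1 hf
    refine contDiff_succ_iff_hasFDerivAt.2
      ⟨fun g => pointwiseApply K E G (postcomp K f' hf'.continuous g), ?_,
        fun g => hasFDerivAt_postcomp hf.continuous hf'.continuous h g⟩
    exact (pointwiseApply K E G).contDiff.comp (ih hf')

theorem contDiff_postcomp {f : E → G} (hf : ContDiff ℝ (⊤ : ℕ∞) f) :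
    ContDiff ℝ (⊤ : ℕ∞) (postcomp K f hf.continuous) :=
  contDiff_infty.2 fun n => contDiff_postcomp_nat n (hf.of_le (by exact_mod_cast le_top))

end Nemytskii

/-! ### Smooth extension of germs -/

section Extension

open Filter Topology

variable {E G : Type} [NormedAddCommGroup E] [NormedSpace ℝ E] [FiniteDimensional ℝ E]
  [NormedAddCommGroup G] [NormedSpace ℝ G]

/-- A function smooth near a point agrees near that point with a globally smooth one. -/
theorem exists_contDiff_eventuallyEq {f : E → G} {s : Set E} (hs : IsOpen s)
    (hf : ContDiffOn ℝ (⊤ : ℕ∞) f s) {x : E} (hx : x ∈ s) :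
    ∃ g : E → G, ContDiff ℝ (⊤ : ℕ∞) g ∧ g =ᶠ[𝓝 x] f := by
  obtain ⟨r, hr, hrs⟩ := Metric.isOpen_iff.1 hs x hx
  let b : ContDiffBump x := ⟨r / 4, r / 2, by positivity, by linarith⟩
  refine ⟨fun y => b y • f y, ?_, ?_⟩
  · rw [contDiff_iff_contDiffAt]
    intro y
    by_cases hy : y ∈ Metric.ball x r
    · exact b.contDiffAt.smul (hf.contDiffAt (hs.mem_nhds (hrs hy)))
    · have : y ∈ (Metric.closedBall x (r / 2))ᶜ := by
        simp only [Metric.mem_ball, not_lt, Set.mem_compl_iff, Metric.mem_closedBall,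
          not_le] at hy ⊢
        linarith
      refine ContDiffAt.congr_of_eventuallyEq (contDiffAt_const (c := (0 : G))) ?_
      filter_upwards [Metric.isClosed_closedBall.isOpen_compl.mem_nhds this] with z hz
      have : b z = 0 := b.zero_of_le_dist (by
        simp only [Set.mem_compl_iff, Metric.mem_closedBall, not_le] at hz; exact hz.le)
      simp [this]
  · filter_upwards [b.eventuallyEq_one] with y hy
    simp [hy]

end Extension

/-! ### Uniqueness for linear ordinary differential equations -/

section LinearODE

open Set

variable {Z : Type} [NormedAddCommGroup Z] [NormedSpace ℝ Z]

/-- On a compact subinterval around `t` and `t₀` the operator norm is bounded, which gives a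
Lipschitz constant; then `z` is compared with the zero solution. -/
theorem linear_ode_eq_zero {a b t₀ : ℝ} {L : ℝ → Z →L[ℝ] Z} {z : ℝ → Z}
    (ht₀ : t₀ ∈ Ioo a b) (hL : ContinuousOn L (Ioo a b))
    (hz : ∀ t ∈ Ioo a b, HasDerivAt z (L t (z t)) t) (h0 : z t₀ = 0) :
    ∀ t ∈ Ioo a b, z t = 0 := by
  intro t ht
  obtain ⟨a', ha1, ha2⟩ := exists_between (lt_min ht.1 ht₀.1)
  obtain ⟨b', hb1, hb2⟩ := exists_between (max_lt ht.2 ht₀.2)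
  have hsub : Icc a' b' ⊆ Ioo a b := fun x hx => ⟨ha1.trans_le hx.1, hx.2.trans_lt hb2⟩
  obtain ⟨C, hC⟩ := isCompact_Icc.exists_bound_of_continuousOn (hL.mono hsub)
  have hlip : ∀ s ∈ Ioo a' b', LipschitzOnWith (Real.toNNReal C) (fun x => L s x) univ := by
    intro s hs
    have := (L s).lipschitz.weaken (K' := Real.toNNReal C) (by
      rw [← NNReal.coe_le_coe]
      exact (hC s (Ioo_subset_Icc_self hs)).trans (Real.le_coe_toNNReal C))
    exact this.lipschitzOnWith
  have := ODE_solution_unique_of_mem_Ioo (v := fun s x => L s x) (s := fun _ => univ)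
    (f := z) (g := fun _ => 0) (t₀ := t₀) hlip
    ⟨ha2.trans_le (min_le_right _ _), (le_max_right _ _).trans_lt hb1⟩
    (fun s hs => ⟨hz s (hsub (Ioo_subset_Icc_self hs)), trivial⟩)
    (fun s _ => ⟨by simpa using hasDerivAt_const s (0 : Z), trivial⟩) h0
  exact this ⟨ha2.trans_le (min_le_left _ _), (le_max_left _ _).trans_lt hb1⟩

end LinearODE

/-! ### The Goursat integral equation via the implicit function theorem -/

section Goursat

open Filter Topology ContinuousMap MeasureTheory unitInterval

/-- The unit square. -/
abbrev Square := unitInterval × unitInterval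

variable {E : Type} [NormedAddCommGroup E] [NormedSpace ℝ E]

theorem continuous_integral_unitInterval {X : Type} [TopologicalSpace X]
    [FirstCountableTopology X] [LocallyCompactSpace X] {f : X → unitInterval → E}
    (hf : Continuous f.uncurry) : Continuous fun x => ∫ r, f x r := by
  simpa using continuous_parametric_integral_of_continuous (μ := (volume : Measure unitInterval))
    hf isCompact_univ

theorem norm_integral_unitInterval_le {f : unitInterval → E} {C : ℝ} (hf : ∀ r, ‖f r‖ ≤ C) :
    ‖∫ r, f r‖ ≤ C := by
  simpa using norm_integral_le_of_norm_le_const (μ := (volume : Measure unitInterval))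
    (Eventually.of_forall hf)

theorem integrable_of_continuous_unitInterval {E : Type} [NormedAddCommGroup E]
    {f : unitInterval → E} (hf : Continuous f) :
    Integrable f := by
  simpa using hf.continuousOn.integrableOn_compact (μ := (volume : Measure unitInterval))
    isCompact_univ

/-- `(x, t) ↦ ∫₀ˣ g(r, t) dr`. -/
noncomputable def integralFst (E : Type) [NormedAddCommGroup E] [NormedSpace ℝ E] :
    C(Square, E) →L[ℝ] C(Square, E) :=
  LinearMap.mkContinuous
    { toFun := fun g => ⟨fun k => (k.1 : ℝ) • ∫ r : unitInterval, g (k.1 * r, k.2), by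
        refine Continuous.smul (by fun_prop) (continuous_integral_unitInterval (X := Square)
          (f := fun k r => g (k.1 * r, k.2)) ?_)
        unfold Function.uncurry; fun_prop⟩
      map_add' := fun g h => by
        ext k
        simp only [ContinuousMap.coe_mk, ContinuousMap.add_apply]
        rw [integral_add (integrable_of_continuous_unitInterval (by fun_prop))
          (integrable_of_continuous_unitInterval (by fun_prop)), smul_add]
      map_smul' := fun c g => by
        ext k
        simp only [ContinuousMap.coe_mk, ContinuousMap.smul_apply, integral_smul, RingHom.id_apply]
        rw [smul_comm] } 1
    (fun g => by
      rw [one_mul, ContinuousMap.norm_le _ (norm_nonneg _)]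
      intro k
      simp only [LinearMap.coe_mk, AddHom.coe_mk, ContinuousMap.coe_mk, norm_smul]
      have h1 : ‖(k.1 : ℝ)‖ ≤ 1 := by
        rw [Real.norm_of_nonneg k.1.2.1]; exact k.1.2.2
      have h2 := norm_integral_unitInterval_le (f := fun r => g (k.1 * r, k.2))
        (fun r => g.norm_coe_le_norm _)
      nlinarith [norm_nonneg (∫ r : unitInterval, g (k.1 * r, k.2)), norm_nonneg g])

/-- `(x, t) ↦ ∫₀ᵗ g(x, s) ds`. -/
noncomputable def integralSnd (E : Type) [NormedAddCommGroup E] [NormedSpace ℝ E] :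
    C(Square, E) →L[ℝ] C(Square, E) :=
  LinearMap.mkContinuous
    { toFun := fun g => ⟨fun k => (k.2 : ℝ) • ∫ r : unitInterval, g (k.1, k.2 * r), by
        refine Continuous.smul (by fun_prop) (continuous_integral_unitInterval (X := Square)
          (f := fun k r => g (k.1, k.2 * r)) ?_)
        unfold Function.uncurry; fun_prop⟩
      map_add' := fun g h => by
        ext k
        simp only [ContinuousMap.coe_mk, ContinuousMap.add_apply]
        rw [integral_add (integrable_of_continuous_unitInterval (by fun_prop))
          (integrable_of_continuous_unitInterval (by fun_prop)), smul_add]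
      map_smul' := fun c g => by
        ext k
        simp only [ContinuousMap.coe_mk, ContinuousMap.smul_apply, integral_smul, RingHom.id_apply]
        rw [smul_comm] } 1
    (fun g => by
      rw [one_mul, ContinuousMap.norm_le _ (norm_nonneg _)]
      intro k
      simp only [LinearMap.coe_mk, AddHom.coe_mk, ContinuousMap.coe_mk, norm_smul]
      have h1 : ‖(k.2 : ℝ)‖ ≤ 1 := by
        rw [Real.norm_of_nonneg k.2.2.1]; exact k.2.2.2
      have h2 := norm_integral_unitInterval_le (f := fun r => g (k.1, k.2 * r))
        (fun r => g.norm_coe_le_norm _)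
      nlinarith [norm_nonneg (∫ r : unitInterval, g (k.1, k.2 * r)), norm_nonneg g])

theorem integralFst_apply (g : C(Square, E)) (k : Square) :
    integralFst E g k = (k.1 : ℝ) • ∫ r : unitInterval, g (k.1 * r, k.2) := rfl

theorem integralSnd_apply (g : C(Square, E)) (k : Square) :
    integralSnd E g k = (k.2 : ℝ) • ∫ r : unitInterval, g (k.1, k.2 * r) := rfl

/-- `(x, t) ↦ ((a x, b t), y(x, t))` for `p = (a, b)`. -/
noncomputable def scaledGraph (E : Type) [NormedAddCommGroup E] [NormedSpace ℝ E]
    (q : (ℝ × ℝ) × C(Square, E)) : C(Square, (ℝ × ℝ) × E) :=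
  ⟨fun k => ((q.1.1 * k.1, q.1.2 * k.2), q.2 k), by fun_prop⟩

theorem contDiff_scaledGraph : ContDiff ℝ (⊤ : ℕ∞) (scaledGraph E) := by
  let X : C(Square, (ℝ × ℝ) × E) := ⟨fun k => (((k.1 : ℝ), 0), 0), by fun_prop⟩
  let T : C(Square, (ℝ × ℝ) × E) := ⟨fun k => ((0, (k.2 : ℝ)), 0), by fun_prop⟩
  let L := ContinuousLinearMap.compLeftContinuous ℝ Square (ContinuousLinearMap.inr ℝ (ℝ × ℝ) E)
  have : scaledGraph E = fun q => q.1.1 • X + q.1.2 • T + L q.2 := by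
    ext q k <;> simp [scaledGraph, X, T, L]
  rw [this]
  have hL : ContDiff ℝ (⊤ : ℕ∞) fun q : (ℝ × ℝ) × C(Square, E) => L q.2 :=
    L.contDiff.comp contDiff_snd
  have h1 : ContDiff ℝ (⊤ : ℕ∞) fun q : (ℝ × ℝ) × C(Square, E) => q.1.1 :=
    contDiff_fst.comp contDiff_fst
  have h2 : ContDiff ℝ (⊤ : ℕ∞) fun q : (ℝ × ℝ) × C(Square, E) => q.1.2 :=
    contDiff_snd.comp contDiff_fst
  exact ((h1.smul contDiff_const).add (h2.smul contDiff_const)).add hL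

/-- Contraction of the square towards the origin. -/
def contract (k : Square) : C(Square, Square) := ⟨fun l => (k.1 * l.1, k.2 * l.2), by fun_prop⟩

/-- A smooth implicit function is smooth near the base point. -/
theorem exists_implicit_smooth {A B : Type} [NormedAddCommGroup A] [NormedSpace ℝ A]
    [CompleteSpace A] [NormedAddCommGroup B] [NormedSpace ℝ B] [CompleteSpace B]
    {Φ : A × B → B} (hΦ : ContDiff ℝ (⊤ : ℕ∞) Φ) (p : A) (y : B) (h0 : Φ (p, y) = 0)
    (hi : (fderiv ℝ Φ (p, y) ∘L .inr ℝ A B).IsInvertible) :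
    ∃ ψ : A → B, ψ p = y ∧ (∀ᶠ q in 𝓝 p, ContDiffAt ℝ (⊤ : ℕ∞) ψ q) ∧
      ∀ᶠ v in 𝓝 (p, y), Φ v = 0 ↔ ψ v.1 = v.2 := by
  have hn : ((⊤ : ℕ∞) : WithTop ℕ∞) ≠ 0 := by simp
  have hc : ∀ v, ContDiffAt ℝ (⊤ : ℕ∞) Φ v := fun v => hΦ.contDiffAt
  set ψ := (hc (p, y)).implicitFunction hn hi with hψ
  have hψp : ψ p = y := (hc (p, y)).implicitFunction_apply_self hn hi
  have hiff : ∀ᶠ v in 𝓝 (p, y), Φ v = 0 ↔ ψ v.1 = v.2 := by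
    simpa [h0] using (hc (p, y)).eventually_apply_eq_iff_implicitFunction hn hi
  have hsm : ContDiffAt ℝ (⊤ : ℕ∞) ψ p := (hc (p, y)).contDiffAt_implicitFunction hn hi
  have h1 : ∀ᶠ q in 𝓝 p, ContDiffAt ℝ 1 ψ q :=
    (hsm.of_le (by exact_mod_cast le_top) : ContDiffAt ℝ 1 ψ p).eventually (by simp)
  have h2 : ∀ᶠ q in 𝓝 p, ∀ᶠ q' in 𝓝 q, Φ (q', ψ q') = 0 := by
    refine eventually_eventually_nhds.2 ?_
    simpa [h0] using (hc (p, y)).eventually_apply_implicitFunction hn hi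
  have h3 : ∀ᶠ q in 𝓝 p, (fderiv ℝ Φ (q, ψ q) ∘L .inr ℝ A B).IsInvertible := by
    have hcont : ContinuousAt (fun q => fderiv ℝ Φ (q, ψ q) ∘L .inr ℝ A B) p := by
      have : Continuous (fderiv ℝ Φ) := hΦ.continuous_fderiv hn
      have h := (this.continuousAt (x := (p, ψ p))).comp
        (f := fun q => (q, ψ q)) (continuousAt_id.prodMk hsm.continuousAt)
      exact (ContinuousLinearMap.compL ℝ B (A × B) B).flip
        (.inr ℝ A B) |>.continuous.continuousAt.comp h
    have hopen : IsOpen {L : B →L[ℝ] B | L.IsInvertible} := by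
      convert ContinuousLinearEquiv.isOpen (𝕜 := ℝ) (E := B) (F := B) using 1
      ext L; exact Iff.rfl
    exact hcont.eventually (hopen.mem_nhds (by simpa only [hψp, Set.mem_ofPred_eq] using hi))
  -- Smoothness of infinite order at `p` provides a neighbourhood for each finite order, but no
  -- common one. The implicit function theorem is therefore applied afresh at each nearby `q`, where
  -- the partial derivative is still invertible, and local uniqueness identifies the new implicit
  -- function with `ψ`.
  refine ⟨ψ, hψp, ?_, hiff⟩
  filter_upwards [h1, h2, h3] with q hq1 hq2 hq3
  have hq0 : Φ (q, ψ q) = 0 := hq2.self_of_nhds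
  have e := (hc (q, ψ q)).eventually_apply_eq_iff_implicitFunction hn hq3
  have hc2 : ContinuousAt (fun q' => (q', ψ q')) q := continuousAt_id.prodMk hq1.continuousAt
  refine ((hc (q, ψ q)).contDiffAt_implicitFunction hn hq3).congr_of_eventuallyEq ?_
  filter_upwards [hc2.eventually e, hq2] with q' h4 h5
  exact (h4.1 (by rw [h5, hq0])).symm

variable [CompleteSpace E]

/-- The integral equation `y = d + ∫₀ˣ f₁(r, t, y) dr + ∫₀ᵗ f₂(x, s, y) ds` has a smooth
solution near the origin. -/
theorem exists_integral_solution {d : ℝ × ℝ → E} {f₁ f₂ : (ℝ × ℝ) × E → E}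
    (hd : ContDiff ℝ (⊤ : ℕ∞) d) (hf₁ : ContDiff ℝ (⊤ : ℕ∞) f₁) (hf₂ : ContDiff ℝ (⊤ : ℕ∞) f₂) :
    ∃ (δ : ℝ) (y : ℝ × ℝ → E), 0 < δ ∧ ContDiffOn ℝ (⊤ : ℕ∞) y (Metric.ball 0 δ) ∧
      ∀ p ∈ Metric.ball (0 : ℝ × ℝ) δ,
        y p = d p + p.1 • (∫ r : unitInterval, f₁ ((p.1 * r, p.2), y (p.1 * r, p.2))) +
          p.2 • ∫ r : unitInterval, f₂ ((p.1, p.2 * r), y (p.1, p.2 * r)) := by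
  have hd' : ContDiff ℝ (⊤ : ℕ∞) fun q : (ℝ × ℝ) × E => d q.1 := hd.comp contDiff_fst
  -- The rectangle with corners `0` and `q.1` is rescaled to the unit square, so its size becomes a
  -- parameter. At size zero the equation is `y = d 0` and its linearization is the identity. Smooth
  -- dependence on the size then yields smoothness of the solution.
  let Φ : (ℝ × ℝ) × C(Square, E) → C(Square, E) := fun q =>
    q.2 - postcomp Square _ hd'.continuous (scaledGraph E q)
      - q.1.1 • integralFst E (postcomp Square f₁ hf₁.continuous (scaledGraph E q))
      - q.1.2 • integralSnd E (postcomp Square f₂ hf₂.continuous (scaledGraph E q))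
  have hΦ : ContDiff ℝ (⊤ : ℕ∞) Φ := by
    have h1 : ContDiff ℝ (⊤ : ℕ∞) fun q : (ℝ × ℝ) × C(Square, E) => q.1.1 :=
      contDiff_fst.comp contDiff_fst
    have h2 : ContDiff ℝ (⊤ : ℕ∞) fun q : (ℝ × ℝ) × C(Square, E) => q.1.2 :=
      contDiff_snd.comp contDiff_fst
    exact ((contDiff_snd.sub ((contDiff_postcomp hd').comp contDiff_scaledGraph)).sub
      (h1.smul ((integralFst E).contDiff.comp
        ((contDiff_postcomp hf₁).comp contDiff_scaledGraph)))).sub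
      (h2.smul ((integralSnd E).contDiff.comp
        ((contDiff_postcomp hf₂).comp contDiff_scaledGraph)))
  let y₀ : C(Square, E) := ContinuousMap.const _ (d 0)
  have hΦ0 : ∀ y, Φ (0, y) = y - y₀ := by
    intro y
    ext k
    simp [Φ, y₀, scaledGraph, Prod.zero_eq_mk]
  have hinv : (fderiv ℝ Φ (0, y₀) ∘L .inr ℝ (ℝ × ℝ) C(Square, E)).IsInvertible := by
    have h1 : HasFDerivAt (fun y => Φ (0, y))
        (fderiv ℝ Φ (0, y₀) ∘L .inr ℝ (ℝ × ℝ) C(Square, E)) y₀ :=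
      ((hΦ.differentiable (by simp)) (0, y₀)).hasFDerivAt.comp y₀ (hasFDerivAt_prodMk_right 0 y₀)
    have h2 : HasFDerivAt (fun y => Φ (0, y)) (ContinuousLinearMap.id ℝ C(Square, E)) y₀ := by
      simp only [hΦ0]
      exact (hasFDerivAt_id y₀).sub_const y₀
    rw [h1.unique h2]
    exact ⟨ContinuousLinearEquiv.refl ℝ _, rfl⟩
  obtain ⟨ψ, hψ0, hsm, hiff⟩ := exists_implicit_smooth hΦ 0 y₀ (by rw [hΦ0, sub_self]) hinv
  obtain ⟨ε, hε, hε'⟩ := Metric.eventually_nhds_iff.1 hiff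
  have hψc : ContinuousAt ψ 0 := hsm.self_of_nhds.continuousAt
  obtain ⟨δ₁, hδ₁, hδ₁'⟩ := Metric.eventually_nhds_iff.1
    (hψc.eventually (Metric.ball_mem_nhds _ hε))
  obtain ⟨δ₂, hδ₂, hδ₂'⟩ := Metric.eventually_nhds_iff.1 hsm
  set δ := min ε (min δ₁ δ₂) with hδ
  have hδ0 : 0 < δ := lt_min hε (lt_min hδ₁ hδ₂)
  have hball : ∀ p ∈ Metric.ball (0 : ℝ × ℝ) δ, ∀ k : Square,
      (p.1 * (k.1 : ℝ), p.2 * (k.2 : ℝ)) ∈ Metric.ball (0 : ℝ × ℝ) δ := by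
    intro p hp k
    simp only [mem_ball_zero_iff, Prod.norm_def, max_lt_iff, norm_mul] at hp ⊢
    have h1 : ‖(k.1 : ℝ)‖ ≤ 1 := by rw [Real.norm_of_nonneg k.1.2.1]; exact k.1.2.2
    have h2 : ‖(k.2 : ℝ)‖ ≤ 1 := by rw [Real.norm_of_nonneg k.2.2.1]; exact k.2.2.2
    exact ⟨(mul_le_of_le_one_right (norm_nonneg _) h1).trans_lt hp.1,
      (mul_le_of_le_one_right (norm_nonneg _) h2).trans_lt hp.2⟩
  have hsol : ∀ p ∈ Metric.ball (0 : ℝ × ℝ) δ, Φ (p, ψ p) = 0 := by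
    intro p hp
    have hp' : dist p 0 < δ := hp
    refine (hε' (y := (p, ψ p)) ?_).2 rfl
    rw [Prod.dist_eq, max_lt_iff]
    refine ⟨hp'.trans_le (min_le_left _ _), ?_⟩
    have := hδ₁' (hp'.trans_le ((min_le_right _ _).trans (min_le_left _ _)))
    rwa [hψ0] at this
  have heq : ∀ p ∈ Metric.ball (0 : ℝ × ℝ) δ, ∀ k : Square, ψ p k =
      d (p.1 * k.1, p.2 * k.2)
      + p.1 • (k.1 : ℝ) •
        (∫ r : unitInterval, f₁ ((p.1 * (k.1 * r), p.2 * k.2), ψ p (k.1 * r, k.2)))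
      + p.2 • (k.2 : ℝ) •
        ∫ r : unitInterval, f₂ ((p.1 * k.1, p.2 * (k.2 * r)), ψ p (k.1, k.2 * r)) := by
    intro p hp k
    have h := DFunLike.congr_fun (hsol p hp) k
    simp only [Φ, ContinuousMap.sub_apply, ContinuousMap.smul_apply, integralFst_apply,
      integralSnd_apply, postcomp_apply, scaledGraph, ContinuousMap.coe_mk,
      ContinuousMap.zero_apply, Set.Icc.coe_mul] at h
    rw [sub_sub, sub_sub, sub_eq_zero] at h
    rw [h]; abel
  -- By uniqueness in the implicit function theorem, the solution on a smaller rectangle is the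
  -- restriction of the one on the larger rectangle. Hence the corner values `ψ p (1, 1)` for
  -- varying `p` contain all values of the solution.
  have hscale : ∀ p ∈ Metric.ball (0 : ℝ × ℝ) δ, ∀ k : Square,
      ψ (p.1 * k.1, p.2 * k.2) (1, 1) = ψ p k := by
    intro p hp k
    have hp' : dist p 0 < δ := hp
    have key : ψ (p.1 * k.1, p.2 * k.2) = (ψ p).comp (contract k) := by
      refine (hε' (y := ((p.1 * k.1, p.2 * k.2), (ψ p).comp (contract k))) ?_).1 ?_
      · rw [Prod.dist_eq, max_lt_iff]
        refine ⟨(show dist _ _ < δ from hball p hp k).trans_le (min_le_left _ _), ?_⟩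
        have h1 := hδ₁' (hp'.trans_le ((min_le_right _ _).trans (min_le_left _ _)))
        rw [hψ0, dist_lt_iff hε] at h1
        simp only
        rw [dist_lt_iff hε]
        intro l
        exact h1 (contract k l)
      · ext l
        have h := heq p hp (contract k l)
        simp only [Φ, ContinuousMap.sub_apply, ContinuousMap.smul_apply, integralFst_apply,
          integralSnd_apply, postcomp_apply, scaledGraph, ContinuousMap.coe_mk,
          ContinuousMap.zero_apply, Set.Icc.coe_mul, ContinuousMap.comp_apply, h]
        simp only [contract, ContinuousMap.coe_mk, Set.Icc.coe_mul, mul_assoc, smul_smul]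
        abel
    rw [key]
    simp [contract]
  refine ⟨δ, fun p => ψ p (1, 1), hδ0, ?_, ?_⟩
  · intro p hp
    have hp' : dist p 0 < δ := hp
    have := hδ₂' (hp'.trans_le ((min_le_right _ _).trans (min_le_right _ _)))
    exact ((ContinuousMap.evalCLM ℝ
      ((1 : unitInterval), (1 : unitInterval))).contDiff.contDiffAt.comp
      p this).contDiffWithinAt
  · intro p hp
    have h := heq p hp (1, 1)
    simp only [Set.Icc.coe_one, mul_one, one_mul, one_smul] at h
    have e1 : ∀ r : unitInterval, ψ (p.1 * r, p.2) (1, 1) = ψ p (r, 1) := fun r => by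
      simpa using hscale p hp (r, 1)
    have e2 : ∀ r : unitInterval, ψ (p.1, p.2 * r) (1, 1) = ψ p (1, r) := fun r => by
      simpa using hscale p hp (1, r)
    simp only [e1, e2]
    exact h

end Goursat

/-! ### From the integral equation to the Goursat problem -/

section GoursatDiff

open Filter Topology MeasureTheory

variable {E : Type} [NormedAddCommGroup E] [NormedSpace ℝ E]

theorem hasDerivAt_fst {u : Plane → E} {p : Plane} (hu : DifferentiableAt ℝ u p) :
    HasDerivAt (fun x => u (x, p.2)) (dx u p) p.1 := by
  have h : HasDerivAt (fun x : ℝ => (x, p.2)) ((1 : ℝ), (0 : ℝ)) p.1 :=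
    (hasDerivAt_id p.1).prodMk (hasDerivAt_const p.1 p.2)
  exact HasFDerivAt.comp_hasDerivAt (f := fun x : ℝ => (x, p.2)) p.1 hu.hasFDerivAt h

theorem hasDerivAt_snd {u : Plane → E} {p : Plane} (hu : DifferentiableAt ℝ u p) :
    HasDerivAt (fun t => u (p.1, t)) (dt u p) p.2 := by
  have h : HasDerivAt (fun t : ℝ => (p.1, t)) ((0 : ℝ), (1 : ℝ)) p.2 :=
    (hasDerivAt_const p.2 p.1).prodMk (hasDerivAt_id p.2)
  exact HasFDerivAt.comp_hasDerivAt (f := fun t : ℝ => (p.1, t)) p.2 hu.hasFDerivAt h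

theorem integral_unitInterval_eq (f : ℝ → E) :
    ∫ r : unitInterval, f r = ∫ r in (0 : ℝ)..1, f r := by
  rw [intervalIntegral.integral_of_le zero_le_one, ← integral_Icc_eq_integral_Ioc]
  exact integral_subtype measurableSet_Icc f

theorem hasDerivAt_smul_integral [CompleteSpace E] {g : ℝ → E} {δ x : ℝ}
    (hg : ContinuousOn g (Set.Ioo (-δ) δ)) (hx : x ∈ Set.Ioo (-δ) δ) :
    HasDerivAt (fun s => s • ∫ r : unitInterval, g (s * r)) (g x) x := by
  have h1 : ∀ s, s • ∫ r : unitInterval, g (s * r) = ∫ r in (0 : ℝ)..s, g r := by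
    intro s
    rw [integral_unitInterval_eq (fun r => g (s * r)), intervalIntegral.smul_integral_comp_mul_left]
    simp
  simp only [h1]
  have h0 : (0 : ℝ) ∈ Set.Ioo (-δ) δ := by
    obtain ⟨h, h'⟩ := hx; constructor <;> linarith
  have hsub : Set.uIcc 0 x ⊆ Set.Ioo (-δ) δ :=
    Set.OrdConnected.uIcc_subset Set.ordConnected_Ioo h0 hx
  refine intervalIntegral.integral_hasDerivAt_right ((hg.mono hsub).intervalIntegrable) ?_
    (hg.continuousAt (isOpen_Ioo.mem_nhds hx))
  exact hg.stronglyMeasurableAtFilter isOpen_Ioo x hx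

variable {E₁ E₂ : Type} [NormedAddCommGroup E₁] [NormedSpace ℝ E₁] [FiniteDimensional ℝ E₁]
  [NormedAddCommGroup E₂] [NormedSpace ℝ E₂] [FiniteDimensional ℝ E₂]

/-- With `f₁ = (G, 0)` and `f₂ = (0, F)`, the first component of the integral equation is `ψ(t)`
plus an integral in `x`, and the second is `φ(x)` plus an integral in `t`. Each is differentiated in
its own variable of integration. -/
theorem exists_goursat_origin {φ : ℝ → E₂} {ψ : ℝ → E₁} (hφ : ContDiff ℝ (⊤ : ℕ∞) φ)
    (hψ : ContDiff ℝ (⊤ : ℕ∞) ψ) {G : Plane × (E₁ × E₂) → E₁} {F : Plane × (E₁ × E₂) → E₂}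
    (hG : ContDiff ℝ (⊤ : ℕ∞) G) (hF : ContDiff ℝ (⊤ : ℕ∞) F) :
    ∃ (δ : ℝ) (y : Plane → E₁ × E₂), 0 < δ ∧ ContDiffOn ℝ (⊤ : ℕ∞) y (Metric.ball 0 δ) ∧
      ∀ p ∈ Metric.ball (0 : Plane) δ,
        dx (fun q => (y q).1) p = G (p, y p) ∧ dt (fun q => (y q).2) p = F (p, y p) ∧
        (p.1 = 0 → (y p).1 = ψ p.2) ∧ (p.2 = 0 → (y p).2 = φ p.1) := by
  have : CompleteSpace E₁ := FiniteDimensional.complete ℝ E₁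
  have : CompleteSpace E₂ := FiniteDimensional.complete ℝ E₂
  obtain ⟨δ, y, hδ, hy, h⟩ := exists_integral_solution (E := E₁ × E₂)
    (d := fun p => (ψ p.2, φ p.1)) (f₁ := fun q => (G q, 0)) (f₂ := fun q => (0, F q))
    ((hψ.comp contDiff_snd).prodMk (hφ.comp contDiff_fst)) (hG.prodMk contDiff_const)
    (contDiff_const.prodMk hF)
  have hmem : ∀ p : Plane, p ∈ Metric.ball (0 : Plane) δ ↔
      p.1 ∈ Set.Ioo (-δ) δ ∧ p.2 ∈ Set.Ioo (-δ) δ := by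
    intro p
    simp [Prod.norm_def, abs_lt]
  have hsc : ∀ p ∈ Metric.ball (0 : Plane) δ, ∀ r : unitInterval,
      (p.1 * r, p.2) ∈ Metric.ball (0 : Plane) δ ∧ (p.1, p.2 * r) ∈ Metric.ball (0 : Plane) δ := by
    intro p hp r
    simp only [mem_ball_zero_iff, Prod.norm_def, max_lt_iff, norm_mul] at hp ⊢
    have h1 : ‖(r : ℝ)‖ ≤ 1 := by rw [Real.norm_of_nonneg r.2.1]; exact r.2.2
    exact ⟨⟨(mul_le_of_le_one_right (norm_nonneg _) h1).trans_lt hp.1, hp.2⟩, hp.1,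
      (mul_le_of_le_one_right (norm_nonneg _) h1).trans_lt hp.2⟩
  have hcG : ContinuousOn (fun q => G (q, y q)) (Metric.ball 0 δ) :=
    hG.continuous.comp_continuousOn (continuousOn_id.prodMk hy.continuousOn)
  have hcF : ContinuousOn (fun q => F (q, y q)) (Metric.ball 0 δ) :=
    hF.continuous.comp_continuousOn (continuousOn_id.prodMk hy.continuousOn)
  have intG : ∀ p ∈ Metric.ball (0 : Plane) δ, Integrable (fun r : unitInterval =>
      G ((p.1 * r, p.2), y (p.1 * r, p.2))) := fun p hp =>
    integrable_of_continuous_unitInterval (hcG.comp_continuous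
      (f := fun r : unitInterval => (p.1 * (r : ℝ), p.2)) (by fun_prop) fun r => (hsc p hp r).1)
  have intF : ∀ p ∈ Metric.ball (0 : Plane) δ, Integrable (fun r : unitInterval =>
      F ((p.1, p.2 * r), y (p.1, p.2 * r))) := fun p hp =>
    integrable_of_continuous_unitInterval (hcF.comp_continuous
      (f := fun r : unitInterval => (p.1, p.2 * (r : ℝ))) (by fun_prop) fun r => (hsc p hp r).2)
  have hu : ∀ p ∈ Metric.ball (0 : Plane) δ, (y p).1 = ψ p.2 +
      p.1 • ∫ r : unitInterval, G ((p.1 * r, p.2), y (p.1 * r, p.2)) := by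
    intro p hp
    have := congrArg Prod.fst (h p hp)
    simp only [Prod.fst_add, Prod.smul_fst] at this
    rw [this, fst_integral ((intG p hp).prodMk (integrable_zero _ _ _)),
      fst_integral ((integrable_zero _ _ _).prodMk (intF p hp))]
    simp
  have hv : ∀ p ∈ Metric.ball (0 : Plane) δ, (y p).2 = φ p.1 +
      p.2 • ∫ r : unitInterval, F ((p.1, p.2 * r), y (p.1, p.2 * r)) := by
    intro p hp
    have := congrArg Prod.snd (h p hp)
    simp only [Prod.snd_add, Prod.smul_snd] at this
    rw [this, snd_integral ((intG p hp).prodMk (integrable_zero _ _ _)),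
      snd_integral ((integrable_zero _ _ _).prodMk (intF p hp))]
    simp
  have hyd : ∀ p ∈ Metric.ball (0 : Plane) δ, DifferentiableAt ℝ y p := fun p hp =>
    (hy.differentiableOn (by simp)).differentiableAt (Metric.isOpen_ball.mem_nhds hp)
  refine ⟨δ, y, hδ, hy, fun p hp => ⟨?_, ?_, ?_, ?_⟩⟩
  · have hp' := (hmem p).1 hp
    have h1 := hasDerivAt_fst (u := fun q => (y q).1) (hyd p hp).fst
    have h2 : HasDerivAt (fun x => ψ p.2 + x • ∫ r : unitInterval,
        G ((x * r, p.2), y (x * r, p.2))) (G (p, y p)) p.1 :=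
      (hasDerivAt_smul_integral (g := fun x => G ((x, p.2), y (x, p.2))) (δ := δ)
        (hcG.comp (f := fun x : ℝ => (x, p.2)) (by fun_prop)
          fun x hx => (hmem (x, p.2)).2 ⟨hx, hp'.2⟩) hp'.1).const_add _
    refine h1.unique (h2.congr_of_eventuallyEq ?_)
    filter_upwards [isOpen_Ioo.mem_nhds hp'.1] with x hx
    exact hu (x, p.2) ((hmem (x, p.2)).2 ⟨hx, hp'.2⟩)
  · have hp' := (hmem p).1 hp
    have h1 := hasDerivAt_snd (u := fun q => (y q).2) (hyd p hp).snd
    have h2 : HasDerivAt (fun t => φ p.1 + t • ∫ r : unitInterval,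
        F ((p.1, t * r), y (p.1, t * r))) (F (p, y p)) p.2 :=
      (hasDerivAt_smul_integral (g := fun t => F ((p.1, t), y (p.1, t))) (δ := δ)
        (hcF.comp (f := fun t : ℝ => (p.1, t)) (by fun_prop)
          fun x hx => (hmem (p.1, x)).2 ⟨hp'.1, hx⟩) hp'.2).const_add _
    refine h1.unique (h2.congr_of_eventuallyEq ?_)
    filter_upwards [isOpen_Ioo.mem_nhds hp'.2] with x hx
    exact hv (p.1, x) ((hmem (p.1, x)).2 ⟨hp'.1, hx⟩)
  · intro h0; rw [hu p hp, h0]; simp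
  · intro h0; rw [hv p hp, h0]; simp

/-- Local solvability of the Goursat problem `u_x = G(x, t, u, v)`, `v_t = F(x, t, u, v)`,
`u(x₀, t) = ψ(t)`, `v(x, t₀) = φ(x)`. -/
theorem exists_goursat (p₀ : Plane) {φ : ℝ → E₂} {ψ : ℝ → E₁} (hφ : ContDiff ℝ (⊤ : ℕ∞) φ)
    (hψ : ContDiff ℝ (⊤ : ℕ∞) ψ) {Ω : Set (Plane × (E₁ × E₂))} (hΩ : IsOpen Ω)
    (hmem : (p₀, (ψ p₀.2, φ p₀.1)) ∈ Ω)
    {G : Plane × (E₁ × E₂) → E₁} {F : Plane × (E₁ × E₂) → E₂}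
    (hG : ContDiffOn ℝ (⊤ : ℕ∞) G Ω) (hF : ContDiffOn ℝ (⊤ : ℕ∞) F Ω) :
    ∃ (δ : ℝ) (u : Plane → E₁) (v : Plane → E₂), 0 < δ ∧
      ContDiffOn ℝ (⊤ : ℕ∞) u (Metric.ball p₀ δ) ∧ ContDiffOn ℝ (⊤ : ℕ∞) v (Metric.ball p₀ δ) ∧
      ∀ p ∈ Metric.ball p₀ δ, (p, (u p, v p)) ∈ Ω ∧
        dx u p = G (p, (u p, v p)) ∧ dt v p = F (p, (u p, v p)) ∧
        (p.1 = p₀.1 → u p = ψ p.2) ∧ (p.2 = p₀.2 → v p = φ p.1) := by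
  -- The right-hand sides are replaced by global smooth functions with the same germ at the initial
  -- value; the ball is shrunk afterwards so that the solution stays where they agree.
  obtain ⟨G', hG', hGe⟩ := exists_contDiff_eventuallyEq hΩ hG hmem
  obtain ⟨F', hF', hFe⟩ := exists_contDiff_eventuallyEq hΩ hF hmem
  obtain ⟨δ, y, hδ, hy, h⟩ := exists_goursat_origin (φ := fun x => φ (x + p₀.1))
    (ψ := fun t => ψ (t + p₀.2)) (hφ.comp (contDiff_id.add contDiff_const))
    (hψ.comp (contDiff_id.add contDiff_const))
    (G := fun q => G' (q.1 + p₀, q.2)) (F := fun q => F' (q.1 + p₀, q.2))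
    (hG'.comp ((contDiff_fst.add contDiff_const).prodMk contDiff_snd))
    (hF'.comp ((contDiff_fst.add contDiff_const).prodMk contDiff_snd))
  have h0 := h 0 (Metric.mem_ball_self hδ)
  have hy0 : y 0 = (ψ p₀.2, φ p₀.1) := by
    ext
    · simpa using h0.2.2.1 rfl
    · simpa using h0.2.2.2 rfl
  have hyc : ContinuousAt y 0 := hy.continuousOn.continuousAt (Metric.ball_mem_nhds _ hδ)
  have hc : ContinuousAt (fun p : Plane => (p, y (p - p₀))) p₀ :=
    continuousAt_id.prodMk (ContinuousAt.comp (f := fun p : Plane => p - p₀)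
      (by simpa using hyc) (by fun_prop))
  have hcv : Tendsto (fun p : Plane => (p, y (p - p₀))) (𝓝 p₀) (𝓝 (p₀, (ψ p₀.2, φ p₀.1))) := by
    simpa [ContinuousAt, hy0] using hc
  obtain ⟨δ', hδ', hall⟩ := Metric.eventually_nhds_iff.1
    (((hcv.eventually hGe).and (hcv.eventually hFe)).and (hcv.eventually (hΩ.mem_nhds hmem)))
  have hsub : ∀ p ∈ Metric.ball p₀ (min δ δ'), p - p₀ ∈ Metric.ball (0 : Plane) δ := by
    intro p hp
    rw [Metric.mem_ball, dist_eq_norm] at hp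
    simpa using hp.trans_le (min_le_left _ _)
  have hs : ContDiffOn ℝ (⊤ : ℕ∞) (fun p => y (p - p₀)) (Metric.ball p₀ (min δ δ')) :=
    hy.comp (contDiff_id.sub contDiff_const).contDiffOn hsub
  refine ⟨min δ δ', fun p => (y (p - p₀)).1, fun p => (y (p - p₀)).2, lt_min hδ hδ',
    hs.fst, hs.snd, fun p hp => ?_⟩
  obtain ⟨⟨e1, e2⟩, e3⟩ := hall (show dist p p₀ < δ' from
    (Metric.mem_ball.1 hp).trans_le (min_le_right _ _))
  obtain ⟨g1, g2, g3, g4⟩ := h (p - p₀) (hsub p hp)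
  simp only [sub_add_cancel] at g1 g2
  refine ⟨e3, ?_, ?_, ?_, ?_⟩
  · rw [← e1, ← g1]
    simp only [dx]
    rw [fderiv_comp_sub (f := fun q => (y q).1)]
  · rw [← e2, ← g2]
    simp only [dt]
    rw [fderiv_comp_sub (f := fun q => (y q).2)]
  · intro hp1
    have := g3 (by simp [hp1])
    simpa using this
  · intro hp1
    have := g4 (by simp [hp1])
    simpa using this

end GoursatDiff

/-! ### Partial derivatives in the plane -/

section Calculus

open Filter Topology

variable {E : Type} [NormedAddCommGroup E] [NormedSpace ℝ E] {V : Set Plane} {u v : Plane → E}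
  {p : Plane}

theorem ContDiffOn.dx (hV : IsOpen V) (hu : ContDiffOn ℝ (⊤ : ℕ∞) u V) :
    ContDiffOn ℝ (⊤ : ℕ∞) (PSS.dx u) V :=
  (hu.fderiv_of_isOpen hV (by simp)).clm_apply contDiffOn_const

theorem ContDiffOn.dt (hV : IsOpen V) (hu : ContDiffOn ℝ (⊤ : ℕ∞) u V) :
    ContDiffOn ℝ (⊤ : ℕ∞) (PSS.dt u) V :=
  (hu.fderiv_of_isOpen hV (by simp)).clm_apply contDiffOn_const

theorem ContDiffOn.dx_iterate (hV : IsOpen V) (hu : ContDiffOn ℝ (⊤ : ℕ∞) u V) (k : ℕ) :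
    ContDiffOn ℝ (⊤ : ℕ∞) (PSS.dx^[k] u) V := by
  induction k with
  | zero => exact hu
  | succ k ih => rw [Function.iterate_succ_apply']; exact ContDiffOn.dx hV ih

theorem ContDiffOn.dt_iterate (hV : IsOpen V) (hu : ContDiffOn ℝ (⊤ : ℕ∞) u V) (k : ℕ) :
    ContDiffOn ℝ (⊤ : ℕ∞) (PSS.dt^[k] u) V := by
  induction k with
  | zero => exact hu
  | succ k ih => rw [Function.iterate_succ_apply']; exact ContDiffOn.dt hV ih

theorem differentiableAt_of_smooth (hV : IsOpen V) (hu : ContDiffOn ℝ (⊤ : ℕ∞) u V) (hp : p ∈ V) :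
    DifferentiableAt ℝ u p :=
  (hu.differentiableOn (by simp)).differentiableAt (hV.mem_nhds hp)

theorem dx_congr (hV : IsOpen V) (h : Set.EqOn u v V) : Set.EqOn (dx u) (dx v) V := fun p hp => by
  simp only [dx, (h.eventuallyEq_of_mem (hV.mem_nhds hp)).fderiv_eq]

theorem dt_congr (hV : IsOpen V) (h : Set.EqOn u v V) : Set.EqOn (dt u) (dt v) V := fun p hp => by
  simp only [dt, (h.eventuallyEq_of_mem (hV.mem_nhds hp)).fderiv_eq]

theorem dx_iterate_congr (hV : IsOpen V) (h : Set.EqOn u v V) (k : ℕ) :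
    Set.EqOn (dx^[k] u) (dx^[k] v) V := by
  induction k with
  | zero => exact h
  | succ k ih =>
    rw [Function.iterate_succ_apply', Function.iterate_succ_apply']; exact dx_congr hV ih

theorem dt_dx_comm (hV : IsOpen V) (hu : ContDiffOn ℝ (⊤ : ℕ∞) u V) :
    Set.EqOn (dt (dx u)) (dx (dt u)) V := fun p hp => by
  have hu' : ContDiffAt ℝ (⊤ : ℕ∞) u p := hu.contDiffAt (hV.mem_nhds hp)
  have hd : DifferentiableAt ℝ (fderiv ℝ u) p :=
    (hu'.fderiv_right (m := (⊤ : ℕ∞)) (by simp)).differentiableAt (by simp)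
  have hs : IsSymmSndFDerivAt ℝ u p := hu'.isSymmSndFDerivAt (by
    rw [minSmoothness_of_isRCLikeNormedField]; exact WithTop.coe_le_coe.2 le_top)
  have e1 : dt (dx u) p = fderiv ℝ (fderiv ℝ u) p (0, 1) (1, 0) := by
    unfold dt dx
    rw [fderiv_clm_apply hd (differentiableAt_const _)]
    simp
  have e2 : dx (dt u) p = fderiv ℝ (fderiv ℝ u) p (1, 0) (0, 1) := by
    unfold dt dx
    rw [fderiv_clm_apply hd (differentiableAt_const _)]
    simp
  rw [e1, e2]
  exact hs.eq _ _

theorem dt_iterate_dx (hV : IsOpen V) (hu : ContDiffOn ℝ (⊤ : ℕ∞) u V) (k : ℕ) :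
    Set.EqOn (dt^[k] (dx u)) (dx (dt^[k] u)) V := by
  induction k with
  | zero => exact fun p _ => rfl
  | succ k ih =>
    rw [Function.iterate_succ_apply', Function.iterate_succ_apply']
    exact (dt_congr hV ih).trans (dt_dx_comm hV (ContDiffOn.dt_iterate hV hu k))

theorem dx_iterate_dt (hV : IsOpen V) (hu : ContDiffOn ℝ (⊤ : ℕ∞) u V) (k : ℕ) :
    Set.EqOn (dx^[k] (dt u)) (dt (dx^[k] u)) V := by
  induction k with
  | zero => exact fun p _ => rfl
  | succ k ih =>
    rw [Function.iterate_succ_apply', Function.iterate_succ_apply']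
    exact (dx_congr hV ih).trans (dt_dx_comm hV (ContDiffOn.dx_iterate hV hu k)).symm

theorem dx_iterate_eq_iteratedDeriv (hV : IsOpen V) (hu : ContDiffOn ℝ (⊤ : ℕ∞) u V) {t : ℝ}
    {φ : ℝ → E} (h : ∀ x, (x, t) ∈ V → u (x, t) = φ x) (k : ℕ) :
    ∀ x, (x, t) ∈ V → (dx^[k] u) (x, t) = iteratedDeriv k φ x := by
  induction k with
  | zero => simpa using h
  | succ k ih =>
    intro x hx
    rw [Function.iterate_succ_apply', iteratedDeriv_succ]
    have h1 := hasDerivAt_fst (differentiableAt_of_smooth hV (ContDiffOn.dx_iterate hV hu k) hx)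
    refine (h1.congr_of_eventuallyEq ?_).deriv.symm
    have hc : Continuous fun x : ℝ => (x, t) := by fun_prop
    filter_upwards [hc.continuousAt.preimage_mem_nhds (hV.mem_nhds hx)] with y hy
    exact (ih y hy).symm

theorem dt_iterate_eq_iteratedDeriv (hV : IsOpen V) (hu : ContDiffOn ℝ (⊤ : ℕ∞) u V) {x : ℝ}
    {ψ : ℝ → E} (h : ∀ t, (x, t) ∈ V → u (x, t) = ψ t) (k : ℕ) :
    ∀ t, (x, t) ∈ V → (dt^[k] u) (x, t) = iteratedDeriv k ψ t := by
  induction k with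
  | zero => simpa using h
  | succ k ih =>
    intro t ht
    rw [Function.iterate_succ_apply', iteratedDeriv_succ]
    have h1 := hasDerivAt_snd (differentiableAt_of_smooth hV (ContDiffOn.dt_iterate hV hu k) ht)
    refine (h1.congr_of_eventuallyEq ?_).deriv.symm
    have hc : Continuous fun t : ℝ => (x, t) := by fun_prop
    filter_upwards [hc.continuousAt.preimage_mem_nhds (hV.mem_nhds ht)] with y hy
    exact (ih y hy).symm

end Calculus

/-! ### Jets of curves -/

section CurveJets

variable {E G : Type} [NormedAddCommGroup E] [NormedSpace ℝ E] [NormedAddCommGroup G]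
  [NormedSpace ℝ G]

/-- The derivatives of order at most `k` agree at `t`. -/
def JetEq {E : Type} [NormedAddCommGroup E] [NormedSpace ℝ E] (k : ℕ) (t : ℝ) (y z : ℝ → E) :
    Prop :=
  ∀ i ≤ k, iteratedDeriv i y t = iteratedDeriv i z t

theorem jetEq_succ_iff {k : ℕ} {t : ℝ} {y z : ℝ → E} :
    JetEq (k + 1) t y z ↔ y t = z t ∧ JetEq k t (deriv y) (deriv z) := by
  constructor
  · intro h
    refine ⟨by simpa using h 0 (Nat.zero_le _), fun i hi => ?_⟩
    rw [← iteratedDeriv_succ', ← iteratedDeriv_succ']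
    exact h (i + 1) (by omega)
  · rintro ⟨h0, h⟩ i hi
    cases i with
    | zero => simpa using h0
    | succ i =>
      rw [iteratedDeriv_succ', iteratedDeriv_succ']
      exact h i (by omega)

theorem JetEq.mono {k m : ℕ} {t : ℝ} {y z : ℝ → E} (h : JetEq k t y z) (hm : m ≤ k) :
    JetEq m t y z := fun i hi => h i (hi.trans hm)

theorem deriv_prod {y : ℝ → E} {z : ℝ → G} (hy : Differentiable ℝ y) (hz : Differentiable ℝ z) :
    deriv (fun s => (y s, z s)) = fun s => (deriv y s, deriv z s) := by
  ext1 s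
  exact ((hy s).hasDerivAt.prodMk (hz s).hasDerivAt).deriv

theorem JetEq.prodMk {k : ℕ} {t : ℝ} : ∀ {y z : ℝ → E} {y' z' : ℝ → G},
    ContDiff ℝ (⊤ : ℕ∞) y → ContDiff ℝ (⊤ : ℕ∞) z → ContDiff ℝ (⊤ : ℕ∞) y' →
    ContDiff ℝ (⊤ : ℕ∞) z' → JetEq k t y z → JetEq k t y' z' →
    JetEq k t (fun s => (y s, y' s)) (fun s => (z s, z' s)) := by
  induction k with
  | zero =>
    intro y z y' z' _ _ _ _ h h' i hi
    have e1 := h 0 le_rfl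
    have e2 := h' 0 le_rfl
    obtain rfl : i = 0 := by omega
    simp only [iteratedDeriv_zero] at *
    rw [e1, e2]
  | succ k ih =>
    intro y z y' z' hy hz hy' hz' h h'
    rw [jetEq_succ_iff] at h h' ⊢
    refine ⟨by simp only [h.1, h'.1], ?_⟩
    have hd : ∀ {A : Type} [NormedAddCommGroup A] [NormedSpace ℝ A] {f : ℝ → A},
      ContDiff ℝ (⊤ : ℕ∞) f → Differentiable ℝ f ∧ ContDiff ℝ (⊤ : ℕ∞) (deriv f) :=
      fun hf => contDiff_infty_iff_deriv.1 hf
    rw [deriv_prod (hd hy).1 (hd hy').1, deriv_prod (hd hz).1 (hd hz').1]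
    exact ih (hd hy).2 (hd hz).2 (hd hy').2 (hd hz').2 h.2 h'.2

/-- The derivative of `H ∘ y` is the tangent map of `H` applied to `(y, y')`. The induction replaces
`H` by this map on `E × E`, so `E` must be quantified inside the statement. -/
theorem JetEq.comp {k : ℕ} {t : ℝ} : ∀ {E : Type} [NormedAddCommGroup E] [NormedSpace ℝ E]
    {y z : ℝ → E} {H : E → G},
    ContDiff ℝ (⊤ : ℕ∞) y → ContDiff ℝ (⊤ : ℕ∞) z → ContDiff ℝ (⊤ : ℕ∞) H → JetEq k t y z →
    JetEq k t (fun s => H (y s)) (fun s => H (z s)) := by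
  induction k with
  | zero =>
    intro E _ _ y z H _ _ _ h i hi
    obtain rfl : i = 0 := by omega
    have e1 := h 0 le_rfl
    simp only [iteratedDeriv_zero] at *
    rw [e1]
  | succ k ih =>
    intro E _ _ y z H hy hz hH h
    have h' := jetEq_succ_iff.1 h
    have hd : ∀ {f : ℝ → E},
      ContDiff ℝ (⊤ : ℕ∞) f → Differentiable ℝ f ∧ ContDiff ℝ (⊤ : ℕ∞) (deriv f) :=
      fun hf => contDiff_infty_iff_deriv.1 hf
    have hc : ∀ {f : ℝ → E}, ContDiff ℝ (⊤ : ℕ∞) f →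
        deriv (fun s => H (f s)) =
          fun s => (fun q : E × E => fderiv ℝ H q.1 q.2) (f s, deriv f s) := by
      intro f hf
      ext1 s
      exact (((hH.differentiable (by simp)) (f s)).hasFDerivAt.comp_hasDerivAt s
        ((hd hf).1 s).hasDerivAt).deriv
    rw [jetEq_succ_iff]
    refine ⟨by simp only [h'.1], ?_⟩
    rw [hc hy, hc hz]
    refine ih (H := fun q : E × E => fderiv ℝ H q.1 q.2) (hy.prodMk (hd hy).2)
      (hz.prodMk (hd hz).2) ?_
      (JetEq.prodMk hy hz (hd hy).2 (hd hz).2 (h.mono (Nat.le_succ k)) h'.2)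
    exact ((hH.fderiv_right (m := (⊤ : ℕ∞)) (by simp)).comp contDiff_fst).clm_apply contDiff_snd

theorem JetEq.congr {k : ℕ} {t : ℝ} {y z y' z' : ℝ → E} (h : JetEq k t y z)
    (hy : y =ᶠ[nhds t] y') (hz : z =ᶠ[nhds t] z') : JetEq k t y' z' := fun i hi => by
  rw [← hy.iteratedDeriv_eq i, ← hz.iteratedDeriv_eq i]
  exact h i hi

/-- A smooth function with prescribed derivatives at a point. -/
theorem exists_contDiff_iteratedDeriv_eq (x₀ : ℝ) (c : ℕ → ℝ) (n : ℕ) :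
    ∃ φ : ℝ → ℝ, ContDiff ℝ (⊤ : ℕ∞) φ ∧ ∀ i < n, iteratedDeriv i φ x₀ = c i := by
  have hp : ∀ k : ℕ, ContDiff ℝ (⊤ : ℕ∞) fun x : ℝ => c k / k.factorial * x ^ k := fun k => by
    fun_prop
  refine ⟨fun x => ∑ k ∈ Finset.range n, c k / k.factorial * (x - x₀) ^ k, by fun_prop, ?_⟩
  intro i hi
  rw [iteratedDeriv_comp_sub_const i (fun x : ℝ => ∑ k ∈ Finset.range n, c k / k.factorial * x ^ k)]
  simp only [sub_self]
  rw [iteratedDeriv_fun_sum fun k _ => ((hp k).of_le (WithTop.coe_le_coe.2 le_top)).contDiffAt]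
  rw [Finset.sum_eq_single i]
  · rw [iteratedDeriv_const_mul_field, iteratedDeriv_fun_pow_zero]
    simp [Nat.factorial_ne_zero]
  · intro k _ hk
    rw [iteratedDeriv_const_mul_field, iteratedDeriv_fun_pow_zero]
    simp [hk.symm]
  · intro h
    exact absurd (Finset.mem_range.2 hi) h

end CurveJets

/-! ### Jets of solutions: realization and mixed derivatives -/

section JetSpace

open Filter Topology

variable {F : ℝ → ℝ → ℝ} {U : Set (ℝ × ℝ)} {V : Set Plane} {u : Plane → ℝ} {p : Plane} {l : ℕ}

/-- Every jet over the domain of the equation is the jet of a local solution. -/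
theorem exists_solution_jet (hU : IsOpen U)
    (hF : ContDiffOn ℝ (⊤ : ℕ∞) (fun q : ℝ × ℝ => F q.1 q.2) U) (j : Jet (l + 1))
    (hj : (j.2.2.1, j.2.2.2.1 0) ∈ U) :
    ∃ (V : Set Plane) (u : Plane → ℝ), IsOpen V ∧ (j.1, j.2.1) ∈ V ∧ IsSolution F U V u ∧
      jet (l + 1) u (j.1, j.2.1) = j := by
  -- The Goursat problem is solved for the pair `(u, u_x)`. The data `φ` are the values of `u_x` on
  -- the horizontal line, so the `i`-th derivative of `φ` is the coordinate of `∂_x^{i+1} u`. The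
  -- data `ψ` are the values of `u` itself on the vertical line, hence the shift of index and the
  -- extra order.
  obtain ⟨φ, hφ, hφ'⟩ := exists_contDiff_iteratedDeriv_eq j.1
    (fun i => if h : i < l + 1 then j.2.2.2.1 ⟨i, h⟩ else 0) (l + 1)
  obtain ⟨ψ, hψ, hψ'⟩ := exists_contDiff_iteratedDeriv_eq j.2.1
    (fun i => if i = 0 then j.2.2.1 else if h : i - 1 < l + 1 then j.2.2.2.2 ⟨i - 1, h⟩ else 0)
    (l + 2)
  have hφ0 : φ j.1 = j.2.2.2.1 0 := by simpa using hφ' 0 (by omega)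
  have hψ0 : ψ j.2.1 = j.2.2.1 := by simpa using hψ' 0 (by omega)
  have hc : Continuous fun q : Plane × (ℝ × ℝ) => q.2 := continuous_snd
  obtain ⟨δ, u, v, hδ, hu, hv, h⟩ := exists_goursat (p₀ := (j.1, j.2.1)) hφ hψ
    (Ω := {q | q.2 ∈ U}) (hU.preimage hc) (by simpa [hφ0, hψ0] using hj)
    (G := fun q => q.2.2) (F := fun q => F q.2.1 q.2.2)
    (contDiff_snd.comp contDiff_snd).contDiffOn
    (hF.comp (contDiff_snd (E := Plane)).contDiffOn fun q hq => hq)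
  set p₀ : Plane := (j.1, j.2.1) with hp₀
  have hB : IsOpen (Metric.ball p₀ δ) := Metric.isOpen_ball
  have hmem : p₀ ∈ Metric.ball p₀ δ := Metric.mem_ball_self hδ
  have hdx : Set.EqOn (dx u) v (Metric.ball p₀ δ) := fun p hp => (h p hp).2.1
  refine ⟨Metric.ball p₀ δ, u, hB, hmem, ⟨hu, fun p hp => ?_, fun p hp => ?_⟩, ?_⟩
  · rw [hdx hp]; exact (h p hp).1
  · rw [dt_congr hB hdx hp, hdx hp]; exact (h p hp).2.2.1
  · have e0 : u p₀ = j.2.2.1 := by rw [(h p₀ hmem).2.2.2.1 rfl, ← hψ0]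
    have e1 : ∀ i : Fin (l + 1), (dx^[i.val + 1] u) p₀ = j.2.2.2.1 i := by
      intro i
      rw [Function.iterate_succ_apply, dx_iterate_congr hB hdx i hmem,
        dx_iterate_eq_iteratedDeriv hB hv (t := j.2.1) (φ := φ)
          (fun x hx => (h _ hx).2.2.2.2 rfl) i j.1 hmem, hφ' i i.2]
      exact dif_pos i.2
    have e2 : ∀ i : Fin (l + 1), (dt^[i.val + 1] u) p₀ = j.2.2.2.2 i := by
      intro i
      rw [dt_iterate_eq_iteratedDeriv hB hu (x := j.1) (ψ := ψ)
          (fun x hx => (h _ hx).2.2.2.1 rfl) (i + 1) j.2.1 hmem, hψ' (i + 1) (by omega)]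
      rw [if_neg (Nat.succ_ne_zero _)]
      exact dif_pos i.2
    exact Prod.ext rfl (Prod.ext rfl (Prod.ext e0 (Prod.ext (funext e1) (funext e2))))

theorem differentiableAt_jet (hV : IsOpen V) (hu : ContDiffOn ℝ (⊤ : ℕ∞) u V) (hp : p ∈ V) (l : ℕ) :
    DifferentiableAt ℝ (jet l u) p := by
  have h1 : ∀ i, DifferentiableAt ℝ (dx^[i] u) p := fun i =>
    differentiableAt_of_smooth hV (ContDiffOn.dx_iterate hV hu i) hp
  have h2 : ∀ i, DifferentiableAt ℝ (dt^[i] u) p := fun i =>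
    differentiableAt_of_smooth hV (ContDiffOn.dt_iterate hV hu i) hp
  exact differentiableAt_fst.prodMk (differentiableAt_snd.prodMk ((h1 0).prodMk
    ((differentiableAt_pi.2 fun i => h1 _).prodMk (differentiableAt_pi.2 fun i => h2 _))))

theorem dx_jet (hV : IsOpen V) (hu : ContDiffOn ℝ (⊤ : ℕ∞) u V) (hp : p ∈ V) (l : ℕ) :
    dx (jet l u) p = (1, 0, dx u p, fun i => (dx^[i.val + 2] u) p,
      fun i => dx (dt^[i.val + 1] u) p) := by
  have h1 : ∀ i, HasDerivAt (fun x => (dx^[i] u) (x, p.2)) ((dx^[i + 1] u) p) p.1 := fun i => by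
    rw [Function.iterate_succ_apply']
    exact hasDerivAt_fst (differentiableAt_of_smooth hV (ContDiffOn.dx_iterate hV hu i) hp)
  have h2 : ∀ i, HasDerivAt (fun x => (dt^[i] u) (x, p.2)) (dx (dt^[i] u) p) p.1 := fun i =>
    hasDerivAt_fst (differentiableAt_of_smooth hV (ContDiffOn.dt_iterate hV hu i) hp)
  refine (hasDerivAt_fst (differentiableAt_jet hV hu hp l)).unique ?_
  exact (hasDerivAt_id p.1).prodMk ((hasDerivAt_const _ _).prodMk ((h1 0).prodMk
    ((hasDerivAt_pi.2 fun i => h1 _).prodMk (hasDerivAt_pi.2 fun i => h2 _))))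

theorem dt_jet (hV : IsOpen V) (hu : ContDiffOn ℝ (⊤ : ℕ∞) u V) (hp : p ∈ V) (l : ℕ) :
    dt (jet l u) p = (0, 1, dt u p, fun i => dt (dx^[i.val + 1] u) p,
      fun i => (dt^[i.val + 2] u) p) := by
  have h1 : ∀ i, HasDerivAt (fun x => (dt^[i] u) (p.1, x)) ((dt^[i + 1] u) p) p.2 := fun i => by
    rw [Function.iterate_succ_apply']
    exact hasDerivAt_snd (differentiableAt_of_smooth hV (ContDiffOn.dt_iterate hV hu i) hp)
  have h2 : ∀ i, HasDerivAt (fun x => (dx^[i] u) (p.1, x)) (dt (dx^[i] u) p) p.2 := fun i =>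
    hasDerivAt_snd (differentiableAt_of_smooth hV (ContDiffOn.dx_iterate hV hu i) hp)
  refine (hasDerivAt_snd (differentiableAt_jet hV hu hp l)).unique ?_
  exact (hasDerivAt_const _ _).prodMk ((hasDerivAt_id p.2).prodMk ((h1 0).prodMk
    ((hasDerivAt_pi.2 fun i => h2 _).prodMk (hasDerivAt_pi.2 fun i => h1 _))))

/-- The germ of `w` along a vertical line extends to a smooth curve. -/
theorem exists_curve_snd {E : Type} [NormedAddCommGroup E] [NormedSpace ℝ E] {w : Plane → E}
    (hV : IsOpen V) (hw : ContDiffOn ℝ (⊤ : ℕ∞) w V) (hp : p ∈ V) :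
    ∃ y : ℝ → E, ContDiff ℝ (⊤ : ℕ∞) y ∧ (∀ᶠ t in 𝓝 p.2, y t = w (p.1, t)) ∧
      ∀ i, iteratedDeriv i y p.2 = (dt^[i] w) p := by
  have hc : Continuous fun t : ℝ => (p.1, t) := by fun_prop
  have hcs : ContDiff ℝ (⊤ : ℕ∞) fun t : ℝ => (p.1, t) := by fun_prop
  obtain ⟨y, hy, hye⟩ := exists_contDiff_eventuallyEq (hV.preimage hc)
    (hw.comp hcs.contDiffOn fun t ht => ht) (x := p.2) hp
  refine ⟨y, hy, hye, fun i => ?_⟩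
  rw [Filter.EventuallyEq.iteratedDeriv_eq i hye]
  exact (dt_iterate_eq_iteratedDeriv hV hw (fun t _ => rfl) i p.2 hp).symm

theorem exists_curve_fst {E : Type} [NormedAddCommGroup E] [NormedSpace ℝ E] {w : Plane → E}
    (hV : IsOpen V) (hw : ContDiffOn ℝ (⊤ : ℕ∞) w V) (hp : p ∈ V) :
    ∃ y : ℝ → E, ContDiff ℝ (⊤ : ℕ∞) y ∧ (∀ᶠ x in 𝓝 p.1, y x = w (x, p.2)) ∧
      ∀ i, iteratedDeriv i y p.1 = (dx^[i] w) p := by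
  have hc : Continuous fun x : ℝ => (x, p.2) := by fun_prop
  have hcs : ContDiff ℝ (⊤ : ℕ∞) fun x : ℝ => (x, p.2) := by fun_prop
  obtain ⟨y, hy, hye⟩ := exists_contDiff_eventuallyEq (hV.preimage hc)
    (hw.comp hcs.contDiffOn fun t ht => ht) (x := p.1) hp
  refine ⟨y, hy, hye, fun i => ?_⟩
  rw [Filter.EventuallyEq.iteratedDeriv_eq i hye]
  exact (dx_iterate_eq_iteratedDeriv hV hw (fun t _ => rfl) i p.1 hp).symm

variable {V' : Set Plane} {u' : Plane → ℝ}

/-- `∂_x ∂_t^i u` is determined by `u, u_x, ∂_t u, …, ∂_t^{i-1} u`. -/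
theorem dx_dt_iterate_determined (hU : IsOpen U)
    (hF : ContDiffOn ℝ (⊤ : ℕ∞) (fun q : ℝ × ℝ => F q.1 q.2) U) (hV : IsOpen V) (hV' : IsOpen V')
    (hu : IsSolution F U V u) (hu' : IsSolution F U V' u') (hp : p ∈ V) (hp' : p ∈ V')
    (hx : dx u p = dx u' p) (k : ℕ) (h : ∀ i < k, (dt^[i] u) p = (dt^[i] u') p) :
    ∀ i ≤ k, dx (dt^[i] u) p = dx (dt^[i] u') p := by
  have hux : u p = u' p ∨ k = 0 := by
    rcases Nat.eq_zero_or_pos k with h0 | h0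
    · exact Or.inr h0
    · exact Or.inl (h 0 h0)
  rcases hux with h0 | h0
  swap
  · subst h0; intro i hi; obtain rfl : i = 0 := by omega
    exact hx
  have hmem : (u p, dx u p) ∈ U := hu.mem p hp
  -- On the vertical line through `p`, `y = u` and `z = u_x` satisfy `z' = H(y, z)`, so the `m`-jets
  -- of `y` and `z` determine the `(m+1)`-jet of `z`.
  obtain ⟨H, hH, hHe⟩ := exists_contDiff_eventuallyEq hU hF hmem
  have aux : ∀ {V : Set Plane} {u : Plane → ℝ}, IsOpen V → IsSolution F U V u → p ∈ V →
      H =ᶠ[𝓝 (u p, dx u p)] (fun q : ℝ × ℝ => F q.1 q.2) →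
      ∃ y z : ℝ → ℝ, ContDiff ℝ (⊤ : ℕ∞) y ∧ ContDiff ℝ (⊤ : ℕ∞) z ∧
        (∀ i, iteratedDeriv i y p.2 = (dt^[i] u) p) ∧
        (∀ i, iteratedDeriv i z p.2 = dx (dt^[i] u) p) ∧
        deriv z =ᶠ[𝓝 p.2] fun t => H (y t, z t) := by
    intro V u hV hu hp hHe
    obtain ⟨y, hy, hye, hyd⟩ := exists_curve_snd hV hu.smooth hp
    obtain ⟨z, hz, hze, hzd⟩ := exists_curve_snd hV (ContDiffOn.dx hV hu.smooth) hp
    refine ⟨y, z, hy, hz, hyd, fun i => (hzd i).trans (dt_iterate_dx hV hu.smooth i hp), ?_⟩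
    have hc : Continuous fun t : ℝ => (p.1, t) := by fun_prop
    have hyz : ContinuousAt (fun t => (y t, z t)) p.2 :=
      hy.continuous.continuousAt.prodMk hz.continuous.continuousAt
    have hyz0 : (y p.2, z p.2) = (u p, dx u p) := by
      rw [hye.self_of_nhds, hze.self_of_nhds]
    have h1 : ∀ᶠ t in 𝓝 p.2, H (y t, z t) = F (y t) (z t) := by
      have : Tendsto (fun t => (y t, z t)) (𝓝 p.2) (𝓝 (u p, dx u p)) := by
        rw [← hyz0]; exact hyz
      exact this.eventually hHe
    filter_upwards [hye, hze.eventually_nhds, h1,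
      hc.continuousAt.preimage_mem_nhds (hV.mem_nhds hp)] with t h1 h2 h3 h4
    rw [h3, h1, h2.self_of_nhds, ← hu.eqn _ h4, Filter.EventuallyEq.deriv_eq h2]
    exact (hasDerivAt_snd (differentiableAt_of_smooth hV (ContDiffOn.dx hV hu.smooth) h4)).deriv
  obtain ⟨y, z, hy, hz, hyd, hzd, hode⟩ := aux hV hu hp hHe
  obtain ⟨y', z', hy', hz', hyd', hzd', hode'⟩ := aux hV' hu' hp' (by rw [← h0, ← hx]; exact hHe)
  have key : ∀ m ≤ k, JetEq m p.2 z z' := by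
    intro m
    induction m with
    | zero =>
      intro _ i hi
      obtain rfl : i = 0 := by omega
      rw [hzd, hzd']; exact hx
    | succ m ih =>
      intro hm
      have hyy : JetEq m p.2 y y' := fun i hi => by rw [hyd, hyd']; exact h i (by omega)
      have e := JetEq.comp (hy.prodMk hz) (hy'.prodMk hz') hH
        (JetEq.prodMk hy hy' hz hz' hyy (ih (by omega)))
      have h1 := ih (by omega) 0 (Nat.zero_le _)
      exact jetEq_succ_iff.2 ⟨by simpa using h1, e.congr hode.symm hode'.symm⟩
  intro i hi
  rw [← hzd, ← hzd']
  exact key k le_rfl i hi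

/-- `∂_t ∂_x^{i+1} u` is determined by `u, u_x, …, ∂_x^{i+1} u`. -/
theorem dt_dx_iterate_determined (hU : IsOpen U)
    (hF : ContDiffOn ℝ (⊤ : ℕ∞) (fun q : ℝ × ℝ => F q.1 q.2) U) (hV : IsOpen V) (hV' : IsOpen V')
    (hu : IsSolution F U V u) (hu' : IsSolution F U V' u') (hp : p ∈ V) (hp' : p ∈ V')
    (k : ℕ) (h : ∀ i ≤ k + 1, (dx^[i] u) p = (dx^[i] u') p) :
    dt (dx^[k + 1] u) p = dt (dx^[k + 1] u') p := by
  have hmem : (u p, dx u p) ∈ U := hu.mem p hp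
  -- Here `∂_t ∂_x^{k+1} u = ∂_x^k F(u, u_x)` is the `k`-th derivative of `H(y, z)` on the
  -- horizontal line.
  obtain ⟨H, hH, hHe⟩ := exists_contDiff_eventuallyEq hU hF hmem
  have aux : ∀ {V : Set Plane} {u : Plane → ℝ}, IsOpen V → IsSolution F U V u → p ∈ V →
      H =ᶠ[𝓝 (u p, dx u p)] (fun q : ℝ × ℝ => F q.1 q.2) →
      ∃ y z : ℝ → ℝ, ContDiff ℝ (⊤ : ℕ∞) y ∧ ContDiff ℝ (⊤ : ℕ∞) z ∧
        (∀ i, iteratedDeriv i y p.1 = (dx^[i] u) p) ∧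
        (∀ i, iteratedDeriv i z p.1 = (dx^[i + 1] u) p) ∧
        iteratedDeriv k (fun t => H (y t, z t)) p.1 = dt (dx^[k + 1] u) p := by
    intro V u hV hu hp hHe
    obtain ⟨y, hy, hye, hyd⟩ := exists_curve_fst hV hu.smooth hp
    obtain ⟨z, hz, hze, hzd⟩ := exists_curve_fst hV (ContDiffOn.dx hV hu.smooth) hp
    refine ⟨y, z, hy, hz, hyd, fun i => by rw [hzd, Function.iterate_succ_apply], ?_⟩
    obtain ⟨w, hw, hwe, hwd⟩ := exists_curve_fst hV
      (ContDiffOn.dt hV (ContDiffOn.dx hV hu.smooth)) hp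
    have hc : Continuous fun x : ℝ => (x, p.2) := by fun_prop
    have hyz : ContinuousAt (fun t => (y t, z t)) p.1 :=
      hy.continuous.continuousAt.prodMk hz.continuous.continuousAt
    have hyz0 : (y p.1, z p.1) = (u p, dx u p) := by
      rw [hye.self_of_nhds, hze.self_of_nhds]
    have h1 : ∀ᶠ t in 𝓝 p.1, H (y t, z t) = F (y t) (z t) := by
      have : Tendsto (fun t => (y t, z t)) (𝓝 p.1) (𝓝 (u p, dx u p)) := by
        rw [← hyz0]; exact hyz
      exact this.eventually hHe
    have hE : (fun t => H (y t, z t)) =ᶠ[𝓝 p.1] w := by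
      filter_upwards [hye, hze, h1, hwe,
        hc.continuousAt.preimage_mem_nhds (hV.mem_nhds hp)] with t h1 h2 h3 h4 h5
      rw [h3, h1, h2, h4, ← hu.eqn _ h5]
    rw [hE.iteratedDeriv_eq k, hwd, Function.iterate_succ_apply]
    exact dx_iterate_dt hV (ContDiffOn.dx hV hu.smooth) k hp
  have h0 : u p = u' p := h 0 (Nat.zero_le _)
  have h1 : dx u p = dx u' p := h 1 (by omega)
  obtain ⟨y, z, hy, hz, hyd, hzd, he⟩ := aux hV hu hp hHe
  obtain ⟨y', z', hy', hz', hyd', hzd', he'⟩ := aux hV' hu' hp' (by rw [← h0, ← h1]; exact hHe)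
  rw [← he, ← he']
  refine JetEq.comp (hy.prodMk hz) (hy'.prodMk hz') hH
    (JetEq.prodMk (k := k) hy hy' hz hz' (fun i hi => ?_) fun i hi => ?_) k le_rfl
  · rw [hyd, hyd']; exact h i (by omega)
  · rw [hzd, hzd']; exact h (i + 1) (by omega)

end JetSpace

/-! ### The Gauss and Codazzi equations of an immersion -/

section Immersion

variable {E : Type} [NormedAddCommGroup E] [NormedSpace ℝ E] {p : Plane} {W : Set Plane}

theorem dx_smul {f : Plane → ℝ} {v : Plane → E} (hf : DifferentiableAt ℝ f p)
    (hv : DifferentiableAt ℝ v p) : dx (fun q => f q • v q) p = f p • dx v p + dx f p • v p := by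
  simp [dx, fderiv_fun_smul hf hv]

theorem dt_smul {f : Plane → ℝ} {v : Plane → E} (hf : DifferentiableAt ℝ f p)
    (hv : DifferentiableAt ℝ v p) : dt (fun q => f q • v q) p = f p • dt v p + dt f p • v p := by
  simp [dt, fderiv_fun_smul hf hv]

theorem dx_add {f g : Plane → E} (hf : DifferentiableAt ℝ f p)
    (hg : DifferentiableAt ℝ g p) : dx (fun q => f q + g q) p = dx f p + dx g p := by
  simp [dx, fderiv_fun_add hf hg]

theorem dt_add {f g : Plane → E} (hf : DifferentiableAt ℝ f p)
    (hg : DifferentiableAt ℝ g p) : dt (fun q => f q + g q) p = dt f p + dt g p := by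
  simp [dt, fderiv_fun_add hf hg]

theorem dx_mul {f g : Plane → ℝ} (hf : DifferentiableAt ℝ f p)
    (hg : DifferentiableAt ℝ g p) : dx (fun q => f q * g q) p = f p * dx g p + dx f p * g p :=
  dx_smul hf hg

theorem dt_mul {f g : Plane → ℝ} (hf : DifferentiableAt ℝ f p)
    (hg : DifferentiableAt ℝ g p) : dt (fun q => f q * g q) p = f p * dt g p + dt f p * g p :=
  dt_smul hf hg

theorem dx_inner {v w : Plane → E3} (hv : DifferentiableAt ℝ v p) (hw : DifferentiableAt ℝ w p) :
    dx (fun q => inner ℝ (v q) (w q)) p = inner ℝ (v p) (dx w p) + inner ℝ (dx v p) (w p) := by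
  simp only [dx]
  rw [fderiv_inner_apply ℝ hv hw]

theorem dt_inner {v w : Plane → E3} (hv : DifferentiableAt ℝ v p) (hw : DifferentiableAt ℝ w p) :
    dt (fun q => inner ℝ (v q) (w q)) p = inner ℝ (v p) (dt w p) + inner ℝ (dt v p) (w p) := by
  simp only [dt]
  rw [fderiv_inner_apply ℝ hv hw]

/-- The mixed second derivatives cancel, so only products of first derivatives remain. Applied to
pairs of frame vectors, this is the source of the Gauss and Codazzi equations. -/
theorem curl_inner (hW : IsOpen W) {v w : Plane → E3} (hv : ContDiffOn ℝ (⊤ : ℕ∞) v W)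
    (hw : ContDiffOn ℝ (⊤ : ℕ∞) w W) (hp : p ∈ W) :
    dx (fun q => inner ℝ (dt v q) (w q)) p - dt (fun q => inner ℝ (dx v q) (w q)) p =
      inner ℝ (dt v p) (dx w p) - inner ℝ (dx v p) (dt w p) := by
  have hd {f : Plane → E3} (hf : ContDiffOn ℝ (⊤ : ℕ∞) f W) := differentiableAt_of_smooth hW hf hp
  rw [dx_inner (hd (ContDiffOn.dt hW hv)) (hd hw), dt_inner (hd (ContDiffOn.dx hW hv)) (hd hw),
    dt_dx_comm hW hv hp]
  ring

theorem inner_eq_sum_of_orthonormal {e : Fin 3 → E3} (he : Orthonormal ℝ e) (v w : E3) :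
    inner ℝ v w = inner ℝ v (e 0) * inner ℝ w (e 0) + inner ℝ v (e 1) * inner ℝ w (e 1) +
      inner ℝ v (e 2) * inner ℝ w (e 2) := by
  let b : OrthonormalBasis (Fin 3) ℝ E3 := (basisOfOrthonormalOfCardEqFinrank he
    (by simp)).toOrthonormalBasis (by simpa using he)
  have hb : ∀ i, b i = e i := fun i => by simp [b]
  have := b.sum_inner_mul_inner v w
  simp only [Fin.sum_univ_three, hb] at this
  rw [← this]
  simp only [real_inner_comm w]

variable {ω : Forms} {u : Plane → ℝ} {a b c : Plane → ℝ} {X : Plane → E3} {e : Fin 3 → Plane → E3}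

theorem dx_inner_const (hW : IsOpen W) {v w : Plane → E3} (hv : DifferentiableAt ℝ v p)
    (hw : DifferentiableAt ℝ w p) (hp : p ∈ W) {k : ℝ}
    (h : ∀ q ∈ W, inner ℝ (v q) (w q) = k) :
    inner ℝ (dx w p) (v p) = -inner ℝ (dx v p) (w p) := by
  have h1 := dx_inner hv hw
  have h2 : dx (fun q => inner ℝ (v q) (w q)) p = 0 := by
    rw [dx_congr hW (v := fun _ => k) h hp]; simp [dx]
  rw [real_inner_comm]; linarith

theorem dt_inner_const (hW : IsOpen W) {v w : Plane → E3} (hv : DifferentiableAt ℝ v p)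
    (hw : DifferentiableAt ℝ w p) (hp : p ∈ W) {k : ℝ}
    (h : ∀ q ∈ W, inner ℝ (v q) (w q) = k) :
    inner ℝ (dt w p) (v p) = -inner ℝ (dt v p) (w p) := by
  have h1 := dt_inner hv hw
  have h2 : dt (fun q => inner ℝ (v q) (w q)) p = 0 := by
    rw [dt_congr hW (v := fun _ => k) h hp]; simp [dt]
  rw [real_inner_comm]; linarith

/-- The coefficients of `ω^3_1 = a ω^1 + b ω^2` and `ω^3_2 = b ω^1 + c ω^2` in `dx, dt`. -/
noncomputable def comb (a b : Plane → ℝ) (f g : ℝ → ℝ → ℝ) (u : Plane → ℝ) (q : Plane) : ℝ :=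
  a q * along f u q + b q * along g u q

/-- The Gauss and Codazzi equations at a point. -/
structure GaussCodazzi (ω : Forms) (u a b c : Plane → ℝ) (p : Plane) : Prop where
  gauss : a p * c p - b p ^ 2 = -1
  codazzi₁ : dx (comb a b ω.f12 ω.f22 u) p - dt (comb a b ω.f11 ω.f21 u) p =
    along ω.f31 u p * comb b c ω.f12 ω.f22 u p - along ω.f32 u p * comb b c ω.f11 ω.f21 u p
  codazzi₂ : dx (comb b c ω.f12 ω.f22 u) p - dt (comb b c ω.f11 ω.f21 u) p =
    -(along ω.f31 u p * comb a b ω.f12 ω.f22 u p) + along ω.f32 u p * comb a b ω.f11 ω.f21 u p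

/-- The first two structure equations determine the connection form, so `⟨de₀, e₁⟩ = ω³`. The curls
of `⟨de₀, e₁⟩`, `⟨de₀, e₂⟩`, `⟨de₁, e₂⟩`, expanded in the frame, then give the Gauss equation and
the two Codazzi equations. -/
theorem IsImmersionOn.gaussCodazzi (hW : IsOpen W) (h : IsImmersionOn ω u a b c W X e)
    (hs : ∀ p ∈ W, StructureEqs ω u p)
    (d11 : ∀ p ∈ W, DifferentiableAt ℝ (along ω.f11 u) p)
    (d12 : ∀ p ∈ W, DifferentiableAt ℝ (along ω.f12 u) p)
    (d21 : ∀ p ∈ W, DifferentiableAt ℝ (along ω.f21 u) p)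
    (d22 : ∀ p ∈ W, DifferentiableAt ℝ (along ω.f22 u) p) (hp : p ∈ W) :
    GaussCodazzi ω u a b c p := by
  have de : ∀ i, ∀ q ∈ W, DifferentiableAt ℝ (e i) q := fun i q hq =>
    differentiableAt_of_smooth hW (h.smooth_frame i) hq
  have horth : ∀ q ∈ W, ∀ i j, inner ℝ (e i q) (e j q) = if i = j then (1 : ℝ) else 0 :=
    fun q hq i j => by simpa using orthonormal_iff_ite.1 (h.orthonormal q hq) i j
  have sx : ∀ q ∈ W, ∀ i j, inner ℝ (dx (e j) q) (e i q) = -inner ℝ (dx (e i) q) (e j q) :=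
    fun q hq i j => dx_inner_const hW (de i q hq) (de j q hq) hq fun r hr => horth r hr i j
  have st : ∀ q ∈ W, ∀ i j, inner ℝ (dt (e j) q) (e i q) = -inner ℝ (dt (e i) q) (e j q) :=
    fun q hq i j => dt_inner_const hW (de i q hq) (de j q hq) hq fun r hr => horth r hr i j
  have sx0 : ∀ q ∈ W, ∀ i, inner ℝ (dx (e i) q) (e i q) = 0 := fun q hq i => by
    linarith [sx q hq i i]
  have st0 : ∀ q ∈ W, ∀ i, inner ℝ (dt (e i) q) (e i q) = 0 := fun q hq i => by
    linarith [st q hq i i]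
  -- The components of `X_xt = X_tx` along `e 0` and `e 1`, compared with the structure equations,
  -- are two linear equations for the difference of the two connection forms. Their determinant is
  -- the nonzero area coefficient.
  have conn : ∀ q ∈ W, inner ℝ (dx (e 0) q) (e 1 q) = along ω.f31 u q ∧
      inner ℝ (dt (e 0) q) (e 1 q) = along ω.f32 u q := by
    intro q hq
    have e1 : dt (dx X) q = (along ω.f11 u q • dt (e 0) q + dt (along ω.f11 u) q • e 0 q) +
        (along ω.f21 u q • dt (e 1) q + dt (along ω.f21 u) q • e 1 q) := by
      rw [dt_congr hW h.dx_eq hq, dt_add (f := fun r => along ω.f11 u r • e 0 r)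
          (g := fun r => along ω.f21 u r • e 1 r)
          ((d11 q hq).smul (de 0 q hq)) ((d21 q hq).smul (de 1 q hq)),
        dt_smul (d11 q hq) (de 0 q hq), dt_smul (d21 q hq) (de 1 q hq)]
    have e2 : dx (dt X) q = (along ω.f12 u q • dx (e 0) q + dx (along ω.f12 u) q • e 0 q) +
        (along ω.f22 u q • dx (e 1) q + dx (along ω.f22 u) q • e 1 q) := by
      rw [dx_congr hW h.dt_eq hq, dx_add (f := fun r => along ω.f12 u r • e 0 r)
          (g := fun r => along ω.f22 u r • e 1 r)
          ((d12 q hq).smul (de 0 q hq)) ((d22 q hq).smul (de 1 q hq)),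
        dx_smul (d12 q hq) (de 0 q hq), dx_smul (d22 q hq) (de 1 q hq)]
    have e3 := dt_dx_comm hW h.smooth hq
    rw [e1, e2] at e3
    have i0 := congrArg (fun v => inner ℝ v (e 0 q)) e3
    have i1 := congrArg (fun v => inner ℝ v (e 1 q)) e3
    simp only [inner_add_left, real_inner_smul_left, horth q hq, sx0 q hq, st0 q hq,
      sx q hq 0 1, st q hq 0 1] at i0 i1
    simp at i0 i1
    obtain ⟨s1, s2, -⟩ := hs q hq
    have hA := h.nondegenerate q hq
    rw [show ω.area (u q) (dx u q) = along ω.f11 u q * along ω.f22 u q -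
      along ω.f12 u q * along ω.f21 u q from rfl] at hA
    constructor
    · apply mul_left_cancel₀ hA
      linear_combination along ω.f11 u q * (i0 + s1) + along ω.f21 u q * (i1 + s2)
    · apply mul_left_cancel₀ hA
      linear_combination along ω.f12 u q * (i0 + s1) + along ω.f22 u q * (i1 + s2)
  have k01 := curl_inner hW (h.smooth_frame 0) (h.smooth_frame 1) hp
  have k02 := curl_inner hW (h.smooth_frame 0) (h.smooth_frame 2) hp
  have k12 := curl_inner hW (h.smooth_frame 1) (h.smooth_frame 2) hp
  rw [dx_congr hW (fun q hq => (conn q hq).2) hp, dt_congr hW (fun q hq => (conn q hq).1) hp] at k01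
  rw [dx_congr hW (v := comb a b ω.f12 ω.f22 u) h.second_dt_0 hp,
    dt_congr hW (v := comb a b ω.f11 ω.f21 u) h.second_dx_0 hp] at k02
  rw [dx_congr hW (v := comb b c ω.f12 ω.f22 u) h.second_dt_1 hp,
    dt_congr hW (v := comb b c ω.f11 ω.f21 u) h.second_dx_1 hp] at k12
  have P := inner_eq_sum_of_orthonormal (h.orthonormal p hp)
  rw [P (dt (e 0) p) (dx (e 1) p), P (dx (e 0) p) (dt (e 1) p)] at k01
  rw [P (dt (e 0) p) (dx (e 2) p), P (dx (e 0) p) (dt (e 2) p)] at k02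
  rw [P (dt (e 1) p) (dx (e 2) p), P (dx (e 1) p) (dt (e 2) p)] at k12
  simp only [sx0 p hp, st0 p hp, sx p hp 0 1, st p hp 0 1, sx p hp 0 2, st p hp 0 2,
    sx p hp 1 2, st p hp 1 2, (conn p hp).1, (conn p hp).2, h.second_dx_0 p hp, h.second_dt_0 p hp,
    h.second_dx_1 p hp, h.second_dt_1 p hp] at k01 k02 k12
  obtain ⟨-, -, s3⟩ := hs p hp
  have hA := h.nondegenerate p hp
  rw [show ω.area (u p) (dx u p) = along ω.f11 u p * along ω.f22 u p -
    along ω.f12 u p * along ω.f21 u p from rfl] at hA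
  refine ⟨?_, ?_, ?_⟩
  · apply mul_left_cancel₀ hA
    linear_combination k01 - s3
  · simp only [comb] at k02 ⊢
    linear_combination k02
  · simp only [comb] at k12 ⊢
    linear_combination k12

end Immersion

/-! ### The forms along solutions, and Gauss–Codazzi on jet space -/

section FormCalculus

open Filter Topology

/-- The differential data common to all forms of the classification: `f₁₁, f₃₁` depend locally on
`u_x` only (with derivatives `g11, g31`), `f₁₂, f₂₂, f₃₂` depend locally on `u` only (with
derivatives `p12, p22, p32`), and the structure equations hold identically. -/
structure FormCalculus (η : ℝ) (F : ℝ → ℝ → ℝ) (U : Set (ℝ × ℝ)) (ω : Forms) where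
  g11 : ℝ → ℝ → ℝ
  g31 : ℝ → ℝ → ℝ
  p12 : ℝ → ℝ → ℝ
  p22 : ℝ → ℝ → ℝ
  p32 : ℝ → ℝ → ℝ
  isOpen : IsOpen U
  smooth_F : ContDiffOn ℝ (⊤ : ℕ∞) (fun q : ℝ × ℝ => F q.1 q.2) U
  f21_eq : ∀ z₀ z₁, ω.f21 z₀ z₁ = η
  smooth11 : ContDiffOn ℝ (⊤ : ℕ∞) (fun q : ℝ × ℝ => ω.f11 q.1 q.2) U
  smooth12 : ContDiffOn ℝ (⊤ : ℕ∞) (fun q : ℝ × ℝ => ω.f12 q.1 q.2) U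
  smooth22 : ContDiffOn ℝ (⊤ : ℕ∞) (fun q : ℝ × ℝ => ω.f22 q.1 q.2) U
  smooth31 : ContDiffOn ℝ (⊤ : ℕ∞) (fun q : ℝ × ℝ => ω.f31 q.1 q.2) U
  smooth32 : ContDiffOn ℝ (⊤ : ℕ∞) (fun q : ℝ × ℝ => ω.f32 q.1 q.2) U
  deriv11 : ∀ q ∈ U, HasFDerivAt (fun q : ℝ × ℝ => ω.f11 q.1 q.2)
    (g11 q.1 q.2 • ContinuousLinearMap.snd ℝ ℝ ℝ) q
  deriv31 : ∀ q ∈ U, HasFDerivAt (fun q : ℝ × ℝ => ω.f31 q.1 q.2)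
    (g31 q.1 q.2 • ContinuousLinearMap.snd ℝ ℝ ℝ) q
  deriv12 : ∀ q ∈ U, HasFDerivAt (fun q : ℝ × ℝ => ω.f12 q.1 q.2)
    (p12 q.1 q.2 • ContinuousLinearMap.fst ℝ ℝ ℝ) q
  deriv22 : ∀ q ∈ U, HasFDerivAt (fun q : ℝ × ℝ => ω.f22 q.1 q.2)
    (p22 q.1 q.2 • ContinuousLinearMap.fst ℝ ℝ ℝ) q
  deriv32 : ∀ q ∈ U, HasFDerivAt (fun q : ℝ × ℝ => ω.f32 q.1 q.2)
    (p32 q.1 q.2 • ContinuousLinearMap.fst ℝ ℝ ℝ) q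
  struct₁ : ∀ z₀ z₁, (z₀, z₁) ∈ U → p12 z₀ z₁ * z₁ - g11 z₀ z₁ * F z₀ z₁ =
    ω.f31 z₀ z₁ * ω.f22 z₀ z₁ - ω.f32 z₀ z₁ * η
  struct₂ : ∀ z₀ z₁, (z₀, z₁) ∈ U → p22 z₀ z₁ * z₁ =
    ω.f11 z₀ z₁ * ω.f32 z₀ z₁ - ω.f12 z₀ z₁ * ω.f31 z₀ z₁
  struct₃ : ∀ z₀ z₁, (z₀, z₁) ∈ U → p32 z₀ z₁ * z₁ - g31 z₀ z₁ * F z₀ z₁ =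
    ω.f11 z₀ z₁ * ω.f22 z₀ z₁ - ω.f12 z₀ z₁ * η
  g_ne : ∀ z₀ z₁, (z₀, z₁) ∈ U → g11 z₀ z₁ ≠ 0 ∨ g31 z₀ z₁ ≠ 0

variable {η : ℝ} {F : ℝ → ℝ → ℝ} {U : Set (ℝ × ℝ)} {ω : Forms} {V : Set Plane} {u : Plane → ℝ}
  {p : Plane}

theorem hasFDerivAt_along {f : ℝ → ℝ → ℝ} {a b : ℝ} (hV : IsOpen V)
    (hu : ContDiffOn ℝ (⊤ : ℕ∞) u V) (hp : p ∈ V)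
    (hf : HasFDerivAt (fun q : ℝ × ℝ => f q.1 q.2)
      (a • ContinuousLinearMap.fst ℝ ℝ ℝ + b • ContinuousLinearMap.snd ℝ ℝ ℝ) (u p, dx u p)) :
    DifferentiableAt ℝ (along f u) p ∧ dx (along f u) p = a * dx u p + b * dx (dx u) p ∧
      dt (along f u) p = a * dt u p + b * dt (dx u) p := by
  have h1 : DifferentiableAt ℝ u p := differentiableAt_of_smooth hV hu hp
  have h2 : DifferentiableAt ℝ (dx u) p := differentiableAt_of_smooth hV (ContDiffOn.dx hV hu) hp
  have h := HasFDerivAt.comp (g := fun q : ℝ × ℝ => f q.1 q.2) (f := fun r => (u r, dx u r)) p hf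
    (h1.hasFDerivAt.prodMk h2.hasFDerivAt)
  have h' : HasFDerivAt (along f u) _ p := h
  refine ⟨h'.differentiableAt, ?_, ?_⟩
  · conv_lhs => unfold dx
    rw [h'.fderiv]
    simp [dx]
  · conv_lhs => unfold dt
    rw [h'.fderiv]
    simp [dt]

theorem contDiffOn_along {f : ℝ → ℝ → ℝ} (hV : IsOpen V) (hu : ContDiffOn ℝ (⊤ : ℕ∞) u V)
    (hU : ∀ p ∈ V, (u p, dx u p) ∈ U)
    (hf : ContDiffOn ℝ (⊤ : ℕ∞) (fun q : ℝ × ℝ => f q.1 q.2) U) :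
    ContDiffOn ℝ (⊤ : ℕ∞) (along f u) V :=
  hf.comp (hu.prodMk (ContDiffOn.dx hV hu)) hU

theorem dx_comb {f g : Plane → ℝ} {f' g' : ℝ → ℝ → ℝ} (h1 : DifferentiableAt ℝ f p)
    (h2 : DifferentiableAt ℝ g p) (h3 : DifferentiableAt ℝ (along f' u) p)
    (h4 : DifferentiableAt ℝ (along g' u) p) : dx (comb f g f' g' u) p =
      (f p * dx (along f' u) p + dx f p * along f' u p) +
      (g p * dx (along g' u) p + dx g p * along g' u p) := by
  unfold comb
  rw [dx_add (f := fun q => f q * along f' u q) (g := fun q => g q * along g' u q)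
    (h1.mul h3) (h2.mul h4), dx_mul h1 h3, dx_mul h2 h4]

theorem dt_comb {f g : Plane → ℝ} {f' g' : ℝ → ℝ → ℝ} (h1 : DifferentiableAt ℝ f p)
    (h2 : DifferentiableAt ℝ g p) (h3 : DifferentiableAt ℝ (along f' u) p)
    (h4 : DifferentiableAt ℝ (along g' u) p) : dt (comb f g f' g' u) p =
      (f p * dt (along f' u) p + dt f p * along f' u p) +
      (g p * dt (along g' u) p + dt g p * along g' u p) := by
  unfold comb
  rw [dt_add (f := fun q => f q * along f' u q) (g := fun q => g q * along g' u q)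
    (h1.mul h3) (h2.mul h4), dt_mul h1 h3, dt_mul h2 h4]

namespace FormCalculus

theorem along_f21 (C : FormCalculus η F U ω) : along ω.f21 u = fun _ => η := by
  funext q; exact C.f21_eq _ _

theorem along11 (C : FormCalculus η F U ω) (hV : IsOpen V) (hu : ContDiffOn ℝ (⊤ : ℕ∞) u V)
    (hp : p ∈ V) (hU : (u p, dx u p) ∈ U) : DifferentiableAt ℝ (along ω.f11 u) p ∧
      dx (along ω.f11 u) p = C.g11 (u p) (dx u p) * dx (dx u) p ∧
      dt (along ω.f11 u) p = C.g11 (u p) (dx u p) * dt (dx u) p := by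
  simpa using hasFDerivAt_along (a := 0) hV hu hp (by simpa using C.deriv11 _ hU)

theorem along31 (C : FormCalculus η F U ω) (hV : IsOpen V) (hu : ContDiffOn ℝ (⊤ : ℕ∞) u V)
    (hp : p ∈ V) (hU : (u p, dx u p) ∈ U) : DifferentiableAt ℝ (along ω.f31 u) p ∧
      dx (along ω.f31 u) p = C.g31 (u p) (dx u p) * dx (dx u) p ∧
      dt (along ω.f31 u) p = C.g31 (u p) (dx u p) * dt (dx u) p := by
  simpa using hasFDerivAt_along (a := 0) hV hu hp (by simpa using C.deriv31 _ hU)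

theorem along12 (C : FormCalculus η F U ω) (hV : IsOpen V) (hu : ContDiffOn ℝ (⊤ : ℕ∞) u V)
    (hp : p ∈ V) (hU : (u p, dx u p) ∈ U) : DifferentiableAt ℝ (along ω.f12 u) p ∧
      dx (along ω.f12 u) p = C.p12 (u p) (dx u p) * dx u p ∧
      dt (along ω.f12 u) p = C.p12 (u p) (dx u p) * dt u p := by
  simpa using hasFDerivAt_along (b := 0) hV hu hp (by simpa using C.deriv12 _ hU)

theorem along22 (C : FormCalculus η F U ω) (hV : IsOpen V) (hu : ContDiffOn ℝ (⊤ : ℕ∞) u V)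
    (hp : p ∈ V) (hU : (u p, dx u p) ∈ U) : DifferentiableAt ℝ (along ω.f22 u) p ∧
      dx (along ω.f22 u) p = C.p22 (u p) (dx u p) * dx u p ∧
      dt (along ω.f22 u) p = C.p22 (u p) (dx u p) * dt u p := by
  simpa using hasFDerivAt_along (b := 0) hV hu hp (by simpa using C.deriv22 _ hU)

theorem along32 (C : FormCalculus η F U ω) (hV : IsOpen V) (hu : ContDiffOn ℝ (⊤ : ℕ∞) u V)
    (hp : p ∈ V) (hU : (u p, dx u p) ∈ U) : DifferentiableAt ℝ (along ω.f32 u) p ∧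
      dx (along ω.f32 u) p = C.p32 (u p) (dx u p) * dx u p ∧
      dt (along ω.f32 u) p = C.p32 (u p) (dx u p) * dt u p := by
  simpa using hasFDerivAt_along (b := 0) hV hu hp (by simpa using C.deriv32 _ hU)

/-- The fields `struct₁`, `struct₂`, `struct₃` are the structure equations with `u_xt` replaced by
`F`. The true ones differ from them by `g11 (F - u_xt)`, `0` and `g31 (F - u_xt)`, and `g_ne` says
that one of the two factors does not vanish. -/
theorem structureEqs_iff (C : FormCalculus η F U ω) (hV : IsOpen V)
    (hu : ContDiffOn ℝ (⊤ : ℕ∞) u V) (hp : p ∈ V) (hU : (u p, dx u p) ∈ U) :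
    StructureEqs ω u p ↔ dt (dx u) p = F (u p) (dx u p) := by
  have e : dt (along ω.f21 u) p = 0 := by rw [C.along_f21]; simp [dt]
  have e' : along ω.f21 u p = η := C.f21_eq _ _
  unfold StructureEqs
  rw [(C.along12 hV hu hp hU).2.1, (C.along11 hV hu hp hU).2.2, (C.along22 hV hu hp hU).2.1,
    (C.along32 hV hu hp hU).2.1, (C.along31 hV hu hp hU).2.2, e, e']
  have s1 := C.struct₁ _ _ hU
  have s2 := C.struct₂ _ _ hU
  have s3 := C.struct₃ _ _ hU
  unfold along
  constructor
  · rintro ⟨h1, -, h3⟩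
    rcases C.g_ne _ _ hU with h | h
    · apply mul_left_cancel₀ h; linarith
    · apply mul_left_cancel₀ h; linarith
  · intro h
    rw [h]
    exact ⟨s1, by linarith, s3⟩

theorem describes (C : FormCalculus η F U ω) (h : ∃ q ∈ U, ω.area q.1 q.2 ≠ 0) :
    Describes η F U ω where
  f21_eq := fun q _ => C.f21_eq _ _
  nondegenerate := h
  iff_solution := fun V u hV hu hU => by
    constructor
    · intro h
      exact ⟨hu, hU, fun p hp => (C.structureEqs_iff hV hu hp (hU p hp)).1 (h p hp)⟩
    · intro h p hp
      exact (C.structureEqs_iff hV hu hp (hU p hp)).2 (h.eqn p hp)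

end FormCalculus

theorem IsSolution.mono {V' : Set Plane} (h : IsSolution F U V u) (hV : V' ⊆ V) :
    IsSolution F U V' u :=
  ⟨h.smooth.mono hV, fun p hp => h.mem p (hV hp), fun p hp => h.eqn p (hV hp)⟩

/-- `X` and `T` are the derivatives in `x` and `t` of the jet of a solution passing through
`j`. -/
def TotalDerivs (F : ℝ → ℝ → ℝ) (U : Set (ℝ × ℝ)) (l : ℕ) (j X T : Jet l) : Prop :=
  ∃ (V : Set Plane) (u : Plane → ℝ), IsOpen V ∧ (j.1, j.2.1) ∈ V ∧ IsSolution F U V u ∧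
    jet l u (j.1, j.2.1) = j ∧ X = dx (jet l u) (j.1, j.2.1) ∧ T = dt (jet l u) (j.1, j.2.1)

variable {l : ℕ}

/-- The Gauss and Codazzi equations at a jet, for the values `y = (a, b, c)` and given
derivatives `yX` and `yT`. -/
structure GaussCodazziAt (ω : Forms) (η z₀ z₁ : ℝ) (y yX yT : ℝ × ℝ × ℝ) : Prop where
  gauss : y.1 * y.2.2 - y.2.1 ^ 2 = -1
  codazzi₁ : yX.1 * ω.f12 z₀ z₁ - yT.1 * ω.f11 z₀ z₁ + yX.2.1 * ω.f22 z₀ z₁ - yT.2.1 * η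
    - 2 * y.2.1 * (ω.f31 z₀ z₁ * ω.f12 z₀ z₁ - ω.f32 z₀ z₁ * ω.f11 z₀ z₁)
    + (y.1 - y.2.2) * (ω.f31 z₀ z₁ * ω.f22 z₀ z₁ - ω.f32 z₀ z₁ * η) = 0
  codazzi₂ : yX.2.1 * ω.f12 z₀ z₁ - yT.2.1 * ω.f11 z₀ z₁ + yX.2.2 * ω.f22 z₀ z₁ - yT.2.2 * η
    + (y.1 - y.2.2) * (ω.f31 z₀ z₁ * ω.f12 z₀ z₁ - ω.f32 z₀ z₁ * ω.f11 z₀ z₁)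
    + 2 * y.2.1 * (ω.f31 z₀ z₁ * ω.f22 z₀ z₁ - ω.f32 z₀ z₁ * η) = 0

/-- The functions `y = (a, b, c)` on an open set of regular jets satisfy the Gauss and Codazzi
equations along all solutions. -/
structure JetCodazzi (η : ℝ) (F : ℝ → ℝ → ℝ) (U : Set (ℝ × ℝ)) (ω : Forms) (n : ℕ)
    (D : Set (Jet (n + 1))) (y : Jet (n + 1) → ℝ × ℝ × ℝ) : Prop where
  isOpen : IsOpen D
  regular : D ⊆ regularJets U ω n
  smooth : ContDiffOn ℝ (⊤ : ℕ∞) y D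
  eqs : ∀ j ∈ D, ∀ X T, TotalDerivs F U (n + 1) j X T →
    GaussCodazziAt ω η j.2.2.1 (j.2.2.2.1 0) (y j) (fderiv ℝ y j X) (fderiv ℝ y j T)

/-- The chain rule along a solution realizing the jet turns derivatives of the coefficients into
directional derivatives on jet space, and the structure equations absorb the derivatives of the
forms. -/
theorem IsJetSecondForm.jetCodazzi (C : FormCalculus η F U ω) {n : ℕ} {D : Set (Jet (n + 1))}
    {a b c : Jet (n + 1) → ℝ} (h : IsJetSecondForm F U ω n D a b c) :
    JetCodazzi η F U ω n D (fun j => (a j, b j, c j)) where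
  isOpen := h.isOpen
  regular := h.regular
  smooth := h.smooth_a.prodMk (h.smooth_b.prodMk h.smooth_c)
  eqs := by
    rintro j hj X T ⟨V, u, hV, hp, hu, hju, rfl, rfl⟩
    set p : Plane := (j.1, j.2.1) with hpdef
    have hcont : ContinuousOn (jet (n + 1) u) V := fun q hq =>
      (differentiableAt_jet hV hu.smooth hq (n + 1)).continuousAt.continuousWithinAt
    -- The realizing solution has its jets in `D` only near the given point, while the hypothesis
    -- speaks of solutions all of whose jets lie in `D`.
    set V' := V ∩ jet (n + 1) u ⁻¹' D with hV'def
    have hV' : IsOpen V' := hcont.isOpen_inter_preimage hV h.isOpen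
    have hp' : p ∈ V' := ⟨hp, by rw [Set.mem_preimage, hju]; exact hj⟩
    have hu' : IsSolution F U V' u := hu.mono Set.inter_subset_left
    obtain ⟨W, hW, hpW, hWV, X, e, hX⟩ := h.secondForm V' u hV' hu' (fun q hq => hq.2) p hp'
    have huW : ContDiffOn ℝ (⊤ : ℕ∞) u W := hu'.smooth.mono hWV
    have hUW : ∀ q ∈ W, (u q, dx u q) ∈ U := fun q hq => hu'.mem q (hWV hq)
    have gc := hX.gaussCodazzi hW
      (fun q hq => (C.structureEqs_iff hW huW hq (hUW q hq)).2 (hu'.eqn q (hWV hq)))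
      (fun q hq => (C.along11 hW huW hq (hUW q hq)).1)
      (fun q hq => (C.along12 hW huW hq (hUW q hq)).1)
      (fun q hq => by rw [C.along_f21]; exact differentiableAt_const _)
      (fun q hq => (C.along22 hW huW hq (hUW q hq)).1) hpW
    have hs := (C.structureEqs_iff hW huW hpW (hUW p hpW)).2 (hu'.eqn p (hWV hpW))
    have hjd := differentiableAt_jet hV hu.smooth hp (n + 1)
    have hD : D ∈ nhds (jet (n + 1) u p) := h.isOpen.mem_nhds (by rw [hju]; exact hj)
    have chain : ∀ {f : Jet (n + 1) → ℝ}, ContDiffOn ℝ (⊤ : ℕ∞) f D →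
        DifferentiableAt ℝ f j ∧ DifferentiableAt ℝ (fun q => f (jet (n + 1) u q)) p ∧
        dx (fun q => f (jet (n + 1) u q)) p = fderiv ℝ f j (dx (jet (n + 1) u) p) ∧
        dt (fun q => f (jet (n + 1) u q)) p = fderiv ℝ f j (dt (jet (n + 1) u) p) := by
      intro f hf
      have hfd : DifferentiableAt ℝ f (jet (n + 1) u p) :=
        (hf.contDiffAt hD).differentiableAt (by simp)
      have hcomp := hfd.hasFDerivAt.comp p hjd.hasFDerivAt
      refine ⟨by rwa [hju] at hfd, hcomp.differentiableAt, ?_, ?_⟩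
      · conv_lhs => unfold dx
        rw [show (fun q => f (jet (n + 1) u q)) = f ∘ jet (n + 1) u from rfl, hcomp.fderiv, hju]
        rfl
      · conv_lhs => unfold dt
        rw [show (fun q => f (jet (n + 1) u q)) = f ∘ jet (n + 1) u from rfl, hcomp.fderiv, hju]
        rfl
    obtain ⟨a0, a1, a2, a3⟩ := chain h.smooth_a
    obtain ⟨b0, b1, b2, b3⟩ := chain h.smooth_b
    obtain ⟨c0, c1, c2, c3⟩ := chain h.smooth_c
    have hy : ∀ v, fderiv ℝ (fun j => (a j, b j, c j)) j v =
        (fderiv ℝ a j v, fderiv ℝ b j v, fderiv ℝ c j v) := fun v => by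
      rw [(a0.hasFDerivAt.prodMk (b0.hasFDerivAt.prodMk c0.hasFDerivAt)).fderiv]
      rfl
    have d21 : DifferentiableAt ℝ (along ω.f21 u) p := by
      rw [C.along_f21]; exact differentiableAt_const _
    have d11 := (C.along11 hW huW hpW (hUW p hpW)).1
    have d12 := (C.along12 hW huW hpW (hUW p hpW)).1
    have d22 := (C.along22 hW huW hpW (hUW p hpW)).1
    have e0 : u p = j.2.2.1 := congrArg (fun k : Jet (n + 1) => k.2.2.1) hju
    have e1 : dx u p = j.2.2.2.1 0 := congrArg (fun k : Jet (n + 1) => k.2.2.2.1 0) hju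
    obtain ⟨s1, s2, s3⟩ := hs
    obtain ⟨g0, g1, g2⟩ := gc
    rw [dx_comb a1 b1 d12 d22, dt_comb a1 b1 d11 d21] at g1
    rw [dx_comb b1 c1 d12 d22, dt_comb b1 c1 d11 d21] at g2
    have f21 : along ω.f21 u p = η := C.f21_eq _ _
    simp only [comb, a2, a3, b2, b3, c2, c3, f21, hju] at g0 g1 g2 s1 s2 s3
    have w11 : ω.f11 j.2.2.1 (j.2.2.2.1 0) = along ω.f11 u p := by rw [← e0, ← e1]; rfl
    have w12 : ω.f12 j.2.2.1 (j.2.2.2.1 0) = along ω.f12 u p := by rw [← e0, ← e1]; rfl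
    have w22 : ω.f22 j.2.2.1 (j.2.2.2.1 0) = along ω.f22 u p := by rw [← e0, ← e1]; rfl
    have w31 : ω.f31 j.2.2.1 (j.2.2.2.1 0) = along ω.f31 u p := by rw [← e0, ← e1]; rfl
    have w32 : ω.f32 j.2.2.1 (j.2.2.2.1 0) = along ω.f32 u p := by rw [← e0, ← e1]; rfl
    rw [hy, hy]
    refine ⟨g0, ?_, ?_⟩
    · simp only [w11, w12, w22, w31, w32]
      linear_combination g1 - a j * s1 - b j * s2
    · simp only [w11, w12, w22, w31, w32]
      linear_combination g2 - b j * s1 - c j * s2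

end FormCalculus

/-! ### Jet coordinates, prolongation and directions of constancy -/

section JetBasis

open Filter Topology

variable {l : ℕ}

/-- The direction of `x`. -/
def eX (l : ℕ) : Jet l := (1, 0, 0, 0, 0)
/-- The direction of `t`. -/
def eT (l : ℕ) : Jet l := (0, 1, 0, 0, 0)
/-- The direction of `u`. -/
def eU (l : ℕ) : Jet l := (0, 0, 1, 0, 0)
/-- The direction of `∂_x^{i+1} u`. -/
def eZ (i : Fin l) : Jet l := (0, 0, 0, Pi.single i 1, 0)
/-- The direction of `∂_t^{i+1} u`. -/
def eW (i : Fin l) : Jet l := (0, 0, 0, 0, Pi.single i 1)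

theorem jet_decomposition (v : Jet l) : v = v.1 • eX l + v.2.1 • eT l + v.2.2.1 • eU l +
    ∑ i, v.2.2.2.1 i • eZ i + ∑ i, v.2.2.2.2 i • eW i := by
  have hz : ∑ i, v.2.2.2.1 i • eZ i = ((0, 0, 0, v.2.2.2.1, 0) : Jet l) := by
    simp only [eZ, Prod.smul_mk, smul_zero]
    rw [Prod.ext_iff, Prod.ext_iff, Prod.ext_iff, Prod.ext_iff]
    simp only [Prod.fst_sum, Prod.snd_sum, Finset.sum_const_zero, true_and, and_true]
    exact (pi_eq_sum_univ' v.2.2.2.1).symm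
  have hw : ∑ i, v.2.2.2.2 i • eW i = ((0, 0, 0, 0, v.2.2.2.2) : Jet l) := by
    simp only [eW, Prod.smul_mk, smul_zero]
    rw [Prod.ext_iff, Prod.ext_iff, Prod.ext_iff, Prod.ext_iff]
    simp only [Prod.fst_sum, Prod.snd_sum, Finset.sum_const_zero, true_and]
    exact (pi_eq_sum_univ' v.2.2.2.2).symm
  rw [hz, hw]
  simp [eX, eT, eU]

theorem map_jet {H : Type} [NormedAddCommGroup H] [NormedSpace ℝ H] (A : Jet l →L[ℝ] H)
    (v : Jet l) : A v = v.1 • A (eX l) + v.2.1 • A (eT l) + v.2.2.1 • A (eU l) +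
      ∑ i, v.2.2.2.1 i • A (eZ i) + ∑ i, v.2.2.2.2 i • A (eW i) := by
  conv_lhs => rw [jet_decomposition v]
  simp only [map_add, map_smul, map_sum]

variable {η : ℝ} {F : ℝ → ℝ → ℝ} {U : Set (ℝ × ℝ)} {ω : Forms} {n : ℕ}

theorem exists_totalDerivs (C : FormCalculus η F U ω) (j : Jet (n + 1))
    (hj : (j.2.2.1, j.2.2.2.1 0) ∈ U) : ∃ X T, TotalDerivs F U (n + 1) j X T := by
  obtain ⟨V, u, hV, hp, hu, h⟩ := exists_solution_jet C.isOpen C.smooth_F j hj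
  exact ⟨_, _, V, u, hV, hp, hu, h, rfl, rfl⟩

/-- The components of the total derivatives that are visible from the jet. -/
theorem TotalDerivs.components {j X T : Jet (n + 1)} (h : TotalDerivs F U (n + 1) j X T) :
    X.1 = 1 ∧ X.2.1 = 0 ∧ X.2.2.1 = j.2.2.2.1 0 ∧ T.1 = 0 ∧ T.2.1 = 1 ∧ T.2.2.1 = j.2.2.2.2 0 ∧
    (∀ i (hi : i + 1 < n + 1), X.2.2.2.1 ⟨i, by omega⟩ = j.2.2.2.1 ⟨i + 1, hi⟩) ∧
    (∀ i (hi : i + 1 < n + 1), T.2.2.2.2 ⟨i, by omega⟩ = j.2.2.2.2 ⟨i + 1, hi⟩) ∧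
    T.2.2.2.1 0 = F j.2.2.1 (j.2.2.2.1 0) := by
  obtain ⟨V, u, hV, hp, hu, hju, rfl, rfl⟩ := h
  rw [dx_jet hV hu.smooth hp, dt_jet hV hu.smooth hp]
  have hz : ∀ i, j.2.2.2.1 i = (dx^[i.val + 1] u) (j.1, j.2.1) := fun i =>
    (congrArg (fun k : Jet (n + 1) => k.2.2.2.1 i) hju).symm
  have hw : ∀ i, j.2.2.2.2 i = (dt^[i.val + 1] u) (j.1, j.2.1) := fun i =>
    (congrArg (fun k : Jet (n + 1) => k.2.2.2.2 i) hju).symm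
  have h0 : u (j.1, j.2.1) = j.2.2.1 := congrArg (fun k : Jet (n + 1) => k.2.2.1) hju
  refine ⟨rfl, rfl, (hz 0).symm, rfl, rfl, (hw 0).symm, fun i hi => (hz ⟨i + 1, hi⟩).symm,
    fun i hi => (hw ⟨i + 1, hi⟩).symm, ?_⟩
  have := hu.eqn _ hp
  rw [h0] at this
  rw [hz 0]
  exact this

/-- These components are `x`-derivatives of `F(u, u_x)` and involve no pure `x`-derivative beyond
the index `k`. They therefore do not change when the jet moves in a higher direction, whichever
solution realizes it. -/
theorem TotalDerivs.dt_determined (C : FormCalculus η F U ω) {j X T j' X' T' : Jet (n + 1)}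
    (h : TotalDerivs F U (n + 1) j X T) (h' : TotalDerivs F U (n + 1) j' X' T')
    (hx : j.1 = j'.1) (ht : j.2.1 = j'.2.1) (h0 : j.2.2.1 = j'.2.2.1) (k : Fin (n + 1))
    (hz : ∀ i ≤ k, j.2.2.2.1 i = j'.2.2.2.1 i) : T.2.2.2.1 k = T'.2.2.2.1 k := by
  obtain ⟨V, u, hV, hp, hu, hju, rfl, rfl⟩ := h
  obtain ⟨V', u', hV', hp', hu', hju', rfl, rfl⟩ := h'
  have hpp : (j'.1, j'.2.1) = (j.1, j.2.1) := by rw [hx, ht]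
  rw [hpp] at hp' hju'
  rw [hpp, dt_jet hV hu.smooth hp, dt_jet hV' hu'.smooth hp']
  refine dt_dx_iterate_determined C.isOpen C.smooth_F hV hV' hu hu' hp hp' k fun i hi => ?_
  cases i with
  | zero =>
    have e := congrArg (fun k : Jet (n + 1) => k.2.2.1) hju
    have e' := congrArg (fun k : Jet (n + 1) => k.2.2.1) hju'
    exact e.trans (h0.trans e'.symm)
  | succ i =>
    have hi' : i < n + 1 := by have := k.2; omega
    have e := congrArg (fun k : Jet (n + 1) => k.2.2.2.1 ⟨i, hi'⟩) hju
    have e' := congrArg (fun k : Jet (n + 1) => k.2.2.2.1 ⟨i, hi'⟩) hju'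
    exact e.trans ((hz ⟨i, hi'⟩ (Fin.le_def.2 (by simpa using hi))).trans e'.symm)

/-- The component is `∂_t^k F(u, u_x)`; once `u_xt` is replaced by `F`, it involves `u`, `u_x` and
the `t`-derivatives of order at most `k`, that is, of index below `k`. -/
theorem TotalDerivs.dx_determined (C : FormCalculus η F U ω) {j X T j' X' T' : Jet (n + 1)}
    (h : TotalDerivs F U (n + 1) j X T) (h' : TotalDerivs F U (n + 1) j' X' T')
    (hx : j.1 = j'.1) (ht : j.2.1 = j'.2.1) (h0 : j.2.2.1 = j'.2.2.1)
    (h1 : j.2.2.2.1 0 = j'.2.2.2.1 0) (k : Fin (n + 1))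
    (hw : ∀ i < k, j.2.2.2.2 i = j'.2.2.2.2 i) : X.2.2.2.2 k = X'.2.2.2.2 k := by
  obtain ⟨V, u, hV, hp, hu, hju, rfl, rfl⟩ := h
  obtain ⟨V', u', hV', hp', hu', hju', rfl, rfl⟩ := h'
  have hpp : (j'.1, j'.2.1) = (j.1, j.2.1) := by rw [hx, ht]
  rw [hpp] at hp' hju'
  rw [hpp, dx_jet hV hu.smooth hp, dx_jet hV' hu'.smooth hp']
  have ez := congrArg (fun k : Jet (n + 1) => k.2.2.2.1 0) hju
  have ez' := congrArg (fun k : Jet (n + 1) => k.2.2.2.1 0) hju'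
  refine dx_dt_iterate_determined C.isOpen C.smooth_F hV hV' hu hu' hp hp'
    (ez.trans (h1.trans ez'.symm)) (k + 1) (fun i hi => ?_) (k + 1) le_rfl
  cases i with
  | zero =>
    have e := congrArg (fun k : Jet (n + 1) => k.2.2.1) hju
    have e' := congrArg (fun k : Jet (n + 1) => k.2.2.1) hju'
    exact e.trans (h0.trans e'.symm)
  | succ i =>
    have hi' : i < n + 1 := by have := k.2; omega
    have e := congrArg (fun k : Jet (n + 1) => k.2.2.2.2 ⟨i, hi'⟩) hju
    have e' := congrArg (fun k : Jet (n + 1) => k.2.2.2.2 ⟨i, hi'⟩) hju'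
    exact e.trans ((hw ⟨i, hi'⟩ (Fin.lt_def.2 (by simpa using hi))).trans e'.symm)

/-- Forgetting the derivatives of top order. -/
noncomputable def truncate (n : ℕ) : Jet (n + 1) →L[ℝ] Jet n :=
  LinearMap.toContinuousLinearMap
    { toFun := fun j => (j.1, j.2.1, j.2.2.1, fun i => j.2.2.2.1 i.castSucc,
        fun i => j.2.2.2.2 i.castSucc)
      map_add' := fun _ _ => rfl
      map_smul' := fun _ _ => rfl }

theorem truncate_apply (j : Jet (n + 1)) : truncate n j =
    (j.1, j.2.1, j.2.2.1, fun i => j.2.2.2.1 i.castSucc, fun i => j.2.2.2.2 i.castSucc) := rfl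

theorem TotalDerivs.truncate {j X T : Jet (n + 1)} (h : TotalDerivs F U (n + 1) j X T) :
    TotalDerivs F U n (truncate n j) (truncate n X) (truncate n T) := by
  obtain ⟨V, u, hV, hp, hu, hju, rfl, rfl⟩ := h
  have hj : (PSS.truncate n j).1 = j.1 ∧ (PSS.truncate n j).2.1 = j.2.1 := ⟨rfl, rfl⟩
  refine ⟨V, u, hV, hp, hu, ?_, ?_, ?_⟩
  · rw [hj.1, hj.2, ← hju]; rfl
  · rw [hj.1, hj.2, dx_jet hV hu.smooth hp, dx_jet hV hu.smooth hp]; rfl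
  · rw [hj.1, hj.2, dt_jet hV hu.smooth hp, dt_jet hV hu.smooth hp]; rfl

variable {D : Set (Jet (n + 1))} {y : Jet (n + 1) → ℝ × ℝ × ℝ}

theorem JetCodazzi.differentiableAt (h : JetCodazzi η F U ω n D y) {j : Jet (n + 1)} (hj : j ∈ D) :
    DifferentiableAt ℝ y j :=
  (h.smooth.contDiffAt (h.isOpen.mem_nhds hj)).differentiableAt (by simp)

theorem JetCodazzi.fderiv_comp_truncate (h : JetCodazzi η F U ω n D y) {j : Jet (n + 2)}
    (hj : truncate (n + 1) j ∈ D) (v : Jet (n + 2)) :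
    fderiv ℝ (fun j => y (truncate (n + 1) j)) j v =
      fderiv ℝ y (truncate (n + 1) j) (truncate (n + 1) v) := by
  have := (h.differentiableAt hj).hasFDerivAt.comp j (truncate (n + 1)).hasFDerivAt
  rw [show (fun j => y (truncate (n + 1) j)) = y ∘ truncate (n + 1) from rfl, this.fderiv]
  rfl

/-- Raising the order provides coordinates above all those on which `y` depends. They start the
descending inductions, and they keep the components of total derivatives that cannot be read off
from the jet in directions where `y` is constant. -/
theorem JetCodazzi.prolong (h : JetCodazzi η F U ω n D y) :
    JetCodazzi η F U ω (n + 1) (truncate (n + 1) ⁻¹' D) (fun j => y (truncate (n + 1) j)) where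
  isOpen := h.isOpen.preimage (truncate (n + 1)).continuous
  regular := fun j hj => h.regular hj
  smooth := h.smooth.comp (truncate (n + 1)).contDiff.contDiffOn fun j hj => hj
  eqs := fun j hj X T hXT => by
    rw [h.fderiv_comp_truncate hj, h.fderiv_comp_truncate hj]
    exact h.eqs _ hj _ _ hXT.truncate

/-- The derivative of `y` in the direction `v` vanishes on `D`. -/
def Killed {E H : Type} [NormedAddCommGroup E] [NormedSpace ℝ E] [NormedAddCommGroup H]
    [NormedSpace ℝ H] (D : Set E) (y : E → H) (v : E) : Prop :=
  ∀ j ∈ D, fderiv ℝ y j v = 0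

theorem JetCodazzi.killed_top (h : JetCodazzi η F U ω n D y) :
    Killed (truncate (n + 1) ⁻¹' D) (fun j => y (truncate (n + 1) j)) (eZ (Fin.last (n + 1))) ∧
    Killed (truncate (n + 1) ⁻¹' D) (fun j => y (truncate (n + 1) j)) (eW (Fin.last (n + 1))) := by
  constructor <;> intro j hj
  · rw [h.fderiv_comp_truncate hj]
    have : truncate (n + 1) (eZ (Fin.last (n + 1))) = 0 := by
      rw [truncate_apply]
      simp only [eZ, Pi.single_apply, Fin.castSucc_ne_last, if_false]
      rfl
    rw [this, map_zero]
  · rw [h.fderiv_comp_truncate hj]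
    have : truncate (n + 1) (eW (Fin.last (n + 1))) = 0 := by
      rw [truncate_apply]
      simp only [eW, Pi.single_apply, Fin.castSucc_ne_last, if_false]
      rfl
    rw [this, map_zero]

/-- Along a short segment in a killed direction `y` is constant, from every base point near `j`. So
`y` and its translate agree near `j`, and with them their full derivatives, not just the values. -/
theorem Killed.translate_map {E H G : Type} [NormedAddCommGroup E] [NormedSpace ℝ E]
    [NormedAddCommGroup H] [NormedSpace ℝ H] [NormedAddCommGroup G] [NormedSpace ℝ G] {D : Set E}
    {y : E → H} {L : G →L[ℝ] E} (hD : IsOpen D)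
    (hy : DifferentiableOn ℝ y D) (hv : ∀ w, Killed D y (L w)) {j : E} (hj : j ∈ D) :
    ∀ᶠ w in 𝓝 (0 : G), j + L w ∈ D ∧ y (j + L w) = y j ∧
      fderiv ℝ y (j + L w) = fderiv ℝ y j := by
  obtain ⟨r, hr, hrD⟩ := Metric.isOpen_iff.1 hD j hj
  have hr2 : 0 < r / 2 := half_pos hr
  have hin : ∀ z ∈ Metric.ball j (r / 2), ∀ w : G, ‖L w‖ < r / 2 → z + L w ∈ D := by
    intro z hz s hs
    apply hrD
    rw [Metric.mem_ball, dist_eq_norm] at hz ⊢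
    calc ‖z + L s - j‖ = ‖(z - j) + L s‖ := by congr 1; abel
      _ ≤ ‖z - j‖ + ‖L s‖ := norm_add_le _ _
      _ < r := by linarith
  have hconst : ∀ z ∈ Metric.ball j (r / 2), ∀ w : G, ‖L w‖ < r / 2 → y (z + L w) = y z := by
    intro z hz w hs
    have hd : ∀ τ ∈ Set.Icc (0 : ℝ) 1, HasDerivAt (fun τ : ℝ => y (z + τ • L w)) 0 τ := by
      intro τ hτ
      have hτs : ‖L (τ • w)‖ < r / 2 := by
        rw [map_smul, norm_smul, Real.norm_of_nonneg hτ.1]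
        exact (mul_le_of_le_one_left (norm_nonneg _) hτ.2).trans_lt hs
      have hmem := hin z hz _ hτs
      rw [map_smul] at hmem
      have h1 : HasDerivAt (fun τ : ℝ => z + τ • L w) (L w) τ := by
        simpa using ((hasDerivAt_id τ).smul_const (L w)).const_add z
      have h2 := ((hy.differentiableAt (hD.mem_nhds hmem)).hasFDerivAt).comp_hasDerivAt τ h1
      rw [hv _ _ hmem] at h2
      exact h2
    have := constant_of_has_deriv_right_zero (f := fun τ : ℝ => y (z + τ • L w)) (a := 0)
      (b := 1) (fun τ hτ => (hd τ hτ).continuousAt.continuousWithinAt)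
      (fun τ hτ => (hd τ ⟨hτ.1, hτ.2.le⟩).hasDerivWithinAt) 1 ⟨zero_le_one, le_rfl⟩
    simpa using this
  have hsm : ∀ᶠ w in 𝓝 (0 : G), ‖L w‖ < r / 2 := by
    have : Tendsto (fun w : G => ‖L w‖) (𝓝 0) (𝓝 0) := by
      have : Continuous fun w : G => ‖L w‖ := by fun_prop
      simpa using this.tendsto 0
    exact this.eventually (gt_mem_nhds hr2)
  filter_upwards [hsm] with s hs
  have hjb : j ∈ Metric.ball j (r / 2) := Metric.mem_ball_self hr2
  refine ⟨hin j hjb s hs, hconst j hjb s hs, ?_⟩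
  have heq : (fun z => y (z + L s)) =ᶠ[𝓝 j] y := by
    filter_upwards [Metric.ball_mem_nhds j hr2] with z hz
    exact hconst z hz s hs
  rw [← heq.fderiv_eq, fderiv_comp_add_right]

theorem Killed.translate {E H : Type} [NormedAddCommGroup E] [NormedSpace ℝ E]
    [NormedAddCommGroup H] [NormedSpace ℝ H] {D : Set E} {y : E → H} {v : E} (hD : IsOpen D)
    (hy : DifferentiableOn ℝ y D) (hv : Killed D y v) {j : E} (hj : j ∈ D) :
    ∀ᶠ s in 𝓝 (0 : ℝ), j + s • v ∈ D ∧ y (j + s • v) = y j ∧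
      fderiv ℝ y (j + s • v) = fderiv ℝ y j :=
  Killed.translate_map (L := ContinuousLinearMap.toSpanSingleton ℝ v) hD hy
    (fun w j hj => by
      rw [ContinuousLinearMap.toSpanSingleton_apply, map_smul, hv j hj, smul_zero]) hj

end JetBasis

/-! ### The Codazzi equations as affine equations in the next derivative -/

section Tower

open Filter Topology

variable {η : ℝ} {F : ℝ → ℝ → ℝ} {U : Set (ℝ × ℝ)} {ω : Forms} {n : ℕ}

theorem JetCodazzi.differentiableOn {D : Set (Jet (n + 1))} {y : Jet (n + 1) → ℝ × ℝ × ℝ}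
    (h : JetCodazzi η F U ω n D y) : DifferentiableOn ℝ y D :=
  h.smooth.differentiableOn (by simp)

theorem JetCodazzi.mono {D D' : Set (Jet (n + 1))} {y : Jet (n + 1) → ℝ × ℝ × ℝ}
    (h : JetCodazzi η F U ω n D y) (hD' : IsOpen D') (hs : D' ⊆ D) :
    JetCodazzi η F U ω n D' y :=
  ⟨hD', hs.trans h.regular, h.smooth.mono hs, fun j hj => h.eqs j (hs hj)⟩

theorem Killed.mono {E H : Type} [NormedAddCommGroup E] [NormedSpace ℝ E]
    [NormedAddCommGroup H] [NormedSpace ℝ H] {D D' : Set E} {y : E → H} {v : E}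
    (h : Killed D y v) (hs : D' ⊆ D) : Killed D' y v := fun j hj => h j (hs hj)

theorem eventually_exists_ne {p : ℝ → Prop} (h : ∀ᶠ s in 𝓝 (0 : ℝ), p s) : ∃ s, s ≠ 0 ∧ p s := by
  obtain ⟨s, hs, hs'⟩ := ((h.filter_mono nhdsWithin_le_nhds).and
    (self_mem_nhdsWithin (s := {(0 : ℝ)}ᶜ) (a := 0))).exists
  exact ⟨s, hs', hs⟩

/-- Comparing the Codazzi equations for two derivatives along `t` that differ by `s • d`. -/
theorem GaussCodazziAt.compare_dt {z₀ z₁ s : ℝ} {y yX yT yT' d : ℝ × ℝ × ℝ}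
    (h : GaussCodazziAt ω η z₀ z₁ y yX yT) (h' : GaussCodazziAt ω η z₀ z₁ y yX yT') (hs : s ≠ 0)
    (hd : yT' = yT + s • d) :
    d.1 * ω.f11 z₀ z₁ + d.2.1 * η = 0 ∧ d.2.1 * ω.f11 z₀ z₁ + d.2.2 * η = 0 := by
  have h1 := h.codazzi₁
  have h2 := h.codazzi₂
  have h1' := h'.codazzi₁
  have h2' := h'.codazzi₂
  subst hd
  simp only [Prod.fst_add, Prod.snd_add, Prod.smul_fst, Prod.smul_snd, smul_eq_mul] at h1' h2'
  constructor <;> apply mul_left_cancel₀ hs <;> linarith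

/-- Comparing the Codazzi equations for two derivatives along `x` that differ by `s • d`. -/
theorem GaussCodazziAt.compare_dx {z₀ z₁ s : ℝ} {y yX yX' yT d : ℝ × ℝ × ℝ}
    (h : GaussCodazziAt ω η z₀ z₁ y yX yT) (h' : GaussCodazziAt ω η z₀ z₁ y yX' yT) (hs : s ≠ 0)
    (hd : yX' = yX + s • d) :
    d.1 * ω.f12 z₀ z₁ + d.2.1 * ω.f22 z₀ z₁ = 0 ∧
      d.2.1 * ω.f12 z₀ z₁ + d.2.2 * ω.f22 z₀ z₁ = 0 := by
  have h1 := h.codazzi₁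
  have h2 := h.codazzi₂
  have h1' := h'.codazzi₁
  have h2' := h'.codazzi₂
  subst hd
  simp only [Prod.fst_add, Prod.snd_add, Prod.smul_fst, Prod.smul_snd, smul_eq_mul] at h1' h2'
  constructor <;> apply mul_left_cancel₀ hs <;> linarith

variable {D : Set (Jet (n + 2))} {y : Jet (n + 2) → ℝ × ℝ × ℝ}

/-- If `y` does not depend on the `∂_t^{i+1} u` with `i > k`, the Codazzi equations are affine in
`∂_t^{k+2} u`. -/
theorem JetCodazzi.deriv_eW (C : FormCalculus η F U ω) (h : JetCodazzi η F U ω (n + 1) D y)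
    (hZ : Killed D y (eZ (Fin.last (n + 1)))) {k : ℕ} (hk : k + 1 < n + 2)
    (hW : ∀ i : Fin (n + 2), k < i → Killed D y (eW i)) {j : Jet (n + 2)} (hj : j ∈ D) :
    (fderiv ℝ y j (eW ⟨k, by omega⟩)).1 * ω.f11 j.2.2.1 (j.2.2.2.1 0) +
      (fderiv ℝ y j (eW ⟨k, by omega⟩)).2.1 * η = 0 ∧
    (fderiv ℝ y j (eW ⟨k, by omega⟩)).2.1 * ω.f11 j.2.2.1 (j.2.2.2.1 0) +
      (fderiv ℝ y j (eW ⟨k, by omega⟩)).2.2 * η = 0 := by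
  -- Shifting `∂_t^{k+2} u` by `s` changes neither `y`, nor its derivative, nor the forms, nor the
  -- derivative of `y` along `X`. Along `T` it adds `s` times the partial derivative in `∂_t^{k+1}
  -- u`, because the component of `T` there is `∂_t^{k+2} u`.
  obtain ⟨s, hs, hj', hyj, hfj⟩ := eventually_exists_ne
    ((hW ⟨k + 1, hk⟩ (Nat.lt_succ_self k)).translate h.isOpen h.differentiableOn hj)
  set j' := j + s • eW ⟨k + 1, hk⟩ with hj'def
  have e1 : j'.1 = j.1 := by simp [hj'def, eW]
  have e2 : j'.2.1 = j.2.1 := by simp [hj'def, eW]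
  have e3 : j'.2.2.1 = j.2.2.1 := by simp [hj'def, eW]
  have e4 : j'.2.2.2.1 = j.2.2.2.1 := by simp [hj'def, eW]
  have e5 : ∀ i, j'.2.2.2.2 i = j.2.2.2.2 i + if i = ⟨k + 1, hk⟩ then s else 0 := by
    intro i; simp [hj'def, eW, Pi.single_apply]
  obtain ⟨X, T, hXT⟩ := exists_totalDerivs C j (h.regular hj).1
  obtain ⟨X', T', hXT'⟩ := exists_totalDerivs C j' (h.regular hj').1
  obtain ⟨x1, x2, x3, t1, t2, t3, xz, tw, -⟩ := hXT.components
  obtain ⟨x1', x2', x3', t1', t2', t3', xz', tw', -⟩ := hXT'.components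
  have gc := h.eqs j hj X T hXT
  have gc' := h.eqs j' hj' X' T' hXT'
  rw [e3, e4, hyj, hfj] at gc'
  have hX : fderiv ℝ y j X' = fderiv ℝ y j X := by
    rw [map_jet _ X, map_jet _ X', x1, x2, x3, x1', x2', x3', e4]
    congr 1
    · congr 1
      refine Finset.sum_congr rfl fun i _ => ?_
      rcases Nat.lt_or_ge (i + 1) (n + 2) with hi | hi
      · have a1 := xz i hi
        have a2 := xz' i hi
        rw [e4] at a2
        rw [show i = ⟨i, by omega⟩ from rfl, a1, a2]
      · rw [show i = Fin.last (n + 1) from Fin.ext (by simp; omega), hZ j hj, smul_zero, smul_zero]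
    · refine Finset.sum_congr rfl fun i _ => ?_
      rcases Nat.lt_or_ge k i with hi | hi
      · rw [hW i hi j hj, smul_zero, smul_zero]
      · rw [hXT'.dx_determined C hXT e1 e2 e3 (by rw [e4]) i fun m hm => ?_]
        rw [e5, if_neg, add_zero]
        rintro rfl
        exact absurd (Fin.lt_def.1 hm) (by simp; omega)
  have hT : fderiv ℝ y j T' = fderiv ℝ y j T + s • fderiv ℝ y j (eW ⟨k, by omega⟩) := by
    have hz : ∀ i, T'.2.2.2.1 i = T.2.2.2.1 i := fun i =>
      hXT'.dt_determined C hXT e1 e2 e3 i fun m _ => by rw [e4]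
    rw [map_jet _ T, map_jet _ T', t1, t2, t3, t1', t2', t3', e5, if_neg (by simp [Fin.ext_iff]),
      add_zero]
    simp only [hz]
    have : ∀ i, T'.2.2.2.2 i • fderiv ℝ y j (eW i) = T.2.2.2.2 i • fderiv ℝ y j (eW i) +
        if i = ⟨k, by omega⟩ then s • fderiv ℝ y j (eW i) else 0 := by
      intro i
      rcases Nat.lt_or_ge (i + 1) (n + 2) with hi | hi
      · have a1 := tw i hi
        have a2 := tw' i hi
        rw [e5] at a2
        rw [show i = ⟨i, by omega⟩ from rfl, a1, a2, add_smul]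
        by_cases hik : (i : ℕ) = k
        · simp [hik]
        · simp [Fin.ext_iff, hik]
      · have hl : i = Fin.last (n + 1) := Fin.ext (by simp; omega)
        rw [hW i (by omega) j hj]
        simp
    rw [Finset.sum_congr rfl fun i _ => this i, Finset.sum_add_distrib, Finset.sum_ite_eq',
      if_pos (Finset.mem_univ _), ← add_assoc]
  rw [hX] at gc'
  exact gc.compare_dt gc' hs hT

/-- If `y` does not depend on any `∂_t^{i+1} u`, the Codazzi equations are affine in `∂_t u`. -/
theorem JetCodazzi.deriv_eU (C : FormCalculus η F U ω) (h : JetCodazzi η F U ω (n + 1) D y)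
    (hZ : Killed D y (eZ (Fin.last (n + 1))))
    (hW : ∀ i : Fin (n + 2), Killed D y (eW i)) {j : Jet (n + 2)} (hj : j ∈ D) :
    (fderiv ℝ y j (eU (n + 2))).1 * ω.f11 j.2.2.1 (j.2.2.2.1 0) +
      (fderiv ℝ y j (eU (n + 2))).2.1 * η = 0 ∧
    (fderiv ℝ y j (eU (n + 2))).2.1 * ω.f11 j.2.2.1 (j.2.2.2.1 0) +
      (fderiv ℝ y j (eU (n + 2))).2.2 * η = 0 := by
  -- The same comparison with a shift of `u_t`, which now enters only as the component of `T` along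
  -- `u`.
  obtain ⟨s, hs, hj', hyj, hfj⟩ := eventually_exists_ne
    ((hW 0).translate h.isOpen h.differentiableOn hj)
  set j' := j + s • eW 0 with hj'def
  have e1 : j'.1 = j.1 := by simp [hj'def, eW]
  have e2 : j'.2.1 = j.2.1 := by simp [hj'def, eW]
  have e3 : j'.2.2.1 = j.2.2.1 := by simp [hj'def, eW]
  have e4 : j'.2.2.2.1 = j.2.2.2.1 := by simp [hj'def, eW]
  have e5 : j'.2.2.2.2 0 = j.2.2.2.2 0 + s := by
    simp [hj'def, eW]
  obtain ⟨X, T, hXT⟩ := exists_totalDerivs C j (h.regular hj).1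
  obtain ⟨X', T', hXT'⟩ := exists_totalDerivs C j' (h.regular hj').1
  obtain ⟨x1, x2, x3, t1, t2, t3, xz, tw, -⟩ := hXT.components
  obtain ⟨x1', x2', x3', t1', t2', t3', xz', tw', -⟩ := hXT'.components
  have gc := h.eqs j hj X T hXT
  have gc' := h.eqs j' hj' X' T' hXT'
  rw [e3, e4, hyj, hfj] at gc'
  have hX : fderiv ℝ y j X' = fderiv ℝ y j X := by
    rw [map_jet _ X, map_jet _ X', x1, x2, x3, x1', x2', x3', e4]
    congr 1
    · congr 1
      refine Finset.sum_congr rfl fun i _ => ?_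
      rcases Nat.lt_or_ge (i + 1) (n + 2) with hi | hi
      · have a1 := xz i hi
        have a2 := xz' i hi
        rw [e4] at a2
        rw [show i = ⟨i, by omega⟩ from rfl, a1, a2]
      · rw [show i = Fin.last (n + 1) from Fin.ext (by simp; omega), hZ j hj, smul_zero, smul_zero]
    · refine Finset.sum_congr rfl fun i _ => ?_
      rw [hW i j hj, smul_zero, smul_zero]
  have hT : fderiv ℝ y j T' = fderiv ℝ y j T + s • fderiv ℝ y j (eU (n + 2)) := by
    have hz : ∀ i, T'.2.2.2.1 i = T.2.2.2.1 i := fun i =>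
      hXT'.dt_determined C hXT e1 e2 e3 i fun m _ => by rw [e4]
    have hw : ∀ i, fderiv ℝ y j (eW i) = 0 := fun i => hW i j hj
    rw [map_jet _ T, map_jet _ T', t1, t2, t3, t1', t2', t3', e5]
    simp only [hz, hw, add_smul, smul_zero]
    abel
  rw [hX] at gc'
  exact gc.compare_dt gc' hs hT

/-- If `y` does not depend on `∂_t^{i+1} u` and on the `∂_x^{i+1} u` with `i > k`, the Codazzi
equations are affine in `∂_x^{k+2} u`. -/
theorem JetCodazzi.deriv_eZ (C : FormCalculus η F U ω) (h : JetCodazzi η F U ω (n + 1) D y)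
    (hW : ∀ i : Fin (n + 2), Killed D y (eW i)) {k : ℕ} (hk : k + 1 < n + 2)
    (hZ : ∀ i : Fin (n + 2), k < i → Killed D y (eZ i)) {j : Jet (n + 2)} (hj : j ∈ D) :
    (fderiv ℝ y j (eZ ⟨k, by omega⟩)).1 * ω.f12 j.2.2.1 (j.2.2.2.1 0) +
      (fderiv ℝ y j (eZ ⟨k, by omega⟩)).2.1 * ω.f22 j.2.2.1 (j.2.2.2.1 0) = 0 ∧
    (fderiv ℝ y j (eZ ⟨k, by omega⟩)).2.1 * ω.f12 j.2.2.1 (j.2.2.2.1 0) +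
      (fderiv ℝ y j (eZ ⟨k, by omega⟩)).2.2 * ω.f22 j.2.2.1 (j.2.2.2.1 0) = 0 := by
  -- A shift of `∂_x^{k+2} u` changes the derivative along `X`; the components of `T` that matter
  -- have index at most `k` and are unaffected by `dt_determined`.
  obtain ⟨s, hs, hj', hyj, hfj⟩ := eventually_exists_ne
    ((hZ ⟨k + 1, hk⟩ (Nat.lt_succ_self k)).translate h.isOpen h.differentiableOn hj)
  set j' := j + s • eZ ⟨k + 1, hk⟩ with hj'def
  have e1 : j'.1 = j.1 := by simp [hj'def, eZ]
  have e2 : j'.2.1 = j.2.1 := by simp [hj'def, eZ]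
  have e3 : j'.2.2.1 = j.2.2.1 := by simp [hj'def, eZ]
  have e4 : j'.2.2.2.2 = j.2.2.2.2 := by simp [hj'def, eZ]
  have e5 : ∀ i, j'.2.2.2.1 i = j.2.2.2.1 i + if i = ⟨k + 1, hk⟩ then s else 0 := by
    intro i; simp [hj'def, eZ, Pi.single_apply]
  have e6 : j'.2.2.2.1 0 = j.2.2.2.1 0 := by
    rw [e5, if_neg (by simp [Fin.ext_iff]), add_zero]
  obtain ⟨X, T, hXT⟩ := exists_totalDerivs C j (h.regular hj).1
  obtain ⟨X', T', hXT'⟩ := exists_totalDerivs C j' (h.regular hj').1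
  obtain ⟨x1, x2, x3, t1, t2, t3, xz, tw, -⟩ := hXT.components
  obtain ⟨x1', x2', x3', t1', t2', t3', xz', tw', -⟩ := hXT'.components
  have gc := h.eqs j hj X T hXT
  have gc' := h.eqs j' hj' X' T' hXT'
  rw [e3, e6, hyj, hfj] at gc'
  have hw : ∀ i, fderiv ℝ y j (eW i) = 0 := fun i => hW i j hj
  have hT : fderiv ℝ y j T' = fderiv ℝ y j T := by
    rw [map_jet _ T, map_jet _ T', t1, t2, t3, t1', t2', t3', e4]
    simp only [hw, smul_zero]
    congr 2
    refine Finset.sum_congr rfl fun i _ => ?_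
    rcases Nat.lt_or_ge k i with hi | hi
    · rw [hZ i hi j hj, smul_zero, smul_zero]
    · rw [hXT'.dt_determined C hXT e1 e2 e3 i fun m hm => ?_]
      rw [e5, if_neg, add_zero]
      rintro rfl
      exact absurd (Fin.le_def.1 hm) (by simp; omega)
  have hX : fderiv ℝ y j X' = fderiv ℝ y j X + s • fderiv ℝ y j (eZ ⟨k, by omega⟩) := by
    rw [map_jet _ X, map_jet _ X', x1, x2, x3, x1', x2', x3', e6]
    simp only [hw, smul_zero, Finset.sum_const_zero, add_zero]
    have : ∀ i, X'.2.2.2.1 i • fderiv ℝ y j (eZ i) = X.2.2.2.1 i • fderiv ℝ y j (eZ i) +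
        if i = ⟨k, by omega⟩ then s • fderiv ℝ y j (eZ i) else 0 := by
      intro i
      rcases Nat.lt_or_ge (i + 1) (n + 2) with hi | hi
      · have a1 := xz i hi
        have a2 := xz' i hi
        rw [e5] at a2
        rw [show i = ⟨i, by omega⟩ from rfl, a1, a2, add_smul]
        by_cases hik : (i : ℕ) = k
        · simp [hik]
        · simp [Fin.ext_iff, hik]
      · have hl : i = Fin.last (n + 1) := Fin.ext (by simp; omega)
        rw [hZ i (by omega) j hj]
        simp
    rw [Finset.sum_congr rfl fun i _ => this i, Finset.sum_add_distrib, Finset.sum_ite_eq',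
      if_pos (Finset.mem_univ _), ← add_assoc]
  rw [hT] at gc'
  exact gc.compare_dx gc' hs hX

end Tower

/-! ### Isotropy, and elimination of the derivatives along t -/

section Elimination

open Filter Topology

/-- A symmetric form `(a, b, c)` of determinant `-1` that varies in the direction of a form with
kernel `(p, q)` makes `(p, q)` isotropic. -/
theorem isotropic_of_kernel {a b c p q d₁ d₂ d₃ : ℝ} (hpq : 0 < p ^ 2 + q ^ 2)
    (h₁ : d₁ * p + d₂ * q = 0) (h₂ : d₂ * p + d₃ * q = 0) (hg : a * c - b ^ 2 = -1)
    (hg' : d₁ * c + a * d₃ - 2 * b * d₂ = 0) (hd : (d₁, d₂, d₃) ≠ 0) :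
    (∃ k, k ≠ 0 ∧ d₁ = k * q ^ 2 ∧ d₂ = -k * p * q ∧ d₃ = k * p ^ 2) ∧
    ∃ μ, μ = ((b * p + c * q) * p - (a * p + b * q) * q) / (p ^ 2 + q ^ 2) ∧ μ ^ 2 = 1 ∧
      a * p + b * q = -μ * q ∧ b * p + c * q = μ * p := by
  set N := p ^ 2 + q ^ 2 with hN
  have hN0 : N ≠ 0 := hpq.ne'
  set k := (d₁ + d₃) / N with hk
  have hkN : k * N = d₁ + d₃ := div_mul_cancel₀ _ hN0
  have k1 : d₁ = k * q ^ 2 := by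
    apply mul_right_cancel₀ hN0
    linear_combination (norm := (rw [hN]; ring)) p * h₁ - q * h₂ - q ^ 2 * hkN
  have k2 : d₂ = -k * p * q := by
    apply mul_right_cancel₀ hN0
    linear_combination (norm := (rw [hN]; ring)) q * h₁ + p * h₂ + p * q * hkN
  have k3 : d₃ = k * p ^ 2 := by
    apply mul_right_cancel₀ hN0
    linear_combination (norm := (rw [hN]; ring)) q * h₂ - p * h₁ - p ^ 2 * hkN
  have hk0 : k ≠ 0 := by
    rintro hk0
    rw [hk0] at k1 k2 k3
    apply hd
    simp [k1, k2, k3]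
  -- The kernel condition makes the variation equal to `k` times the square of the covector `(q,
  -- -p)`. The derivative of the determinant in that direction is `k` times the value of the form
  -- `(a, b, c)` at `(p, q)`.
  have hl : (a * p + b * q) * p + (b * p + c * q) * q = 0 := by
    apply mul_left_cancel₀ hk0
    rw [k1, k2, k3] at hg'
    linear_combination hg'
  refine ⟨⟨k, hk0, k1, k2, k3⟩, _, rfl, ?_⟩
  set μ := ((b * p + c * q) * p - (a * p + b * q) * q) / N with hμ
  have hμN : μ * N = (b * p + c * q) * p - (a * p + b * q) * q := div_mul_cancel₀ _ hN0
  have m1 : a * p + b * q = -μ * q := by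
    apply mul_right_cancel₀ hN0
    linear_combination (norm := (rw [hN]; ring)) p * hl + q * hμN
  have m2 : b * p + c * q = μ * p := by
    apply mul_right_cancel₀ hN0
    linear_combination (norm := (rw [hN]; ring)) q * hl - p * hμN
  refine ⟨?_, m1, m2⟩
  apply mul_right_cancel₀ hN0
  -- The form maps `(p, q)` to `μ (-q, p)`; in the orthogonal basis `(p, q)`, `(-q, p)` its
  -- determinant is `-μ²`, hence `μ² = 1`.
  have e1 : (μ ^ 2 - 1) * p = 0 := by
    linear_combination -p * hg + c * m1 - b * m2 - μ * m2
  have e2 : (μ ^ 2 - 1) * q = 0 := by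
    linear_combination -q * hg + a * m2 - b * m1 + μ * m1
  linear_combination (norm := (rw [hN]; ring)) p * e1 + q * e2

/-- A coefficient `f(u, u_x)` as a function on the jet space. -/
abbrev onJet {n : ℕ} (f : ℝ → ℝ → ℝ) (j : Jet (n + 1)) : ℝ := f j.2.2.1 (j.2.2.2.1 0)

/-- The projection of jets to `(u, u_x)`. -/
noncomputable def baseProj (n : ℕ) : Jet (n + 1) →L[ℝ] ℝ × ℝ :=
  LinearMap.toContinuousLinearMap
    { toFun := fun j => (j.2.2.1, j.2.2.2.1 0)
      map_add' := fun _ _ => rfl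
      map_smul' := fun _ _ => rfl }

variable {n : ℕ}

theorem baseProj_apply (j : Jet (n + 1)) : baseProj n j = (j.2.2.1, j.2.2.2.1 0) := rfl

theorem hasFDerivAt_onJet {f : ℝ → ℝ → ℝ} {A : ℝ × ℝ →L[ℝ] ℝ} {j : Jet (n + 1)}
    (hf : HasFDerivAt (fun q : ℝ × ℝ => f q.1 q.2) A (j.2.2.1, j.2.2.2.1 0)) :
    HasFDerivAt (onJet f) (A.comp (baseProj n)) j :=
  HasFDerivAt.comp (g := fun q : ℝ × ℝ => f q.1 q.2) j hf (baseProj n).hasFDerivAt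

theorem HasFDerivAt.apply_eq_zero_of_eqOn {E H : Type} [NormedAddCommGroup E] [NormedSpace ℝ E]
    [NormedAddCommGroup H] [NormedSpace ℝ H] {Φ : E → H} {Φ' : E →L[ℝ] H} {D : Set E} {j : E}
    (h : HasFDerivAt Φ Φ' j) (hD : IsOpen D) (hj : j ∈ D) (h0 : ∀ z ∈ D, Φ z = 0) (v : E) :
    Φ' v = 0 := by
  have : HasFDerivAt Φ (0 : E →L[ℝ] H) j := (hasFDerivAt_const (0 : H) j).congr_of_eventuallyEq
    (by filter_upwards [hD.mem_nhds hj] with z hz using h0 z hz)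
  rw [h.unique this]
  rfl

theorem deriv_eq_zero_of_onJet_eq_zero {f : ℝ → ℝ → ℝ} {A : ℝ × ℝ →L[ℝ] ℝ} {j : Jet (n + 1)}
    {D : Set (Jet (n + 1))} (hD : IsOpen D) (hj : j ∈ D)
    (hf : HasFDerivAt (fun q : ℝ × ℝ => f q.1 q.2) A (j.2.2.1, j.2.2.2.1 0))
    (h0 : ∀ z ∈ D, onJet f z = 0) : A = 0 := by
  refine ContinuousLinearMap.ext fun q => ?_
  exact (hasFDerivAt_onJet hf).apply_eq_zero_of_eqOn hD hj h0 (0, 0, q.1, fun _ => q.2, 0)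

variable {η : ℝ} {F : ℝ → ℝ → ℝ} {U : Set (ℝ × ℝ)} {ω : Forms}

section

variable {D : Set (Jet (n + 1))} {y : Jet (n + 1) → ℝ × ℝ × ℝ}

theorem JetCodazzi.gauss (C : FormCalculus η F U ω) (h : JetCodazzi η F U ω n D y)
    {j : Jet (n + 1)} (hj : j ∈ D) : (y j).1 * (y j).2.2 - (y j).2.1 ^ 2 = -1 := by
  obtain ⟨X, T, hXT⟩ := exists_totalDerivs C j (h.regular hj).1
  exact (h.eqs j hj X T hXT).gauss

theorem JetCodazzi.hasFDerivAt_components (h : JetCodazzi η F U ω n D y) {j : Jet (n + 1)}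
    (hj : j ∈ D) :
    HasFDerivAt (fun j => (y j).1) ((ContinuousLinearMap.fst ℝ ℝ (ℝ × ℝ)).comp (fderiv ℝ y j)) j ∧
    HasFDerivAt (fun j => (y j).2.1) ((ContinuousLinearMap.fst ℝ ℝ ℝ).comp
      ((ContinuousLinearMap.snd ℝ ℝ (ℝ × ℝ)).comp (fderiv ℝ y j))) j ∧
    HasFDerivAt (fun j => (y j).2.2) ((ContinuousLinearMap.snd ℝ ℝ ℝ).comp
      ((ContinuousLinearMap.snd ℝ ℝ (ℝ × ℝ)).comp (fderiv ℝ y j))) j :=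
  have hd := (h.differentiableAt hj).hasFDerivAt
  ⟨hd.fst, hd.snd.fst, hd.snd.snd⟩

theorem JetCodazzi.gauss_deriv (C : FormCalculus η F U ω) (h : JetCodazzi η F U ω n D y)
    {j : Jet (n + 1)} (hj : j ∈ D) (v : Jet (n + 1)) :
    (fderiv ℝ y j v).1 * (y j).2.2 + (y j).1 * (fderiv ℝ y j v).2.2 -
      2 * (y j).2.1 * (fderiv ℝ y j v).2.1 = 0 := by
  obtain ⟨ha, hb, hc⟩ := h.hasFDerivAt_components hj
  have := (((ha.mul hc).sub (hb.pow 2)).add_const 1).apply_eq_zero_of_eqOn h.isOpen hj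
    (fun z hz => by simp only [Pi.mul_apply, Pi.sub_apply]; linarith [h.gauss C hz]) v
  simp at this
  linarith

/-- If `y` varies in the direction `v` by forms with kernel `(p, q)`, then `(p, q)` is isotropic
near the given jet. -/
theorem JetCodazzi.exists_isotropic (C : FormCalculus η F U ω) (h : JetCodazzi η F U ω n D y)
    {v : Jet (n + 1)} {p q : Jet (n + 1) → ℝ} (hp : ContinuousOn p D) (hq : ContinuousOn q D)
    (hpq : ∀ j ∈ D, 0 < p j ^ 2 + q j ^ 2)
    (hrel : ∀ j ∈ D, (fderiv ℝ y j v).1 * p j + (fderiv ℝ y j v).2.1 * q j = 0 ∧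
      (fderiv ℝ y j v).2.1 * p j + (fderiv ℝ y j v).2.2 * q j = 0)
    (hv : ¬ Killed D y v) :
    ∃ D' ⊆ D, IsOpen D' ∧ D'.Nonempty ∧ ∃ μ : ℝ, μ ^ 2 = 1 ∧ ∀ j ∈ D',
      (y j).1 * p j + (y j).2.1 * q j = -μ * q j ∧ (y j).2.1 * p j + (y j).2.2 * q j = μ * p j ∧
      ∃ k, k ≠ 0 ∧ (fderiv ℝ y j v).1 = k * q j ^ 2 ∧ (fderiv ℝ y j v).2.1 = -k * p j * q j ∧
        (fderiv ℝ y j v).2.2 = k * p j ^ 2 := by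
  simp only [Killed, not_forall] at hv
  obtain ⟨j₀, hj₀, hv⟩ := hv
  have hcont : ContinuousOn (fun j => fderiv ℝ y j v) D :=
    (h.smooth.continuousOn_fderiv_of_isOpen h.isOpen (by simp)).clm_apply continuousOn_const
  have hopen : IsOpen (D ∩ (fun j => fderiv ℝ y j v) ⁻¹' {0}ᶜ) :=
    hcont.isOpen_inter_preimage h.isOpen isOpen_compl_singleton
  obtain ⟨r, hr, hball⟩ := Metric.isOpen_iff.1 hopen j₀ ⟨hj₀, hv⟩
  have hD' : Metric.ball j₀ r ⊆ D := fun j hj => (hball hj).1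
  have key := fun j (hj : j ∈ Metric.ball j₀ r) => isotropic_of_kernel (hpq j (hD' hj))
    (hrel j (hD' hj)).1 (hrel j (hD' hj)).2 (h.gauss C (hD' hj)) (h.gauss_deriv C (hD' hj) v)
    (hball hj).2
  set M : Jet (n + 1) → ℝ := fun j => (((y j).2.1 * p j + (y j).2.2 * q j) * p j -
    ((y j).1 * p j + (y j).2.1 * q j) * q j) / (p j ^ 2 + q j ^ 2) with hM
  have hMc : ContinuousOn M (Metric.ball j₀ r) := by
    have hy := h.smooth.continuousOn.mono hD'
    have hp' := hp.mono hD'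
    have hq' := hq.mono hD'
    have h1 : ContinuousOn (fun j => (y j).1) (Metric.ball j₀ r) :=
      continuous_fst.comp_continuousOn hy
    have h2 : ContinuousOn (fun j => (y j).2.1) (Metric.ball j₀ r) :=
      (continuous_fst.comp continuous_snd).comp_continuousOn hy
    have h3 : ContinuousOn (fun j => (y j).2.2) (Metric.ball j₀ r) :=
      (continuous_snd.comp continuous_snd).comp_continuousOn hy
    exact (((((h2.mul hp').add (h3.mul hq')).mul hp').sub
      (((h1.mul hp').add (h2.mul hq')).mul hq')).div ((hp'.pow 2).add (hq'.pow 2))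
      fun j hj => (hpq j (hD' hj)).ne')
  have hM2 : Set.EqOn (M ^ 2) 1 (Metric.ball j₀ r) := fun j hj => by
    obtain ⟨-, μ, hμ, hμ2, -⟩ := key j hj
    rw [Pi.pow_apply, hM]
    simp only [Pi.one_apply]
    rw [← hμ, hμ2]
  -- The sign is a continuous function with square one on a ball, hence constant there; without this
  -- the isotropy relation could not be differentiated with `μ` fixed.
  have hconst : ∃ μ : ℝ, μ ^ 2 = 1 ∧ ∀ j ∈ Metric.ball j₀ r, M j = μ := by
    rcases (convex_ball j₀ r).isPreconnected.eq_one_or_eq_neg_one_of_sq_eq hMc hM2 with h1 | h1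
    · exact ⟨1, by norm_num, fun j hj => h1 hj⟩
    · exact ⟨-1, by norm_num, fun j hj => h1 hj⟩
  obtain ⟨μ, hμ, hMμ⟩ := hconst
  refine ⟨_, hD', Metric.isOpen_ball, ⟨j₀, Metric.mem_ball_self hr⟩, μ, hμ, fun j hj => ?_⟩
  obtain ⟨hk, μ', hμ', -, h1, h2⟩ := key j hj
  rw [show μ' = μ from hμ'.trans (hMμ j hj)] at h1 h2
  exact ⟨h1, h2, hk⟩

/-- Differentiating the isotropy relations. -/
theorem JetCodazzi.isotropic_deriv (h : JetCodazzi η F U ω n D y) {p q : Jet (n + 1) → ℝ}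
    {p' q' : Jet (n + 1) →L[ℝ] ℝ} {μ : ℝ} {j : Jet (n + 1)} (hj : j ∈ D)
    (hp : HasFDerivAt p p' j) (hq : HasFDerivAt q q' j)
    (hrel : ∀ j ∈ D, (y j).1 * p j + (y j).2.1 * q j = -μ * q j ∧
      (y j).2.1 * p j + (y j).2.2 * q j = μ * p j) (v : Jet (n + 1)) :
    (fderiv ℝ y j v).1 * p j + (y j).1 * p' v + (fderiv ℝ y j v).2.1 * q j + (y j).2.1 * q' v =
      -μ * q' v ∧
    (fderiv ℝ y j v).2.1 * p j + (y j).2.1 * p' v + (fderiv ℝ y j v).2.2 * q j +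
      (y j).2.2 * q' v = μ * p' v := by
  obtain ⟨ha, hb, hc⟩ := h.hasFDerivAt_components hj
  have h1 := (((ha.mul hp).add (hb.mul hq)).add (hq.const_mul μ)).apply_eq_zero_of_eqOn h.isOpen hj
    (fun z hz => by simp only [Pi.mul_apply, Pi.add_apply]; linarith [(hrel z hz).1]) v
  have h2 := (((hb.mul hp).add (hc.mul hq)).sub (hp.const_mul μ)).apply_eq_zero_of_eqOn h.isOpen hj
    (fun z hz => by
      simp only [Pi.mul_apply, Pi.add_apply, Pi.sub_apply]; linarith [(hrel z hz).2]) v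
  simp at h1 h2
  constructor <;> linarith

/-- Differentiating an affine relation for `y` along a line. -/
theorem JetCodazzi.affine_deriv (h : JetCodazzi η F U ω n D y) {j v : Jet (n + 1)} (hj : j ∈ D)
    {α β γ δ : ℝ} (hrel : ∀ s : ℝ, j + s • v ∈ D → α * (y (j + s • v)).1 + β * (y (j + s • v)).2.1 +
      γ * (y (j + s • v)).2.2 + δ = 0) :
    α * (fderiv ℝ y j v).1 + β * (fderiv ℝ y j v).2.1 + γ * (fderiv ℝ y j v).2.2 = 0 := by
  have hl : HasDerivAt (fun s : ℝ => j + s • v) v 0 := by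
    simpa using ((hasDerivAt_id (0 : ℝ)).smul_const v).const_add j
  have hj0 : j = j + (0 : ℝ) • v := by simp
  obtain ⟨ha, hb, hc⟩ := h.hasFDerivAt_components hj
  have h1 := ha.comp_hasDerivAt_of_eq 0 hl hj0
  have h3 := hb.comp_hasDerivAt_of_eq 0 hl hj0
  have h4 := hc.comp_hasDerivAt_of_eq 0 hl hj0
  have hev : ∀ᶠ s in 𝓝 (0 : ℝ), j + s • v ∈ D :=
    hl.continuousAt.eventually_mem (by simpa using h.isOpen.mem_nhds hj)
  have h5 := (((h1.const_mul α).add (h3.const_mul β)).add (h4.const_mul γ)).add_const δ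
  exact h5.unique ((hasDerivAt_const (0 : ℝ) (0 : ℝ)).congr_of_eventuallyEq (by
    filter_upwards [hev] with s hs using hrel s hs))

theorem JetCodazzi.exists_translate (h : JetCodazzi η F U ω n D y) {j : Jet (n + 1)} (hj : j ∈ D)
    (v : Jet (n + 1)) : ∃ s : ℝ, s ≠ 0 ∧ j + s • v ∈ D := by
  apply eventually_exists_ne
  have hl : Continuous fun s : ℝ => j + s • v := by fun_prop
  exact hl.continuousAt.eventually_mem (by simpa using h.isOpen.mem_nhds hj)

theorem FormCalculus.hasFDerivAt_onJet11 (C : FormCalculus η F U ω) {j : Jet (n + 1)}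
    (hj : (j.2.2.1, j.2.2.2.1 0) ∈ U) : HasFDerivAt (onJet ω.f11)
      ((onJet C.g11 j • ContinuousLinearMap.snd ℝ ℝ ℝ).comp (baseProj n)) j :=
  hasFDerivAt_onJet (C.deriv11 _ hj)

theorem FormCalculus.hasFDerivAt_onJet12 (C : FormCalculus η F U ω) {j : Jet (n + 1)}
    (hj : (j.2.2.1, j.2.2.2.1 0) ∈ U) : HasFDerivAt (onJet ω.f12)
      ((onJet C.p12 j • ContinuousLinearMap.fst ℝ ℝ ℝ).comp (baseProj n)) j :=
  hasFDerivAt_onJet (C.deriv12 _ hj)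

theorem FormCalculus.hasFDerivAt_onJet22 (C : FormCalculus η F U ω) {j : Jet (n + 1)}
    (hj : (j.2.2.1, j.2.2.2.1 0) ∈ U) : HasFDerivAt (onJet ω.f22)
      ((onJet C.p22 j • ContinuousLinearMap.fst ℝ ℝ ℝ).comp (baseProj n)) j :=
  hasFDerivAt_onJet (C.deriv22 _ hj)

theorem JetCodazzi.area_ne (C : FormCalculus η F U ω) (h : JetCodazzi η F U ω n D y)
    {j : Jet (n + 1)} (hj : j ∈ D) :
    onJet ω.f11 j * onJet ω.f22 j - onJet ω.f12 j * η ≠ 0 := by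
  have := (h.regular hj).2
  rwa [Forms.area, C.f21_eq] at this

theorem JetCodazzi.column_pos (C : FormCalculus η F U ω) (h : JetCodazzi η F U ω n D y)
    {j : Jet (n + 1)} (hj : j ∈ D) : 0 < onJet ω.f12 j ^ 2 + onJet ω.f22 j ^ 2 := by
  rcases (add_nonneg (sq_nonneg (onJet ω.f12 j)) (sq_nonneg (onJet ω.f22 j))).lt_or_eq with h0 | h0
  · exact h0
  · exfalso
    have h1 : onJet ω.f12 j = 0 := by
      nlinarith [sq_nonneg (onJet ω.f12 j), sq_nonneg (onJet ω.f22 j)]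
    have h2 : onJet ω.f22 j = 0 := by
      nlinarith [sq_nonneg (onJet ω.f12 j), sq_nonneg (onJet ω.f22 j)]
    exact h.area_ne C hj (by rw [h1, h2]; ring)

end

variable {D : Set (Jet (n + 2))} {y : Jet (n + 2) → ℝ × ℝ × ℝ}

/-- `y` does not depend on `∂_t^{k+1} u` if it does not depend on the higher `∂_t^{i+1} u`. -/
theorem JetCodazzi.killed_eW (hη : η ≠ 0) (C : FormCalculus η F U ω)
    (h : JetCodazzi η F U ω (n + 1) D y)
    (hZ : Killed D y (eZ (Fin.last (n + 1)))) {k : ℕ} (hk : k + 1 < n + 2)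
    (hW : ∀ i : Fin (n + 2), k < i → Killed D y (eW i)) : Killed D y (eW ⟨k, by omega⟩) := by
  by_contra hv
  obtain ⟨D', hD', hD'o, ⟨j₀, hj₀⟩, μ, hμ, hiso⟩ := h.exists_isotropic C (p := onJet ω.f11)
    (q := fun _ => η)
    (fun j hj => (C.hasFDerivAt_onJet11 (h.regular hj).1).continuousAt.continuousWithinAt)
    continuousOn_const (fun j hj => by positivity)
    (fun j hj => h.deriv_eW C hZ hk hW hj) hv
  have h' := h.mono hD'o hD'
  set v : Jet (n + 2) := eW ⟨k, by omega⟩ with hvdef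
  -- The two Codazzi equations are contracted with `(f11, η)`. By symmetry all derivatives of `y`
  -- then occur through those of `y (f11, η)`, which the isotropy relation supplies. The result is
  -- affine in `y`, with coefficients depending on `u, u_x, u_xx` only.
  have hrel : ∀ j ∈ D', onJet C.g11 j * j.2.2.2.1 1 *
      (-(y j).1 * onJet ω.f12 j + (μ - (y j).2.1) * onJet ω.f22 j) -
      2 * μ * η * onJet C.g11 j * onJet F j +
      onJet ω.f11 j * (-2 * (y j).2.1 *
        (onJet ω.f31 j * onJet ω.f12 j - onJet ω.f32 j * onJet ω.f11 j) +
        ((y j).1 - (y j).2.2) * (onJet ω.f31 j * onJet ω.f22 j - onJet ω.f32 j * η)) +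
      η * (((y j).1 - (y j).2.2) *
        (onJet ω.f31 j * onJet ω.f12 j - onJet ω.f32 j * onJet ω.f11 j) +
        2 * (y j).2.1 * (onJet ω.f31 j * onJet ω.f22 j - onJet ω.f32 j * η)) = 0 := by
    intro j hj
    obtain ⟨X, T, hXT⟩ := exists_totalDerivs C j (h'.regular hj).1
    obtain ⟨-, -, -, -, -, -, xz, -, tz⟩ := hXT.components
    have gc := h'.eqs j hj X T hXT
    have hd := fun v => h'.isotropic_deriv hj (C.hasFDerivAt_onJet11 (h'.regular hj).1)
      (hasFDerivAt_const η j) (fun j hj => ⟨(hiso j hj).1, (hiso j hj).2.1⟩) v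
    obtain ⟨x1, x2⟩ := hd X
    obtain ⟨t1, t2⟩ := hd T
    have xz0 : X.2.2.2.1 0 = j.2.2.2.1 1 := xz 0 (by omega)
    simp [baseProj_apply, xz0, tz] at x1 x2 t1 t2
    have c1 := gc.codazzi₁
    have c2 := gc.codazzi₂
    have i1 := (hiso j hj).1
    simp only [onJet] at *
    linear_combination (ω.f11 j.2.2.1 (j.2.2.2.1 0)) * c1 + η * c2 -
      (ω.f12 j.2.2.1 (j.2.2.2.1 0)) * x1 - (ω.f22 j.2.2.1 (j.2.2.2.1 0)) * x2 +
      (ω.f11 j.2.2.1 (j.2.2.2.1 0)) * t1 + η * t2 -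
      C.g11 j.2.2.1 (j.2.2.2.1 0) * F j.2.2.1 (j.2.2.2.1 0) * i1
  -- In the direction `v` the coefficients of that relation are constant while `y` moves by `k (η²,
  -- -f11 η, f11²)`. The common factor `k` times the area cancels.
  have hK : ∀ j ∈ D', η * onJet C.g11 j * j.2.2.2.1 1 =
      (η ^ 2 + onJet ω.f11 j ^ 2) * onJet ω.f31 j := by
    intro j hj
    have hl := h'.affine_deriv (v := v) hj
      (α := -onJet C.g11 j * j.2.2.2.1 1 * onJet ω.f12 j +
        onJet ω.f11 j * (onJet ω.f31 j * onJet ω.f22 j - onJet ω.f32 j * η) +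
        η * (onJet ω.f31 j * onJet ω.f12 j - onJet ω.f32 j * onJet ω.f11 j))
      (β := -onJet C.g11 j * j.2.2.2.1 1 * onJet ω.f22 j -
        2 * onJet ω.f11 j * (onJet ω.f31 j * onJet ω.f12 j - onJet ω.f32 j * onJet ω.f11 j) +
        2 * η * (onJet ω.f31 j * onJet ω.f22 j - onJet ω.f32 j * η))
      (γ := -onJet ω.f11 j * (onJet ω.f31 j * onJet ω.f22 j - onJet ω.f32 j * η) -
        η * (onJet ω.f31 j * onJet ω.f12 j - onJet ω.f32 j * onJet ω.f11 j))
      (δ := onJet C.g11 j * j.2.2.2.1 1 * μ * onJet ω.f22 j -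
        2 * μ * η * onJet C.g11 j * onJet F j) (fun s hs => by
          have e3 : (j + s • v).2.2.1 = j.2.2.1 := by simp [hvdef, eW]
          have e4 : (j + s • v).2.2.2.1 = j.2.2.2.1 := by simp [hvdef, eW]
          have := hrel _ hs
          simp only [onJet, e3, e4] at this ⊢
          linear_combination this)
    obtain ⟨-, -, k, hk, k1, k2, k3⟩ := hiso j hj
    rw [k1, k2, k3] at hl
    have := h'.area_ne C hj
    apply mul_left_cancel₀ (mul_ne_zero hk this)
    linear_combination hl
  -- The left side of `hK` is linear in `u_xx`, on which the right side does not depend.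
  have hg : ∀ j ∈ D', onJet C.g11 j = 0 := by
    intro j hj
    obtain ⟨s, hs, hjs⟩ := h'.exists_translate hj (eZ 1)
    have e3 : (j + s • eZ 1).2.2.1 = j.2.2.1 := by simp [eZ]
    have e4 : (j + s • eZ 1).2.2.2.1 0 = j.2.2.2.1 0 := by simp [eZ]
    have e5 : (j + s • eZ 1).2.2.2.1 1 = j.2.2.2.1 1 + s := by simp [eZ]
    have a1 := hK j hj
    have a2 := hK _ hjs
    simp only [onJet, e3, e4, e5] at a1 a2 ⊢
    apply mul_left_cancel₀ (mul_ne_zero hη hs)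
    linear_combination a2 - a1
  have hf31 : ∀ j ∈ D', onJet ω.f31 j = 0 := by
    intro j hj
    have a1 := hK j hj
    rw [hg j hj] at a1
    have : 0 < η ^ 2 + onJet ω.f11 j ^ 2 := by positivity
    apply mul_left_cancel₀ this.ne'
    linear_combination -a1
  -- Since `f31` vanishes on an open set, so does its derivative `g31`; together with `g11 = 0` this
  -- contradicts `g_ne`.
  have hg31 := deriv_eq_zero_of_onJet_eq_zero hD'o hj₀ (C.deriv31 _ (h'.regular hj₀).1) hf31
  have hg31' : onJet C.g31 j₀ = 0 := by simpa using DFunLike.congr_fun hg31 (0, 1)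
  exact (C.g_ne _ _ (h'.regular hj₀).1).elim (fun hh => hh (hg j₀ hj₀)) fun hh => hh hg31'

end Elimination

/-! ### Elimination of the derivatives of order at least two along x -/

section SpaceDirections

open Filter Topology

variable {η : ℝ} {F : ℝ → ℝ → ℝ} {U : Set (ℝ × ℝ)} {ω : Forms} {n : ℕ}

section

variable {D : Set (Jet (n + 1))} {y : Jet (n + 1) → ℝ × ℝ × ℝ} {μ : ℝ}

/-- The Codazzi equations when `(f₁₂, f₂₂)` is isotropic, with the derivatives of `y` along `x`
eliminated. -/
theorem JetCodazzi.codazzi_of_isotropic_column (C : FormCalculus η F U ω)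
    (h : JetCodazzi η F U ω n D y)
    (hiso : ∀ j ∈ D, (y j).1 * onJet ω.f12 j + (y j).2.1 * onJet ω.f22 j = -μ * onJet ω.f22 j ∧
      (y j).2.1 * onJet ω.f12 j + (y j).2.2 * onJet ω.f22 j = μ * onJet ω.f12 j)
    {j X T : Jet (n + 1)} (hj : j ∈ D) (hXT : TotalDerivs F U (n + 1) j X T) :
    (fderiv ℝ y j T).1 * onJet ω.f11 j + (y j).1 * (onJet C.g11 j * onJet F j) +
      (fderiv ℝ y j T).2.1 * η =
        onJet ω.f32 j * ((y j).2.1 * onJet ω.f11 j + (y j).2.2 * η - μ * onJet ω.f11 j) ∧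
    (fderiv ℝ y j T).2.1 * onJet ω.f11 j + (y j).2.1 * (onJet C.g11 j * onJet F j) +
      (fderiv ℝ y j T).2.2 * η - μ * (onJet C.g11 j * onJet F j) =
        -(onJet ω.f32 j * ((y j).1 * onJet ω.f11 j + (y j).2.1 * η + μ * η)) := by
  obtain ⟨-, -, xu, -, -, -, -, -, -⟩ := hXT.components
  have gc := h.eqs j hj X T hXT
  obtain ⟨x1, x2⟩ := h.isotropic_deriv hj (C.hasFDerivAt_onJet12 (h.regular hj).1)
    (C.hasFDerivAt_onJet22 (h.regular hj).1) hiso X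
  simp [baseProj_apply, xu] at x1 x2
  have c1 := gc.codazzi₁
  have c2 := gc.codazzi₂
  have s1 := C.struct₁ _ _ (h.regular hj).1
  have s2 := C.struct₂ _ _ (h.regular hj).1
  obtain ⟨i1, i2⟩ := hiso j hj
  simp only [onJet] at *
  constructor
  · linear_combination -c1 + x1 - (y j).1 * s1 - (y j).2.1 * s2 - μ * s2 -
      ω.f31 j.2.2.1 (j.2.2.2.1 0) * i2
  · linear_combination -c2 + x2 - (y j).2.1 * s1 - (y j).2.2 * s2 + μ * s1 +
      ω.f31 j.2.2.1 (j.2.2.2.1 0) * i1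

/-- The first-order consequence of the Codazzi equations when `(f₁₂, f₂₂)` is isotropic. -/
theorem JetCodazzi.eliminate_of_isotropic_column (C : FormCalculus η F U ω)
    (h : JetCodazzi η F U ω n D y)
    (hiso : ∀ j ∈ D, (y j).1 * onJet ω.f12 j + (y j).2.1 * onJet ω.f22 j = -μ * onJet ω.f22 j ∧
      (y j).2.1 * onJet ω.f12 j + (y j).2.2 * onJet ω.f22 j = μ * onJet ω.f12 j)
    {j : Jet (n + 1)} (hj : j ∈ D) :
    j.2.2.2.2 0 * (onJet C.p12 j * ((y j).1 * onJet ω.f11 j + (y j).2.1 * η - μ * η) +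
      onJet C.p22 j * ((y j).2.1 * onJet ω.f11 j + (y j).2.2 * η + μ * onJet ω.f11 j)) +
    onJet ω.f32 j *
      (onJet ω.f12 j * ((y j).2.1 * onJet ω.f11 j + (y j).2.2 * η - μ * onJet ω.f11 j) -
        onJet ω.f22 j * ((y j).1 * onJet ω.f11 j + (y j).2.1 * η + μ * η)) +
    2 * μ * onJet ω.f22 j * onJet C.g11 j * onJet F j = 0 := by
  obtain ⟨X, T, hXT⟩ := exists_totalDerivs C j (h.regular hj).1
  obtain ⟨-, -, -, -, -, tu, -, -, -⟩ := hXT.components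
  obtain ⟨l1, l2⟩ := h.codazzi_of_isotropic_column C hiso hj hXT
  obtain ⟨t1, t2⟩ := h.isotropic_deriv hj (C.hasFDerivAt_onJet12 (h.regular hj).1)
    (C.hasFDerivAt_onJet22 (h.regular hj).1) hiso T
  simp [baseProj_apply, tu] at t1 t2
  obtain ⟨i1, i2⟩ := hiso j hj
  simp only [onJet] at *
  linear_combination -ω.f12 j.2.2.1 (j.2.2.2.1 0) * l1 - ω.f22 j.2.2.1 (j.2.2.2.1 0) * l2 +
    ω.f11 j.2.2.1 (j.2.2.2.1 0) * t1 + η * t2 + C.g11 j.2.2.1 (j.2.2.2.1 0) *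
      F j.2.2.1 (j.2.2.2.1 0) * i1

end

variable {D : Set (Jet (n + 2))} {y : Jet (n + 2) → ℝ × ℝ × ℝ}

theorem FormCalculus.continuousOn_column (C : FormCalculus η F U ω) {D : Set (Jet (n + 1))}
    (hD : D ⊆ regularJets U ω n) :
    ContinuousOn (onJet ω.f12) D ∧ ContinuousOn (onJet ω.f22) D :=
  ⟨fun _ hj => (C.hasFDerivAt_onJet12 (hD hj).1).continuousAt.continuousWithinAt,
    fun _ hj => (C.hasFDerivAt_onJet22 (hD hj).1).continuousAt.continuousWithinAt⟩

/-- `y` does not depend on `∂_x^{k+1} u`, `k ≥ 1`, if it does not depend on the `∂_t^{i+1} u` and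
on the higher `∂_x^{i+1} u`. -/
theorem JetCodazzi.killed_eZ (C : FormCalculus η F U ω) (h : JetCodazzi η F U ω (n + 1) D y)
    (hW : ∀ i : Fin (n + 2), Killed D y (eW i)) {k : ℕ} (hk : k + 1 < n + 2) (hk1 : 1 ≤ k)
    (hZ : ∀ i : Fin (n + 2), k < i → Killed D y (eZ i)) : Killed D y (eZ ⟨k, by omega⟩) := by
  by_contra hv
  obtain ⟨D', hD', hD'o, ⟨j₀, hj₀⟩, μ, hμ, hiso⟩ := h.exists_isotropic C (p := onJet ω.f12)
    (q := onJet ω.f22) (C.continuousOn_column h.regular).1 (C.continuousOn_column h.regular).2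
    (fun _ hj => h.column_pos C hj) (fun _ hj => h.deriv_eZ C hW hk hZ hj) hv
  have h' := h.mono hD'o hD'
  set v : Jet (n + 2) := eZ ⟨k, by omega⟩ with hvdef
  have hrel := fun j (hj : j ∈ D') => h'.eliminate_of_isotropic_column C
    (fun j hj => ⟨(hiso j hj).1, (hiso j hj).2.1⟩) hj
  -- The eliminated relation is affine in `y`. Since `k ≥ 1`, the direction `v` leaves `u` and `u_x`
  -- fixed, so differentiating along it touches only `y`, which moves by a multiple of the square of
  -- `(f22, -f12)`.
  have hK : ∀ j ∈ D', j.2.2.2.2 0 * (onJet ω.f22 j * onJet C.p12 j - onJet ω.f12 j * onJet C.p22 j)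
      = onJet ω.f32 j * (onJet ω.f12 j ^ 2 + onJet ω.f22 j ^ 2) := by
    intro j hj
    have hl := h'.affine_deriv (v := v) hj
      (α := j.2.2.2.2 0 * onJet C.p12 j * onJet ω.f11 j -
        onJet ω.f32 j * onJet ω.f22 j * onJet ω.f11 j)
      (β := j.2.2.2.2 0 * (onJet C.p12 j * η + onJet C.p22 j * onJet ω.f11 j) +
        onJet ω.f32 j * (onJet ω.f12 j * onJet ω.f11 j - onJet ω.f22 j * η))
      (γ := j.2.2.2.2 0 * onJet C.p22 j * η + onJet ω.f32 j * onJet ω.f12 j * η)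
      (δ := j.2.2.2.2 0 * (-onJet C.p12 j * μ * η + onJet C.p22 j * μ * onJet ω.f11 j) -
        onJet ω.f32 j * (onJet ω.f12 j * μ * onJet ω.f11 j + onJet ω.f22 j * μ * η) +
        2 * μ * onJet ω.f22 j * onJet C.g11 j * onJet F j) (fun s hs => by
          have e3 : (j + s • v).2.2.1 = j.2.2.1 := by simp [hvdef, eZ]
          have e4 : (j + s • v).2.2.2.1 0 = j.2.2.2.1 0 := by
            have : (0 : Fin (n + 2)) ≠ ⟨k, by omega⟩ := by
              intro hh
              have := congrArg Fin.val hh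
              simp at this
              omega
            simp [hvdef, eZ, this]
          have e5 : (j + s • v).2.2.2.2 0 = j.2.2.2.2 0 := by simp [hvdef, eZ]
          have := hrel _ hs
          simp only [onJet, e3, e4, e5] at this ⊢
          linear_combination this)
    obtain ⟨-, -, k, hk, k1, k2, k3⟩ := hiso j hj
    rw [k1, k2, k3] at hl
    have := h'.area_ne C hj
    apply mul_left_cancel₀ (mul_ne_zero hk this)
    linear_combination hl
  -- The variable `u_t` is free and occurs only in front of the Wronskian of `f12` and `f22`.
  have hWr : ∀ j ∈ D', onJet ω.f22 j * onJet C.p12 j - onJet ω.f12 j * onJet C.p22 j = 0 := by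
    intro j hj
    obtain ⟨s, hs, hjs⟩ := h'.exists_translate hj (eW 0)
    have e3 : (j + s • eW 0).2.2.1 = j.2.2.1 := by simp [eW]
    have e4 : (j + s • eW 0).2.2.2.1 = j.2.2.2.1 := by simp [eW]
    have e5 : (j + s • eW 0).2.2.2.2 0 = j.2.2.2.2 0 + s := by simp [eW]
    have a1 := hK j hj
    have a2 := hK _ hjs
    simp only [onJet, e3, e4, e5] at a1 a2 ⊢
    apply mul_left_cancel₀ hs
    linear_combination a2 - a1
  have hf32 : ∀ j ∈ D', onJet ω.f32 j = 0 := by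
    intro j hj
    have a1 := hK j hj
    rw [hWr j hj] at a1
    apply mul_right_cancel₀ (h'.column_pos C hj).ne'
    linear_combination -a1
  -- With vanishing Wronskian, `(p12, p22)` is proportional to `(f12, f22)`, and isotropy makes the
  -- whole `u_t`-term zero (`hS`). What is left of the relation is `f22 g11 F = 0`, and then the
  -- first two structure equations give `f31 (f12² + f22²) = 0`.
  have hf31 : ∀ j ∈ D', onJet ω.f31 j = 0 := by
    intro j hj
    obtain ⟨i1, i2, -⟩ := hiso j hj
    have a1 := hrel j hj
    have a2 := hf32 j hj
    have a3 := hWr j hj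
    have hN := h'.column_pos C hj
    have s1 := C.struct₁ _ _ (h'.regular hj).1
    have s2 := C.struct₂ _ _ (h'.regular hj).1
    have hS : onJet C.p12 j * ((y j).1 * onJet ω.f11 j + (y j).2.1 * η - μ * η) +
      onJet C.p22 j * ((y j).2.1 * onJet ω.f11 j + (y j).2.2 * η + μ * onJet ω.f11 j) = 0 := by
      apply mul_left_cancel₀ hN.ne'
      simp only [onJet] at *
      linear_combination ((y j).1 * ω.f11 j.2.2.1 (j.2.2.2.1 0) + (y j).2.1 * η - μ * η) *
          ω.f22 j.2.2.1 (j.2.2.2.1 0) * a3 -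
        ((y j).2.1 * ω.f11 j.2.2.1 (j.2.2.2.1 0) + (y j).2.2 * η +
          μ * ω.f11 j.2.2.1 (j.2.2.2.1 0)) * ω.f12 j.2.2.1 (j.2.2.2.1 0) * a3 +
        (ω.f12 j.2.2.1 (j.2.2.2.1 0) * C.p12 j.2.2.1 (j.2.2.2.1 0) +
          ω.f22 j.2.2.1 (j.2.2.2.1 0) * C.p22 j.2.2.1 (j.2.2.2.1 0)) *
          (ω.f11 j.2.2.1 (j.2.2.2.1 0) * i1 + η * i2)
    rw [hS, a2] at a1
    have hμ0 : μ ≠ 0 := by rintro rfl; norm_num at hμ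
    have a4 : onJet ω.f22 j * (onJet C.g11 j * onJet F j) = 0 := by
      apply mul_left_cancel₀ (mul_ne_zero two_ne_zero hμ0)
      linear_combination a1
    apply mul_left_cancel₀ hN.ne'
    simp only [onJet] at *
    rw [a2] at s1 s2
    linear_combination -ω.f22 j.2.2.1 (j.2.2.2.1 0) * s1 + ω.f12 j.2.2.1 (j.2.2.2.1 0) * s2 +
      j.2.2.2.1 0 * a3 - a4
  have hg31 := deriv_eq_zero_of_onJet_eq_zero hD'o hj₀ (C.deriv31 _ (h'.regular hj₀).1) hf31
  have hp32 := deriv_eq_zero_of_onJet_eq_zero hD'o hj₀ (C.deriv32 _ (h'.regular hj₀).1) hf32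
  have hg31' : onJet C.g31 j₀ = 0 := by simpa using DFunLike.congr_fun hg31 (0, 1)
  have hp32' : onJet C.p32 j₀ = 0 := by simpa using DFunLike.congr_fun hp32 (1, 0)
  -- Both terms on the left of the third structure equation vanish, so the area would vanish.
  have s3 := C.struct₃ _ _ (h'.regular hj₀).1
  apply h'.area_ne C hj₀
  simp only [onJet] at *
  rw [hg31', hp32'] at s3
  linear_combination -s3

/-- Only the derivatives of order at most one along `x` can enter. -/
theorem JetCodazzi.killed_of_prolonged (hη : η ≠ 0) (C : FormCalculus η F U ω)
    (h : JetCodazzi η F U ω (n + 1) D y) (hZl : Killed D y (eZ (Fin.last (n + 1))))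
    (hWl : Killed D y (eW (Fin.last (n + 1)))) :
    (∀ i : Fin (n + 2), Killed D y (eW i)) ∧
      ∀ i : Fin (n + 2), 1 ≤ (i : ℕ) → Killed D y (eZ i) := by
  -- Descending induction: `m` bounds the distance of the index from the top index `n + 1`, which is
  -- covered by hypothesis.
  have hW : ∀ m : ℕ, ∀ i : Fin (n + 2), n + 1 ≤ i + m → Killed D y (eW i) := by
    intro m
    induction m with
    | zero =>
      intro i hi
      rwa [show i = Fin.last (n + 1) from Fin.ext (by simp; omega)]
    | succ m ih =>
      intro i hi
      rcases Nat.lt_or_ge (i + 1) (n + 2) with hi' | hi'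
      · exact h.killed_eW hη C hZl hi' fun i' hi'' => ih i' (by omega)
      · rwa [show i = Fin.last (n + 1) from Fin.ext (by simp; omega)]
  have hW' : ∀ i : Fin (n + 2), Killed D y (eW i) := fun i => hW (n + 1) i (by omega)
  refine ⟨hW', ?_⟩
  have hZ : ∀ m : ℕ, ∀ i : Fin (n + 2), n + 1 ≤ i + m → 1 ≤ (i : ℕ) → Killed D y (eZ i) := by
    intro m
    induction m with
    | zero =>
      intro i hi _
      rwa [show i = Fin.last (n + 1) from Fin.ext (by simp; omega)]
    | succ m ih =>
      intro i hi hi1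
      rcases Nat.lt_or_ge (i + 1) (n + 2) with hi' | hi'
      · exact h.killed_eZ C hW' hi' hi1 fun i' hi'' => ih i' (by omega) (by omega)
      · rwa [show i = Fin.last (n + 1) from Fin.ext (by simp; omega)]
  exact fun i => hZ (n + 1) i (by omega)

end SpaceDirections

/-! ### Two isotropic directions at once -/

section FirstOrder

open Filter Topology

variable {η : ℝ} {F : ℝ → ℝ → ℝ} {U : Set (ℝ × ℝ)} {ω : Forms} {n : ℕ}

/-- `P` holds at points of every nonempty open set of regular `(u, u_x)`. -/
def Generic (U : Set (ℝ × ℝ)) (ω : Forms) (P : ℝ → ℝ → Prop) : Prop :=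
  ∀ O : Set (ℝ × ℝ), IsOpen O → O.Nonempty → (∀ q ∈ O, q ∈ U ∧ ω.area q.1 q.2 ≠ 0) →
    ∃ q ∈ O, P q.1 q.2

/-- The projection of jets to `(u, u_x)` is open, so generic points of the plane are met by every
open set of jets. -/
theorem Generic.exists_jet {P : ℝ → ℝ → Prop} (hP : Generic U ω P) {D : Set (Jet (n + 1))}
    (hD : IsOpen D) (hne : D.Nonempty) (hr : D ⊆ regularJets U ω n) :
    ∃ j ∈ D, P j.2.2.1 (j.2.2.2.1 0) := by
  have hsurj : Function.Surjective (baseProj n) := fun q => ⟨(0, 0, q.1, fun _ => q.2, 0), rfl⟩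
  obtain ⟨_, ⟨j, hj, rfl⟩, hq⟩ := hP (baseProj n '' D) ((baseProj n).isOpenMap hsurj D hD)
    (hne.image _) (by rintro _ ⟨j, hj, rfl⟩; exact hr hj)
  exact ⟨j, hj, hq⟩

theorem FormCalculus.continuousOn_onJet32 (C : FormCalculus η F U ω) {D : Set (Jet (n + 1))}
    (hD : D ⊆ regularJets U ω n) : ContinuousOn (onJet ω.f32) D :=
  fun _ hj => (hasFDerivAt_onJet (C.deriv32 _ (hD hj).1)).continuousAt.continuousWithinAt

theorem continuousOn_deriv_coef {f g : ℝ → ℝ → ℝ} {L : ℝ × ℝ →L[ℝ] ℝ} (e : ℝ × ℝ) (he : L e = 1)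
    (hU : IsOpen U) (hf : ContDiffOn ℝ (⊤ : ℕ∞) (fun q : ℝ × ℝ => f q.1 q.2) U)
    (hd : ∀ q ∈ U, HasFDerivAt (fun q : ℝ × ℝ => f q.1 q.2) (g q.1 q.2 • L) q) :
    ContinuousOn (fun q : ℝ × ℝ => g q.1 q.2) U := by
  refine ((hf.continuousOn_fderiv_of_isOpen hU (by simp)).clm_apply
    (continuousOn_const (c := e))).congr fun q hq => ?_
  simp only [(hd q hq).fderiv, smul_apply, he, smul_eq_mul, mul_one]

theorem continuousOn_onJet {g : ℝ → ℝ → ℝ} (hg : ContinuousOn (fun q : ℝ × ℝ => g q.1 q.2) U)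
    {D : Set (Jet (n + 1))} (hD : D ⊆ regularJets U ω n) : ContinuousOn (onJet g) D :=
  hg.comp (baseProj n).continuous.continuousOn fun _ hj => (hD hj).1

variable {D : Set (Jet (n + 1))} {y : Jet (n + 1) → ℝ × ℝ × ℝ} {μ : ℝ}

/-- The second fundamental form cannot be governed by both `dx` and `dt` being isotropic. -/
theorem JetCodazzi.not_isotropic_both (hη : η ≠ 0) (C : FormCalculus η F U ω)
    (h : JetCodazzi η F U ω n D y) (hne : D.Nonempty) (hμ : μ ^ 2 = 1)
    (hgen : Generic U ω fun z₀ z₁ => F z₀ z₁ ≠ 0 ∨ ω.f32 z₀ z₁ ≠ 0 ∨ C.g11 z₀ z₁ = 0)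
    (hiso : ∀ j ∈ D, (y j).1 * onJet ω.f12 j + (y j).2.1 * onJet ω.f22 j = -μ * onJet ω.f22 j ∧
      (y j).2.1 * onJet ω.f12 j + (y j).2.2 * onJet ω.f22 j = μ * onJet ω.f12 j)
    (hiso' : ∀ j ∈ D, (y j).1 * onJet ω.f11 j + (y j).2.1 * η = -(-μ) * η ∧
      (y j).2.1 * onJet ω.f11 j + (y j).2.2 * η = (-μ) * onJet ω.f11 j)
    (hk : ∀ j ∈ D, ∃ k, k ≠ 0 ∧ (fderiv ℝ y j (eZ 0)).1 = k * onJet ω.f22 j ^ 2 ∧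
      (fderiv ℝ y j (eZ 0)).2.1 = -k * onJet ω.f12 j * onJet ω.f22 j ∧
      (fderiv ℝ y j (eZ 0)).2.2 = k * onJet ω.f12 j ^ 2) : False := by
  have hμ0 : μ ≠ 0 := by rintro rfl; norm_num at hμ
  -- The `T`-derivative of `y (f11, η)` is computed twice: from the Codazzi equations with `(f12,
  -- f22)` isotropic, and from the isotropy of `(f11, η)`. The signs `μ` and `-μ` make the two
  -- results differ.
  have hd : ∀ j ∈ D, onJet ω.f11 j * onJet ω.f32 j = 0 ∧
      onJet C.g11 j * onJet F j = onJet ω.f32 j * η := by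
    intro j hj
    obtain ⟨X, T, hXT⟩ := exists_totalDerivs C j (h.regular hj).1
    obtain ⟨-, -, -, -, -, -, -, -, tz⟩ := hXT.components
    obtain ⟨l1, l2⟩ := h.codazzi_of_isotropic_column C hiso hj hXT
    obtain ⟨t1, t2⟩ := h.isotropic_deriv hj (C.hasFDerivAt_onJet11 (h.regular hj).1)
      (hasFDerivAt_const η j) hiso' T
    simp [baseProj_apply, tz] at t1 t2
    obtain ⟨i1, i2⟩ := hiso' j hj
    simp only [onJet] at *
    constructor
    · apply mul_left_cancel₀ (mul_ne_zero two_ne_zero hμ0)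
      linear_combination l1 - t1 + ω.f32 j.2.2.1 (j.2.2.2.1 0) * i2
    · apply mul_left_cancel₀ (mul_ne_zero two_ne_zero hμ0)
      linear_combination t2 - l2 + ω.f32 j.2.2.1 (j.2.2.2.1 0) * i1
  obtain ⟨j, hj, hF⟩ := hgen.exists_jet h.isOpen hne h.regular
  -- Near a point with `f32 ≠ 0` the first relation forces `f11 = 0`, hence `g11 = 0`, and the
  -- second relation then fails.
  have h32 : ω.f32 j.2.2.1 (j.2.2.2.1 0) = 0 := by
    by_contra h0
    have hO : IsOpen (D ∩ onJet ω.f32 ⁻¹' {0}ᶜ) :=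
      (C.continuousOn_onJet32 h.regular).isOpen_inter_preimage h.isOpen isOpen_compl_singleton
    have h11 : ∀ z ∈ D ∩ onJet ω.f32 ⁻¹' {0}ᶜ, onJet ω.f11 z = 0 := fun z hz =>
      (mul_eq_zero.1 (hd z hz.1).1).resolve_right hz.2
    have hg := deriv_eq_zero_of_onJet_eq_zero hO ⟨hj, h0⟩ (C.deriv11 _ (h.regular hj).1) h11
    have hg' : onJet C.g11 j = 0 := by simpa using DFunLike.congr_fun hg (0, 1)
    have := (hd j hj).2
    rw [hg', zero_mul] at this
    exact mul_ne_zero h0 hη this.symm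
  have hgF := (hd j hj).2
  simp only [onJet] at hgF
  rw [h32, zero_mul] at hgF
  have hg : C.g11 j.2.2.1 (j.2.2.2.1 0) = 0 := by
    rcases hF with h0 | h0 | h0
    · exact (mul_eq_zero.1 hgF).resolve_right h0
    · exact absurd h32 h0
    · exact h0
  -- Once `g11 = 0`, the `u_x`-derivative of `y` annihilates `(f11, η)` as well as `(f12, f22)`.
  -- These vectors are independent because the area is nonzero, but that derivative is not zero.
  obtain ⟨d1, d2⟩ := h.isotropic_deriv hj (C.hasFDerivAt_onJet11 (h.regular hj).1)
    (hasFDerivAt_const η j) hiso' (eZ 0)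
  obtain ⟨k, hk, k1, k2, k3⟩ := hk j hj
  simp [onJet, hg, k1, k2, k3] at d1 d2
  have ha := h.area_ne C hj
  simp only [onJet] at ha
  have e1 : ω.f22 j.2.2.1 (j.2.2.2.1 0) = 0 := by
    apply mul_left_cancel₀ (mul_ne_zero hk ha)
    linear_combination d1
  have e2 : ω.f12 j.2.2.1 (j.2.2.2.1 0) = 0 := by
    apply mul_left_cancel₀ (mul_ne_zero hk ha)
    linear_combination -d2
  exact ha (by rw [e1, e2]; ring)

end FirstOrder

/-! ### Independence of u_x -/

section UxDirection

open Filter Topology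

variable {η : ℝ} {F : ℝ → ℝ → ℝ} {U : Set (ℝ × ℝ)} {ω : Forms} {n : ℕ}

/-- A condition on the forms at a point which excludes that the second fundamental form depends
on `u_x`. -/
def Obstruction (C : FormCalculus η F U ω) (z₀ z₁ : ℝ) : Prop :=
  ω.f22 z₀ z₁ * C.p12 z₀ z₁ - ω.f12 z₀ z₁ * C.p22 z₀ z₁ ≠ 0 ∨
  ((∀ q ∈ U, ω.f22 q.1 q.2 = 0) ∧ ω.f32 z₀ z₁ ≠ 0) ∨
  ((∀ s s' z, C.g11 s z = C.g11 s' z) ∧ (∀ s s' z, ω.f11 s z = ω.f11 s' z) ∧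
    ∃ m k, HasDerivAt (fun z => C.g11 z₀ z * F z₀ z) m z₁ ∧ HasDerivAt (fun s => F s z₁) k z₀ ∧
      ω.f22 z₀ z₁ * m * k + ω.f32 z₀ z₁ * C.p32 z₀ z₁ *
        (ω.f11 z₀ z₁ * ω.f22 z₀ z₁ - ω.f12 z₀ z₁ * η) ≠ 0)

variable {D : Set (Jet (n + 2))} {y : Jet (n + 2) → ℝ × ℝ × ℝ}

/-- Dependence on `u_x` makes `(f12, f22)` isotropic with sign `μ`, and the eliminated relation
splits into its `u_t`-part and the rest. Then `y` cannot depend on `u`: otherwise `(f11, η)` would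
be isotropic with sign `-μ`, which `not_isotropic_both` excludes. Here, unlike for higher
derivatives, the direction also moves the forms, so `y` cannot simply be differentiated out; the
three alternatives of `Obstruction` are the ways to finish. -/
theorem JetCodazzi.killed_eZ_zero (hη : η ≠ 0) (C : FormCalculus η F U ω)
    (h : JetCodazzi η F U ω (n + 1) D y)
    (hW : ∀ i : Fin (n + 2), Killed D y (eW i))
    (hZ : ∀ i : Fin (n + 2), 1 ≤ (i : ℕ) → Killed D y (eZ i))
    (hgen : Generic U ω fun z₀ z₁ => F z₀ z₁ ≠ 0 ∨ ω.f32 z₀ z₁ ≠ 0 ∨ C.g11 z₀ z₁ = 0)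
    (hobs : Generic U ω (Obstruction C)) : Killed D y (eZ 0) := by
  by_contra hv
  obtain ⟨D', hD', hD'o, hne, μ, hμ, hiso⟩ := h.exists_isotropic C (p := onJet ω.f12)
    (q := onJet ω.f22) (C.continuousOn_column h.regular).1 (C.continuousOn_column h.regular).2
    (fun _ hj => h.column_pos C hj)
    (fun _ hj => h.deriv_eZ C hW (k := 0) (by omega) (fun i hi => hZ i hi) hj) hv
  have h' := h.mono hD'o hD'
  have hμ0 : μ ≠ 0 := by rintro rfl; norm_num at hμ
  have hiso1 := fun j (hj : j ∈ D') => And.intro (hiso j hj).1 (hiso j hj).2.1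
  have hiso2 := fun j (hj : j ∈ D') => (hiso j hj).2.2
  have hZl := hZ (Fin.last (n + 1)) (by simp)
  have hW0 := (hW 0).mono hD'
  -- the terms with `u_t` and without
  have hS : ∀ j ∈ D', onJet C.p12 j * ((y j).1 * onJet ω.f11 j + (y j).2.1 * η - μ * η) +
      onJet C.p22 j * ((y j).2.1 * onJet ω.f11 j + (y j).2.2 * η + μ * onJet ω.f11 j) = 0 := by
    intro j hj
    obtain ⟨s, hs, hjs, hys, -⟩ := eventually_exists_ne (hW0.translate hD'o h'.differentiableOn hj)
    have e3 : (j + s • eW 0).2.2.1 = j.2.2.1 := by simp [eW]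
    have e4 : (j + s • eW 0).2.2.2.1 = j.2.2.2.1 := by simp [eW]
    have e5 : (j + s • eW 0).2.2.2.2 0 = j.2.2.2.2 0 + s := by simp [eW]
    have a1 := h'.eliminate_of_isotropic_column C hiso1 hj
    have a2 := h'.eliminate_of_isotropic_column C hiso1 hjs
    simp only [onJet, e3, e4, e5, hys] at a1 a2 ⊢
    apply mul_left_cancel₀ hs
    linear_combination a2 - a1
  have hstar : ∀ j ∈ D', onJet ω.f32 j *
      (onJet ω.f12 j * ((y j).2.1 * onJet ω.f11 j + (y j).2.2 * η - μ * onJet ω.f11 j) -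
        onJet ω.f22 j * ((y j).1 * onJet ω.f11 j + (y j).2.1 * η + μ * η)) +
      2 * μ * onJet ω.f22 j * (onJet C.g11 j * onJet F j) = 0 := by
    intro j hj
    have a1 := h'.eliminate_of_isotropic_column C hiso1 hj
    rw [hS j hj] at a1
    linear_combination a1
  have harea : ∀ j ∈ D',
      onJet ω.f12 j * ((y j).1 * onJet ω.f11 j + (y j).2.1 * η + μ * η) + onJet ω.f22 j *
        ((y j).2.1 * onJet ω.f11 j + (y j).2.2 * η - μ * onJet ω.f11 j) =
      -(2 * μ * (onJet ω.f11 j * onJet ω.f22 j - onJet ω.f12 j * η)) := by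
    intro j hj
    obtain ⟨i1, i2⟩ := hiso1 j hj
    linear_combination onJet ω.f11 j * i1 + η * i2
  obtain ⟨j, hj, hobs⟩ := hobs.exists_jet hD'o hne h'.regular
  -- `y` does not depend on `u`
  have hU : Killed D' y (eU (n + 2)) := by
    by_contra hv
    obtain ⟨D'', hD'', hD''o, ⟨j, hj⟩, μ', hμ', hiso'⟩ := h'.exists_isotropic C
      (p := onJet ω.f11) (q := fun _ => η)
      (fun j hj => (C.hasFDerivAt_onJet11 (h'.regular hj).1).continuousAt.continuousWithinAt)
      continuousOn_const (fun j hj => by positivity)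
      (fun j hj => h'.deriv_eU C (hZl.mono hD') (fun i => (hW i).mono hD') hj) hv
    -- The value of the bilinear form on the pair `(f11, η)`, `(f12, f22)`, computed from either
    -- isotropy relation, is `-μ` or `μ'` times the area.
    have hμμ : μ' = -μ := by
      have ha := h'.area_ne C (hD'' hj)
      obtain ⟨i1, i2⟩ := hiso1 j (hD'' hj)
      obtain ⟨i3, i4, -⟩ := hiso' j hj
      apply mul_left_cancel₀ ha
      linear_combination onJet ω.f11 j * i1 + η * i2 - onJet ω.f12 j * i3 - onJet ω.f22 j * i4
    rw [hμμ] at hiso'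
    exact (h'.mono hD''o hD'').not_isotropic_both hη C ⟨j, hj⟩ hμ hgen
      (fun j hj => hiso1 j (hD'' hj)) (fun j hj => ⟨(hiso' j hj).1, (hiso' j hj).2.1⟩)
      (fun j hj => hiso2 j (hD'' hj))
  rcases hobs with ho | ⟨ho, ho'⟩ | ⟨hg, hf, m, k, hm, hk, ho⟩
  -- First alternative: `a1` and `a2` are linear equations whose determinant is the nonzero
  -- Wronskian, and their solution is the isotropy of `(f11, η)` with sign `-μ`.
  · have hc12 := continuousOn_onJet (n := n + 1) (continuousOn_deriv_coef (1, 0) (by simp) C.isOpen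
      C.smooth12 C.deriv12) h'.regular
    have hc22 := continuousOn_onJet (n := n + 1) (continuousOn_deriv_coef (1, 0) (by simp) C.isOpen
      C.smooth22 C.deriv22) h'.regular
    have hcol := C.continuousOn_column h'.regular
    have hO := ((hcol.2.mul hc12).sub (hcol.1.mul hc22)).isOpen_inter_preimage hD'o
      (isOpen_compl_singleton (x := (0 : ℝ)))
    refine (h'.mono hO Set.inter_subset_left).not_isotropic_both hη C ⟨j, hj, ho⟩ hμ hgen
      (fun j hj => hiso1 j hj.1) (fun j hj => ?_) (fun j hj => hiso2 j hj.1)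
    have hj0 : onJet ω.f22 j * onJet C.p12 j - onJet ω.f12 j * onJet C.p22 j ≠ 0 := hj.2
    obtain ⟨i1, i2⟩ := hiso1 j hj.1
    have a1 := hS j hj.1
    have a2 : onJet ω.f12 j * ((y j).1 * onJet ω.f11 j + (y j).2.1 * η - μ * η) +
      onJet ω.f22 j * ((y j).2.1 * onJet ω.f11 j + (y j).2.2 * η + μ * onJet ω.f11 j) = 0 := by
      linear_combination onJet ω.f11 j * i1 + η * i2
    constructor
    · apply mul_left_cancel₀ hj0
      linear_combination onJet ω.f22 j * a1 - onJet C.p22 j * a2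
    · apply mul_left_cancel₀ hj0
      linear_combination onJet C.p12 j * a2 - onJet ω.f12 j * a1
  -- Second alternative: with `f22 = 0` the relations `hstar` and `harea` determine `y (f11, η)`
  -- completely. Differentiating one component along `T` and comparing with the Codazzi equations
  -- leaves `2 μ η f32 = 0`.
  · have hO : IsOpen (D' ∩ onJet ω.f32 ⁻¹' {0}ᶜ) :=
      (C.continuousOn_onJet32 h'.regular).isOpen_inter_preimage h'.isOpen isOpen_compl_singleton
    have hK : ∀ z ∈ D' ∩ onJet ω.f32 ⁻¹' {0}ᶜ,
        (y z).2.1 * onJet ω.f11 z + (y z).2.2 * η - μ * onJet ω.f11 z = 0 ∧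
        (y z).1 * onJet ω.f11 z + (y z).2.1 * η + μ * η = 2 * μ * η := by
      intro z hz
      have q0 : onJet ω.f22 z = 0 := ho _ (h'.regular hz.1).1
      have ha := h'.area_ne C hz.1
      have h12 : onJet ω.f12 z ≠ 0 := by
        intro h0; rw [h0, q0] at ha; exact ha (by ring)
      have a1 := hstar z hz.1
      have a2 := harea z hz.1
      rw [q0] at a1 a2
      constructor
      · apply mul_left_cancel₀ (mul_ne_zero (show onJet ω.f32 z ≠ 0 from hz.2) h12)
        linear_combination a1
      · apply mul_left_cancel₀ h12
        linear_combination a2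
    have hjO : j ∈ D' ∩ onJet ω.f32 ⁻¹' {0}ᶜ := ⟨hj, ho'⟩
    obtain ⟨X, T, hXT⟩ := exists_totalDerivs C j (h'.regular hj).1
    obtain ⟨-, -, -, -, -, -, -, -, tz⟩ := hXT.components
    obtain ⟨-, l2⟩ := h'.codazzi_of_isotropic_column C hiso1 hj hXT
    obtain ⟨-, hb, hc⟩ := h'.hasFDerivAt_components hj
    have hp := C.hasFDerivAt_onJet11 (h'.regular hj).1
    have d := (((hb.mul hp).add (hc.mul_const η)).sub
      (hp.const_mul μ)).apply_eq_zero_of_eqOn hO hjO (fun z hz => (hK z hz).1) T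
    simp [baseProj_apply, tz] at d
    have := (hK j hjO).2
    refine mul_ne_zero (mul_ne_zero (mul_ne_zero two_ne_zero hμ0) hη) ho' ?_
    simp only [onJet] at *
    linear_combination l2 - d - ω.f32 j.2.2.1 (j.2.2.2.1 0) * this
  -- Third alternative: `Hz` and `Kz` are the `u_x`-derivatives of `H` and `K`. As `y`, `f11` and
  -- `g11` do not depend on `u`, the Codazzi equations along the line in direction `u` involve it
  -- only through `F` and `f32`; their `u`-derivatives are `r1` and `r2`. The `u_x`-derivative of
  -- `hstar` is `r3`. Together with `r4` everything cancels except `2 μ` times the nonzero quantity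
  -- of the obstruction.
  · set Hz := (fderiv ℝ y j (eZ 0)).1 * onJet ω.f11 j + (fderiv ℝ y j (eZ 0)).2.1 * η +
      (y j).1 * onJet C.g11 j with hHz
    set Kz := (fderiv ℝ y j (eZ 0)).2.1 * onJet ω.f11 j + (fderiv ℝ y j (eZ 0)).2.2 * η +
      (y j).2.1 * onJet C.g11 j - μ * onJet C.g11 j with hKz
    set H := (y j).1 * onJet ω.f11 j + (y j).2.1 * η + μ * η with hH
    set K := (y j).2.1 * onJet ω.f11 j + (y j).2.2 * η - μ * onJet ω.f11 j with hKd
    have hT : ∀ j ∈ D', ∀ X T, TotalDerivs F U (n + 2) j X T →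
        fderiv ℝ y j T = fderiv ℝ y j (eT (n + 2)) + onJet F j • fderiv ℝ y j (eZ 0) := by
      intro j hj X T hXT
      obtain ⟨-, -, -, t1, t2, -, -, -, tz⟩ := hXT.components
      rw [map_jet _ T, t1, t2, hU j hj]
      have e1 : ∑ i, T.2.2.2.2 i • fderiv ℝ y j (eW i) = 0 :=
        Finset.sum_eq_zero fun i _ => by rw [hW i j (hD' hj), smul_zero]
      have e2 : ∑ i, T.2.2.2.1 i • fderiv ℝ y j (eZ i) = onJet F j • fderiv ℝ y j (eZ 0) := by
        rw [Finset.sum_eq_single 0, tz]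
        · intro i _ hi
          rw [hZ i (Nat.one_le_iff_ne_zero.2 fun h0 => hi (Fin.ext h0)) j (hD' hj), smul_zero]
        · simp
      rw [e1, e2]
      simp
    have hlin : ∀ᶠ s in 𝓝 (0 : ℝ),
        ((fderiv ℝ y j (eT (n + 2))).1 * onJet ω.f11 j + (fderiv ℝ y j (eT (n + 2))).2.1 * η +
          F (j.2.2.1 + s) (j.2.2.2.1 0) * Hz - ω.f32 (j.2.2.1 + s) (j.2.2.2.1 0) * K = 0) ∧
        ((fderiv ℝ y j (eT (n + 2))).2.1 * onJet ω.f11 j + (fderiv ℝ y j (eT (n + 2))).2.2 * η +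
          F (j.2.2.1 + s) (j.2.2.2.1 0) * Kz + ω.f32 (j.2.2.1 + s) (j.2.2.2.1 0) * H = 0) := by
      filter_upwards [hU.translate hD'o h'.differentiableOn hj] with s ⟨hs, hys, hfs⟩
      obtain ⟨X, T, hXT⟩ := exists_totalDerivs C _ (h'.regular hs).1
      obtain ⟨l1, l2⟩ := h'.codazzi_of_isotropic_column C hiso1 hs hXT
      rw [hT _ hs X T hXT, hfs, hys] at l1 l2
      have e3 : (j + s • eU (n + 2)).2.2.1 = j.2.2.1 + s := by simp [eU]
      have e4 : (j + s • eU (n + 2)).2.2.2.1 = j.2.2.2.1 := by simp [eU]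
      simp only [onJet, e3, e4] at l1 l2
      simp only [Prod.fst_add, Prod.snd_add, Prod.smul_fst, Prod.smul_snd, smul_eq_mul,
        hf (j.2.2.1 + s) j.2.2.1, hg (j.2.2.1 + s) j.2.2.1] at l1 l2
      simp only [hHz, hKz, hH, hKd, onJet]
      constructor
      · linear_combination l1
      · linear_combination l2
    have hF' : HasDerivAt (fun s => F (j.2.2.1 + s) (j.2.2.2.1 0)) k 0 :=
      HasDerivAt.comp_const_add j.2.2.1 0 (by simpa using hk)
    have h32' : HasDerivAt (fun s => ω.f32 (j.2.2.1 + s) (j.2.2.2.1 0)) (onJet C.p32 j) 0 := by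
      have : HasDerivAt (fun s : ℝ => j + s • eU (n + 2)) (eU (n + 2)) 0 := by
        simpa using ((hasDerivAt_id (0 : ℝ)).smul_const (eU (n + 2))).const_add j
      have := (hasFDerivAt_onJet (C.deriv32 _ (h'.regular hj).1)).comp_hasDerivAt_of_eq 0 this
        (by simp)
      simpa [eU, baseProj_apply, onJet, Function.comp_def] using this
    have r1 : k * Hz - onJet C.p32 j * K = 0 := by
      have d := ((hF'.mul_const Hz).const_add ((fderiv ℝ y j (eT (n + 2))).1 * onJet ω.f11 j +
        (fderiv ℝ y j (eT (n + 2))).2.1 * η)).sub (h32'.mul_const K)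
      exact d.unique ((hasDerivAt_const (0 : ℝ) (0 : ℝ)).congr_of_eventuallyEq
        (hlin.mono fun s hs => hs.1))
    have r2 : k * Kz + onJet C.p32 j * H = 0 := by
      have d := ((hF'.mul_const Kz).const_add ((fderiv ℝ y j (eT (n + 2))).2.1 * onJet ω.f11 j +
        (fderiv ℝ y j (eT (n + 2))).2.2 * η)).add (h32'.mul_const H)
      exact d.unique ((hasDerivAt_const (0 : ℝ) (0 : ℝ)).congr_of_eventuallyEq
        (hlin.mono fun s hs => hs.2))
    have r3 : onJet ω.f32 j * (onJet ω.f12 j * Kz - onJet ω.f22 j * Hz) +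
        2 * μ * onJet ω.f22 j * m = 0 := by
      have hl : HasDerivAt (fun s : ℝ => j + s • eZ (0 : Fin (n + 2))) (eZ 0) 0 := by
        simpa using ((hasDerivAt_id (0 : ℝ)).smul_const (eZ (0 : Fin (n + 2)))).const_add j
      have hj0 : j = j + (0 : ℝ) • eZ (0 : Fin (n + 2)) := by simp
      obtain ⟨ha, hb, hc⟩ := h'.hasFDerivAt_components hj
      have ha := ha.comp_hasDerivAt_of_eq 0 hl hj0
      have hb := hb.comp_hasDerivAt_of_eq 0 hl hj0
      have hc := hc.comp_hasDerivAt_of_eq 0 hl hj0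
      have h11 := (C.hasFDerivAt_onJet11 (h'.regular hj).1).comp_hasDerivAt_of_eq 0 hl hj0
      have h12 := (C.hasFDerivAt_onJet12 (h'.regular hj).1).comp_hasDerivAt_of_eq 0 hl hj0
      have h22 := (C.hasFDerivAt_onJet22 (h'.regular hj).1).comp_hasDerivAt_of_eq 0 hl hj0
      have h32 := (hasFDerivAt_onJet (C.deriv32 _ (h'.regular hj).1)).comp_hasDerivAt_of_eq 0 hl hj0
      have hgF : HasDerivAt (fun s : ℝ => onJet C.g11 (j + s • eZ (0 : Fin (n + 2))) *
          onJet F (j + s • eZ (0 : Fin (n + 2)))) m 0 := by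
        have : HasDerivAt (fun s => C.g11 j.2.2.1 (j.2.2.2.1 0 + s) *
          F j.2.2.1 (j.2.2.2.1 0 + s)) m 0 := HasDerivAt.comp_const_add (j.2.2.2.1 0) 0
            (f := fun z => C.g11 j.2.2.1 z * F j.2.2.1 z) (by simpa using hm)
        simpa [onJet, eZ] using this
      have d := (h32.mul ((h12.mul (((hb.mul h11).add (hc.mul_const η)).sub (h11.const_mul μ))).sub
        (h22.mul (((ha.mul h11).add (hb.mul_const η)).add_const (μ * η))))).add
        ((h22.const_mul (2 * μ)).mul hgF)
      have hev : ∀ᶠ s in 𝓝 (0 : ℝ), j + s • eZ (0 : Fin (n + 2)) ∈ D' :=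
        hl.continuousAt.eventually_mem (by simpa using hD'o.mem_nhds hj)
      have := d.unique ((hasDerivAt_const (0 : ℝ) (0 : ℝ)).congr_of_eventuallyEq
        (hev.mono fun s hs => hstar _ hs))
      have hbz : baseProj (n + 1) (eZ 0) = (0, 1) := by simp [baseProj_apply, eZ]
      simp [hbz, onJet] at this
      simp only [hHz, hKz, onJet]
      linear_combination this
    have r4 := harea j hj
    rw [← hH, ← hKd] at r4
    refine mul_ne_zero (mul_ne_zero two_ne_zero hμ0) ho ?_
    simp only [onJet] at *
    linear_combination k * r3 - ω.f32 j.2.2.1 (j.2.2.2.1 0) * (ω.f12 j.2.2.1 (j.2.2.2.1 0) * r2 -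
      ω.f22 j.2.2.1 (j.2.2.2.1 0) * r1) + ω.f32 j.2.2.1 (j.2.2.2.1 0) *
      C.p32 j.2.2.1 (j.2.2.2.1 0) * r4

end UxDirection

/-! ### Dependence on u, and descent to the original jets -/

section LowOrder

open Filter Topology

variable {η : ℝ} {F : ℝ → ℝ → ℝ} {U : Set (ℝ × ℝ)} {ω : Forms} {n : ℕ}

/-- Dependence on `u` would make `(f11, η)` isotropic. Since `y` does not depend on `u_x`, the
`u_x`-derivative of the isotropy relation reads `a g11 = 0`, so `a = 0` wherever `g11 ≠ 0`; but the
`u`-derivative of `a` is a nonzero multiple of `η²`. -/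
theorem JetCodazzi.killed_eU (hη : η ≠ 0) (C : FormCalculus η F U ω)
    {D : Set (Jet (n + 2))} {y : Jet (n + 2) → ℝ × ℝ × ℝ}
    (h : JetCodazzi η F U ω (n + 1) D y)
    (hW : ∀ i : Fin (n + 2), Killed D y (eW i)) (hZ : ∀ i : Fin (n + 2), Killed D y (eZ i))
    (hgen : Generic U ω fun z₀ z₁ => C.g11 z₀ z₁ ≠ 0) : Killed D y (eU (n + 2)) := by
  by_contra hv
  obtain ⟨D', hD', hD'o, hne, μ, hμ, hiso⟩ := h.exists_isotropic C
    (p := onJet ω.f11) (q := fun _ => η)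
    (fun j hj => (C.hasFDerivAt_onJet11 (h.regular hj).1).continuousAt.continuousWithinAt)
    continuousOn_const (fun j hj => by positivity)
    (fun j hj => h.deriv_eU C (hZ _) hW hj) hv
  have h' := h.mono hD'o hD'
  obtain ⟨j, hj, hg⟩ := hgen.exists_jet hD'o hne h'.regular
  have hc := continuousOn_onJet (n := n + 1) (continuousOn_deriv_coef (0, 1) (by simp) C.isOpen
    C.smooth11 C.deriv11) h'.regular
  have hO := hc.isOpen_inter_preimage hD'o (isOpen_compl_singleton (x := (0 : ℝ)))
  have ha : ∀ z ∈ D' ∩ onJet C.g11 ⁻¹' {0}ᶜ, (y z).1 = 0 := by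
    intro z hz
    obtain ⟨d1, -⟩ := h'.isotropic_deriv hz.1 (C.hasFDerivAt_onJet11 (h'.regular hz.1).1)
      (hasFDerivAt_const η z) (fun j hj => ⟨(hiso j hj).1, (hiso j hj).2.1⟩) (eZ 0)
    have hbz : baseProj (n + 1) (eZ 0) = (0, 1) := by simp [baseProj_apply, eZ]
    rw [hZ 0 z (hD' hz.1)] at d1
    simp [hbz] at d1
    exact d1.resolve_right hz.2
  have := (h'.hasFDerivAt_components hj).1.apply_eq_zero_of_eqOn hO ⟨hj, hg⟩ ha (eU (n + 2))
  obtain ⟨-, -, k, hk, k1, -⟩ := hiso j hj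
  simp [k1, hk, hη] at this

theorem truncate_surjective : Function.Surjective (truncate n) := by
  rintro ⟨x, t, u, z, w⟩
  exact ⟨(x, t, u, fun i => if h : i.val < n then z ⟨i, h⟩ else 0,
    fun i => if h : i.val < n then w ⟨i, h⟩ else 0), by simp [truncate_apply]⟩

theorem truncate_eZ (i : Fin n) : truncate n (eZ i.castSucc) = eZ i := by
  simp only [truncate_apply, eZ, Pi.single_apply, Fin.castSucc_inj]
  congr
  funext m
  rw [Pi.single_apply]

theorem truncate_eW (i : Fin n) : truncate n (eW i.castSucc) = eW i := by
  simp only [truncate_apply, eW, Pi.single_apply, Fin.castSucc_inj]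
  congr
  funext m
  rw [Pi.single_apply]

variable {D : Set (Jet (n + 1))} {y : Jet (n + 1) → ℝ × ℝ × ℝ}

/-- Truncation is onto, so constancy found on the prolonged jets descends. -/
theorem JetCodazzi.killed_of_prolong (h : JetCodazzi η F U ω n D y) {v : Jet (n + 2)}
    (hv : Killed (truncate (n + 1) ⁻¹' D) (fun j => y (truncate (n + 1) j)) v) :
    Killed D y (truncate (n + 1) v) := by
  intro j hj
  obtain ⟨j', rfl⟩ := truncate_surjective j
  rw [← h.fderiv_comp_truncate hj]
  exact hv j' hj

/-- The second fundamental form depends on `x, t, u` only. -/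
theorem JetCodazzi.killed_derivatives (hη : η ≠ 0) (C : FormCalculus η F U ω)
    (h : JetCodazzi η F U ω n D y)
    (hgen : Generic U ω fun z₀ z₁ => F z₀ z₁ ≠ 0 ∨ ω.f32 z₀ z₁ ≠ 0 ∨ C.g11 z₀ z₁ = 0)
    (hobs : Generic U ω (Obstruction C)) :
    (∀ i, Killed D y (eZ i)) ∧ (∀ i, Killed D y (eW i)) ∧
    (∀ j ∈ D, (fderiv ℝ y j (eU (n + 1))).1 * ω.f11 j.2.2.1 (j.2.2.2.1 0) +
      (fderiv ℝ y j (eU (n + 1))).2.1 * η = 0 ∧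
    (fderiv ℝ y j (eU (n + 1))).2.1 * ω.f11 j.2.2.1 (j.2.2.2.1 0) +
      (fderiv ℝ y j (eU (n + 1))).2.2 * η = 0) ∧
    ((Generic U ω fun z₀ z₁ => C.g11 z₀ z₁ ≠ 0) → Killed D y (eU (n + 1))) := by
  have hp := h.prolong
  obtain ⟨hW, hZ⟩ := hp.killed_of_prolonged hη C h.killed_top.1 h.killed_top.2
  have hZ0 := hp.killed_eZ_zero hη C hW hZ hgen hobs
  have hZ' : ∀ i, Killed (truncate (n + 1) ⁻¹' D) (fun j => y (truncate (n + 1) j)) (eZ i) := by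
    intro i
    rcases Nat.eq_zero_or_pos i with hi | hi
    · rwa [show i = 0 from Fin.ext hi]
    · exact hZ i hi
  have hUt : truncate (n + 1) (eU (n + 2)) = eU (n + 1) := rfl
  refine ⟨fun i => ?_, fun i => ?_, fun j hj => ?_, fun hg => ?_⟩
  · have := h.killed_of_prolong (hZ' i.castSucc)
    rwa [truncate_eZ] at this
  · have := h.killed_of_prolong (hW i.castSucc)
    rwa [truncate_eW] at this
  · obtain ⟨j', rfl⟩ := truncate_surjective j
    have := hp.deriv_eU C (hZ' _) hW hj
    rw [h.fderiv_comp_truncate hj, hUt] at this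
    exact this
  · rw [← hUt]
    exact h.killed_of_prolong (hp.killed_eU hη C hW hZ' hg)

theorem JetCodazzi.fderiv_of_killed (hZ : ∀ i, Killed D y (eZ i)) (hW : ∀ i, Killed D y (eW i))
    {j : Jet (n + 1)} (hj : j ∈ D) (v : Jet (n + 1)) :
    fderiv ℝ y j v = v.1 • fderiv ℝ y j (eX (n + 1)) + v.2.1 • fderiv ℝ y j (eT (n + 1)) +
      v.2.2.1 • fderiv ℝ y j (eU (n + 1)) := by
  rw [map_jet _ v, Finset.sum_eq_zero fun i _ => by rw [hZ i j hj, smul_zero],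
    Finset.sum_eq_zero fun i _ => by rw [hW i j hj, smul_zero], add_zero, add_zero]

/-- For a second fundamental form that depends on `x, t` only, the Codazzi equations hold with
the same derivatives for all nearby `(u, u_x)`. -/
theorem JetCodazzi.eventually_gaussCodazziAt (C : FormCalculus η F U ω)
    (h : JetCodazzi η F U ω n D y) (hZ : ∀ i, Killed D y (eZ i)) (hW : ∀ i, Killed D y (eW i))
    (hU : Killed D y (eU (n + 1))) {j : Jet (n + 1)} (hj : j ∈ D) :
    ∀ᶠ q in 𝓝 (j.2.2.1, j.2.2.2.1 0), GaussCodazziAt ω η q.1 q.2 (y j)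
      (fderiv ℝ y j (eX (n + 1))) (fderiv ℝ y j (eT (n + 1))) := by
  have hfd := fun j (hj : j ∈ D) v => JetCodazzi.fderiv_of_killed hZ hW hj v
  set L : ℝ × ℝ →L[ℝ] Jet (n + 1) := (ContinuousLinearMap.fst ℝ ℝ ℝ).smulRight (eU (n + 1)) +
    (ContinuousLinearMap.snd ℝ ℝ ℝ).smulRight (eZ 0) with hL
  have hLa : ∀ w, L w = w.1 • eU (n + 1) + w.2 • eZ 0 := fun w => by simp [hL]
  have hLk : ∀ w, Killed D y (L w) := fun w j hj => by
    rw [hLa, map_add, map_smul, map_smul, hU j hj, hZ 0 j hj]; simp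
  have ev := Killed.translate_map h.isOpen h.differentiableOn hLk hj
  have ht : Tendsto (fun q : ℝ × ℝ => q - (j.2.2.1, j.2.2.2.1 0)) (𝓝 (j.2.2.1, j.2.2.2.1 0))
      (𝓝 0) := by
    have : Continuous fun q : ℝ × ℝ => q - (j.2.2.1, j.2.2.2.1 0) := by fun_prop
    simpa using this.tendsto (j.2.2.1, j.2.2.2.1 0)
  filter_upwards [ht.eventually ev] with q ⟨hq, hy, hf⟩
  obtain ⟨X, T, hXT⟩ := exists_totalDerivs C _ (h.regular hq).1
  obtain ⟨x1, x2, -, t1, t2, -, -, -, -⟩ := hXT.components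
  have gc := h.eqs _ hq X T hXT
  rw [hfd _ hq X, hfd _ hq T, x1, x2, t1, t2, hU _ hq, hy, hf] at gc
  simpa [hLa, eU, eZ] using gc

end LowOrder

/-! ### Nonexistence through the mixed derivative of the Codazzi equations -/

section NoUniversal

open Filter Topology

variable {η : ℝ} {F : ℝ → ℝ → ℝ} {U : Set (ℝ × ℝ)} {ω : Forms} {n : ℕ}

/-- The derivatives of the Codazzi equations with respect to `u_x` and `u`. -/
theorem FormCalculus.codazzi_deriv (C : FormCalculus η F U ω) {q : ℝ × ℝ} (hq : q ∈ U)
    {y yX yT : ℝ × ℝ × ℝ} (h : ∀ᶠ q in 𝓝 q, GaussCodazziAt ω η q.1 q.2 y yX yT) :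
    ((-yT.1 * C.g11 q.1 q.2 - 2 * y.2.1 * (C.g31 q.1 q.2 * ω.f12 q.1 q.2 -
        ω.f32 q.1 q.2 * C.g11 q.1 q.2) + (y.1 - y.2.2) * (C.g31 q.1 q.2 * ω.f22 q.1 q.2) = 0) ∧
     (-yT.2.1 * C.g11 q.1 q.2 + (y.1 - y.2.2) * (C.g31 q.1 q.2 * ω.f12 q.1 q.2 -
        ω.f32 q.1 q.2 * C.g11 q.1 q.2) + 2 * y.2.1 * (C.g31 q.1 q.2 * ω.f22 q.1 q.2) = 0)) ∧
    (yX.1 * C.p12 q.1 q.2 + yX.2.1 * C.p22 q.1 q.2 - 2 * y.2.1 * (ω.f31 q.1 q.2 * C.p12 q.1 q.2 -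
        C.p32 q.1 q.2 * ω.f11 q.1 q.2) + (y.1 - y.2.2) * (ω.f31 q.1 q.2 * C.p22 q.1 q.2 -
        C.p32 q.1 q.2 * η) = 0) ∧
    (yX.2.1 * C.p12 q.1 q.2 + yX.2.2 * C.p22 q.1 q.2 + (y.1 - y.2.2) *
        (ω.f31 q.1 q.2 * C.p12 q.1 q.2 - C.p32 q.1 q.2 * ω.f11 q.1 q.2) +
        2 * y.2.1 * (ω.f31 q.1 q.2 * C.p22 q.1 q.2 - C.p32 q.1 q.2 * η) = 0) := by
  have d11 := C.deriv11 q hq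
  have d12 := C.deriv12 q hq
  have d22 := C.deriv22 q hq
  have d31 := C.deriv31 q hq
  have d32 := C.deriv32 q hq
  have dP := (d31.mul d12).sub (d32.mul d11)
  have dR := (d31.mul d22).sub (d32.mul_const η)
  have e1 := (((((d12.const_mul yX.1).sub (d11.const_mul yT.1)).add
    (d22.const_mul yX.2.1)).sub_const (yT.2.1 * η)).sub (dP.const_mul (2 * y.2.1))).add
    (dR.const_mul (y.1 - y.2.2))
  have e2 := (((((d12.const_mul yX.2.1).sub (d11.const_mul yT.2.1)).add
    (d22.const_mul yX.2.2)).sub_const (yT.2.2 * η)).add (dP.const_mul (y.1 - y.2.2))).add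
    (dR.const_mul (2 * y.2.1))
  have e1' := e1.unique ((hasFDerivAt_const (0 : ℝ) q).congr_of_eventuallyEq
    (h.mono fun r hr => hr.codazzi₁))
  have e2' := e2.unique ((hasFDerivAt_const (0 : ℝ) q).congr_of_eventuallyEq
    (h.mono fun r hr => hr.codazzi₂))
  have z1 := DFunLike.congr_fun e1' (0, 1)
  have z2 := DFunLike.congr_fun e2' (0, 1)
  have u1 := DFunLike.congr_fun e1' (1, 0)
  have u2 := DFunLike.congr_fun e2' (1, 0)
  simp at z1 z2 u1 u2
  refine ⟨⟨?_, ?_⟩, ?_, ?_⟩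
  · linear_combination z1
  · linear_combination z2
  · linear_combination u1
  · linear_combination u2

/-- The mixed derivative of the Codazzi equations with respect to `u` and `u_x`. -/
theorem FormCalculus.mixed_deriv (C : FormCalculus η F U ω) {q : ℝ × ℝ} (hq : q ∈ U)
    {y yX yT : ℝ × ℝ × ℝ}
    (h : ∀ᶠ q in 𝓝 q, GaussCodazziAt ω η q.1 q.2 y yX yT)
    (hg11 : ∀ s s' z, C.g11 s z = C.g11 s' z) (hg31 : ∀ s s' z, C.g31 s z = C.g31 s' z) :
    (- 2 * y.2.1 * (C.g31 q.1 q.2 * C.p12 q.1 q.2 - C.p32 q.1 q.2 * C.g11 q.1 q.2) +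
        (y.1 - y.2.2) * (C.g31 q.1 q.2 * C.p22 q.1 q.2) = 0) ∧
    ((y.1 - y.2.2) * (C.g31 q.1 q.2 * C.p12 q.1 q.2 - C.p32 q.1 q.2 * C.g11 q.1 q.2) +
        2 * y.2.1 * (C.g31 q.1 q.2 * C.p22 q.1 q.2) = 0) := by
  have hev : ∀ᶠ s in 𝓝 q.1, (s, q.2) ∈ U ∧
      ∀ᶠ q in 𝓝 (s, q.2), GaussCodazziAt ω η q.1 q.2 y yX yT := by
    have hc : ContinuousAt (fun s : ℝ => (s, q.2)) q.1 := by fun_prop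
    exact hc.eventually ((C.isOpen.eventually_mem hq).and h.eventually_nhds :
      ∀ᶠ r in 𝓝 (q.1, q.2), _)
  have hl : HasDerivAt (fun s : ℝ => (s, q.2)) (1, 0) q.1 :=
    (hasDerivAt_id q.1).prodMk (hasDerivAt_const q.1 q.2)
  have d12 := (C.deriv12 q hq).comp_hasDerivAt_of_eq q.1 hl rfl
  have d22 := (C.deriv22 q hq).comp_hasDerivAt_of_eq q.1 hl rfl
  have d32 := (C.deriv32 q hq).comp_hasDerivAt_of_eq q.1 hl rfl
  have dP := (d12.const_mul (C.g31 q.1 q.2)).sub (d32.mul_const (C.g11 q.1 q.2))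
  have dR := d22.const_mul (C.g31 q.1 q.2)
  have e1 := (((dP.const_mul (2 * y.2.1)).const_sub (-yT.1 * C.g11 q.1 q.2))).add
    (dR.const_mul (y.1 - y.2.2))
  have e2 := (((dP.const_mul (y.1 - y.2.2)).const_add (-yT.2.1 * C.g11 q.1 q.2))).add
    (dR.const_mul (2 * y.2.1))
  have e1' := e1.unique ((hasDerivAt_const q.1 (0 : ℝ)).congr_of_eventuallyEq
      (hev.mono fun s hs => by
        have := (C.codazzi_deriv hs.1 hs.2).1.1
        simp only [hg11 s q.1, hg31 s q.1] at this
        exact this))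
  have e2' := e2.unique ((hasDerivAt_const q.1 (0 : ℝ)).congr_of_eventuallyEq
      (hev.mono fun s hs => by
        have := (C.codazzi_deriv hs.1 hs.2).1.2
        simp only [hg11 s q.1, hg31 s q.1] at this
        exact this))
  simp at e1' e2'
  constructor
  · linear_combination e1'
  · linear_combination e2'

/-- There is no second fundamental form of finite order if it would have to be universal and the
mixed derivative of the Codazzi equations is nondegenerate. -/
theorem FormCalculus.not_hasFiniteJetForm (hη : η ≠ 0) (C : FormCalculus η F U ω)
    (hgen : Generic U ω fun z₀ z₁ => F z₀ z₁ ≠ 0 ∨ ω.f32 z₀ z₁ ≠ 0 ∨ C.g11 z₀ z₁ = 0)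
    (hobs : Generic U ω (Obstruction C)) (hgen' : Generic U ω fun z₀ z₁ => C.g11 z₀ z₁ ≠ 0)
    (hg11 : ∀ s s' z, C.g11 s z = C.g11 s' z) (hg31 : ∀ s s' z, C.g31 s z = C.g31 s' z)
    (hmix : ∀ z₀ z₁, (z₀, z₁) ∈ U → ω.area z₀ z₁ ≠ 0 →
      C.g31 z₀ z₁ * C.p12 z₀ z₁ - C.p32 z₀ z₁ * C.g11 z₀ z₁ ≠ 0 ∨
        C.g31 z₀ z₁ * C.p22 z₀ z₁ ≠ 0) :
    ¬ HasFiniteJetForm F U ω := by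
  rintro ⟨n, D, a, b, c, hD⟩
  have h := hD.jetCodazzi C
  obtain ⟨hZ, hW, -, hU⟩ := h.killed_derivatives hη C hgen hobs
  obtain ⟨j, hj⟩ := hD.isConnected.nonempty
  have ev := h.eventually_gaussCodazziAt C hZ hW (hU hgen') hj
  obtain ⟨m1, m2⟩ := C.mixed_deriv (h.regular hj).1 ev hg11 hg31
  have hm := hmix _ _ (h.regular hj).1 (h.regular hj).2
  simp only at m1 m2
  set P := C.g31 j.2.2.1 (j.2.2.2.1 0) * C.p12 j.2.2.1 (j.2.2.2.1 0) -
    C.p32 j.2.2.1 (j.2.2.2.1 0) * C.g11 j.2.2.1 (j.2.2.2.1 0)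
  set R := C.g31 j.2.2.1 (j.2.2.2.1 0) * C.p22 j.2.2.1 (j.2.2.2.1 0)
  have hPR : 0 < P ^ 2 + R ^ 2 := by
    rcases hm with hm | hm <;> positivity
  -- The mixed derivative is a linear system for `2b` and `a - c` with determinant `-(P² + R²)`. Its
  -- trivial solution turns the Gauss equation into `c² = -1`.
  have hb : b j = 0 := by
    apply mul_left_cancel₀ hPR.ne'
    linear_combination (R * m2 - P * m1) / 2
  have hac : a j = c j := by
    rw [← sub_eq_zero]
    apply mul_left_cancel₀ hPR.ne'
    linear_combination R * m1 + P * m2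
  have hg := h.gauss C hj
  simp only at hg
  rw [hb, hac] at hg
  nlinarith [sq_nonneg (c j)]

end NoUniversal

/-! ### Proportional forms: all coefficients are universal -/

section Proportional

open Filter Topology

variable {η : ℝ} {F : ℝ → ℝ → ℝ} {U : Set (ℝ × ℝ)} {ω : Forms} {n : ℕ}

/-- If `ω³ = s (f₁₁ dx + f₁₂ dt)` with `s = ±1` and `f₂₂` is constant, all second fundamental
forms of finite order are universal. -/
theorem FormCalculus.areUniversal_of_proportional (hη : η ≠ 0) (C : FormCalculus η F U ω)
    (hgen : Generic U ω fun z₀ z₁ => F z₀ z₁ ≠ 0 ∨ ω.f32 z₀ z₁ ≠ 0 ∨ C.g11 z₀ z₁ = 0)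
    (hobs : Generic U ω (Obstruction C)) (hg11 : ∀ q ∈ U, C.g11 q.1 q.2 ≠ 0)
    {s r : ℝ} (hs : s ^ 2 = 1) (h31 : ∀ z₀ z₁, ω.f31 z₀ z₁ = s * ω.f11 z₀ z₁)
    (hg31 : ∀ z₀ z₁, C.g31 z₀ z₁ = s * C.g11 z₀ z₁) (h32 : ∀ z₀ z₁, ω.f32 z₀ z₁ = s * ω.f12 z₀ z₁)
    (hp32 : ∀ z₀ z₁, C.p32 z₀ z₁ = s * C.p12 z₀ z₁) (h22 : ∀ z₀ z₁, ω.f22 z₀ z₁ = r)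
    (hp22 : ∀ z₀ z₁, C.p22 z₀ z₁ = 0) (hcase : (∀ q ∈ U, C.p12 q.1 q.2 ≠ 0) ∨ r = 0)
    {D : Set (Jet (n + 1))} {a b c : Jet (n + 1) → ℝ} (hD : IsJetSecondForm F U ω n D a b c) :
    AreUniversal D a b c := by
  have hs0 : s ≠ 0 := by rintro rfl; norm_num at hs
  have h := hD.jetCodazzi C
  obtain ⟨hZ, hW, -, hU⟩ := h.killed_derivatives hη C hgen hobs
  replace hU := hU fun O _ hne hO => hne.imp fun q hq => ⟨hq, hg11 q (hO q hq).1⟩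
  set y : Jet (n + 1) → ℝ × ℝ × ℝ := fun j => (a j, b j, c j) with hy
  have hya : ∀ j, (y j).1 = a j := fun _ => rfl
  have hyb : ∀ j, (y j).2.1 = b j := fun _ => rfl
  have hg : ∀ j ∈ D, a j * c j - b j ^ 2 = -1 := fun j hj => h.gauss C hj
  -- The `u_x`-derivatives of the Codazzi equations give the `t`-derivatives of `a` and `b` after
  -- cancelling `g11`; the `u`-derivatives give the `x`-derivatives after cancelling `p12`. In the
  -- branch with `r = 0`, the Codazzi equations themselves are used instead, and they leave `b_x`
  -- coupled to `c_t`.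
  have hXT : ∀ j ∈ D, (fderiv ℝ y j (eX (n + 1))).1 = s * η * (a j - c j) ∧
      (fderiv ℝ y j (eT (n + 1))).1 = s * r * (a j - c j) ∧
      (fderiv ℝ y j (eT (n + 1))).2.1 = 2 * s * r * b j ∧
      (r ≠ 0 → (fderiv ℝ y j (eX (n + 1))).2.1 = 2 * s * η * b j) ∧
      (r = 0 → ω.f12 j.2.2.1 (j.2.2.2.1 0) * ((fderiv ℝ y j (eX (n + 1))).2.1 - 2 * s * η * b j) =
        (fderiv ℝ y j (eT (n + 1))).2.2 * η) := by
    intro j hj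
    have hjU := (h.regular hj).1
    have ev := h.eventually_gaussCodazziAt C hZ hW hU hj
    obtain ⟨⟨z1, z2⟩, u1, u2⟩ := C.codazzi_deriv hjU ev
    have gc := ev.self_of_nhds
    have c1 := gc.codazzi₁
    have c2 := gc.codazzi₂
    simp only [h31, h32, h22, hg31, hp32, hp22] at z1 z2 u1 u2 c1 c2
    simp only [hy] at z1 z2 u1 u2 c1 c2
    have hg0 := hg11 _ hjU
    have aT : (fderiv ℝ y j (eT (n + 1))).1 = s * r * (a j - c j) := by
      apply mul_left_cancel₀ hg0
      linear_combination -z1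
    have bT : (fderiv ℝ y j (eT (n + 1))).2.1 = 2 * s * r * b j := by
      apply mul_left_cancel₀ hg0
      linear_combination -z2
    have ha := h.area_ne C hj
    simp only [onJet, h22] at ha
    refine ⟨?_, aT, bT, fun hr => ?_, fun hr => ?_⟩
    · rcases hcase with hp | hr
      · apply mul_left_cancel₀ (hp _ hjU)
        linear_combination u1
      · rw [hr] at ha c1 aT bT
        have h12 : ω.f12 j.2.2.1 (j.2.2.2.1 0) ≠ 0 := by
          intro h0; rw [h0] at ha; exact ha (by ring)
        apply mul_left_cancel₀ h12
        linear_combination c1 + ω.f11 j.2.2.1 (j.2.2.2.1 0) * aT + η * bT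
    · have hp := hcase.resolve_right hr
      apply mul_left_cancel₀ (hp _ hjU)
      linear_combination u2
    · rw [hr] at c2 bT
      linear_combination c2 + ω.f11 j.2.2.1 (j.2.2.2.1 0) * bT
  have hbX : ∀ j ∈ D, (fderiv ℝ y j (eX (n + 1))).2.1 = 2 * s * η * b j := by
    intro j hj
    by_cases hr : r = 0
    -- For `r = 0` one has `a_t = b_t = 0`, so the Gauss equation gives `a c_t = 0`. On the open set
    -- where `c_t ≠ 0` this means `a = 0`, then `a_x = s η (a - c)` gives `c = 0`, a contradiction.
    · have hcT : (fderiv ℝ y j (eT (n + 1))).2.2 = 0 := by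
        by_contra h0
        have hcont : ContinuousOn (fun j => (fderiv ℝ y j (eT (n + 1))).2.2) D :=
          (continuous_snd.comp continuous_snd).comp_continuousOn
            ((h.smooth.continuousOn_fderiv_of_isOpen h.isOpen (by simp)).clm_apply
              continuousOn_const)
        have hO := hcont.isOpen_inter_preimage h.isOpen (isOpen_compl_singleton (x := (0 : ℝ)))
        set O := D ∩ (fun j => (fderiv ℝ y j (eT (n + 1))).2.2) ⁻¹' {0}ᶜ with hOdef
        have ha0 : ∀ z ∈ O, (y z).1 = 0 := by
          intro z hz
          have := h.gauss_deriv C hz.1 (eT (n + 1))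
          obtain ⟨-, aT, bT, -, -⟩ := hXT z hz.1
          rw [aT, bT, hr] at this
          have hne : (fderiv ℝ y z (eT (n + 1))).2.2 ≠ 0 := hz.2
          apply mul_right_cancel₀ hne
          linear_combination this
        have hc0 : ∀ z ∈ O, (y z).2.2 = 0 := by
          intro z hz
          have := (h.hasFDerivAt_components hz.1).1.apply_eq_zero_of_eqOn hO hz ha0 (eX (n + 1))
          have aX := (hXT z hz.1).1
          have a0 : a z = 0 := ha0 z hz
          have : (fderiv ℝ y z (eX (n + 1))).1 = 0 := this
          show c z = 0
          apply mul_left_cancel₀ (mul_ne_zero hs0 hη)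
          linear_combination aX - this + s * η * a0
        exact h0 ((h.hasFDerivAt_components hj).2.2.apply_eq_zero_of_eqOn hO ⟨hj, h0⟩ hc0 _)
      have ha := h.area_ne C hj
      simp only [onJet, h22, hr] at ha
      have h12 : ω.f12 j.2.2.1 (j.2.2.2.1 0) ≠ 0 := by
        intro h0; rw [h0] at ha; exact ha (by ring)
      have := (hXT j hj).2.2.2.2 hr
      rw [hcT] at this
      apply mul_left_cancel₀ h12
      linear_combination this
    · exact (hXT j hj).2.2.2.1 hr
  -- At a zero of `a` the Gauss equation gives `b² = 1`, while its `x`-derivative gives `c² + 4 b² =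
  -- 0`.
  have ha0 : ∀ j ∈ D, a j ≠ 0 := by
    intro j hj h0
    have := h.gauss_deriv C hj (eX (n + 1))
    have hgj := hg j hj
    rw [(hXT j hj).1, hbX j hj] at this
    simp only [hy, h0] at this hgj
    have h4 : c j ^ 2 + 4 * b j ^ 2 = 0 := by
      apply mul_left_cancel₀ (mul_ne_zero hs0 hη)
      linear_combination -this
    nlinarith [sq_nonneg (c j), sq_nonneg (b j)]
  -- The system is `a_x = s η (a - c)`, `b_x = 2 s η b`, with `r` in place of `η` for `t`. Since `ac
  -- = b² - 1`, both `b` and `a² + 1 + b²` grow like `exp (2 s (η x + r t))`, so `E b` and `E (a² +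
  -- 1 + b²)` are first integrals.
  set E : Jet (n + 1) → ℝ := fun j => Real.exp (-(2 * s * (η * j.1 + r * j.2.1))) with hE
  obtain ⟨pX, hpX⟩ : ∃ p : Jet (n + 1) →L[ℝ] ℝ, ∀ v, p v = v.1 :=
    ⟨ContinuousLinearMap.fst ℝ ℝ _, fun _ => rfl⟩
  obtain ⟨pT, hpT⟩ : ∃ p : Jet (n + 1) →L[ℝ] ℝ, ∀ v, p v = v.2.1 :=
    ⟨(ContinuousLinearMap.fst ℝ ℝ _).comp (ContinuousLinearMap.snd ℝ ℝ _), fun _ => rfl⟩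
  have hEd : ∀ j, HasFDerivAt E (E j • -((2 * s) • (η • pX + r • pT))) j := by
    intro j
    have h1 : HasFDerivAt (fun j : Jet (n + 1) => j.1) pX j := by
      simpa only [← hpX] using pX.hasFDerivAt
    have h2 : HasFDerivAt (fun j : Jet (n + 1) => j.2.1) pT j := by
      simpa only [← hpT] using pT.hasFDerivAt
    exact ((((h1.const_mul η).add (h2.const_mul r)).const_mul (2 * s)).neg).exp
  have hd : ∀ j ∈ D, ∀ v, (fderiv ℝ y j v).1 = v.1 * (s * η * (a j - c j)) +
      v.2.1 * (s * r * (a j - c j)) ∧ (fderiv ℝ y j v).2.1 =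
      v.1 * (2 * s * η * b j) + v.2.1 * (2 * s * r * b j) := by
    intro j hj v
    rw [JetCodazzi.fderiv_of_killed hZ hW hj v, hU j hj]
    obtain ⟨aX, aT, bT, -, -⟩ := hXT j hj
    simp [aX, aT, bT, hbX j hj]
  obtain ⟨β, hβ⟩ : ∃ β, ∀ j ∈ D, E j * b j = β := by
    have key : ∀ j ∈ D, HasFDerivAt (fun j => E j * b j) (0 : Jet (n + 1) →L[ℝ] ℝ) j := by
      intro j hj
      refine ((hEd j).mul (h.hasFDerivAt_components hj).2.1).congr_fderiv
        (ContinuousLinearMap.ext fun v => ?_)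
      have := (hd j hj v).2
      simp [this, hyb, hpX, hpT]
      ring
    exact h.isOpen.exists_is_const_of_fderiv_eq_zero hD.isConnected.isPreconnected
      (fun j hj => (key j hj).differentiableAt.differentiableWithinAt)
      (fun j hj => (key j hj).fderiv)
  obtain ⟨κ, hκ⟩ : ∃ κ, ∀ j ∈ D, E j * (a j ^ 2 + (1 + b j ^ 2)) = κ := by
    have key : ∀ j ∈ D, HasFDerivAt (fun j => E j * (a j ^ 2 + (1 + b j ^ 2)))
        (0 : Jet (n + 1) →L[ℝ] ℝ) j := by
      intro j hj
      refine ((hEd j).mul (((h.hasFDerivAt_components hj).1.pow 2).add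
        (((h.hasFDerivAt_components hj).2.1.pow 2).const_add 1))).congr_fderiv
        (ContinuousLinearMap.ext fun v => ?_)
      obtain ⟨d1, d2⟩ := hd j hj v
      have hgj := hg j hj
      simp [d1, d2, hya, hyb, hpX, hpT]
      linear_combination (-2 * s * (η * v.1 + r * v.2.1) * E j) * hgj
    exact h.isOpen.exists_is_const_of_fderiv_eq_zero hD.isConnected.isPreconnected
      (fun j hj => (key j hj).differentiableAt.differentiableWithinAt)
      (fun j hj => (key j hj).fderiv)
  have hE0 : ∀ j, E j ≠ 0 := fun j => (Real.exp_pos _).ne'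
  set e : ℝ → ℝ → ℝ := fun x t => Real.exp (-(2 * s * (η * x + r * t))) with he
  have hb : ∀ j ∈ D, b j = β / e j.1 j.2.1 := fun j hj => by
    rw [eq_div_iff (hE0 j), mul_comm]; exact hβ j hj
  -- The first integrals give `b` and `a²` as functions of `x, t`. As `a` has no zero on the
  -- connected set `D`, one sign of the root serves throughout, and `c` follows from the Gauss
  -- equation.
  set f : ℝ → ℝ → ℝ := fun x t => Real.sqrt (κ / e x t - 1 - (β / e x t) ^ 2) with hf
  have hsq : ∀ j ∈ D, κ / e j.1 j.2.1 - 1 - (β / e j.1 j.2.1) ^ 2 = a j ^ 2 := by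
    intro j hj
    rw [← hb j hj, ← hκ j hj, mul_div_cancel_left₀ _ (hE0 j)]
    ring
  have hfsq : Set.EqOn (a ^ 2) ((fun j : Jet (n + 1) => f j.1 j.2.1) ^ 2) D := by
    intro j hj
    simp only [Pi.pow_apply, hf]
    rw [hsq j hj, Real.sq_sqrt (sq_nonneg _)]
  have hfc : ContinuousOn (fun j : Jet (n + 1) => f j.1 j.2.1) D := by
    have he0 : ∀ x t, e x t ≠ 0 := fun x t => (Real.exp_pos _).ne'
    have hec : Continuous fun j : Jet (n + 1) => e j.1 j.2.1 := by simp only [he]; fun_prop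
    exact (((continuous_const.div hec fun j => he0 _ _).sub continuous_const).sub
      ((continuous_const.div hec fun j => he0 _ _).pow 2)).sqrt.continuousOn
  have hfne : ∀ {j}, j ∈ D → f j.1 j.2.1 ≠ 0 := by
    intro j hj
    simp only [hf]
    rw [hsq j hj]
    exact (Real.sqrt_pos.2 (by have := ha0 j hj; positivity)).ne'
  have hsign : ∃ ε : ℝ, ∀ j ∈ D, a j = ε * f j.1 j.2.1 := by
    rcases hD.isConnected.isPreconnected.eq_or_eq_neg_of_sq_eq hD.smooth_a.continuousOn hfc hfsq
      hfne with h1 | h1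
    · exact ⟨1, fun j hj => by rw [one_mul]; exact h1 hj⟩
    · exact ⟨-1, fun j hj => by rw [neg_one_mul]; exact h1 hj⟩
  obtain ⟨ε, hε⟩ := hsign
  refine ⟨fun x t => ε * f x t, fun x t => β / e x t,
    fun x t => ((β / e x t) ^ 2 - 1) / (ε * f x t), fun j hj => ⟨hε j hj, hb j hj, ?_⟩⟩
  change c j = ((β / e j.1 j.2.1) ^ 2 - 1) / (ε * f j.1 j.2.1)
  rw [← hε j hj, ← hb j hj, eq_div_iff (ha0 j hj)]
  linarith [hg j hj]

end Proportional

/-! ### Constant f₁₁: coefficients are functions of u -/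

section ConstantColumn

open Filter Topology

variable {η : ℝ} {F : ℝ → ℝ → ℝ} {U : Set (ℝ × ℝ)} {ω : Forms} {n : ℕ}

/-- If `f₁₁` is constant and `f₃₂ = 0`, all second fundamental forms of finite order are given, up
to a sign, by explicit functions of `u`, and they are not universal. -/
theorem FormCalculus.dependOnZeroJet_of_constant (hη : η ≠ 0) (C : FormCalculus η F U ω)
    (hgen : Generic U ω fun z₀ z₁ => F z₀ z₁ ≠ 0 ∨ ω.f32 z₀ z₁ ≠ 0 ∨ C.g11 z₀ z₁ = 0)
    (hobs : Generic U ω (Obstruction C)) {m : ℝ} (h11 : ∀ z₀ z₁, ω.f11 z₀ z₁ = m)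
    (hg11 : ∀ z₀ z₁, C.g11 z₀ z₁ = 0) (h32 : ∀ z₀ z₁, ω.f32 z₀ z₁ = 0)
    (h12 : ∀ z₀ z₁ z₁', ω.f12 z₀ z₁ = ω.f12 z₀ z₁')
    (h22 : ∀ z₀ z₁ z₁', ω.f22 z₀ z₁ = ω.f22 z₀ z₁')
    {D : Set (Jet (n + 1))} {a b c : Jet (n + 1) → ℝ} (hD : IsJetSecondForm F U ω n D a b c) :
    DependOnZeroJet D a b c ∧ ¬ AreUniversal D a b c := by
  have h := hD.jetCodazzi C
  obtain ⟨hZ, hW, hUrel, -⟩ := h.killed_derivatives hη C hgen hobs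
  set y : Jet (n + 1) → ℝ × ℝ × ℝ := fun j => (a j, b j, c j) with hy
  have hya : ∀ j, (y j).1 = a j := fun _ => rfl
  have hyb : ∀ j, (y j).2.1 = b j := fun _ => rfl
  have hyc : ∀ j, (y j).2.2 = c j := fun _ => rfl
  have hN : 0 < m ^ 2 + η ^ 2 := by positivity
  have hrel : ∀ j ∈ D, (fderiv ℝ y j (eU (n + 1))).1 * m +
      (fderiv ℝ y j (eU (n + 1))).2.1 * η = 0 ∧ (fderiv ℝ y j (eU (n + 1))).2.1 * m +
      (fderiv ℝ y j (eU (n + 1))).2.2 * η = 0 := fun j hj => by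
    have := hUrel j hj
    simp only [h11] at this
    exact this
  -- the coefficient of `u_x` in the Codazzi equations
  have hux : ∀ j ∈ D, ((fderiv ℝ y j (eU (n + 1))).1 * onJet ω.f12 j +
      (fderiv ℝ y j (eU (n + 1))).2.1 * onJet ω.f22 j - 2 * b j * (onJet C.g31 j * onJet ω.f12 j) +
      (a j - c j) * (onJet C.g31 j * onJet ω.f22 j) = 0) ∧
      ((fderiv ℝ y j (eU (n + 1))).2.1 * onJet ω.f12 j +
      (fderiv ℝ y j (eU (n + 1))).2.2 * onJet ω.f22 j + (a j - c j) *
        (onJet C.g31 j * onJet ω.f12 j) + 2 * b j * (onJet C.g31 j * onJet ω.f22 j) = 0) := by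
    intro j hj
    set dX := fderiv ℝ y j (eX (n + 1)) with hdX
    set dT := fderiv ℝ y j (eT (n + 1)) with hdT
    set dU := fderiv ℝ y j (eU (n + 1)) with hdU
    set p := onJet ω.f12 j with hp
    set q := onJet ω.f22 j with hq
    set z := j.2.2.2.1 0 with hz
    set w := j.2.2.2.2 0 with hw
    obtain ⟨r1, r2⟩ := hrel j hj
    -- The Codazzi equations at the jets obtained by moving `u_x`; here `y` and its derivatives stay
    -- the same. The terms with `u_t` have been removed by `hrel`, so what remains can be
    -- differentiated in `s` at `0`.
    have hlin : ∀ᶠ s in 𝓝 (0 : ℝ),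
        ((dX.1 + (z + s) * dU.1) * p - dT.1 * m + (dX.2.1 + (z + s) * dU.2.1) * q - dT.2.1 * η -
          2 * b j * (ω.f31 j.2.2.1 (z + s) * p) + (a j - c j) * (ω.f31 j.2.2.1 (z + s) * q) = 0) ∧
        ((dX.2.1 + (z + s) * dU.2.1) * p - dT.2.1 * m + (dX.2.2 + (z + s) * dU.2.2) * q -
          dT.2.2 * η + (a j - c j) * (ω.f31 j.2.2.1 (z + s) * p) +
          2 * b j * (ω.f31 j.2.2.1 (z + s) * q) = 0) := by
      filter_upwards [(hZ 0).translate h.isOpen h.differentiableOn hj] with s ⟨hs, hys, hfs⟩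
      obtain ⟨X, T, hXT⟩ := exists_totalDerivs C _ (h.regular hs).1
      obtain ⟨x1, x2, x3, t1, t2, t3, -, -, -⟩ := hXT.components
      have gc := h.eqs _ hs X T hXT
      have e3 : (j + s • eZ 0).2.2.1 = j.2.2.1 := by simp [eZ]
      have e4 : (j + s • eZ 0).2.2.2.1 0 = z + s := by simp [eZ, hz]
      have e5 : (j + s • eZ 0).2.2.2.2 0 = w := by simp [eZ, hw]
      rw [JetCodazzi.fderiv_of_killed hZ hW hs X, JetCodazzi.fderiv_of_killed hZ hW hs T, x1, x2,
        x3, t1, t2, t3, hfs, hys, e3, e4, e5] at gc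
      have c1 := gc.codazzi₁
      have c2 := gc.codazzi₂
      simp only [h11, h32, h12 _ (z + s) z, h22 _ (z + s) z, ← hdX, ← hdT, ← hdU, Prod.fst_add,
        Prod.snd_add, Prod.smul_fst, Prod.smul_snd, smul_eq_mul, hya, hyb, hyc] at c1 c2
      simp only [hp, hq, onJet]
      constructor
      · linear_combination c1 + w * r1
      · linear_combination c2 + w * r2
    have h31 : HasDerivAt (fun s => ω.f31 j.2.2.1 (z + s)) (onJet C.g31 j) 0 := by
      have hl : HasDerivAt (fun s : ℝ => (j.2.2.1, z + s)) (0, 1) 0 :=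
        (hasDerivAt_const 0 _).prodMk ((hasDerivAt_id (0 : ℝ)).const_add z)
      have := (C.deriv31 _ (h.regular hj).1).comp_hasDerivAt_of_eq 0 hl (by simp [hz])
      simpa [Function.comp_def] using this
    have hid := fun d : ℝ => ((hasDerivAt_id (0 : ℝ)).const_add z).mul_const d
    have d1 := ((((((hid dU.1).const_add dX.1).mul_const p).sub_const (dT.1 * m)).add
      (((hid dU.2.1).const_add dX.2.1).mul_const q)).sub_const (dT.2.1 * η)).sub
      ((h31.mul_const p).const_mul (2 * b j)) |>.add ((h31.mul_const q).const_mul (a j - c j))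
    have d2 := ((((((hid dU.2.1).const_add dX.2.1).mul_const p).sub_const (dT.2.1 * m)).add
      (((hid dU.2.2).const_add dX.2.2).mul_const q)).sub_const (dT.2.2 * η)).add
      ((h31.mul_const p).const_mul (a j - c j)) |>.add ((h31.mul_const q).const_mul (2 * b j))
    have d1' := d1.unique ((hasDerivAt_const (0 : ℝ) (0 : ℝ)).congr_of_eventuallyEq
      (hlin.mono fun s hs => hs.1))
    have d2' := d2.unique ((hasDerivAt_const (0 : ℝ) (0 : ℝ)).congr_of_eventuallyEq
      (hlin.mono fun s hs => hs.2))
    constructor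
    · linear_combination d1'
    · linear_combination d2'
  have hg31 : ∀ j ∈ D, onJet C.g31 j ≠ 0 := fun j hj =>
    (C.g_ne _ _ (h.regular hj).1).resolve_left (not_not.2 (hg11 _ _))
  have harea : ∀ j ∈ D, m * onJet ω.f22 j - onJet ω.f12 j * η ≠ 0 := fun j hj => by
    have := h.area_ne C hj
    rwa [show onJet ω.f11 j = m from h11 _ _] at this
  -- If the `u`-derivative vanished, `hux` would be a nondegenerate homogeneous system for `2b` and
  -- `a - c`, and `b = 0`, `a = c` contradicts the Gauss equation. So the isotropy of `(m, η)` holds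
  -- on all of `D`.
  have hUne : ∀ j ∈ D, ((fderiv ℝ y j (eU (n + 1))).1, (fderiv ℝ y j (eU (n + 1))).2.1,
      (fderiv ℝ y j (eU (n + 1))).2.2) ≠ 0 := by
    intro j hj h0
    obtain ⟨u1, u2⟩ := hux j hj
    rw [Prod.mk_eq_zero, Prod.mk_eq_zero] at h0
    rw [h0.1, h0.2.1] at u1
    rw [h0.2.1, h0.2.2] at u2
    have hc := h.column_pos C hj
    have hb : b j = 0 := by
      apply mul_left_cancel₀ (mul_ne_zero (hg31 j hj) hc.ne')
      linear_combination (onJet ω.f22 j * u2 - onJet ω.f12 j * u1) / 2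
    have hac : a j - c j = 0 := by
      apply mul_left_cancel₀ (mul_ne_zero (hg31 j hj) hc.ne')
      linear_combination onJet ω.f12 j * u2 + onJet ω.f22 j * u1
    have hg := h.gauss C hj
    rw [hya, hyb, hyc, hb, sub_eq_zero.1 hac] at hg
    nlinarith [sq_nonneg (c j)]
  have key := fun j (hj : j ∈ D) => isotropic_of_kernel hN (hrel j hj).1 (hrel j hj).2
    (h.gauss C hj) (h.gauss_deriv C hj (eU (n + 1))) (hUne j hj)
  constructor
  -- The sign in the isotropy relation is continuous with square one on the connected set `D`, hence
  -- a single constant. This is why the explicit formulas hold globally.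
  · set M : Jet (n + 1) → ℝ := fun j => ((b j * m + c j * η) * m - (a j * m + b j * η) * η) /
      (m ^ 2 + η ^ 2) with hM
    have hMc : ContinuousOn M D := by
      have h1 := hD.smooth_a.continuousOn
      have h2 := hD.smooth_b.continuousOn
      have h3 := hD.smooth_c.continuousOn
      fun_prop
    have hM2 : Set.EqOn (M ^ 2) 1 D := fun j hj => by
      obtain ⟨-, μ, hμ, hμ2, -⟩ := key j hj
      rw [Pi.pow_apply, show M j = μ from hμ.symm, hμ2, Pi.one_apply]
    obtain ⟨μ, hMμ⟩ : ∃ μ : ℝ, ∀ j ∈ D, M j = μ := by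
      rcases hD.isConnected.isPreconnected.eq_one_or_eq_neg_one_of_sq_eq hMc hM2 with h1 | h1
      · exact ⟨1, fun j hj => h1 hj⟩
      · exact ⟨-1, fun j hj => h1 hj⟩
    refine ⟨fun _ _ u => -2 * μ * η * ω.f22 u 0 / (m * ω.f22 u 0 - ω.f12 u 0 * η),
      fun _ _ u => μ * (m * ω.f22 u 0 + η * ω.f12 u 0) / (m * ω.f22 u 0 - ω.f12 u 0 * η),
      fun _ _ u => -2 * μ * m * ω.f12 u 0 / (m * ω.f22 u 0 - ω.f12 u 0 * η), fun j hj => ?_⟩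
    have hA := harea j hj
    obtain ⟨u1, u2⟩ := hux j hj
    obtain ⟨⟨k, -, k1, k2, k3⟩, μ', hμ', -, i1, i2⟩ := key j hj
    rw [show μ' = μ from hμ'.trans (hMμ j hj)] at i1 i2
    rw [k1, k2] at u1
    rw [k2, k3] at u2
    simp only [onJet, h12 _ (j.2.2.2.1 0) 0, h22 _ (j.2.2.2.1 0) 0] at hA u1 u2
    rw [hya, hyb] at i1
    rw [hyb, hyc] at i2
    set p := ω.f12 j.2.2.1 0
    set q := ω.f22 j.2.2.1 0
    -- Contracting `hux` with `(m, η)`, the kernel of the `u`-derivative, removes the derivatives of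
    -- `y` and leaves a third linear equation beside the two isotropy relations.
    have e : (2 * b j * p - (a j - c j) * q) * m = ((a j - c j) * p + 2 * b j * q) * η := by
      apply mul_left_cancel₀ (hg31 j hj)
      simp only [onJet]
      linear_combination -m * u1 - η * u2
    have ea : a j * (m * q - p * η) = -2 * μ * η * q := by
      apply mul_left_cancel₀ hN.ne'
      linear_combination η ^ 2 * e - (η * (2 * p * m - 2 * q * η) - m * (q * m + p * η)) * i1 -
        (q * m + p * η) * η * i2
    have eb : η * (b j * (m * q - p * η)) = η * (μ * (m * q + η * p)) := by
      linear_combination (m * q - p * η) * i1 - m * ea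
    have ec : η * (c j * (m * q - p * η)) = η * (-2 * μ * m * p) := by
      linear_combination (m * q - p * η) * i2 - m * mul_left_cancel₀ hη eb
    exact ⟨(eq_div_iff hA).2 ea, (eq_div_iff hA).2 (mul_left_cancel₀ hη eb),
      (eq_div_iff hA).2 (mul_left_cancel₀ hη ec)⟩
  -- The `u`-derivative of `a` is `k η²` with `k ≠ 0`, so `a` cannot be a function of `x, t` alone.
  · rintro ⟨a₀, b₀, c₀, h0⟩
    obtain ⟨j, hj⟩ := hD.isConnected.nonempty
    have := h.affine_deriv (v := eU (n + 1)) hj (α := 1) (β := 0) (γ := 0) (δ := -a j)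
      (fun s hs => by
        have e1 : (j + s • eU (n + 1)).1 = j.1 := by simp [eU]
        have e2 : (j + s • eU (n + 1)).2.1 = j.2.1 := by simp [eU]
        rw [hya, (h0 _ hs).1, (h0 _ hj).1, e1, e2]
        ring)
    obtain ⟨⟨k, hk, k1, -⟩, -⟩ := key j hj
    rw [k1] at this
    have : k * η ^ 2 = 0 := by linear_combination this
    exact mul_ne_zero hk (pow_ne_zero 2 hη) this

end ConstantColumn

/-! ### Linear systems with vanishing curvature -/

section FlatSystem

open Filter Topology

variable {E : Type} [NormedAddCommGroup E] [NormedSpace ℝ E] {p₀ : Plane} {δ : ℝ}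

theorem mem_ball_iff {p : Plane} : p ∈ Metric.ball p₀ δ ↔
    p.1 ∈ Set.Ioo (p₀.1 - δ) (p₀.1 + δ) ∧ p.2 ∈ Set.Ioo (p₀.2 - δ) (p₀.2 + δ) := by
  rw [← Real.ball_eq_Ioo, ← Real.ball_eq_Ioo]
  simp [Prod.dist_eq]

theorem eq_zero_of_dx {A : Plane → E →L[ℝ] E} {z : Plane → E}
    (hA : ContinuousOn A (Metric.ball p₀ δ))
    (hz : ∀ p ∈ Metric.ball p₀ δ, DifferentiableAt ℝ z p ∧ dx z p = A p (z p))
    (h0 : ∀ p ∈ Metric.ball p₀ δ, p.1 = p₀.1 → z p = 0) : ∀ p ∈ Metric.ball p₀ δ, z p = 0 := by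
  intro p hp
  have hp' := mem_ball_iff.1 hp
  have hm : ∀ x ∈ Set.Ioo (p₀.1 - δ) (p₀.1 + δ), (x, p.2) ∈ Metric.ball p₀ δ := fun x hx =>
    mem_ball_iff.2 ⟨hx, hp'.2⟩
  have hx₀ : p₀.1 ∈ Set.Ioo (p₀.1 - δ) (p₀.1 + δ) := by
    obtain ⟨⟨h1, h2⟩, -⟩ := hp'
    constructor <;> linarith
  refine linear_ode_eq_zero (L := fun x => A (x, p.2)) (z := fun x => z (x, p.2)) hx₀
    (hA.comp (by fun_prop) hm) (fun x hx => ?_) (h0 _ (hm _ hx₀) rfl) p.1 hp'.1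
  obtain ⟨h1, h2⟩ := hz _ (hm x hx)
  simpa only [h2] using hasDerivAt_fst h1

theorem eq_zero_of_dt {A : Plane → E →L[ℝ] E} {z : Plane → E}
    (hA : ContinuousOn A (Metric.ball p₀ δ))
    (hz : ∀ p ∈ Metric.ball p₀ δ, DifferentiableAt ℝ z p ∧ dt z p = A p (z p))
    (h0 : z p₀ = 0) : ∀ p ∈ Metric.ball p₀ δ, p.1 = p₀.1 → z p = 0 := by
  intro p hp hp1
  have hp' := mem_ball_iff.1 hp
  have hm : ∀ x ∈ Set.Ioo (p₀.2 - δ) (p₀.2 + δ), (p₀.1, x) ∈ Metric.ball p₀ δ := fun x hx =>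
    mem_ball_iff.2 ⟨hp1 ▸ hp'.1, hx⟩
  have hx₀ : p₀.2 ∈ Set.Ioo (p₀.2 - δ) (p₀.2 + δ) := by
    obtain ⟨-, h1, h2⟩ := hp'
    constructor <;> linarith
  have := linear_ode_eq_zero (L := fun x => A (p₀.1, x)) (z := fun x => z (p₀.1, x)) hx₀
    (hA.comp (by fun_prop) hm) (fun x hx => ?_) h0 p.2 hp'.2
  · rwa [← hp1] at this
  obtain ⟨h1, h2⟩ := hz _ (hm x hx)
  simpa only [h2] using hasDerivAt_snd h1

theorem eq_zero_of_dx_dt {A B : Plane → E →L[ℝ] E} {z : Plane → E}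
    (hA : ContinuousOn A (Metric.ball p₀ δ)) (hB : ContinuousOn B (Metric.ball p₀ δ))
    (hz : ∀ p ∈ Metric.ball p₀ δ, DifferentiableAt ℝ z p ∧ dx z p = A p (z p) ∧ dt z p = B p (z p))
    (h0 : z p₀ = 0) : ∀ p ∈ Metric.ball p₀ δ, z p = 0 :=
  eq_zero_of_dx hA (fun p hp => ⟨(hz p hp).1, (hz p hp).2.1⟩)
    (eq_zero_of_dt hB (fun p hp => ⟨(hz p hp).1, (hz p hp).2.2⟩) h0)

theorem dx_clm_apply {A : Plane → E →L[ℝ] E} {z : Plane → E} {p : Plane}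
    (hA : DifferentiableAt ℝ A p) (hz : DifferentiableAt ℝ z p) :
    dx (fun q => A q (z q)) p = A p (dx z p) + dx A p (z p) := by
  simp [dx, fderiv_clm_apply hA hz]

theorem dt_clm_apply {A : Plane → E →L[ℝ] E} {z : Plane → E} {p : Plane}
    (hA : DifferentiableAt ℝ A p) (hz : DifferentiableAt ℝ z p) :
    dt (fun q => A q (z q)) p = A p (dt z p) + dt A p (z p) := by
  simp [dt, fderiv_clm_apply hA hz]

/-- Local solvability of a linear system `Y_x = A Y`, `Y_t = B Y` with vanishing curvature. -/
theorem exists_flat_section [FiniteDimensional ℝ E] {V : Set Plane} (hV : IsOpen V) (hp₀ : p₀ ∈ V)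
    {A B : Plane → E →L[ℝ] E} (hA : ContDiffOn ℝ (⊤ : ℕ∞) A V) (hB : ContDiffOn ℝ (⊤ : ℕ∞) B V)
    (hflat : ∀ p ∈ V, ∀ y, dt A p y + A p (B p y) = dx B p y + B p (A p y)) (y₀ : E) :
    ∃ (δ : ℝ) (Y : Plane → E), 0 < δ ∧ Metric.ball p₀ δ ⊆ V ∧
      ContDiffOn ℝ (⊤ : ℕ∞) Y (Metric.ball p₀ δ) ∧ Y p₀ = y₀ ∧
      ∀ p ∈ Metric.ball p₀ δ, dx Y p = A p (Y p) ∧ dt Y p = B p (Y p) := by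
  have hΩ : IsOpen {q : Plane × (E × E) | q.1 ∈ V} := hV.preimage continuous_fst
  have lift : ∀ {A : Plane → E →L[ℝ] E}, ContDiffOn ℝ (⊤ : ℕ∞) A V →
      ContDiffOn ℝ (⊤ : ℕ∞) (fun q : Plane × (E × E) => A q.1) {q | q.1 ∈ V} := fun h =>
    h.comp contDiff_fst.contDiffOn fun q hq => hq
  -- Two ordinary differential equations with parameters, solved as degenerate Goursat problems:
  -- first `v_t = B v`, used only on the vertical line through `p₀`, then `Y_x = A Y` with these
  -- initial values.
  obtain ⟨δ₁, _, v, hδ₁, _, hv, h₁⟩ := exists_goursat p₀ (φ := fun _ => y₀) (ψ := fun _ => (0 : E))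
    contDiff_const contDiff_const hΩ hp₀ (G := fun q => 0) (F := fun q => B q.1 q.2.2)
    contDiffOn_const ((lift hB).clm_apply contDiff_snd.snd.contDiffOn)
  obtain ⟨ψ, hψ, hψe, -⟩ := exists_curve_snd Metric.isOpen_ball hv (Metric.mem_ball_self hδ₁)
  obtain ⟨ε, hε, hψε⟩ := Metric.eventually_nhds_iff.1 hψe
  obtain ⟨δ₂, Y, _, hδ₂, hY, _, h₂⟩ := exists_goursat p₀ (φ := fun _ => (0 : E)) (ψ := ψ)
    contDiff_const hψ hΩ hp₀ (G := fun q => A q.1 q.2.1) (F := fun q => 0)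
    ((lift hA).clm_apply contDiff_snd.fst.contDiffOn) contDiffOn_const
  set δ := min δ₁ (min ε δ₂) with hδdef
  have hδ : 0 < δ := lt_min hδ₁ (lt_min hε hδ₂)
  have s₁ : Metric.ball p₀ δ ⊆ Metric.ball p₀ δ₁ := Metric.ball_subset_ball (min_le_left _ _)
  have s₂ : Metric.ball p₀ δ ⊆ Metric.ball p₀ δ₂ :=
    Metric.ball_subset_ball ((min_le_right _ _).trans (min_le_right _ _))
  have sV : Metric.ball p₀ δ ⊆ V := fun p hp => (h₁ p (s₁ hp)).1
  have hO : IsOpen (Metric.ball p₀ δ) := Metric.isOpen_ball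
  have hYs := hY.mono s₂
  have hline : ∀ p ∈ Metric.ball p₀ δ, p.1 = p₀.1 → Y p = v p := by
    intro p hp hp1
    rw [(h₂ p (s₂ hp)).2.2.2.1 hp1, hψε, ← hp1]
    rw [Metric.mem_ball, Prod.dist_eq] at hp
    exact (le_max_right _ _).trans_lt (hp.trans_le ((min_le_right _ _).trans (min_le_left _ _)))
  have hYx : ∀ p ∈ Metric.ball p₀ δ, dx Y p = A p (Y p) := fun p hp => (h₂ p (s₂ hp)).2.1
  have dY : ∀ p ∈ Metric.ball p₀ δ, DifferentiableAt ℝ Y p := fun p hp =>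
    differentiableAt_of_smooth hO hYs hp
  have dYt : ∀ p ∈ Metric.ball p₀ δ, DifferentiableAt ℝ (dt Y) p := fun p hp =>
    differentiableAt_of_smooth hO (ContDiffOn.dt hO hYs) hp
  have dA : ∀ p ∈ Metric.ball p₀ δ, DifferentiableAt ℝ A p := fun p hp =>
    differentiableAt_of_smooth hV hA (sV hp)
  have dB : ∀ p ∈ Metric.ball p₀ δ, DifferentiableAt ℝ B p := fun p hp =>
    differentiableAt_of_smooth hV hB (sV hp)
  -- By flatness, `Z = Y_t - B Y` satisfies `Z_x = A Z`; it vanishes on the vertical line by the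
  -- choice of the initial values.
  have hZ : ∀ p ∈ Metric.ball p₀ δ, dt Y p - B p (Y p) = 0 := by
    refine eq_zero_of_dx (A := A) (hA.continuousOn.mono sV) (fun p hp => ?_) fun p hp hp1 => ?_
    · have hBY : DifferentiableAt ℝ (fun q => B q (Y q)) p := (dB p hp).clm_apply (dY p hp)
      refine ⟨(dYt p hp).sub hBY, ?_⟩
      have e1 : dx (fun q => dt Y q - B q (Y q)) p = dx (dt Y) p - dx (fun q => B q (Y q)) p := by
        unfold dx
        rw [fderiv_fun_sub (dYt p hp) hBY]
        simp
      rw [e1, ← dt_dx_comm hO hYs hp, dt_congr hO (v := fun q => A q (Y q)) hYx hp,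
        dt_clm_apply (dA p hp) (dY p hp), dx_clm_apply (dB p hp) (dY p hp), hYx p hp, map_sub]
      have hf := hflat p (sV hp) (Y p)
      rw [← eq_sub_iff_add_eq] at hf
      rw [hf]
      abel
    · have hp' := mem_ball_iff.1 hp
      have : dt Y p = B p (v p) := by
        rw [← (h₁ p (s₁ hp)).2.2.1]
        refine (hasDerivAt_snd (dY p hp)).unique
          ((hasDerivAt_snd (differentiableAt_of_smooth Metric.isOpen_ball hv
            (s₁ hp))).congr_of_eventuallyEq ?_)
        filter_upwards [isOpen_Ioo.mem_nhds hp'.2] with t ht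
        exact hline _ (mem_ball_iff.2 ⟨hp'.1, ht⟩) hp1
      rw [this, hline p hp hp1, sub_self]
  refine ⟨δ, Y, hδ, sV, hYs, ?_, fun p hp => ⟨hYx p hp, sub_eq_zero.1 (hZ p hp)⟩⟩
  rw [hline p₀ (Metric.mem_ball_self hδ) rfl]
  exact (h₁ p₀ (Metric.mem_ball_self hδ₁)).2.2.2.2 rfl

end FlatSystem

/-! ### Bonnet's theorem -/

section Bonnet

open Filter Topology

/-- A matrix of coefficients acting on tuples of vectors. -/
noncomputable def frameAct : (Fin 4 → Fin 4 → ℝ) →L[ℝ] (Fin 4 → E3) →L[ℝ] (Fin 4 → E3) :=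
  LinearMap.toContinuousLinearMap ((LinearMap.toContinuousLinearMap :
      ((Fin 4 → E3) →ₗ[ℝ] (Fin 4 → E3)) ≃ₗ[ℝ] ((Fin 4 → E3) →L[ℝ] (Fin 4 → E3))).toLinearMap ∘ₗ
    LinearMap.mk₂ ℝ (fun (M : Fin 4 → Fin 4 → ℝ) (y : Fin 4 → E3) i => ∑ j, M i j • y j)
      (fun M N y => by ext1 i; simp [add_smul, Finset.sum_add_distrib])
      (fun r M y => by ext1 i; simp [mul_smul, Finset.smul_sum])
      (fun M y z => by ext1 i; simp [Finset.sum_add_distrib])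
      (fun r M y => by ext1 i; simp [Finset.smul_sum, smul_comm r]))

theorem frameAct_apply (M : Fin 4 → Fin 4 → ℝ) (y : Fin 4 → E3) (i : Fin 4) :
    frameAct M y i = ∑ j, M i j • y j := rfl

theorem frameAct_comp (M N : Fin 4 → Fin 4 → ℝ) (y : Fin 4 → E3) :
    frameAct M (frameAct N y) = frameAct (fun i j => ∑ k, M i k * N k j) y := by
  ext1 i
  simp only [frameAct_apply, Finset.smul_sum, Finset.sum_smul, smul_smul]
  exact Finset.sum_comm

/-- The derivative of a Gram matrix along a frame equation. -/
noncomputable def gramAct : (Fin 4 → Fin 4 → ℝ) →L[ℝ] (Fin 3 → Fin 3 → ℝ) →L[ℝ]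
    (Fin 3 → Fin 3 → ℝ) :=
  LinearMap.toContinuousLinearMap ((LinearMap.toContinuousLinearMap :
      ((Fin 3 → Fin 3 → ℝ) →ₗ[ℝ] (Fin 3 → Fin 3 → ℝ)) ≃ₗ[ℝ]
        ((Fin 3 → Fin 3 → ℝ) →L[ℝ] (Fin 3 → Fin 3 → ℝ))).toLinearMap ∘ₗ
    LinearMap.mk₂ ℝ (fun (M : Fin 4 → Fin 4 → ℝ) (g : Fin 3 → Fin 3 → ℝ) i j =>
        ∑ k : Fin 3, (M i.castSucc k.castSucc * g k j + M j.castSucc k.castSucc * g i k))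
      (fun M N y => by ext i j; simp [← Finset.sum_add_distrib]; congr 1; ext; ring)
      (fun r M y => by ext i j; simp [Finset.mul_sum]; congr 1; ext; ring)
      (fun M y z => by ext i j; simp [← Finset.sum_add_distrib]; congr 1; ext; ring)
      (fun r M y => by ext i j; simp [Finset.mul_sum]; congr 1; ext; ring))

theorem gramAct_apply (M : Fin 4 → Fin 4 → ℝ) (g : Fin 3 → Fin 3 → ℝ) (i j : Fin 3) :
    gramAct M g i j =
      ∑ k : Fin 3, (M i.castSucc k.castSucc * g k j + M j.castSucc k.castSucc * g i k) := rfl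

/-- The rows of the frame vectors do not involve the position vector, so their Gram matrix obeys a
closed linear equation. Skew-symmetry makes the identity matrix a stationary solution, so the
deviation from it satisfies the same homogeneous equation. -/
theorem gramAct_gram {M : Fin 4 → Fin 4 → ℝ} (h3 : ∀ i : Fin 3, M i.castSucc (Fin.last 3) = 0)
    (hM : ∀ i j : Fin 3, M i.castSucc j.castSucc = -M j.castSucc i.castSucc) (y : Fin 4 → E3)
    (i j : Fin 3) :
    inner ℝ (y i.castSucc) (∑ k, M j.castSucc k • y k) +
      inner ℝ (∑ k, M i.castSucc k • y k) (y j.castSucc) =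
    gramAct M (fun i j => inner ℝ (y i.castSucc) (y j.castSucc) - if i = j then 1 else 0) i j := by
  simp only [Fin.sum_univ_castSucc (n := 3), h3, zero_smul, add_zero, inner_sum, sum_inner,
    real_inner_smul_left, real_inner_smul_right, gramAct_apply, mul_sub, Finset.sum_add_distrib,
    Finset.sum_sub_distrib, mul_ite, mul_one, mul_zero, Finset.sum_ite_eq, Finset.sum_ite_eq',
    Finset.mem_univ, if_true]
  linarith [hM i j]

/-- The coefficient matrix of the moving frame equations: `w` is the connection form, `h` and `k`
the components of the second fundamental form, `f` and `g` the components of `dX`. -/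
def frameMatrix (w h k f g : ℝ) : Fin 4 → Fin 4 → ℝ :=
  ![![0, w, h, 0], ![-w, 0, k, 0], ![-h, -k, 0, 0], ![f, g, 0, 0]]

variable {V : Set Plane} {w h k f g w' h' k' f' g' : Plane → ℝ} {p p₀ : Plane}

theorem contDiffOn_frameMatrix (hw : ContDiffOn ℝ (⊤ : ℕ∞) w V) (hh : ContDiffOn ℝ (⊤ : ℕ∞) h V)
    (hk : ContDiffOn ℝ (⊤ : ℕ∞) k V) (hf : ContDiffOn ℝ (⊤ : ℕ∞) f V)
    (hg : ContDiffOn ℝ (⊤ : ℕ∞) g V) :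
    ContDiffOn ℝ (⊤ : ℕ∞) (fun p => frameMatrix (w p) (h p) (k p) (f p) (g p)) V := by
  refine contDiffOn_pi.2 fun i => contDiffOn_pi.2 fun j => ?_
  fin_cases i <;> fin_cases j <;>
    first
      | exact contDiffOn_const
      | assumption
      | exact hw.neg
      | exact hh.neg
      | exact hk.neg

theorem hasDerivAt_frameMatrix {w h k f g : ℝ → ℝ} {w' h' k' f' g' s : ℝ} (hw : HasDerivAt w w' s)
    (hh : HasDerivAt h h' s) (hk : HasDerivAt k k' s) (hf : HasDerivAt f f' s)
    (hg : HasDerivAt g g' s) :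
    HasDerivAt (fun s => frameMatrix (w s) (h s) (k s) (f s) (g s)) (frameMatrix w' h' k' f' g')
      s := by
  refine hasDerivAt_pi.2 fun i => hasDerivAt_pi.2 fun j => ?_
  fin_cases i <;> fin_cases j <;>
    first
      | exact hasDerivAt_const _ _
      | assumption
      | exact hw.neg
      | exact hh.neg
      | exact hk.neg

theorem dx_frameAct {M : Plane → Fin 4 → Fin 4 → ℝ} (hM : DifferentiableAt ℝ M p) :
    dx (fun q => frameAct (M q)) p = frameAct (dx M p) := by
  unfold dx
  rw [show (fun q => frameAct (M q)) = frameAct ∘ M from rfl,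
    (frameAct.hasFDerivAt.comp p hM.hasFDerivAt).fderiv]
  rfl

theorem dt_frameAct {M : Plane → Fin 4 → Fin 4 → ℝ} (hM : DifferentiableAt ℝ M p) :
    dt (fun q => frameAct (M q)) p = frameAct (dt M p) := by
  unfold dt
  rw [show (fun q => frameAct (M q)) = frameAct ∘ M from rfl,
    (frameAct.hasFDerivAt.comp p hM.hasFDerivAt).fderiv]
  rfl

/-- The position vector is carried as a fourth unknown next to the frame, so that one linear system
is integrated. Its flatness consists of the five curl equations and of `symm`, the normal component
of `X_xt = X_tx`. Orthonormality propagates because the deviation of the Gram matrix solves a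
homogeneous linear system and starts at zero. -/
theorem exists_orthonormal_frame (hV : IsOpen V) (hp₀ : p₀ ∈ V)
    (hw : ContDiffOn ℝ (⊤ : ℕ∞) w V) (hh : ContDiffOn ℝ (⊤ : ℕ∞) h V)
    (hk : ContDiffOn ℝ (⊤ : ℕ∞) k V) (hf : ContDiffOn ℝ (⊤ : ℕ∞) f V)
    (hg : ContDiffOn ℝ (⊤ : ℕ∞) g V) (hw' : ContDiffOn ℝ (⊤ : ℕ∞) w' V)
    (hh' : ContDiffOn ℝ (⊤ : ℕ∞) h' V) (hk' : ContDiffOn ℝ (⊤ : ℕ∞) k' V)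
    (hf' : ContDiffOn ℝ (⊤ : ℕ∞) f' V) (hg' : ContDiffOn ℝ (⊤ : ℕ∞) g' V)
    (curl_w : ∀ p ∈ V, dx w' p - dt w p = h' p * k p - h p * k' p)
    (curl_h : ∀ p ∈ V, dx h' p - dt h p = w p * k' p - w' p * k p)
    (curl_k : ∀ p ∈ V, dx k' p - dt k p = w' p * h p - w p * h' p)
    (curl_f : ∀ p ∈ V, dx f' p - dt f p = w p * g' p - w' p * g p)
    (curl_g : ∀ p ∈ V, dx g' p - dt g p = w' p * f p - w p * f' p)
    (symm : ∀ p ∈ V, f p * h' p + g p * k' p = f' p * h p + g' p * k p) :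
    ∃ W : Set Plane, IsOpen W ∧ p₀ ∈ W ∧ W ⊆ V ∧ ∃ (X : Plane → E3) (e : Fin 3 → Plane → E3),
      ContDiffOn ℝ (⊤ : ℕ∞) X W ∧ (∀ i, ContDiffOn ℝ (⊤ : ℕ∞) (e i) W) ∧
      (∀ p ∈ W, Orthonormal ℝ (fun i => e i p)) ∧ ∀ p ∈ W,
        dx X p = f p • e 0 p + g p • e 1 p ∧ dt X p = f' p • e 0 p + g' p • e 1 p ∧
        dx (e 0) p = w p • e 1 p + h p • e 2 p ∧ dt (e 0) p = w' p • e 1 p + h' p • e 2 p ∧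
        dx (e 1) p = -w p • e 0 p + k p • e 2 p ∧ dt (e 1) p = -w' p • e 0 p + k' p • e 2 p := by
  set M : Plane → Fin 4 → Fin 4 → ℝ := fun p => frameMatrix (w p) (h p) (k p) (f p) (g p) with hM
  set N : Plane → Fin 4 → Fin 4 → ℝ := fun p => frameMatrix (w' p) (h' p) (k' p) (f' p) (g' p)
    with hN
  have sM : ContDiffOn ℝ (⊤ : ℕ∞) M V := contDiffOn_frameMatrix hw hh hk hf hg
  have sN : ContDiffOn ℝ (⊤ : ℕ∞) N V := contDiffOn_frameMatrix hw' hh' hk' hf' hg'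
  have d {f : Plane → ℝ} (hf : ContDiffOn ℝ (⊤ : ℕ∞) f V) {p : Plane} (hp : p ∈ V) :=
    differentiableAt_of_smooth hV hf hp
  have tM : ∀ p ∈ V, dt M p = frameMatrix (dt w p) (dt h p) (dt k p) (dt f p) (dt g p) :=
    fun p hp => (hasDerivAt_snd (differentiableAt_of_smooth hV sM hp)).unique
      (hasDerivAt_frameMatrix (hasDerivAt_snd (d hw hp)) (hasDerivAt_snd (d hh hp))
        (hasDerivAt_snd (d hk hp)) (hasDerivAt_snd (d hf hp)) (hasDerivAt_snd (d hg hp)))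
  have xN : ∀ p ∈ V, dx N p = frameMatrix (dx w' p) (dx h' p) (dx k' p) (dx f' p) (dx g' p) :=
    fun p hp => (hasDerivAt_fst (differentiableAt_of_smooth hV sN hp)).unique
      (hasDerivAt_frameMatrix (hasDerivAt_fst (d hw' hp)) (hasDerivAt_fst (d hh' hp))
        (hasDerivAt_fst (d hk' hp)) (hasDerivAt_fst (d hf' hp)) (hasDerivAt_fst (d hg' hp)))
  obtain ⟨δ, Y, hδ, hBV, hY, hY0, hYd⟩ := exists_flat_section hV hp₀
    (A := fun p => frameAct (M p)) (B := fun p => frameAct (N p))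
    (frameAct.contDiff.comp_contDiffOn sM) (frameAct.contDiff.comp_contDiffOn sN)
    (fun p hp y => by
      rw [dt_frameAct (differentiableAt_of_smooth hV sM hp),
        dx_frameAct (differentiableAt_of_smooth hV sN hp), frameAct_comp, frameAct_comp,
        tM p hp, xN p hp, ← add_apply, ← add_apply, ← map_add, ← map_add]
      congr 2
      have c1 := curl_w p hp
      have c2 := curl_h p hp
      have c3 := curl_k p hp
      have c4 := curl_f p hp
      have c5 := curl_g p hp
      have c6 := symm p hp
      ext i j
      fin_cases i <;> fin_cases j <;>
        simp [hM, hN, frameMatrix, Fin.sum_univ_four] <;> linarith)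
    ![EuclideanSpace.single 0 1, EuclideanSpace.single 1 1, EuclideanSpace.single 2 1, 0]
  have hO : IsOpen (Metric.ball p₀ δ) := Metric.isOpen_ball
  have hYi : ∀ i, ContDiffOn ℝ (⊤ : ℕ∞) (fun p => Y p i) (Metric.ball p₀ δ) := fun i =>
    contDiffOn_pi.1 hY i
  have dYi : ∀ i, ∀ p ∈ Metric.ball p₀ δ, DifferentiableAt ℝ (fun p => Y p i) p := fun i p hp =>
    differentiableAt_of_smooth hO (hYi i) hp
  have Yx : ∀ i, ∀ p ∈ Metric.ball p₀ δ, dx (fun p => Y p i) p = ∑ j, M p i j • Y p j := by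
    intro i p hp
    rw [← frameAct_apply, ← (hYd p hp).1]
    exact (hasDerivAt_fst (dYi i p hp)).unique
      (hasDerivAt_pi.1 (hasDerivAt_fst (differentiableAt_of_smooth hO hY hp)) i)
  have Yt : ∀ i, ∀ p ∈ Metric.ball p₀ δ, dt (fun p => Y p i) p = ∑ j, N p i j • Y p j := by
    intro i p hp
    rw [← frameAct_apply, ← (hYd p hp).2]
    exact (hasDerivAt_snd (dYi i p hp)).unique
      (hasDerivAt_pi.1 (hasDerivAt_snd (differentiableAt_of_smooth hO hY hp)) i)
  let gram : Plane → Fin 3 → Fin 3 → ℝ := fun p i j =>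
    inner ℝ (Y p i.castSucc) (Y p j.castSucc) - if i = j then 1 else 0
  have dg : ∀ p ∈ Metric.ball p₀ δ, ∀ i j, DifferentiableAt ℝ (fun p => gram p i j) p :=
    fun p hp i j => ((dYi _ p hp).inner ℝ (dYi _ p hp)).sub_const _
  have dgram : ∀ p ∈ Metric.ball p₀ δ, DifferentiableAt ℝ gram p := fun p hp =>
    differentiableAt_pi.2 fun i => differentiableAt_pi.2 fun j => dg p hp i j
  have hgram : ∀ p ∈ Metric.ball p₀ δ, gram p = 0 := by
    refine eq_zero_of_dx_dt (A := fun p => gramAct (M p)) (B := fun p => gramAct (N p))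
      (gramAct.continuous.comp_continuousOn (sM.continuousOn.mono hBV))
      (gramAct.continuous.comp_continuousOn (sN.continuousOn.mono hBV))
      (fun p hp => ⟨dgram p hp, ?_, ?_⟩) ?_
    · ext i j
      have e1 : dx gram p i j = dx (fun p => gram p i j) p :=
        (hasDerivAt_pi.1 (hasDerivAt_pi.1 (hasDerivAt_fst (dgram p hp)) i) j).unique
          (hasDerivAt_fst (dg p hp i j))
      have e2 : dx (fun p => gram p i j) p =
          dx (fun p => inner ℝ (Y p i.castSucc) (Y p j.castSucc)) p := by
        simp only [dx, gram, fderiv_sub_const]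
      rw [e1, e2, dx_inner (v := fun p => Y p i.castSucc) (w := fun p => Y p j.castSucc)
        (dYi _ p hp) (dYi _ p hp), Yx _ p hp, Yx _ p hp, gramAct_apply]
      exact gramAct_gram (fun i => by fin_cases i <;> rfl)
        (fun i j => by fin_cases i <;> fin_cases j <;> simp [hM, frameMatrix]) _ i j
    · ext i j
      have e1 : dt gram p i j = dt (fun p => gram p i j) p :=
        (hasDerivAt_pi.1 (hasDerivAt_pi.1 (hasDerivAt_snd (dgram p hp)) i) j).unique
          (hasDerivAt_snd (dg p hp i j))
      have e2 : dt (fun p => gram p i j) p =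
          dt (fun p => inner ℝ (Y p i.castSucc) (Y p j.castSucc)) p := by
        simp only [dt, gram, fderiv_sub_const]
      rw [e1, e2, dt_inner (v := fun p => Y p i.castSucc) (w := fun p => Y p j.castSucc)
        (dYi _ p hp) (dYi _ p hp), Yt _ p hp, Yt _ p hp, gramAct_apply]
      exact gramAct_gram (fun i => by fin_cases i <;> rfl)
        (fun i j => by fin_cases i <;> fin_cases j <;> simp [hN, frameMatrix]) _ i j
    · ext i j
      simp only [gram, hY0]
      fin_cases i <;> fin_cases j <;> simp [EuclideanSpace.inner_single_left]
  refine ⟨Metric.ball p₀ δ, hO, Metric.mem_ball_self hδ, hBV, fun p => Y p 3,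
    fun i p => Y p i.castSucc, hYi 3, fun i => hYi _, fun p hp => ?_, fun p hp => ?_⟩
  · rw [orthonormal_iff_ite]
    intro i j
    have := congrFun (congrFun (hgram p hp) i) j
    simpa [gram, sub_eq_zero] using this
  · have x0 := Yx 0 p hp
    have x1 := Yx 1 p hp
    have x3 := Yx 3 p hp
    have t0 := Yt 0 p hp
    have t1 := Yt 1 p hp
    have t3 := Yt 3 p hp
    simp only [hM, hN, frameMatrix, Fin.sum_univ_four, Matrix.cons_val, Matrix.cons_val_zero,
      Matrix.cons_val_one, zero_smul, add_zero, zero_add] at x0 x1 x3 t0 t1 t3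
    exact ⟨x3, t3, x0, t0, x1, t1⟩

/-- The curl conditions of the moving frame are the structure equations together with the Gauss and
Codazzi equations. The symmetry condition is automatic because the same `b` occurs in both rows of
the second fundamental form. -/
theorem FormCalculus.isSecondForm {η : ℝ} {F : ℝ → ℝ → ℝ} {U : Set (ℝ × ℝ)} {ω : Forms}
    (C : FormCalculus η F U ω) {u a b c : Plane → ℝ} (hV : IsOpen V) (hu : IsSolution F U V u)
    (hreg : ∀ p ∈ V, ω.area (u p) (dx u p) ≠ 0) (ha : ContDiffOn ℝ (⊤ : ℕ∞) a V)
    (hb : ContDiffOn ℝ (⊤ : ℕ∞) b V) (hc : ContDiffOn ℝ (⊤ : ℕ∞) c V)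
    (hgc : ∀ p ∈ V, GaussCodazzi ω u a b c p) : IsSecondForm ω u V a b c := by
  intro p₀ hp₀
  have s11 := contDiffOn_along hV hu.smooth hu.mem C.smooth11
  have s12 := contDiffOn_along hV hu.smooth hu.mem C.smooth12
  have s22 := contDiffOn_along hV hu.smooth hu.mem C.smooth22
  have s31 := contDiffOn_along hV hu.smooth hu.mem C.smooth31
  have s32 := contDiffOn_along hV hu.smooth hu.mem C.smooth32
  have s21 : ContDiffOn ℝ (⊤ : ℕ∞) (along ω.f21 u) V := by
    rw [C.along_f21]; exact contDiffOn_const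
  have hs : ∀ p ∈ V, StructureEqs ω u p := fun p hp =>
    (C.structureEqs_iff hV hu.smooth hp (hu.mem p hp)).2 (hu.eqn p hp)
  obtain ⟨W, hW, hp₀W, hWV, X, e, hX, he, horth, hd⟩ := exists_orthonormal_frame hV hp₀
    (w := along ω.f31 u) (h := comb a b ω.f11 ω.f21 u) (k := comb b c ω.f11 ω.f21 u)
    (f := along ω.f11 u) (g := along ω.f21 u)
    (w' := along ω.f32 u) (h' := comb a b ω.f12 ω.f22 u) (k' := comb b c ω.f12 ω.f22 u)
    (f' := along ω.f12 u) (g' := along ω.f22 u)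
    s31 ((ha.mul s11).add (hb.mul s21)) ((hb.mul s11).add (hc.mul s21)) s11 s21
    s32 ((ha.mul s12).add (hb.mul s22)) ((hb.mul s12).add (hc.mul s22)) s12 s22
    (fun p hp => by
      simp only [comb]
      linear_combination (hs p hp).2.2 + (along ω.f11 u p * along ω.f22 u p -
        along ω.f12 u p * along ω.f21 u p) * (hgc p hp).gauss)
    (fun p hp => (hgc p hp).codazzi₁)
    (fun p hp => by linear_combination (hgc p hp).codazzi₂)
    (fun p hp => (hs p hp).1)
    (fun p hp => by linear_combination (hs p hp).2.1)
    (fun p hp => by simp only [comb]; ring)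
  have orth : ∀ p ∈ W, ∀ i j, inner ℝ (e i p) (e j p) = if i = j then (1 : ℝ) else 0 :=
    fun p hp i j => by simpa using orthonormal_iff_ite.1 (horth p hp) i j
  refine ⟨W, hW, hp₀W, hWV, X, e, hX, he, horth, fun p hp => hreg p (hWV hp),
    fun p hp => (hd p hp).1, fun p hp => (hd p hp).2.1, fun p hp => ?_, fun p hp => ?_,
    fun p hp => ?_, fun p hp => ?_⟩
  · rw [(hd p hp).2.2.1]
    simp only [inner_add_left, real_inner_smul_left, orth p hp, comb, if_true, mul_one,
      show ((1 : Fin 3) = 2) = False by simp, if_false,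
      mul_zero, zero_add]
  · rw [(hd p hp).2.2.2.1]
    simp only [inner_add_left, real_inner_smul_left, orth p hp, comb, if_true, mul_one,
      show ((1 : Fin 3) = 2) = False by simp, if_false,
      mul_zero, zero_add]
  · rw [(hd p hp).2.2.2.2.1]
    simp only [inner_add_left, real_inner_smul_left, orth p hp, comb, if_true, mul_one,
      show ((0 : Fin 3) = 2) = False by simp, if_false,
      mul_zero, zero_add]
  · rw [(hd p hp).2.2.2.2.2]
    simp only [inner_add_left, real_inner_smul_left, orth p hp, comb, if_true, mul_one,
      show ((0 : Fin 3) = 2) = False by simp, if_false,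
      mul_zero, zero_add]

end Bonnet

/-! ### Existence of coefficients -/

section Existence

open Filter Topology

variable {η : ℝ} {F : ℝ → ℝ → ℝ} {U : Set (ℝ × ℝ)} {ω : Forms}

theorem ContDiffOn.jet {V : Set Plane} {u : Plane → ℝ} (hV : IsOpen V)
    (hu : ContDiffOn ℝ (⊤ : ℕ∞) u V) (l : ℕ) : ContDiffOn ℝ (⊤ : ℕ∞) (PSS.jet l u) V :=
  contDiffOn_fst.prodMk (contDiffOn_snd.prodMk (hu.prodMk
    ((contDiffOn_pi.2 fun _ => ContDiffOn.dx_iterate hV hu _).prodMk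
      (contDiffOn_pi.2 fun _ => ContDiffOn.dt_iterate hV hu _))))

theorem FormCalculus.smooth_area (C : FormCalculus η F U ω) :
    ContDiffOn ℝ (⊤ : ℕ∞) (fun q : ℝ × ℝ => ω.area q.1 q.2) U := by
  unfold Forms.area
  simp only [C.f21_eq]
  exact (C.smooth11.mul C.smooth22).sub (C.smooth12.mul contDiffOn_const)

theorem FormCalculus.isOpen_regularJets (C : FormCalculus η F U ω) (n : ℕ) :
    IsOpen (regularJets U ω n) := by
  have : regularJets U ω n = baseProj n ⁻¹' (U ∩ (fun q : ℝ × ℝ => ω.area q.1 q.2) ⁻¹' {0}ᶜ) := rfl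
  rw [this]
  exact (C.smooth_area.continuousOn.isOpen_inter_preimage C.isOpen isOpen_compl_singleton).preimage
    (baseProj n).continuous

theorem FormCalculus.isJetSecondForm (C : FormCalculus η F U ω) {D : Set (Jet 1)}
    {a b c : Jet 1 → ℝ} (hD : IsOpen D) (hDc : IsConnected D) (hr : D ⊆ regularJets U ω 0)
    (ha : ContDiffOn ℝ (⊤ : ℕ∞) a D) (hb : ContDiffOn ℝ (⊤ : ℕ∞) b D)
    (hc : ContDiffOn ℝ (⊤ : ℕ∞) c D)
    (h : ∀ (V : Set Plane) (u : Plane → ℝ), IsOpen V → IsSolution F U V u →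
      (∀ p ∈ V, jet 1 u p ∈ D) → ∀ p ∈ V, GaussCodazzi ω u (fun p => a (jet 1 u p))
        (fun p => b (jet 1 u p)) (fun p => c (jet 1 u p)) p) :
    IsJetSecondForm F U ω 0 D a b c := by
  refine ⟨hD, hDc, hr, ha, hb, hc, fun V u hV hu hj => ?_⟩
  have hs := ContDiffOn.jet hV hu.smooth 1
  exact C.isSecondForm hV hu (fun p hp => (hr (hj p hp)).2) (ha.comp hs hj) (hb.comp hs hj)
    (hc.comp hs hj) (h V u hV hu hj)

theorem HasFiniteJetFormNearEveryJet.hasFiniteJetForm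
    (h : HasFiniteJetFormNearEveryJet F U ω) (hne : ∃ q ∈ U, ω.area q.1 q.2 ≠ 0) :
    HasFiniteJetForm F U ω := by
  obtain ⟨q, hq, hq'⟩ := hne
  obtain ⟨D, a, b, c, -, hD⟩ := h (0, 0, q.1, fun _ => q.2, 0) ⟨hq, hq'⟩
  exact ⟨0, D, a, b, c, hD⟩

theorem IsOpen.exists_connected_nhd {n : ℕ} {O : Set (Jet n)} (hO : IsOpen O) {j : Jet n}
    (hj : j ∈ O) : ∃ D ⊆ O, IsOpen D ∧ IsConnected D ∧ j ∈ D := by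
  obtain ⟨r, hr, h⟩ := Metric.isOpen_iff.1 hO j hj
  exact ⟨Metric.ball j r, h, Metric.isOpen_ball,
    (convex_ball j r).isConnected ⟨j, Metric.mem_ball_self hr⟩, Metric.mem_ball_self hr⟩

/-- The coefficients are those of the uniqueness analysis with `μ = 1`. They are designed so that
`ω^3_1 = -η dx + f22 dt` and `ω^3_2 = m dx - f12 dt`, for which the Codazzi equations are the second
and the first structure equation. -/
theorem FormCalculus.existence_of_constant (C : FormCalculus η F U ω) {m : ℝ}
    (h11 : ∀ z₀ z₁, ω.f11 z₀ z₁ = m) (hg11 : ∀ z₀ z₁, C.g11 z₀ z₁ = 0)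
    (h32 : ∀ z₀ z₁, ω.f32 z₀ z₁ = 0) : HasFiniteJetFormNearEveryJet F U ω := by
  intro j hj
  obtain ⟨D, hDr, hD, hDc, hjD⟩ := IsOpen.exists_connected_nhd (C.isOpen_regularJets 0) hj
  have hA : ∀ z₀ z₁, ω.area z₀ z₁ = m * ω.f22 z₀ z₁ - η * ω.f12 z₀ z₁ := fun z₀ z₁ => by
    unfold Forms.area
    rw [h11, C.f21_eq]; ring
  have lift : ∀ {f : ℝ → ℝ → ℝ}, ContDiffOn ℝ (⊤ : ℕ∞) (fun q : ℝ × ℝ => f q.1 q.2) U →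
      ContDiffOn ℝ (⊤ : ℕ∞) (onJet f) D := fun hf =>
    hf.comp (baseProj 0).contDiff.contDiffOn fun k hk => (hDr hk).1
  have sA : ContDiffOn ℝ (⊤ : ℕ∞) (onJet ω.area) D := lift C.smooth_area
  have s12 : ContDiffOn ℝ (⊤ : ℕ∞) (onJet ω.f12) D := lift C.smooth12
  have s22 : ContDiffOn ℝ (⊤ : ℕ∞) (onJet ω.f22) D := lift C.smooth22
  refine ⟨D, fun k => -2 * η * onJet ω.f22 k / onJet ω.area k,
    fun k => (m * onJet ω.f22 k + η * onJet ω.f12 k) / onJet ω.area k,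
    fun k => -2 * m * onJet ω.f12 k / onJet ω.area k, hjD,
    C.isJetSecondForm hD hDc hDr ((contDiffOn_const.mul s22).div sA fun k hk => (hDr hk).2)
      (((contDiffOn_const.mul s22).add (contDiffOn_const.mul s12)).div sA fun k hk => (hDr hk).2)
      ((contDiffOn_const.mul s12).div sA fun k hk => (hDr hk).2) fun V u hV hu hVD p hp => ?_⟩
  have hne : ∀ q ∈ V, m * ω.f22 (u q) (dx u q) - η * ω.f12 (u q) (dx u q) ≠ 0 := fun q hq => by
    rw [← hA]; exact (hDr (hVD q hq)).2
  have j0 : ∀ q, (jet 1 u q).2.2.1 = u q := fun q => rfl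
  have j1 : ∀ q, (jet 1 u q).2.2.2.1 0 = dx u q := fun q => rfl
  have e12 : Set.EqOn (comb (fun q => -2 * η * onJet ω.f22 (jet 1 u q) / onJet ω.area (jet 1 u q))
      (fun q => (m * onJet ω.f22 (jet 1 u q) + η * onJet ω.f12 (jet 1 u q)) /
        onJet ω.area (jet 1 u q)) ω.f12 ω.f22 u) (along ω.f22 u) V := fun q hq => by
    have := hne q hq
    simp only [comb, along, onJet, j0, j1, hA]
    generalize hΔ : m * ω.f22 (u q) (dx u q) - η * ω.f12 (u q) (dx u q) = Δ at this ⊢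
    field_simp
    rw [← hΔ]
    ring
  have e11 : Set.EqOn (comb (fun q => -2 * η * onJet ω.f22 (jet 1 u q) / onJet ω.area (jet 1 u q))
      (fun q => (m * onJet ω.f22 (jet 1 u q) + η * onJet ω.f12 (jet 1 u q)) /
        onJet ω.area (jet 1 u q)) ω.f11 ω.f21 u) (fun _ => -η) V := fun q hq => by
    have := hne q hq
    simp only [comb, along, onJet, j0, j1, hA, h11, C.f21_eq]
    generalize hΔ : m * ω.f22 (u q) (dx u q) - η * ω.f12 (u q) (dx u q) = Δ at this ⊢
    field_simp
    rw [← hΔ]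
    ring
  have k12 : Set.EqOn (comb (fun q => (m * onJet ω.f22 (jet 1 u q) + η * onJet ω.f12 (jet 1 u q)) /
        onJet ω.area (jet 1 u q))
      (fun q => -2 * m * onJet ω.f12 (jet 1 u q) / onJet ω.area (jet 1 u q)) ω.f12 ω.f22 u)
      (fun q => (-1 : ℝ) * along ω.f12 u q) V := fun q hq => by
    have := hne q hq
    simp only [comb, along, onJet, j0, j1, hA]
    generalize hΔ : m * ω.f22 (u q) (dx u q) - η * ω.f12 (u q) (dx u q) = Δ at this ⊢
    field_simp
    rw [← hΔ]
    ring
  have k11 : Set.EqOn (comb (fun q => (m * onJet ω.f22 (jet 1 u q) + η * onJet ω.f12 (jet 1 u q)) /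
        onJet ω.area (jet 1 u q))
      (fun q => -2 * m * onJet ω.f12 (jet 1 u q) / onJet ω.area (jet 1 u q)) ω.f11 ω.f21 u)
      (fun _ => m) V := fun q hq => by
    have := hne q hq
    simp only [comb, along, onJet, j0, j1, hA, h11, C.f21_eq]
    generalize hΔ : m * ω.f22 (u q) (dx u q) - η * ω.f12 (u q) (dx u q) = Δ at this ⊢
    field_simp
    rw [← hΔ]
    ring
  have c0 : ∀ r : ℝ, dt (fun _ => r) p = 0 := fun r => by simp [dt]
  have hU := hu.mem p hp
  obtain ⟨d12, x12, -⟩ := C.along12 hV hu.smooth hp hU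
  obtain ⟨-, x22, -⟩ := C.along22 hV hu.smooth hp hU
  have st1 := C.struct₁ _ _ hU
  have st2 := C.struct₂ _ _ hU
  simp only [hg11, h32, h11] at st1 st2
  refine ⟨?_, ?_, ?_⟩
  · have := hne p hp
    simp only [onJet, j0, j1, hA]
    generalize hΔ : m * ω.f22 (u p) (dx u p) - η * ω.f12 (u p) (dx u p) = Δ at this ⊢
    field_simp
    rw [← hΔ]
    ring
  · rw [dx_congr hV e12 hp, dt_congr hV e11 hp, k12 hp, k11 hp, x22, c0]
    simp only [along, h32]
    linear_combination st2
  · rw [dx_congr hV k12 hp, dt_congr hV k11 hp, e12 hp, e11 hp,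
      dx_mul (differentiableAt_const _) d12, x12, c0]
    simp only [along, h32, dx, fderiv_const_apply, zero_apply]
    simp only [dx] at st1
    linear_combination -st1

/-- Universal coefficients for proportional forms. -/
theorem FormCalculus.existence_of_proportional (C : FormCalculus η F U ω) {s r : ℝ}
    (h31 : ∀ z₀ z₁, ω.f31 z₀ z₁ = s * ω.f11 z₀ z₁)
    (h32 : ∀ z₀ z₁, ω.f32 z₀ z₁ = s * ω.f12 z₀ z₁) (h22 : ∀ z₀ z₁, ω.f22 z₀ z₁ = r) :
    HasFiniteJetFormNearEveryJet F U ω := by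
  intro j hj
  -- The first integrals with `b = 0` leave `a² = κ exp (2 s (η x + r t)) - 1` and `c = -1/a`. Here
  -- the exponent is centred at the given jet and `κ = 2`, so that `a² = 1` there and `a²` stays
  -- positive on a neighbourhood.
  let E : ℝ → ℝ → ℝ := fun x t => 2 * Real.exp (2 * s * (η * (x - j.1) + r * (t - j.2.1))) - 1
  have hEc : Continuous fun k : Jet 1 => E k.1 k.2.1 := by fun_prop
  have hE0 : E j.1 j.2.1 = 1 := by simp [E]; norm_num
  obtain ⟨D, hDr, hD, hDc, hjD⟩ := IsOpen.exists_connected_nhd ((C.isOpen_regularJets 0).inter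
    (isOpen_Ioi.preimage hEc)) (j := j) ⟨hj, show (0 : ℝ) < E j.1 j.2.1 by rw [hE0]; norm_num⟩
  have hpos : ∀ k ∈ D, 0 < E k.1 k.2.1 := fun k hk => (hDr hk).2
  have sE : ContDiff ℝ (⊤ : ℕ∞) fun k : Jet 1 => E k.1 k.2.1 := by
    refine (contDiff_const.mul (Real.contDiff_exp.comp (contDiff_const.mul
      ((contDiff_const.mul (contDiff_fst.sub contDiff_const)).add
        (contDiff_const.mul (contDiff_snd.fst.sub contDiff_const)))))).sub contDiff_const
  have sa : ContDiffOn ℝ (⊤ : ℕ∞) (fun k : Jet 1 => √(E k.1 k.2.1)) D := fun k hk =>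
    (sE.contDiffAt.sqrt (hpos k hk).ne').contDiffWithinAt
  refine ⟨D, fun k => √(E k.1 k.2.1), fun _ => 0, fun k => -(√(E k.1 k.2.1))⁻¹, hjD,
    C.isJetSecondForm hD hDc (fun k hk => (hDr hk).1) sa contDiffOn_const
      (sa.inv fun k hk => (Real.sqrt_pos.2 (hpos k hk)).ne').neg fun V u hV hu hVD p hp => ?_⟩
  have hp0 : 0 < E p.1 p.2 := hpos _ (hVD p hp)
  have hq0 := Real.sqrt_pos.2 hp0
  have hsq : √(E p.1 p.2) ^ 2 = E p.1 p.2 := Real.sq_sqrt hp0.le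
  have hEd : HasFDerivAt (fun q : Plane => E q.1 q.2) ((E p.1 p.2 + 1) • (2 * s) •
      (η • ContinuousLinearMap.fst ℝ ℝ ℝ + r • ContinuousLinearMap.snd ℝ ℝ ℝ)) p := by
    have h1 : HasFDerivAt (fun q : Plane => 2 * s * (η * (q.1 - j.1) + r * (q.2 - j.2.1)))
        ((2 * s) • (η • ContinuousLinearMap.fst ℝ ℝ ℝ + r • ContinuousLinearMap.snd ℝ ℝ ℝ)) p :=
      (((hasFDerivAt_fst.sub_const _).const_mul η).add
        ((hasFDerivAt_snd.sub_const _).const_mul r)).const_mul _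
    refine ((h1.exp.const_mul 2).sub_const 1).congr_fderiv ?_
    simp only [E, sub_add_cancel, smul_smul, mul_assoc]
  set ρ := s * (E p.1 p.2 + 1) / √(E p.1 p.2) with hρ
  have had : HasFDerivAt (fun q : Plane => √(E q.1 q.2))
      (ρ • (η • ContinuousLinearMap.fst ℝ ℝ ℝ + r • ContinuousLinearMap.snd ℝ ℝ ℝ)) p := by
    refine (hEd.sqrt hp0.ne').congr_fderiv ?_
    rw [smul_smul, smul_smul, hρ]
    congr 1
    field_simp
  have hcd : HasFDerivAt (fun q : Plane => -(√(E q.1 q.2))⁻¹) ((ρ / E p.1 p.2) •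
      (η • ContinuousLinearMap.fst ℝ ℝ ℝ + r • ContinuousLinearMap.snd ℝ ℝ ℝ)) p := by
    refine (((hasDerivAt_inv hq0.ne').comp_hasFDerivAt p had).neg).congr_fderiv ?_
    rw [hsq, smul_smul, ← neg_smul]
    congr 1
    field_simp
  have hU := hu.mem p hp
  obtain ⟨d11, x11, t11⟩ := C.along11 hV hu.smooth hp hU
  obtain ⟨d12, x12, t12⟩ := C.along12 hV hu.smooth hp hU
  obtain ⟨d22, x22, t22⟩ := C.along22 hV hu.smooth hp hU
  have f21 : along ω.f21 u = fun _ => η := C.along_f21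
  have d21 : DifferentiableAt ℝ (along ω.f21 u) p := by
    rw [f21]; exact differentiableAt_const _
  obtain ⟨s1, s2, -⟩ := (C.structureEqs_iff hV hu.smooth hp hU).2 (hu.eqn p hp)
  have c0 : DifferentiableAt ℝ (fun _ : Plane => (0 : ℝ)) p := differentiableAt_const _
  have z0 : dx (fun _ : Plane => (0 : ℝ)) p = 0 := by simp [dx]
  have z1 : dt (fun _ : Plane => (0 : ℝ)) p = 0 := by simp [dt]
  have xa : dx (fun q : Plane => √(E q.1 q.2)) p = ρ * η := by simp [dx, had.fderiv]
  have ta : dt (fun q : Plane => √(E q.1 q.2)) p = ρ * r := by simp [dt, had.fderiv]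
  have xc : dx (fun q : Plane => -(√(E q.1 q.2))⁻¹) p = ρ / E p.1 p.2 * η := by
    simp [dx, hcd.fderiv]
  have tc : dt (fun q : Plane => -(√(E q.1 q.2))⁻¹) p = ρ / E p.1 p.2 * r := by
    simp [dt, hcd.fderiv]
  have hac : ρ = s * (√(E p.1 p.2) + (√(E p.1 p.2))⁻¹) := by
    rw [hρ]
    field_simp
    rw [hsq]
  have e31 : along ω.f31 u p = s * along ω.f11 u p := h31 _ _
  have e32 : along ω.f32 u p = s * along ω.f12 u p := h32 _ _
  have e22 : along ω.f22 u p = r := h22 _ _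
  have e21 : along ω.f21 u p = η := C.f21_eq _ _
  show GaussCodazzi ω u (fun q => √(E q.1 q.2)) (fun _ => 0) (fun q => -(√(E q.1 q.2))⁻¹) p
  rw [e31, e32, e22, e21] at s1
  rw [e31, e32] at s2
  refine ⟨?_, ?_, ?_⟩
  · field_simp
    simp
  · rw [dx_comb had.differentiableAt c0 d12 d22, dt_comb had.differentiableAt c0 d11 d21, xa, ta,
      z0, z1]
    simp only [comb, e31, e32, e22, e21]
    rw [hac]
    linear_combination √(E p.1 p.2) * s1
  · rw [dx_comb c0 hcd.differentiableAt d12 d22, dt_comb c0 hcd.differentiableAt d11 d21, xc, tc,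
      z0, z1]
    simp only [comb, e31, e32, e22, e21]
    linear_combination -(√(E p.1 p.2))⁻¹ * s2

end Existence

/-! ### The equations u_xt = F(u) with F'' + α F = 0 -/

section Harmonic

open Filter Topology

theorem hasFDerivAt_comp_fst {f : ℝ → ℝ} {d : ℝ} {q : ℝ × ℝ} (h : HasDerivAt f d q.1) :
    HasFDerivAt (fun q : ℝ × ℝ => f q.1) (d • ContinuousLinearMap.fst ℝ ℝ ℝ) q :=
  h.comp_hasFDerivAt q hasFDerivAt_fst

theorem hasFDerivAt_comp_snd {f : ℝ → ℝ} {d : ℝ} {q : ℝ × ℝ} (h : HasDerivAt f d q.2) :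
    HasFDerivAt (fun q : ℝ × ℝ => f q.2) (d • ContinuousLinearMap.snd ℝ ℝ ℝ) q :=
  h.comp_hasFDerivAt q hasFDerivAt_snd

/-- The differential data of the forms of `u_{xt} = F(u)`, where `F = Q h - η g`, `g' = -h`,
`h' = α g`. -/
noncomputable def harmonicCalculus {η α A B Q : ℝ} {F g h : ℝ → ℝ} {ω : Forms}
    (hpar : α * (A ^ 2 - B ^ 2) = 1) (hg : ContDiff ℝ (⊤ : ℕ∞) g) (hh : ContDiff ℝ (⊤ : ℕ∞) h)
    (hg' : ∀ s, HasDerivAt g (-h s) s) (hh' : ∀ s, HasDerivAt h (α * g s) s)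
    (hF : ∀ s, F s = Q * h s - η * g s)
    (h11 : ∀ z₀ z₁, ω.f11 z₀ z₁ = -α * (B * z₁ - A * Q))
    (h12 : ∀ z₀ z₁, ω.f12 z₀ z₁ = A * α * g z₀) (h21 : ∀ z₀ z₁, ω.f21 z₀ z₁ = η)
    (h22 : ∀ z₀ z₁, ω.f22 z₀ z₁ = h z₀)
    (h31 : ∀ z₀ z₁, ω.f31 z₀ z₁ = -α * (A * z₁ - B * Q))
    (h32 : ∀ z₀ z₁, ω.f32 z₀ z₁ = B * α * g z₀) :
    FormCalculus η (fun u _ => F u) Set.univ ω where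
  g11 := fun _ _ => -α * B
  g31 := fun _ _ => -α * A
  p12 := fun z₀ _ => A * α * -h z₀
  p22 := fun z₀ _ => α * g z₀
  p32 := fun z₀ _ => B * α * -h z₀
  isOpen := isOpen_univ
  smooth_F := by
    simp only [hF]
    exact ((contDiff_const.mul (hh.comp contDiff_fst)).sub
      (contDiff_const.mul (hg.comp contDiff_fst))).contDiffOn
  f21_eq := h21
  smooth11 := by
    simp only [h11]
    exact (contDiff_const.mul ((contDiff_const.mul contDiff_snd).sub contDiff_const)).contDiffOn
  smooth12 := by
    simp only [h12]
    exact (contDiff_const.mul (hg.comp contDiff_fst)).contDiffOn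
  smooth22 := by
    simp only [h22]
    exact (hh.comp contDiff_fst).contDiffOn
  smooth31 := by
    simp only [h31]
    exact (contDiff_const.mul ((contDiff_const.mul contDiff_snd).sub contDiff_const)).contDiffOn
  smooth32 := by
    simp only [h32]
    exact (contDiff_const.mul (hg.comp contDiff_fst)).contDiffOn
  deriv11 := fun q _ => by
    simp only [h11]
    refine hasFDerivAt_comp_snd (f := fun z => -α * (B * z - A * Q)) ?_
    simpa using (((hasDerivAt_id q.2).const_mul B).sub_const (A * Q)).const_mul (-α)
  deriv31 := fun q _ => by
    simp only [h31]
    refine hasFDerivAt_comp_snd (f := fun z => -α * (A * z - B * Q)) ?_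
    simpa using (((hasDerivAt_id q.2).const_mul A).sub_const (B * Q)).const_mul (-α)
  deriv12 := fun q _ => by
    simp only [h12]
    exact hasFDerivAt_comp_fst ((hg' q.1).const_mul _)
  deriv22 := fun q _ => by
    simp only [h22]
    exact hasFDerivAt_comp_fst (hh' q.1)
  deriv32 := fun q _ => by
    simp only [h32]
    exact hasFDerivAt_comp_fst ((hg' q.1).const_mul _)
  struct₁ := fun z₀ z₁ _ => by rw [h31, h22, h32, hF]; ring
  struct₂ := fun z₀ z₁ _ => by
    rw [h11, h12, h31, h32]; linear_combination -α * g z₀ * z₁ * hpar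
  struct₃ := fun z₀ z₁ _ => by rw [h11, h22, h12, hF]; ring
  g_ne := fun z₀ z₁ _ => by
    by_contra! hc
    obtain ⟨h1, h2⟩ := hc
    have : α * (α * (A ^ 2 - B ^ 2)) = 0 := by linear_combination -A * h2 * α + B * h1 * α
    rw [hpar, mul_one] at this
    rw [this] at hpar
    simp at hpar

/-- The forms of `u_{xt} = F(u)` in terms of a pair of functions with `g' = -h`, `h' = α g`. -/
theorem IsHarmonic.exists_rotation {η α : ℝ} {F : ℝ → ℝ} {A B Q : ℝ} {ω : Forms}
    (H : IsHarmonic η α F A B Q ω) : ∃ g h : ℝ → ℝ, ContDiff ℝ (⊤ : ℕ∞) g ∧ ContDiff ℝ (⊤ : ℕ∞) h ∧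
      (∀ s, HasDerivAt g (-h s) s) ∧ (∀ s, HasDerivAt h (α * g s) s) ∧
      (∀ s, F s = Q * h s - η * g s) ∧
      (∀ z₀ z₁, ω.f11 z₀ z₁ = -α * (B * z₁ - A * Q)) ∧ (∀ z₀ z₁, ω.f12 z₀ z₁ = A * α * g z₀) ∧
      (∀ z₀ z₁, ω.f21 z₀ z₁ = η) ∧ (∀ z₀ z₁, ω.f22 z₀ z₁ = h z₀) ∧
      (∀ z₀ z₁, ω.f31 z₀ z₁ = -α * (A * z₁ - B * Q)) ∧ ∀ z₀ z₁, ω.f32 z₀ z₁ = B * α * g z₀ := by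
  have hd := H.denominator
  have sF' : ContDiff ℝ (⊤ : ℕ∞) (deriv F) := (contDiff_infty_iff_deriv.1 H.smooth).2
  have dF : ∀ s, HasDerivAt F (deriv F s) s := fun s =>
    (H.smooth.differentiable (by simp) s).hasDerivAt
  have dF' : ∀ s, HasDerivAt (deriv F) (-(α * F s)) s := fun s => by
    rw [← eq_neg_of_add_eq_zero_left (H.ode s)]
    exact (sF'.differentiable (by simp) s).hasDerivAt
  obtain rfl := H.forms
  refine ⟨fun s => (Q * deriv F s - η * F s) / (Q ^ 2 * α + η ^ 2),
    fun s => (η * deriv F s + α * Q * F s) / (Q ^ 2 * α + η ^ 2),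
    ((contDiff_const.mul sF').sub (contDiff_const.mul H.smooth)).div_const _,
    ((contDiff_const.mul sF').add (contDiff_const.mul H.smooth)).div_const _,
    fun s => ((((dF' s).const_mul Q).sub ((dF s).const_mul η)).div_const _).congr_deriv ?_,
    fun s => ((((dF' s).const_mul η).add ((dF s).const_mul (α * Q))).div_const _).congr_deriv ?_,
    fun s => ?_, fun _ _ => rfl, fun _ _ => mul_div_assoc _ _ _, fun _ _ => rfl, fun _ _ => rfl,
    fun _ _ => rfl, fun _ _ => mul_div_assoc _ _ _⟩
  · ring
  · ring
  · field_simp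
    ring

theorem exists_fst_wiggle {O : Set (ℝ × ℝ)} (hO : IsOpen O) {q : ℝ × ℝ} (hq : q ∈ O)
    {P : ℝ → Prop} (hP : ∀ᶠ s in 𝓝[≠] q.1, P s) : ∃ s, (s, q.2) ∈ O ∧ P s := by
  have hc : Continuous fun s : ℝ => (s, q.2) := by fun_prop
  have : ∀ᶠ s in 𝓝[≠] q.1, (s, q.2) ∈ O :=
    eventually_nhdsWithin_of_eventually_nhds (hc.continuousAt.preimage_mem_nhds (hO.mem_nhds hq))
  exact (this.and hP).exists

/-- If one of `g, h` vanishes at `s`, the other does not and is, up to a nonzero factor, the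
derivative of the first; so zeros are simple and isolated. This provides generic points where both
are nonzero. -/
theorem eventually_ne_of_rotation {α : ℝ} {g h : ℝ → ℝ} (hα : α ≠ 0)
    (hg' : ∀ s, HasDerivAt g (-h s) s) (hh' : ∀ s, HasDerivAt h (α * g s) s) {s : ℝ}
    (hs : g s ≠ 0 ∨ h s ≠ 0) : ∀ᶠ r in 𝓝[≠] s, g r ≠ 0 ∧ h r ≠ 0 := by
  have cg : g s ≠ 0 → ∀ᶠ r in 𝓝[≠] s, g r ≠ 0 := fun h0 =>
    eventually_nhdsWithin_of_eventually_nhds ((hg' s).continuousAt.eventually_ne h0)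
  have ch : h s ≠ 0 → ∀ᶠ r in 𝓝[≠] s, h r ≠ 0 := fun h0 =>
    eventually_nhdsWithin_of_eventually_nhds ((hh' s).continuousAt.eventually_ne h0)
  rcases eq_or_ne (g s) 0 with h0 | h0
  · have h1 : h s ≠ 0 := hs.resolve_left (by simpa using h0)
    exact ((hg' s).eventually_ne (neg_ne_zero.2 h1)).and (ch h1)
  · exact (cg h0).and ((hh' s).eventually_ne (mul_ne_zero hα h0))

/-- The derivative of `f11` is `-α B`, and `f32 = α B g`. So `B = 0` is the situation of constant
`f11` with `f32 = 0`, while for `B ≠ 0` the form has to be universal and the mixed derivative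
excludes it. -/
theorem IsHarmonic.describes_and_dichotomy {η α : ℝ} (hη : η ≠ 0) {F : ℝ → ℝ} {A B Q : ℝ}
    {ω : Forms} (hα : α ≠ 0) (H : IsHarmonic η α F A B Q ω) :
    Describes η (fun u _ => F u) Set.univ ω ∧
    (B ≠ 0 → ¬ HasFiniteJetForm (fun u _ => F u) Set.univ ω) ∧
    (0 < α → B = 0 → HasFiniteJetFormNearEveryJet (fun u _ => F u) Set.univ ω ∧
      HasFiniteJetForm (fun u _ => F u) Set.univ ω ∧
      ∀ (n : ℕ) (D : Set (Jet (n + 1))) (a b c : Jet (n + 1) → ℝ),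
        IsJetSecondForm (fun u _ => F u) Set.univ ω n D a b c →
          DependOnZeroJet D a b c ∧ ¬ AreUniversal D a b c) := by
  obtain ⟨g, h, hg, hh, hg', hh', hF, h11, h12, h21, h22, h31, h32⟩ := H.exists_rotation
  set C : FormCalculus η (fun u _ => F u) Set.univ ω := harmonicCalculus H.parameters hg hh hg' hh'
    hF h11 h12 h21 h22 h31 h32 with hC
  have hA : ∀ z₀ z₁, ω.area z₀ z₁ = -α * B * z₁ * h z₀ + α * A * F z₀ := fun z₀ z₁ => by
    unfold Forms.area
    rw [h11, h22, h12, h21, hF]; ring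
  have hgh : ∀ z₀ z₁, ω.area z₀ z₁ ≠ 0 → g z₀ ≠ 0 ∨ h z₀ ≠ 0 := by
    intro z₀ z₁ h0
    by_contra! hc
    apply h0
    rw [hA, hF, hc.1, hc.2]
    ring
  have hne : ∃ q ∈ (Set.univ : Set (ℝ × ℝ)), ω.area q.1 q.2 ≠ 0 := by
    obtain ⟨s, hs⟩ := H.ne_zero
    by_cases hA0 : A = 0
    · have hB : B ≠ 0 := by
        rintro rfl
        have := H.parameters
        rw [hA0] at this
        simp at this
      have hs' : g s ≠ 0 ∨ h s ≠ 0 := by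
        by_contra! hc
        apply hs
        rw [hF, hc.1, hc.2]; ring
      obtain ⟨r, -, hr⟩ := (eventually_ne_of_rotation hα hg' hh' hs').exists
      refine ⟨(r, 1), trivial, ?_⟩
      rw [hA, hA0]
      simp [hα, hB, hr]
    · refine ⟨(s, 0), trivial, ?_⟩
      rw [hA]
      simp [hα, hA0, hs]
  have wiggle : ∀ O : Set (ℝ × ℝ), IsOpen O → O.Nonempty →
      (∀ q ∈ O, q ∈ Set.univ ∧ ω.area q.1 q.2 ≠ 0) →
      ∃ q ∈ O, ω.area q.1 q.2 ≠ 0 ∧ g q.1 ≠ 0 ∧ h q.1 ≠ 0 := by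
    rintro O hO ⟨q, hq⟩ hr
    obtain ⟨s, h1, h2⟩ := exists_fst_wiggle hO hq
      (eventually_ne_of_rotation hα hg' hh' (hgh _ _ (hr q hq).2))
    exact ⟨_, h1, (hr _ h1).2, h2⟩
  refine ⟨C.describes hne, fun hB => ?_, fun hα0 hB => ?_⟩
  · refine C.not_hasFiniteJetForm hη ?_ ?_ ?_ (fun _ _ _ => rfl) (fun _ _ _ => rfl) ?_
    · intro O hO hn hr
      obtain ⟨q, hq, -, h1, -⟩ := wiggle O hO hn hr
      refine ⟨q, hq, Or.inr (Or.inl ?_)⟩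
      rw [h32]
      exact mul_ne_zero (mul_ne_zero hB hα) h1
    · intro O hO hn hr
      obtain ⟨q, hq, h0, h1, h2⟩ := wiggle O hO hn hr
      -- The third alternative holds with `m = 0`, because `g11 F = -α B F(u)` does not involve
      -- `u_x`. What remains is the product of `f32`, `p32` and the area, nonzero where `g`, `h` and
      -- the area are.
      refine ⟨q, hq, Or.inr (Or.inr ⟨fun _ _ _ => rfl, fun s s' z => by rw [h11, h11], 0,
        Q * (α * g q.1) - η * -h q.1, hasDerivAt_const q.2 (C.g11 q.1 q.2 * F q.1), ?_, ?_⟩)⟩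
      · simp only [hF]
        exact ((hh' _).const_mul _).sub ((hg' _).const_mul _)
      · have e : ω.f11 q.1 q.2 * ω.f22 q.1 q.2 - ω.f12 q.1 q.2 * η ≠ 0 := by
          have := h0
          unfold Forms.area at this
          rwa [h21] at this
        rw [mul_zero, zero_mul, zero_add, h32]
        exact mul_ne_zero (mul_ne_zero (mul_ne_zero (mul_ne_zero hB hα) h1)
          (mul_ne_zero (mul_ne_zero hB hα) (neg_ne_zero.2 h2))) e
    · rintro O hO ⟨q, hq⟩ -
      exact ⟨q, hq, mul_ne_zero (neg_ne_zero.2 hα) hB⟩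
    -- By `α (A² - B²) = 1` the first quantity is `α h`. Where `h = 0`, the nonzero area forces `A ≠
    -- 0` and `g ≠ 0`, and the second quantity takes over.
    · intro z₀ z₁ _ h0
      rcases eq_or_ne (h z₀) 0 with h1 | h1
      · right
        have h2 : g z₀ ≠ 0 := (hgh _ _ h0).resolve_right (by simpa using h1)
        have hA0 : A ≠ 0 := by
          rintro rfl
          apply h0
          rw [hA, h1]
          ring
        exact mul_ne_zero (mul_ne_zero (neg_ne_zero.2 hα) hA0) (mul_ne_zero hα h2)
      · left
        show -α * A * (A * α * -h z₀) - B * α * -h z₀ * (-α * B) ≠ 0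
        have : -α * A * (A * α * -h z₀) - B * α * -h z₀ * (-α * B) = α * h z₀ := by
          linear_combination α * h z₀ * H.parameters
        rw [this]
        exact mul_ne_zero hα h1
  · subst hB
    have hg11 : ∀ z₀ z₁, C.g11 z₀ z₁ = 0 := fun _ _ => by simp [hC, harmonicCalculus]
    have h11' : ∀ z₀ z₁, ω.f11 z₀ z₁ = α * A * Q := fun z₀ z₁ => by rw [h11]; ring
    have h32' : ∀ z₀ z₁, ω.f32 z₀ z₁ = 0 := fun z₀ z₁ => by rw [h32]; ring
    have ex := C.existence_of_constant h11' hg11 h32'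
    have hA0 : A ≠ 0 := by
      rintro rfl
      have := H.parameters
      simp at this
    refine ⟨ex, ex.hasFiniteJetForm hne, fun n D a b c hD => ?_⟩
    refine C.dependOnZeroJet_of_constant hη ?_ ?_ h11' hg11 h32' (fun z₀ z₁ z₁' => by rw [h12, h12])
      (fun z₀ z₁ z₁' => by rw [h22, h22]) hD
    · rintro O hO ⟨q, hq⟩ -
      exact ⟨q, hq, Or.inr (Or.inr (hg11 _ _))⟩
    · rintro O hO ⟨q, hq⟩ hr
      refine ⟨q, hq, Or.inl ?_⟩
      show ω.f22 q.1 q.2 * (A * α * -h q.1) - ω.f12 q.1 q.2 * (α * g q.1) ≠ 0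
      rw [h22, h12]
      -- The Wronskian is a multiple of `h² + α g²`, which is positive for `α > 0`.
      have : h q.1 * (A * α * -h q.1) - A * α * g q.1 * (α * g q.1) =
        -(A * α) * (h q.1 ^ 2 + α * g q.1 ^ 2) := by ring
      rw [this]
      refine mul_ne_zero (neg_ne_zero.2 (mul_ne_zero hA0 hα)) (ne_of_gt ?_)
      rcases hgh _ _ (hr q hq).2 with h1 | h1
      · positivity
      · positivity

end Harmonic

/-! ### The equations u_xt = λu + ξu_x + τ -/

section Linear

open Filter Topology

/-- The differential data of the forms of `u_{xt} = 0`. -/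
noncomputable def zeroCalculus (η : ℝ) :
    FormCalculus η (fun _ _ => 0) Set.univ (zeroForms η) where
  g11 := fun _ _ => 1
  g31 := fun _ _ => 0
  p12 := fun _ _ => 0
  p22 := fun z₀ _ => Real.exp z₀
  p32 := fun z₀ _ => Real.exp z₀
  isOpen := isOpen_univ
  smooth_F := contDiffOn_const
  f21_eq := fun _ _ => rfl
  smooth11 := contDiff_snd.contDiffOn
  smooth12 := contDiffOn_const
  smooth22 := (Real.contDiff_exp.comp contDiff_fst).contDiffOn
  smooth31 := contDiffOn_const
  smooth32 := (Real.contDiff_exp.comp contDiff_fst).contDiffOn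
  deriv11 := fun q _ => hasFDerivAt_comp_snd (hasDerivAt_id _)
  deriv31 := fun q _ => by
    rw [zero_smul]; exact hasFDerivAt_const _ _
  deriv12 := fun q _ => by
    rw [zero_smul]; exact hasFDerivAt_const _ _
  deriv22 := fun q _ => hasFDerivAt_comp_fst (Real.hasDerivAt_exp _)
  deriv32 := fun q _ => hasFDerivAt_comp_fst (Real.hasDerivAt_exp _)
  struct₁ := fun z₀ z₁ _ => by simp only [zeroForms]; ring
  struct₂ := fun z₀ z₁ _ => by simp only [zeroForms]; ring
  struct₃ := fun z₀ z₁ _ => by simp only [zeroForms]; ring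
  g_ne := fun _ _ _ => Or.inl one_ne_zero

theorem zeroForms_area (η z₀ z₁ : ℝ) : (zeroForms η).area z₀ z₁ = z₁ * Real.exp z₀ := by
  simp [Forms.area, zeroForms]

theorem describes_zero (η : ℝ) : Describes η (fun _ _ => 0) Set.univ (zeroForms η) :=
  (zeroCalculus η).describes ⟨(0, 1), trivial, by simp [zeroForms_area]⟩

/-- Here `f32 = p32 = e^u`, so the third alternative of the obstruction holds even with `m = k = 0`,
and the mixed derivative contains `-e^u`. -/
theorem not_hasFiniteJetForm_zero {η : ℝ} (hη : η ≠ 0) :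
    ¬ HasFiniteJetForm (fun _ _ => 0) Set.univ (zeroForms η) := by
  refine (zeroCalculus η).not_hasFiniteJetForm hη ?_ ?_ ?_ (fun _ _ _ => rfl) (fun _ _ _ => rfl) ?_
  · rintro O hO ⟨q, hq⟩ -
    exact ⟨q, hq, Or.inr (Or.inl (Real.exp_ne_zero _))⟩
  · rintro O hO ⟨q, hq⟩ hr
    refine ⟨q, hq, Or.inr (Or.inr ⟨fun _ _ _ => rfl, fun _ _ _ => rfl, 0, 0, ?_, ?_, ?_⟩)⟩
    · simpa using hasDerivAt_const q.2 (0 : ℝ)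
    · exact hasDerivAt_const _ _
    · have h := (hr q hq).2
      rw [zeroForms_area] at h
      have e := Real.exp_ne_zero q.1
      simp only [mul_zero, zero_add]
      refine mul_ne_zero (mul_ne_zero e e) ?_
      simpa [zeroForms] using h
  · rintro O hO ⟨q, hq⟩ -
    exact ⟨q, hq, one_ne_zero⟩
  · intro z₀ z₁ _ _
    left
    simp [zeroCalculus]

/-- The differential data of the forms of `u_{xt} = lam u + ξ u_x + τ`. -/
noncomputable def linCalculus {lam ξ τ η T s : ℝ} (hη : η ≠ 0) (hlam : lam ≠ 0) (hT : T ≠ 0)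
    (hs : s ^ 2 = 1) : FormCalculus η (linRHS lam ξ τ) Set.univ (linForms lam ξ τ η T s) where
  g11 := fun _ _ => s * (η * T / lam)
  g31 := fun _ _ => η * T / lam
  p12 := fun _ _ => T
  p22 := fun _ _ => 0
  p32 := fun _ _ => s * T
  isOpen := isOpen_univ
  smooth_F := (((contDiff_const.mul contDiff_fst).add (contDiff_const.mul contDiff_snd)).add
    contDiff_const).contDiffOn
  f21_eq := fun _ _ => rfl
  smooth11 := (contDiff_const.mul ((contDiff_const.mul contDiff_snd).div_const _)).contDiffOn
  smooth12 := ((contDiff_const.mul contDiff_fst).add contDiff_const).contDiffOn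
  smooth22 := contDiffOn_const
  smooth31 := ((contDiff_const.mul contDiff_snd).div_const _).contDiffOn
  smooth32 := (contDiff_const.mul ((contDiff_const.mul contDiff_fst).add
    contDiff_const)).contDiffOn
  deriv11 := fun q _ => by
    refine hasFDerivAt_comp_snd (f := fun z => s * (η * T * z / lam)) ?_
    simpa using (((hasDerivAt_id q.2).const_mul (η * T)).div_const lam).const_mul s
  deriv31 := fun q _ => by
    refine hasFDerivAt_comp_snd (f := fun z => η * T * z / lam) ?_
    simpa using ((hasDerivAt_id q.2).const_mul (η * T)).div_const lam
  deriv12 := fun q _ => by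
    refine hasFDerivAt_comp_fst (f := fun z => T * z + τ * T / lam) ?_
    simpa using ((hasDerivAt_id q.1).const_mul T).add_const (τ * T / lam)
  deriv22 := fun q _ => by
    rw [zero_smul]; exact hasFDerivAt_const _ _
  deriv32 := fun q _ => by
    refine hasFDerivAt_comp_fst (f := fun z => s * (T * z + τ * T / lam)) ?_
    simpa using (((hasDerivAt_id q.1).const_mul T).add_const (τ * T / lam)).const_mul s
  struct₁ := fun z₀ z₁ _ => by simp only [linForms, linRHS]; field_simp; ring
  struct₂ := fun z₀ z₁ _ => by
    simp only [linForms]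
    linear_combination -(η * T * z₁ / lam) * (T * z₀ + τ * T / lam) * hs
  struct₃ := fun z₀ z₁ _ => by
    simp only [linForms, linRHS]; field_simp; linear_combination η * z₁ * ξ * hs
  g_ne := fun _ _ _ => Or.inr (div_ne_zero (mul_ne_zero hη hT) hlam)

theorem linForms_nondegenerate {lam ξ τ η T s : ℝ} (hη : η ≠ 0) (hT : T ≠ 0) :
    ∃ q ∈ (Set.univ : Set (ℝ × ℝ)), (linForms lam ξ τ η T s).area q.1 q.2 ≠ 0 := by
  refine ⟨(1 - τ / lam, 0), trivial, ?_⟩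
  have : (linForms lam ξ τ η T s).area (1 - τ / lam) 0 = -(T * η) := by
    simp only [Forms.area, linForms]
    ring
  rw [this]
  exact neg_ne_zero.2 (mul_ne_zero hT hη)

/-- Since `s² = 1`, the forms are proportional with factor `s`, and `f22` is a constant `r`. For `r
≠ 0` the Wronskian `r T` is the obstruction; for `r = 0` it is the second alternative, at points
where `f32 ≠ 0`. -/
theorem areUniversal_lin {lam ξ τ η T s : ℝ} (hη : η ≠ 0) (hlam : lam ≠ 0) (hT : T ≠ 0)
    (hs : s ^ 2 = 1) {n : ℕ} {D : Set (Jet (n + 1))} {a b c : Jet (n + 1) → ℝ}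
    (hD : IsJetSecondForm (linRHS lam ξ τ) Set.univ (linForms lam ξ τ η T s) n D a b c) :
    AreUniversal D a b c := by
  have hs0 : s ≠ 0 := by rintro rfl; norm_num at hs
  have hgen : Generic Set.univ (linForms lam ξ τ η T s)
      fun z₀ z₁ => (linForms lam ξ τ η T s).f32 z₀ z₁ ≠ 0 := by
    rintro O hO ⟨q, hq⟩ -
    have h : HasDerivAt (fun z => s * (T * z + τ * T / lam)) (s * T) q.1 := by
      simpa using (((hasDerivAt_id q.1).const_mul T).add_const (τ * T / lam)).const_mul s
    obtain ⟨z, h1, h2⟩ := exists_fst_wiggle hO hq (h.eventually_ne (c := 0) (mul_ne_zero hs0 hT))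
    exact ⟨_, h1, h2⟩
  refine (linCalculus hη hlam hT hs).areUniversal_of_proportional hη ?_ ?_
    (fun _ _ => mul_ne_zero hs0 (div_ne_zero (mul_ne_zero hη hT) hlam)) (r := lam / η - s * ξ) hs
    (fun z₀ z₁ => ?_) (fun _ _ => ?_) (fun _ _ => rfl) (fun _ _ => rfl) (fun _ _ => rfl)
    (fun _ _ => rfl) (Or.inl fun _ _ => hT) hD
  · intro O hO hne hr
    obtain ⟨q, hq, h⟩ := hgen O hO hne hr
    exact ⟨q, hq, Or.inr (Or.inl h)⟩
  · intro O hO hne hr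
    obtain ⟨q, hq, h⟩ := hgen O hO hne hr
    refine ⟨q, hq, ?_⟩
    by_cases hr0 : lam / η - s * ξ = 0
    · exact Or.inr (Or.inl ⟨fun _ _ => hr0, h⟩)
    · left
      simpa [linCalculus, linForms, hT] using hr0
  · simp only [linForms]
    linear_combination -(η * T * z₁ / lam) * hs
  · simp only [linCalculus]
    linear_combination -(η * T / lam) * hs

theorem existence_lin {lam ξ τ η T s : ℝ} (hη : η ≠ 0) (hlam : lam ≠ 0) (hT : T ≠ 0)
    (hs : s ^ 2 = 1) :
    HasFiniteJetFormNearEveryJet (linRHS lam ξ τ) Set.univ (linForms lam ξ τ η T s) :=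
  (linCalculus hη hlam hT hs).existence_of_proportional (s := s)
    (fun z₀ z₁ => by simp only [linForms]; linear_combination -(η * T * z₁ / lam) * hs)
    (fun _ _ => rfl) (fun _ _ => rfl)

/-- The differential data of the forms of `u_{xt} = ξ u_x + τ`. -/
noncomputable def primitiveCalculus {ξ τ η : ℝ} (hη : η ≠ 0) {G : ℝ → ℝ}
    (hG : ∀ z, ξ * z + τ ≠ 0 → HasDerivAt G (1 / (ξ * z + τ)) z) :
    FormCalculus η (linRHS 0 ξ τ) {q | ξ * q.2 + τ ≠ 0} (primitiveForms η G) :=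
  have hO : IsOpen {z : ℝ | ξ * z + τ ≠ 0} :=
    isOpen_compl_singleton.preimage (f := fun z : ℝ => ξ * z + τ) (by fun_prop)
  have sG : ContDiffOn ℝ (⊤ : ℕ∞) G {z | ξ * z + τ ≠ 0} := by
    refine (contDiffOn_infty_iff_deriv_of_isOpen hO).2
      ⟨fun z hz => (hG z hz).differentiableAt.differentiableWithinAt, ?_⟩
    refine ContDiffOn.congr (f := fun z => 1 / (ξ * z + τ)) ?_ fun z hz => (hG z hz).deriv
    exact contDiffOn_const.div ((contDiff_const.mul contDiff_id).add contDiff_const).contDiffOn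
      fun z hz => hz
  have sG' : ContDiffOn ℝ (⊤ : ℕ∞) (fun q : ℝ × ℝ => G q.2) {q | ξ * q.2 + τ ≠ 0} :=
    sG.comp contDiff_snd.contDiffOn fun q hq => hq
  { g11 := fun _ z₁ => 1 / (ξ * z₁ + τ)
    g31 := fun _ z₁ => 1 / (ξ * z₁ + τ)
    p12 := fun _ _ => 0
    p22 := fun _ _ => 0
    p32 := fun _ _ => 0
    isOpen := hO.preimage continuous_snd
    smooth_F := (((contDiff_const.mul contDiff_fst).add (contDiff_const.mul contDiff_snd)).add
      contDiff_const).contDiffOn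
    f21_eq := fun _ _ => rfl
    smooth11 := sG'
    smooth12 := contDiffOn_const
    smooth22 := contDiffOn_const
    smooth31 := sG'
    smooth32 := contDiffOn_const
    deriv11 := fun q hq => hasFDerivAt_comp_snd (hG q.2 hq)
    deriv31 := fun q hq => hasFDerivAt_comp_snd (hG q.2 hq)
    deriv12 := fun q _ => by
      rw [zero_smul]; exact hasFDerivAt_const _ _
    deriv22 := fun q _ => by
      rw [zero_smul]; exact hasFDerivAt_const _ _
    deriv32 := fun q _ => by
      rw [zero_smul]; exact hasFDerivAt_const _ _
    struct₁ := fun z₀ z₁ hz => by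
      have hz' : ξ * z₁ + τ ≠ 0 := hz
      simp only [primitiveForms, linRHS, zero_mul, zero_add]
      rw [one_div_mul_cancel hz', one_div_mul_cancel hη]
      ring
    struct₂ := fun z₀ z₁ _ => by simp only [primitiveForms]; ring
    struct₃ := fun z₀ z₁ hz => by
      have hz' : ξ * z₁ + τ ≠ 0 := hz
      simp only [primitiveForms, linRHS, zero_mul, zero_add]
      rw [one_div_mul_cancel hz', one_div_mul_cancel hη]
      ring
    g_ne := fun z₀ z₁ hz => Or.inl (one_div_ne_zero hz) }

theorem primitiveForms_nondegenerate {ξ τ η : ℝ} (hη : η ≠ 0) (h : ¬ (ξ = 0 ∧ τ = 0))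
    (G : ℝ → ℝ) : ∃ q ∈ {q : ℝ × ℝ | ξ * q.2 + τ ≠ 0}, (primitiveForms η G).area q.1 q.2 ≠ 0 := by
  have hA : ∀ z₀ z₁, (primitiveForms η G).area z₀ z₁ ≠ 0 := fun z₀ z₁ => by
    simp [Forms.area, primitiveForms, hη]
  by_cases h0 : ξ = 0
  · refine ⟨(0, 0), ?_, hA _ _⟩
    simpa [h0] using h
  · refine ⟨(0, (1 - τ) / ξ), ?_, hA _ _⟩
    simp only [Set.mem_ofPred_eq]
    field_simp
    simp

/-- Here `f22 = 0` and `f32 = 1/η`, so the second alternative of the obstruction holds everywhere.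
As `p12 = 0`, the proportional case is used in its branch `r = 0`. -/
theorem areUniversal_primitive {ξ τ η : ℝ} (hη : η ≠ 0) {G : ℝ → ℝ}
    (hG : ∀ z, ξ * z + τ ≠ 0 → HasDerivAt G (1 / (ξ * z + τ)) z) {n : ℕ} {D : Set (Jet (n + 1))}
    {a b c : Jet (n + 1) → ℝ}
    (hD : IsJetSecondForm (linRHS 0 ξ τ) {q | ξ * q.2 + τ ≠ 0} (primitiveForms η G) n D a b c) :
    AreUniversal D a b c := by
  refine (primitiveCalculus hη hG).areUniversal_of_proportional hη ?_ ?_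
    (fun q hq => one_div_ne_zero hq) (s := 1) (r := 0) (one_pow 2) (fun _ _ => (one_mul _).symm)
    (fun _ _ => (one_mul _).symm) (fun _ _ => (one_mul _).symm) (fun _ _ => (one_mul _).symm)
    (fun _ _ => rfl) (fun _ _ => rfl) (Or.inr rfl) hD
  · rintro O hO ⟨q, hq⟩ -
    exact ⟨q, hq, Or.inr (Or.inl (one_div_ne_zero hη))⟩
  · rintro O hO ⟨q, hq⟩ -
    exact ⟨q, hq, Or.inr (Or.inl ⟨fun _ _ => rfl, one_div_ne_zero hη⟩)⟩

theorem existence_primitive {ξ τ η : ℝ} (hη : η ≠ 0) {G : ℝ → ℝ}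
    (hG : ∀ z, ξ * z + τ ≠ 0 → HasDerivAt G (1 / (ξ * z + τ)) z) :
    HasFiniteJetFormNearEveryJet (linRHS 0 ξ τ) {q | ξ * q.2 + τ ≠ 0} (primitiveForms η G) :=
  (primitiveCalculus hη hG).existence_of_proportional (s := 1) (fun _ _ => (one_mul _).symm)
    (fun _ _ => (one_mul _).symm) (fun _ _ => rfl)

end Linear

/-! ### The exponential equations with γ ≠ 1 -/

section Exponential

open Filter Topology

variable {η ν δ β γ A B s : ℝ}

theorem isOpen_expDomain (β γ : ℝ) : IsOpen (expDomain β γ) :=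
  isOpen_Ioi.preimage (f := fun q : ℝ × ℝ => β + γ * q.2 ^ 2) (by fun_prop)

theorem contDiffOn_sqrt (β γ : ℝ) :
    ContDiffOn ℝ (⊤ : ℕ∞) (fun q : ℝ × ℝ => √(β + γ * q.2 ^ 2)) (expDomain β γ) := fun _ hq =>
  ((contDiff_const.add (contDiff_const.mul (contDiff_snd.pow 2))).contDiffAt.sqrt
    (ne_of_gt hq)).contDiffWithinAt

theorem hasDerivAt_sqrt {z : ℝ} (hz : 0 < β + γ * z ^ 2) :
    HasDerivAt (fun z => √(β + γ * z ^ 2)) (γ * z / √(β + γ * z ^ 2)) z := by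
  refine ((((hasDerivAt_pow 2 z).const_mul γ).const_add β).sqrt hz.ne').congr_deriv ?_
  have := (Real.sqrt_pos.2 hz).ne'
  field_simp
  norm_num

theorem contDiff_exp_fst (ν δ : ℝ) :
    ContDiff ℝ (⊤ : ℕ∞) fun q : ℝ × ℝ => ν * Real.exp (δ * q.1) :=
  contDiff_const.mul (Real.contDiff_exp.comp (contDiff_const.mul contDiff_fst))

theorem hasDerivAt_const_mul_exp (ν δ z : ℝ) :
    HasDerivAt (fun z => ν * Real.exp (δ * z)) (δ * (ν * Real.exp (δ * z))) z := by
  refine ((((hasDerivAt_id z).const_mul δ).exp).const_mul ν).congr_deriv ?_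
  simp only [id]
  ring

theorem smooth_expRHS (ν δ β γ : ℝ) :
    ContDiffOn ℝ (⊤ : ℕ∞) (fun q : ℝ × ℝ => expRHS ν δ β γ q.1 q.2) (expDomain β γ) :=
  (contDiff_exp_fst ν δ).contDiffOn.mul (contDiffOn_sqrt β γ)

theorem expRHS_ne_zero (hν : ν ≠ 0) {q : ℝ × ℝ} (hq : q ∈ expDomain β γ) :
    expRHS ν δ β γ q.1 q.2 ≠ 0 :=
  mul_ne_zero (mul_ne_zero hν (Real.exp_ne_zero _)) (Real.sqrt_pos.2 hq).ne'

theorem exists_snd_wiggle {O : Set (ℝ × ℝ)} (hO : IsOpen O) {q : ℝ × ℝ} (hq : q ∈ O)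
    {P : ℝ → Prop} (hP : ∀ᶠ s in 𝓝[≠] q.2, P s) : ∃ s, (q.1, s) ∈ O ∧ P s := by
  have hc : Continuous fun s : ℝ => (q.1, s) := by fun_prop
  have : ∀ᶠ s in 𝓝[≠] q.2, (q.1, s) ∈ O :=
    eventually_nhdsWithin_of_eventually_nhds (hc.continuousAt.preimage_mem_nhds (hO.mem_nhds hq))
  exact (this.and hP).exists

/-- The differential data of the forms of `u_{xt} = ν e^{δ u} √(β + γ u_x²)`, `γ ≠ 1`. -/
noncomputable def expCalculus (η ν : ℝ) (β : ℝ) (hδ : δ ≠ 0) (hs : s ^ 2 = 1) (hγ : γ ≠ 1)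
    (hAB : A ^ 2 - B ^ 2 = (γ - 1) / δ ^ 2) :
    FormCalculus η (expRHS ν δ β γ) (expDomain β γ) (expForms ν δ β γ η A B s) where
  g11 := fun _ z₁ => -(δ ^ 2 / (γ - 1) * (B - s * A * (γ * z₁ / √(β + γ * z₁ ^ 2))))
  g31 := fun _ z₁ => -(δ ^ 2 / (γ - 1) * (A - s * B * (γ * z₁ / √(β + γ * z₁ ^ 2))))
  p12 := fun z₀ _ => s * (A * δ) * (δ * (ν * Real.exp (δ * z₀)))
  p22 := fun z₀ _ => s * (δ * (ν * Real.exp (δ * z₀)))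
  p32 := fun z₀ _ => s * (B * δ) * (δ * (ν * Real.exp (δ * z₀)))
  isOpen := isOpen_expDomain β γ
  smooth_F := smooth_expRHS ν δ β γ
  f21_eq := fun _ _ => rfl
  smooth11 := contDiffOn_const.sub ((((contDiff_const.mul contDiff_snd).contDiffOn.sub
    (contDiffOn_const.mul (contDiffOn_sqrt β γ))).mul contDiffOn_const).div_const _)
  smooth12 := (contDiff_const.mul (contDiff_exp_fst (A * δ * ν) δ)).contDiffOn
  smooth22 := (contDiff_const.mul (contDiff_exp_fst ν δ)).contDiffOn
  smooth31 := contDiffOn_const.sub ((((contDiff_const.mul contDiff_snd).contDiffOn.sub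
    (contDiffOn_const.mul (contDiffOn_sqrt β γ))).mul contDiffOn_const).div_const _)
  smooth32 := (contDiff_const.mul (contDiff_exp_fst (B * δ * ν) δ)).contDiffOn
  deriv11 := fun q hq => hasFDerivAt_comp_snd
    (f := fun z => η * A * δ - (B * z - s * A * √(β + γ * z ^ 2)) * δ ^ 2 / (γ - 1)) <| by
    refine ((((((hasDerivAt_id q.2).const_mul B).sub ((hasDerivAt_sqrt hq).const_mul
      (s * A))).mul_const (δ ^ 2)).div_const (γ - 1)).const_sub (η * A * δ)).congr_deriv ?_
    ring
  deriv31 := fun q hq => hasFDerivAt_comp_snd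
    (f := fun z => η * B * δ - (A * z - s * B * √(β + γ * z ^ 2)) * δ ^ 2 / (γ - 1)) <| by
    refine ((((((hasDerivAt_id q.2).const_mul A).sub ((hasDerivAt_sqrt hq).const_mul
      (s * B))).mul_const (δ ^ 2)).div_const (γ - 1)).const_sub (η * B * δ)).congr_deriv ?_
    ring
  deriv12 := fun q _ => hasFDerivAt_comp_fst
    (f := fun z => s * (A * δ * ν * Real.exp (δ * z))) <| by
    refine ((hasDerivAt_const_mul_exp (A * δ * ν) δ q.1).const_mul s).congr_deriv ?_
    ring
  deriv22 := fun q _ => hasFDerivAt_comp_fst ((hasDerivAt_const_mul_exp ν δ q.1).const_mul s)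
  deriv32 := fun q _ => hasFDerivAt_comp_fst
    (f := fun z => s * (B * δ * ν * Real.exp (δ * z))) <| by
    refine ((hasDerivAt_const_mul_exp (B * δ * ν) δ q.1).const_mul s).congr_deriv ?_
    ring
  struct₁ := fun z₀ z₁ hz => by
    have hR := (Real.sqrt_pos.2 hz).ne'
    have hγ' : γ - 1 ≠ 0 := sub_ne_zero.2 hγ
    simp only [expForms, expRHS] at hR ⊢
    generalize √(β + γ * z₁ ^ 2) = R at hR ⊢
    field_simp
    linear_combination -(δ * ν * B * R) * hs
  struct₂ := fun z₀ z₁ _ => by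
    have hγ' : γ - 1 ≠ 0 := sub_ne_zero.2 hγ
    have e : δ ^ 2 / (γ - 1) * (A ^ 2 - B ^ 2) = 1 := by rw [hAB]; field_simp
    simp only [expForms]
    linear_combination -(s * δ * ν * Real.exp (δ * z₀) * z₁) * e
  struct₃ := fun z₀ z₁ hz => by
    have hR := (Real.sqrt_pos.2 hz).ne'
    have hγ' : γ - 1 ≠ 0 := sub_ne_zero.2 hγ
    simp only [expForms, expRHS] at hR ⊢
    generalize √(β + γ * z₁ ^ 2) = R at hR ⊢
    field_simp
    linear_combination -(δ * ν * A * R) * hs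
  g_ne := fun z₀ z₁ _ => by
    have hγ' : γ - 1 ≠ 0 := sub_ne_zero.2 hγ
    have hκ : δ ^ 2 / (γ - 1) ≠ 0 := div_ne_zero (pow_ne_zero 2 hδ) hγ'
    by_contra! hc
    obtain ⟨h1, h2⟩ := hc
    have h1' := (mul_eq_zero.1 (neg_eq_zero.1 h1)).resolve_left hκ
    have h2' := (mul_eq_zero.1 (neg_eq_zero.1 h2)).resolve_left hκ
    have : A ^ 2 - B ^ 2 = 0 := by linear_combination A * h2' - B * h1'
    rw [this] at hAB
    exact div_ne_zero hγ' (pow_ne_zero 2 hδ) hAB.symm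

theorem expForms_area (z₀ z₁ : ℝ) : (expForms ν δ β γ η A B s).area z₀ z₁ =
    -(δ ^ 2 / (γ - 1) * s * (ν * Real.exp (δ * z₀)) * (B * z₁ - s * A * √(β + γ * z₁ ^ 2))) := by
  simp only [Forms.area, expForms]
  ring

theorem expForms_nondegenerate (hν : ν ≠ 0) (hδ : δ ≠ 0) (hs : s ^ 2 = 1) (hγ : γ ≠ 1)
    (hAB : A ^ 2 - B ^ 2 = (γ - 1) / δ ^ 2) (hU : (expDomain β γ).Nonempty) :
    ∃ q ∈ expDomain β γ, (expForms ν δ β γ η A B s).area q.1 q.2 ≠ 0 := by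
  have hs0 : s ≠ 0 := by rintro rfl; norm_num at hs
  have hγ' : γ - 1 ≠ 0 := sub_ne_zero.2 hγ
  obtain ⟨q, hq⟩ := hU
  obtain ⟨z, hz, hz0⟩ := exists_snd_wiggle (isOpen_expDomain β γ) hq
    ((hasDerivAt_id q.2).eventually_ne (c := 0) one_ne_zero)
  have hz0' : z ≠ 0 := hz0
  have hz' : 0 < β + γ * z ^ 2 := hz
  have hR := Real.sqrt_pos.2 hz'
  by_contra! hc
  have key : ∀ w, (q.1, w) ∈ expDomain β γ → B * w - s * A * √(β + γ * w ^ 2) = 0 := by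
    intro w hw
    have := hc _ hw
    rw [expForms_area, neg_eq_zero] at this
    exact (mul_eq_zero.1 this).resolve_left (mul_ne_zero (mul_ne_zero
      (div_ne_zero (pow_ne_zero 2 hδ) hγ') hs0) (mul_ne_zero hν (Real.exp_ne_zero _)))
  -- The domain is symmetric under `z ↦ -z`, so the odd part `B z` and the even part `s A √(β + γ
  -- z²)` vanish separately. With `z ≠ 0` this gives `A = B = 0`, against `γ ≠ 1`.
  have k1 := key z hz
  have k2 := key (-z) (show 0 < β + γ * (-z) ^ 2 by rwa [neg_sq])
  rw [neg_sq] at k2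
  have hB : B = 0 := by
    have : B * z = 0 := by linarith
    exact (mul_eq_zero.1 this).resolve_right hz0'
  have hA : A = 0 := by
    have : s * A * √(β + γ * z ^ 2) = 0 := by linarith
    exact (mul_eq_zero.1 ((mul_eq_zero.1 this).resolve_right hR.ne')).resolve_left hs0
  rw [hA, hB] at hAB
  exact div_ne_zero hγ' (pow_ne_zero 2 hδ) (by rw [← hAB]; ring)

/-- With `κ = δ²/(γ - 1)`, `E = ν e^{δu}` and `R = √(β + γ u_x²)`, the third obstruction is `-s δ κ
E³ (B u_x - s A R) (γ + B² δ²)`. The relation between `A` and `B` makes the last factor `1 + A² δ² >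
0`, and `B u_x - s A R` is the area up to a nonzero factor. The mixed derivative contains `-s δ² E`.
-/
theorem not_hasFiniteJetForm_exp (hη : η ≠ 0) (hν : ν ≠ 0) (hδ : δ ≠ 0) (hγ0 : γ ≠ 0)
    (hs : s ^ 2 = 1) (hγ : γ ≠ 1) (hAB : A ^ 2 - B ^ 2 = (γ - 1) / δ ^ 2) :
    ¬ HasFiniteJetForm (expRHS ν δ β γ) (expDomain β γ) (expForms ν δ β γ η A B s) := by
  have hs0 : s ≠ 0 := by rintro rfl; norm_num at hs
  have hγ' : γ - 1 ≠ 0 := sub_ne_zero.2 hγ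
  have hκ : δ ^ 2 / (γ - 1) ≠ 0 := div_ne_zero (pow_ne_zero 2 hδ) hγ'
  have e : δ ^ 2 / (γ - 1) * (A ^ 2 - B ^ 2) = 1 := by rw [hAB]; field_simp
  have hE : ∀ z₀, ν * Real.exp (δ * z₀) ≠ 0 := fun z₀ => mul_ne_zero hν (Real.exp_ne_zero _)
  have hAne : ∀ z₀ z₁, (expForms ν δ β γ η A B s).area z₀ z₁ ≠ 0 →
      B * z₁ - s * A * √(β + γ * z₁ ^ 2) ≠ 0 := fun z₀ z₁ h h0 => h (by
    rw [expForms_area, h0, mul_zero, neg_zero])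
  refine (expCalculus η ν β hδ hs hγ hAB).not_hasFiniteJetForm hη ?_ ?_ ?_ (fun _ _ _ => rfl)
    (fun _ _ _ => rfl) ?_
  · rintro O hO ⟨q, hq⟩ hr
    exact ⟨q, hq, Or.inl (expRHS_ne_zero hν (hr q hq).1)⟩
  · rintro O hO ⟨q, hq⟩ hr
    have hU : 0 < β + γ * q.2 ^ 2 := (hr q hq).1
    have hR := (Real.sqrt_pos.2 hU).ne'
    refine ⟨q, hq, Or.inr (Or.inr ⟨fun _ _ _ => rfl, fun _ _ _ => rfl,
      -(δ ^ 2 / (γ - 1)) * (ν * Real.exp (δ * q.1)) *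
        (B * (γ * q.2 / √(β + γ * q.2 ^ 2)) - s * A * γ),
      δ * (ν * Real.exp (δ * q.1)) * √(β + γ * q.2 ^ 2), ?_, ?_, ?_⟩)⟩
    · have h : HasDerivAt (fun z => -(δ ^ 2 / (γ - 1)) * (ν * Real.exp (δ * q.1)) *
          (B * √(β + γ * z ^ 2) - s * A * γ * z)) (-(δ ^ 2 / (γ - 1)) * (ν * Real.exp (δ * q.1)) *
          (B * (γ * q.2 / √(β + γ * q.2 ^ 2)) - s * A * γ)) q.2 := by
        refine ((((hasDerivAt_sqrt hU).const_mul B).sub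
          ((hasDerivAt_id q.2).const_mul (s * A * γ))).const_mul
            (-(δ ^ 2 / (γ - 1)) * (ν * Real.exp (δ * q.1)))).congr_deriv ?_
        ring
      refine h.congr_of_eventuallyEq ?_
      have hc : Continuous fun z : ℝ => β + γ * z ^ 2 := by fun_prop
      filter_upwards [(isOpen_Ioi.preimage hc).mem_nhds hU] with z hz
      have hRz := (Real.sqrt_pos.2 hz).ne'
      simp only [expCalculus, expRHS]
      generalize √(β + γ * z ^ 2) = R at hRz ⊢
      field_simp
    · exact (hasDerivAt_const_mul_exp ν δ q.1).mul_const _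
    · have h0 := hAne _ _ (hr q hq).2
      have e' : A ^ 2 * δ ^ 2 = B ^ 2 * δ ^ 2 + γ - 1 := by
        field_simp at e
        linear_combination e
      have hpos : 1 + A ^ 2 * δ ^ 2 ≠ 0 := by positivity
      have : (expForms ν δ β γ η A B s).f11 q.1 q.2 * (expForms ν δ β γ η A B s).f22 q.1 q.2 -
          (expForms ν δ β γ η A B s).f12 q.1 q.2 * η =
            (expForms ν δ β γ η A B s).area q.1 q.2 := rfl
      rw [this, expForms_area]
      have key : s * δ * (ν * Real.exp (δ * q.1)) ^ 3 * (δ ^ 2 / (γ - 1)) *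
          (B * q.2 - s * A * √(β + γ * q.2 ^ 2)) * (1 + A ^ 2 * δ ^ 2) ≠ 0 :=
        mul_ne_zero (mul_ne_zero (mul_ne_zero (mul_ne_zero (mul_ne_zero hs0 hδ)
          (pow_ne_zero 3 (hE _))) hκ) h0) hpos
      intro hzero
      apply key
      simp only [expForms, expCalculus] at hzero
      generalize √(β + γ * q.2 ^ 2) = R at hR hzero ⊢
      generalize δ ^ 2 / (γ - 1) = κ at hzero ⊢
      have hdiv : B * (γ * q.2 / R) * R = B * (γ * q.2) := by field_simp
      linear_combination -hzero - s * κ * δ * (ν * Real.exp (δ * q.1)) ^ 3 * hdiv +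
        s * δ * (ν * Real.exp (δ * q.1)) ^ 3 * κ * (B * q.2 - s * A * R) * e' -
        κ * s * B ^ 2 * δ ^ 3 * (ν * Real.exp (δ * q.1)) ^ 3 * (B * q.2 - s * A * R) * hs
  · rintro O hO ⟨q, hq⟩ hr
    have hU : 0 < β + γ * q.2 ^ 2 := (hr q hq).1
    have hR := (Real.sqrt_pos.2 hU).ne'
    -- Up to nonzero factors `g11` is this function divided by the square root. Its derivative is
    -- `γ/√(β + γ u_x²)` times a factor of the area, hence nonzero as `γ ≠ 0`, so `g11` is nonzero
    -- at nearby points.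
    have hφ : HasDerivAt (fun z => B * √(β + γ * z ^ 2) - s * A * γ * z)
        (B * (γ * q.2 / √(β + γ * q.2 ^ 2)) - s * A * γ) q.2 := by
      refine (((hasDerivAt_sqrt hU).const_mul B).sub
        ((hasDerivAt_id q.2).const_mul (s * A * γ))).congr_deriv ?_
      ring
    have hφ' : B * (γ * q.2 / √(β + γ * q.2 ^ 2)) - s * A * γ ≠ 0 := by
      have : B * (γ * q.2 / √(β + γ * q.2 ^ 2)) - s * A * γ =
          γ / √(β + γ * q.2 ^ 2) * (B * q.2 - s * A * √(β + γ * q.2 ^ 2)) := by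
        generalize √(β + γ * q.2 ^ 2) = R at hR ⊢
        field_simp
      rw [this]
      exact mul_ne_zero (div_ne_zero hγ0 hR) (hAne _ _ (hr q hq).2)
    obtain ⟨z, hz, hz'⟩ := exists_snd_wiggle hO hq (hφ.eventually_ne (c := 0) hφ')
    refine ⟨_, hz, ?_⟩
    have hRz := (Real.sqrt_pos.2 (hr _ hz).1).ne'
    simp only at hRz
    refine neg_ne_zero.2 (mul_ne_zero hκ fun h0 => hz' ?_)
    simp only at h0
    generalize √(β + γ * z ^ 2) = R at hRz h0 ⊢
    field_simp at h0
    linear_combination h0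
  · intro z₀ z₁ _ _
    left
    simp only [expCalculus]
    generalize γ * z₁ / √(β + γ * z₁ ^ 2) = w
    have : -(δ ^ 2 / (γ - 1) * (A - s * B * w)) * (s * (A * δ) * (δ * (ν * Real.exp (δ * z₀)))) -
        s * (B * δ) * (δ * (ν * Real.exp (δ * z₀))) * -(δ ^ 2 / (γ - 1) * (B - s * A * w)) =
        -(s * δ ^ 2 * (ν * Real.exp (δ * z₀))) := by
      linear_combination -(s * δ ^ 2 * (ν * Real.exp (δ * z₀))) * e
    rw [this]
    exact neg_ne_zero.2 (mul_ne_zero (mul_ne_zero hs0 (pow_ne_zero 2 hδ)) (hE _))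

end Exponential

/-! ### The exponential equation with γ = 1 -/

section ExponentialOne

open Filter Topology

variable {η ν δ A s : ℝ}

theorem mem_expDomain_one {q : ℝ × ℝ} : q ∈ expDomain 0 1 ↔ q.2 ≠ 0 := by
  simp [expDomain, sq_pos_iff]

theorem expRHS_one (ν δ z₀ z₁ : ℝ) : expRHS ν δ 0 1 z₀ z₁ = ν * Real.exp (δ * z₀) * |z₁| := by
  simp [expRHS, Real.sqrt_sq_eq_abs]

theorem sign_mul_abs (z : ℝ) : Real.sign z * |z| = z := by
  rcases lt_trichotomy z 0 with h | h | h
  · rw [Real.sign_of_neg h, abs_of_neg h]; ring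
  · simp [h]
  · rw [Real.sign_of_pos h, abs_of_pos h]; ring

theorem sign_sq {z : ℝ} (hz : z ≠ 0) : Real.sign z ^ 2 = 1 := by
  rcases hz.lt_or_gt with h | h
  · rw [Real.sign_of_neg h]; norm_num
  · rw [Real.sign_of_pos h]; norm_num

theorem real_sign_ne_zero {z : ℝ} (hz : z ≠ 0) : Real.sign z ≠ 0 := fun h => by
  simpa [h] using sign_sq hz

theorem eventually_sign_eq {z : ℝ} (hz : z ≠ 0) : ∀ᶠ w in 𝓝 z, Real.sign w = Real.sign z := by
  rcases hz.lt_or_gt with h | h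
  · filter_upwards [gt_mem_nhds h] with w hw
    rw [Real.sign_of_neg h, Real.sign_of_neg hw]
  · filter_upwards [lt_mem_nhds h] with w hw
    rw [Real.sign_of_pos h, Real.sign_of_pos hw]

theorem eventually_sign_snd {f : ℝ × ℝ → ℝ} {q : ℝ × ℝ} (hq : q ∈ expDomain 0 1) :
    (fun r : ℝ × ℝ => Real.sign r.2 * f r) =ᶠ[𝓝 q] fun r => Real.sign q.2 * f r := by
  filter_upwards [continuous_snd.continuousAt.eventually
    (eventually_sign_eq (mem_expDomain_one.1 hq))] with r hr
  rw [hr]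

theorem contDiffOn_sign_mul {f : ℝ × ℝ → ℝ} (hf : ContDiff ℝ (⊤ : ℕ∞) f) :
    ContDiffOn ℝ (⊤ : ℕ∞) (fun q : ℝ × ℝ => Real.sign q.2 * f q) (expDomain 0 1) := fun _ hq =>
  ((contDiff_const.mul hf).contDiffAt.congr_of_eventuallyEq
    (eventually_sign_snd hq)).contDiffWithinAt

theorem hasFDerivAt_sign_mul {f : ℝ → ℝ} {d : ℝ} {q : ℝ × ℝ} (hq : q ∈ expDomain 0 1)
    (hf : HasDerivAt f d q.1) : HasFDerivAt (fun q : ℝ × ℝ => Real.sign q.2 * f q.1)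
      ((Real.sign q.2 * d) • ContinuousLinearMap.fst ℝ ℝ ℝ) q :=
  (hasFDerivAt_comp_fst (hf.const_mul (Real.sign q.2))).congr_of_eventuallyEq
    (eventually_sign_snd (f := fun r => f r.1) hq)

/-- The differential data of the forms of `u_{xt} = ν e^{δ u} |u_x|`. -/
noncomputable def expOneCalculus (η ν δ : ℝ) (hs : s ^ 2 = 1) (hA : A ≠ 0) :
    FormCalculus η (expRHS ν δ 0 1) (expDomain 0 1) (expOneForms ν δ η A s) where
  g11 := fun _ _ => s * ((1 / A + δ ^ 2 * A) / 2)
  g31 := fun _ _ => (-(1 / A) + δ ^ 2 * A) / 2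
  p12 := fun z₀ z₁ => s * (Real.sign z₁ * (δ * (A * δ * ν * Real.exp (δ * z₀))))
  p22 := fun z₀ z₁ => s * (Real.sign z₁ * (δ * (ν * Real.exp (δ * z₀))))
  p32 := fun z₀ z₁ => Real.sign z₁ * (δ * (A * δ * ν * Real.exp (δ * z₀)))
  isOpen := isOpen_expDomain 0 1
  smooth_F := smooth_expRHS ν δ 0 1
  f21_eq := fun _ _ => rfl
  smooth11 := ((contDiff_const.mul (contDiff_const.mul contDiff_snd)).add
    contDiff_const).contDiffOn
  smooth12 := contDiffOn_const.mul (contDiffOn_sign_mul (contDiff_exp_fst (A * δ * ν) δ))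
  smooth22 := contDiffOn_const.mul (contDiffOn_sign_mul (contDiff_exp_fst ν δ))
  smooth31 := ((contDiff_const.mul contDiff_snd).add contDiff_const).contDiffOn
  smooth32 := contDiffOn_sign_mul (contDiff_exp_fst (A * δ * ν) δ)
  deriv11 := fun q _ => hasFDerivAt_comp_snd
    (f := fun z => s * ((1 / A + δ ^ 2 * A) / 2 * z) + η * δ * A) <| by
    simpa using (((hasDerivAt_id q.2).const_mul ((1 / A + δ ^ 2 * A) / 2)).const_mul s).add_const
      (η * δ * A)
  deriv31 := fun q _ => hasFDerivAt_comp_snd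
    (f := fun z => (-(1 / A) + δ ^ 2 * A) / 2 * z + s * (η * δ * A)) <| by
    simpa using ((hasDerivAt_id q.2).const_mul ((-(1 / A) + δ ^ 2 * A) / 2)).add_const
      (s * (η * δ * A))
  deriv12 := fun q hq => by
    have := (hasFDerivAt_sign_mul hq (hasDerivAt_const_mul_exp (A * δ * ν) δ q.1)).const_mul s
    rwa [smul_smul] at this
  deriv22 := fun q hq => by
    have := (hasFDerivAt_sign_mul hq (hasDerivAt_const_mul_exp ν δ q.1)).const_mul s
    rwa [smul_smul] at this
  deriv32 := fun q hq => hasFDerivAt_sign_mul hq (hasDerivAt_const_mul_exp (A * δ * ν) δ q.1)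
  struct₁ := fun z₀ z₁ hz => by
    have h1 := sign_sq (mem_expDomain_one.1 hz)
    have h2 := sign_mul_abs z₁
    simp only [expOneForms, expRHS_one] at h1 ⊢
    generalize Real.sign z₁ = σ at h1 h2 ⊢
    generalize |z₁| = w at h2 ⊢
    subst h2
    field_simp
    linear_combination (ν * s * w * (1 + δ ^ 2 * A ^ 2)) * h1 - 2 * σ * η * δ * A ^ 2 * ν * hs
  struct₂ := fun z₀ z₁ hz => by
    simp only [expOneForms]
    field_simp
    linear_combination 2 * Real.sign z₁ * δ ^ 2 * ν * A ^ 2 * η * hs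
  struct₃ := fun z₀ z₁ hz => by
    have h1 := sign_sq (mem_expDomain_one.1 hz)
    have h2 := sign_mul_abs z₁
    simp only [expOneForms, expRHS_one] at h1 ⊢
    generalize Real.sign z₁ = σ at h1 h2 ⊢
    generalize |z₁| = w at h2 ⊢
    subst h2
    field_simp
    linear_combination -(ν * w * σ ^ 2 * (1 + δ ^ 2 * A ^ 2)) * hs -
      ν * w * (1 - δ ^ 2 * A ^ 2) * h1
  g_ne := fun _ _ _ => by
    have hs0 : s ≠ 0 := by rintro rfl; norm_num at hs
    left
    have : (1 / A + δ ^ 2 * A) / 2 = (1 + δ ^ 2 * A ^ 2) / (2 * A) := by field_simp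
    rw [this]
    exact mul_ne_zero hs0 (div_ne_zero (by positivity) (by simpa using hA))

theorem expOneForms_area (hs : s ^ 2 = 1) (z₀ z₁ : ℝ) : (expOneForms ν δ η A s).area z₀ z₁ =
    Real.sign z₁ * (ν * Real.exp (δ * z₀)) * ((1 / A + δ ^ 2 * A) / 2) * z₁ := by
  simp only [Forms.area, expOneForms]
  linear_combination (1 / A + δ ^ 2 * A) / 2 * z₁ * Real.sign z₁ * ν * Real.exp (δ * z₀) * hs

theorem expOneForms_area_ne (hν : ν ≠ 0) (hs : s ^ 2 = 1) (hA : A ≠ 0) {z₀ z₁ : ℝ}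
    (hz : z₁ ≠ 0) : (expOneForms ν δ η A s).area z₀ z₁ ≠ 0 := by
  rw [expOneForms_area hs]
  have : (1 / A + δ ^ 2 * A) / 2 = (1 + δ ^ 2 * A ^ 2) / (2 * A) := by field_simp
  rw [this]
  exact mul_ne_zero (mul_ne_zero (mul_ne_zero (real_sign_ne_zero hz)
    (mul_ne_zero hν (Real.exp_ne_zero _))) (div_ne_zero (by positivity) (by simpa using hA))) hz

/-- On `u_x ≠ 0` the sign of `u_x` is locally constant and does not disturb the calculus. With `E =
ν e^{δu}` and `K = (1/A + δ² A)/2`, the third obstruction is `δ E³ K |u_x| (1 + A² δ²)`, and the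
mixed derivative contains `δ² E` up to sign. -/
theorem not_hasFiniteJetForm_expOne (hη : η ≠ 0) (hν : ν ≠ 0) (hδ : δ ≠ 0) (hs : s ^ 2 = 1)
    (hA : A ≠ 0) :
    ¬ HasFiniteJetForm (expRHS ν δ 0 1) (expDomain 0 1) (expOneForms ν δ η A s) := by
  have hs0 : s ≠ 0 := by rintro rfl; norm_num at hs
  have hE : ∀ z₀, ν * Real.exp (δ * z₀) ≠ 0 := fun z₀ => mul_ne_zero hν (Real.exp_ne_zero _)
  have hc : (1 / A + δ ^ 2 * A) / 2 ≠ 0 := by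
    have : (1 / A + δ ^ 2 * A) / 2 = (1 + δ ^ 2 * A ^ 2) / (2 * A) := by field_simp
    rw [this]
    exact div_ne_zero (by positivity) (by simpa using hA)
  refine (expOneCalculus η ν δ hs hA).not_hasFiniteJetForm hη ?_ ?_ ?_ (fun _ _ _ => rfl)
    (fun _ _ _ => rfl) ?_
  · rintro O hO ⟨q, hq⟩ hr
    exact ⟨q, hq, Or.inl (expRHS_ne_zero hν (hr q hq).1)⟩
  · rintro O hO ⟨q, hq⟩ hr
    have hz := mem_expDomain_one.1 (hr q hq).1
    refine ⟨q, hq, Or.inr (Or.inr ⟨fun _ _ _ => rfl, fun _ _ _ => rfl,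
      s * ((1 / A + δ ^ 2 * A) / 2) * (ν * Real.exp (δ * q.1) * Real.sign q.2),
      δ * (ν * Real.exp (δ * q.1)) * |q.2|, ?_, ?_, ?_⟩)⟩
    · have h : HasDerivAt (fun z => s * ((1 / A + δ ^ 2 * A) / 2) *
          (ν * Real.exp (δ * q.1) * (Real.sign q.2 * z)))
          (s * ((1 / A + δ ^ 2 * A) / 2) * (ν * Real.exp (δ * q.1) * Real.sign q.2)) q.2 := by
        simpa using (((hasDerivAt_id q.2).const_mul (Real.sign q.2)).const_mul
          (ν * Real.exp (δ * q.1))).const_mul (s * ((1 / A + δ ^ 2 * A) / 2))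
      refine h.congr_of_eventuallyEq ?_
      filter_upwards [eventually_sign_eq hz, continuousAt_id.eventually_ne hz] with z h1 h2
      have h3 := sign_mul_abs z
      have h4 := sign_sq h2
      rw [id, h1] at h4
      rw [h1] at h3
      simp only [expOneCalculus, expRHS_one]
      linear_combination s * ((1 / A + δ ^ 2 * A) / 2) * (ν * Real.exp (δ * q.1)) *
        (Real.sign q.2 * h3 - |z| * h4)
    · simp only [expRHS_one]
      exact (hasDerivAt_const_mul_exp ν δ q.1).mul_const _
    · have e : (expOneForms ν δ η A s).f11 q.1 q.2 * (expOneForms ν δ η A s).f22 q.1 q.2 -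
          (expOneForms ν δ η A s).f12 q.1 q.2 * η = (expOneForms ν δ η A s).area q.1 q.2 := rfl
      rw [e, expOneForms_area hs]
      have h1 := sign_sq hz
      have h2 := sign_mul_abs q.2
      have key : δ * (ν * Real.exp (δ * q.1)) ^ 3 * ((1 / A + δ ^ 2 * A) / 2) * |q.2| *
          (1 + A ^ 2 * δ ^ 2) ≠ 0 :=
        mul_ne_zero (mul_ne_zero (mul_ne_zero (mul_ne_zero hδ (pow_ne_zero 3 (hE _))) hc)
          (abs_ne_zero.2 hz)) (by positivity)
      intro hzero
      apply key
      simp only [expOneForms, expOneCalculus] at hzero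
      generalize hK : (1 / A + δ ^ 2 * A) / 2 = K at hzero ⊢
      generalize Real.sign q.2 = σ at h1 h2 hzero
      generalize |q.2| = w at h2 hzero ⊢
      generalize q.2 = z at h2 hzero
      subst h2
      linear_combination hzero - δ * (ν * Real.exp (δ * q.1)) ^ 3 * K * w * (s ^ 2 * h1 + hs) -
        A ^ 2 * δ ^ 3 * (ν * Real.exp (δ * q.1)) ^ 3 * K * w * (σ ^ 2 + 1) * h1
  · rintro O hO ⟨q, hq⟩ -
    exact ⟨q, hq, mul_ne_zero hs0 hc⟩
  · intro z₀ z₁ hz _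
    left
    have : (-(1 / A) + δ ^ 2 * A) / 2 * (s * (Real.sign z₁ * (δ * (A * δ * ν * Real.exp (δ * z₀)))))
        - Real.sign z₁ * (δ * (A * δ * ν * Real.exp (δ * z₀))) *
          (s * ((1 / A + δ ^ 2 * A) / 2)) =
        -(s * Real.sign z₁ * δ ^ 2 * (ν * Real.exp (δ * z₀))) := by
      field_simp
      ring
    simp only [expOneCalculus]
    rw [this]
    exact neg_ne_zero.2 (mul_ne_zero (mul_ne_zero (mul_ne_zero hs0
      (real_sign_ne_zero (mem_expDomain_one.1 hz))) (pow_ne_zero 2 hδ)) (hE _))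

end ExponentialOne

/-! ### Assembling the cases -/

theorem sq_eq_one_of_sign {s : ℝ} (hs : s = 1 ∨ s = -1) : s ^ 2 = 1 := by
  rcases hs with rfl | rfl <;> norm_num

theorem IsExp.describes_and_not_hasFiniteJetForm {η ν δ β γ : ℝ} (hη : η ≠ 0) {ω : Forms}
    (hν : ν ≠ 0) (hδ : δ ≠ 0) (hγ0 : γ ≠ 0)
    (hU : (expDomain β γ).Nonempty) (H : IsExp η ν δ β γ ω) :
    Describes η (expRHS ν δ β γ) (expDomain β γ) ω ∧
      ¬ HasFiniteJetForm (expRHS ν δ β γ) (expDomain β γ) ω := by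
  cases H with
  | gamma_ne_one A B s hs hγ hAB =>
    have hs := sq_eq_one_of_sign hs
    exact ⟨(expCalculus η ν β hδ hs hγ hAB).describes (expForms_nondegenerate hν hδ hs hγ hAB hU),
      not_hasFiniteJetForm_exp hη hν hδ hγ0 hs hγ hAB⟩
  | gamma_eq_one A s hs hγ hβ hA =>
    have hs := sq_eq_one_of_sign hs
    subst hγ hβ
    exact ⟨(expOneCalculus η ν δ hs hA).describes
      ⟨(0, 1), mem_expDomain_one.2 one_ne_zero, expOneForms_area_ne hν hs hA one_ne_zero⟩,
      not_hasFiniteJetForm_expOne hη hν hδ hs hA⟩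

theorem linRHS_zero : linRHS 0 0 0 = fun _ _ => 0 := by
  funext z₀ z₁
  simp [linRHS]

theorem IsLin.describes_and_universal {η lam ξ τ : ℝ} (hη : η ≠ 0) {U : Set (ℝ × ℝ)} {ω : Forms}
    (H : IsLin η lam ξ τ U ω) :
    Describes η (linRHS lam ξ τ) U ω ∧
      (HasFiniteJetForm (linRHS lam ξ τ) U ω ↔ ¬ (lam = 0 ∧ ξ = 0 ∧ τ = 0)) ∧
      (¬ (lam = 0 ∧ ξ = 0 ∧ τ = 0) → HasFiniteJetFormNearEveryJet (linRHS lam ξ τ) U ω) ∧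
      ∀ (n : ℕ) (D : Set (Jet (n + 1))) (a b c : Jet (n + 1) → ℝ),
        IsJetSecondForm (linRHS lam ξ τ) U ω n D a b c → AreUniversal D a b c := by
  cases H with
  | all_zero h =>
    obtain ⟨rfl, rfl, rfl⟩ := h
    rw [linRHS_zero]
    have hn := not_hasFiniteJetForm_zero hη
    exact ⟨describes_zero η, ⟨fun h => absurd h hn, fun h => absurd ⟨rfl, rfl, rfl⟩ h⟩,
      fun h => absurd ⟨rfl, rfl, rfl⟩ h, fun n D a b c h => absurd ⟨n, D, a, b, c, h⟩ hn⟩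
  | lam_ne_zero T s hs hlam hT =>
    have hs := sq_eq_one_of_sign hs
    have hn := linForms_nondegenerate (lam := lam) (ξ := ξ) (τ := τ) (s := s) hη hT
    have ex := existence_lin (ξ := ξ) (τ := τ) hη hlam hT hs
    exact ⟨(linCalculus hη hlam hT hs).describes hn,
      ⟨fun _ h => hlam h.1, fun _ => ex.hasFiniteJetForm hn⟩, fun _ => ex,
      fun n D a b c hD => areUniversal_lin hη hlam hT hs hD⟩
  | lam_eq_zero G hlam h hG =>
    subst hlam
    have hn := primitiveForms_nondegenerate hη h G
    have ex := existence_primitive hη hG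
    exact ⟨(primitiveCalculus hη hG).describes hn,
      ⟨fun _ h' => h h'.2, fun _ => ex.hasFiniteJetForm hn⟩, fun _ => ex,
      fun n D a b c hD => areUniversal_primitive hη hG hD⟩

end PSS

theorem theorem3 (η : ℝ) (hη : η ≠ 0) :
    -- (1) `u_xt = F(u)`, `F'' + α F = 0`, `α > 0`
    (∀ (α : ℝ) (F : ℝ → ℝ) (A B Q : ℝ) (ω : Forms), 0 < α → IsHarmonic η α F A B Q ω →
      Describes η (fun u _ => F u) Set.univ ω ∧
      (HasFiniteJetForm (fun u _ => F u) Set.univ ω ↔ B = 0) ∧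
      (B = 0 → HasFiniteJetFormNearEveryJet (fun u _ => F u) Set.univ ω) ∧
      ∀ (n : ℕ) (D : Set (Jet (n + 1))) (a b c : Jet (n + 1) → ℝ),
        IsJetSecondForm (fun u _ => F u) Set.univ ω n D a b c →
          DependOnZeroJet D a b c ∧ ¬ AreUniversal D a b c) ∧
    -- (2) `u_xt = lam u + ξ u_x + τ`
    (∀ (lam ξ τ : ℝ) (U : Set (ℝ × ℝ)) (ω : Forms), IsLin η lam ξ τ U ω →
      Describes η (linRHS lam ξ τ) U ω ∧
      (HasFiniteJetForm (linRHS lam ξ τ) U ω ↔ ¬ (lam = 0 ∧ ξ = 0 ∧ τ = 0)) ∧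
      (¬ (lam = 0 ∧ ξ = 0 ∧ τ = 0) → HasFiniteJetFormNearEveryJet (linRHS lam ξ τ) U ω) ∧
      ∀ (n : ℕ) (D : Set (Jet (n + 1))) (a b c : Jet (n + 1) → ℝ),
        IsJetSecondForm (linRHS lam ξ τ) U ω n D a b c → AreUniversal D a b c) ∧
    -- (3) the remaining equations
    (∀ (α : ℝ) (F : ℝ → ℝ) (A B Q : ℝ) (ω : Forms), α < 0 → IsHarmonic η α F A B Q ω →
      Describes η (fun u _ => F u) Set.univ ω ∧
      ¬ HasFiniteJetForm (fun u _ => F u) Set.univ ω) ∧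
    (∀ (ν δ β γ : ℝ) (ω : Forms), ν ≠ 0 → δ ≠ 0 → γ ≠ 0 → (expDomain β γ).Nonempty →
      IsExp η ν δ β γ ω →
      Describes η (expRHS ν δ β γ) (expDomain β γ) ω ∧
      ¬ HasFiniteJetForm (expRHS ν δ β γ) (expDomain β γ) ω) ∧
    (∀ (U : Set (ℝ × ℝ)) (ω : Forms), IsLin η 0 0 0 U ω →
      Describes η (fun _ _ => 0) U ω ∧ ¬ HasFiniteJetForm (fun _ _ => 0) U ω) := by
  refine ⟨fun α F A B Q ω hα H => ?_, fun lam ξ τ U ω H => H.describes_and_universal hη,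
    fun α F A B Q ω hα H => ?_,
    fun ν δ β γ ω hν hδ hγ hU H =>
      H.describes_and_not_hasFiniteJetForm hη hν hδ hγ hU, fun U ω H => ?_⟩
  · obtain ⟨h1, h2, h3⟩ := H.describes_and_dichotomy hη hα.ne'
    -- Any finite-jet form forces `B = 0`, so the clause about all finite-jet forms needs the
    -- analysis only in that case.
    have hB : HasFiniteJetForm (fun u _ => F u) Set.univ ω → B = 0 := fun h =>
      by_contra fun hB => h2 hB h
    exact ⟨h1, ⟨hB, fun h => (h3 hα h).2.1⟩, fun h => (h3 hα h).1, fun n D a b c hD =>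
      (h3 hα (hB ⟨n, D, a, b, c, hD⟩)).2.2 n D a b c hD⟩
  · obtain ⟨h1, h2, -⟩ := H.describes_and_dichotomy hη hα.ne
    refine ⟨h1, h2 ?_⟩
    -- With `B = 0` the parameters would satisfy `α A² = 1`, impossible for `α < 0`.
    rintro rfl
    have := H.parameters
    nlinarith [mul_nonneg (neg_pos.2 hα).le (sq_nonneg A)]
  · obtain ⟨h1, h2, -⟩ := H.describes_and_universal hη
    rw [linRHS_zero] at h1 h2
    exact ⟨h1, fun h => (h2.1 h) ⟨rfl, rfl, rfl⟩⟩
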